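/- **Setting.** Let $G$ be an ample groupoid, i.e. a locally compact Hausdorff étale groupoid with totally disconnected unit space $G^{(0)}$, with source $s$ and range $r$. Assume that $G$ is *proper*, i.e. $(s,r):G\to G^{(0)}\times G^{(0)}$ is a proper map, and that the orbit space $G\backslash G^{(0)}$ is paracompact. For a totally disconnected locally compact Hausdorff space $X$ let $C_c^\infty(X)$ be the algebra of compactly supported locally constant functions $X\to\mathbb C$; write $R=C_c^\infty(G^{(0)})$, and let $\mathcal D(G)$ be $C_c^\infty(G)$ with the convolution product $(f*g)(\alpha)=\sum_{r(\beta)=r(\alpha)}f(\beta)g(\beta^{-1}\alpha)$. All vector spaces are over $\mathbb C$. **Modules and algebras.** A $G$-module is an essential left $\mathcal D(G)$-module $M$ (i.e. $\mathcal D(G)M=M$); it is an essential $R$-module via $R\subseteq\mathcal D(G)$. Tensor products $M\otimes_R N$ of $G$-modules carry the diagonal action $\chi_U\cdot(m\otimes n)=\chi_U m\otimes\chi_U n$ for compact open bisections $U\subseteq G$. A $G$-algebra is a (not necessarily unital) associative algebra $A$ which is a $G$-module such that the multiplication is an equivariant linear map $A\otimes_R A\to A$; homomorphisms of $G$-algebras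 are $\mathcal D(G)$-linear algebra homomorphisms. Let $\mathcal K_G=\mathcal D(G)\otimes_R\mathcal D(G)$, where $\mathcal D(G)$ is a $G$-module by left multiplication, with the product $(e\otimes f)(e'\otimes f')=e\otimes\lambda(f,e')f'$, where $\lambda(f,e')(x)=\sum_{r(\alpha)=x}f(\alpha)e'(\alpha)$. **Forms and the periodic tensor algebra.** For a $G$-algebra $A$ let $\Omega^0(A)=A$ and $\Omega^n(A)=A^{\otimes_R(n+1)}\oplus A^{\otimes_R n}$ for $n>0$ be the noncommutative differential forms, spanned by $a^0da^1\cdots da^n$ and $da^1\cdots da^n$, with the usual multiplication and differential $d$. The periodic tensor algebra $\mathcal TA$ is the projective system of $G$-algebras $(\mathcal TA)_N=A\oplus\Omega^2(A)\oplus\dots\oplus\Omega^{2N}(A)$, $N\in\mathbb N$, with the Fedosov product $\omega\circ\eta=\omega\eta-(-1)^{|\omega|}d\omega\,d\eta$ (forms of degree $>2N$ being set to zero) and the obvious projections. **Equivariant $X$-complex.** Let $G_{ad}=\{\alpha\in G: s(\alpha)=r(\alpha)\}$, on which $G$ acts by conjugation, and let $\mathcal O_G=C_c^\infty(G_{ad})$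 with pointwise multiplication. A $G$-anti-Yetter–Drinfeld module is a $G$-module which is also an essential $\mathcal O_G$-module such that the module action induces an equivariant linear map $\mathcal O_G\otimes_R M\to M$; with the $\mathcal D(G)$- and $\mathcal O_G$-linear maps as morphisms one obtains a category $A(G)$. For a $G$-module $E$, the module $\mathcal O_G\otimes_R E$, with the diagonal action of $G$ and multiplication by $\mathcal O_G$ on the first factor, is an object of $A(G)$ with canonical automorphism $T(\chi_U\otimes e)=\chi_U\otimes\chi_{U^{-1}}e$ for compact open bisections $U$ (where $\chi_U$ is restricted to $G_{ad}$ in the first factor). For a $G$-algebra $A$ put $\Omega^n_G(A)=\mathcal O_G\otimes_R\Omega^n(A)$, $d_G=\mathrm{id}\otimes d$ and, for $n\ge1$, $$b_G(f\otimes\omega\,da)=(-1)^{n-1}\bigl(f\otimes\omega a-(\mathrm{id}\otimes\mu)(T(f\otimes a)\otimes\omega)\bigr)$$ for $\omega\in\Omega^{n-1}(A)$, $\mu$ being multiplication of forms, and $b_G(f\otimes da)=f\otimes a-T(f\otimes a)$. The equivariant $X$-complex $X_G(A)$ consists of the even part $\Omega^0_G(A)$ and the odd part $\Omega^1_G(A)/b_G(\Omega^2_G(A))$,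 with the odd maps $\natural d_G$ and $b_G$ between them, where $\natural$ is the quotient projection. Applying this to each $(\mathcal TA)_N$ gives a $\mathbb Z/2$-graded pro-object $X_G(\mathcal TA)$ of $A(G)$ with an odd endomorphism $\partial$. **Homology.** Morphisms of pro-objects $V=(V_i)$, $W=(W_j)$ are $\varprojlim_j\varinjlim_i\mathrm{Hom}_{A(G)}(V_i,W_j)$. Let $\mathrm{Hom}_{A(G)}(X_G(\mathcal TA),X_G(\mathcal TB))$ be the $\mathbb Z/2$-graded space of even and odd morphisms of pro-objects, with boundary $\phi\mapsto\phi\,\partial-(-1)^{|\phi|}\partial\,\phi$. This is a complex, and $$HP^G_*(A,B)=H_*\bigl(\mathrm{Hom}_{A(G)}(X_G(\mathcal T(A\otimes_R\mathcal K_G)),X_G(\mathcal T(B\otimes_R\mathcal K_G)))\bigr),\qquad *=0,1.$$ **Proposition.** Let $G$ be a proper ample groupoid with paracompact orbit space $G\backslash G^{(0)}$. Then there are isomorphisms of complex vector spaces $$HP^G_*(A,B)\;\cong\;H_*\bigl(\mathrm{Hom}_{A(G)}(X_G(\mathcal TA),X_G(\mathcal TB))\bigr),\qquad *=0,1,$$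 for all $G$-algebras $A,B$, which are natural, contravariantly in $A$ and covariantly in $B$, with respect to homomorphisms of $G$-algebras. -/

import Mathlib

noncomputable section

open TopologicalSpace
open scoped TensorProduct

namespace AmpleHP

/-! ### Locally constant functions with compact support -/

/-- Locally constant functions `X → ℂ` with compact support, with pointwise operations. -/
def ccSub (X : Type*) [TopologicalSpace X] : NonUnitalSubalgebra ℂ (X → ℂ) where
  carrier := {f | IsLocallyConstant f ∧ HasCompactSupport f}
  add_mem' := fun ha hb => ⟨ha.1.add hb.1, ha.2.add hb.2⟩
  zero_mem' := ⟨IsLocallyConstant.const 0, HasCompactSupport.zero⟩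
  mul_mem' := fun ha hb => ⟨ha.1.mul hb.1, ha.2.mul_right⟩
  smul_mem' := fun c _ hf => ⟨hf.1.comp (fun z => c • z), hf.2.smul_left (f := fun _ => c)⟩

/-- The algebra `C_c^∞(X)`. -/
def Cc (X : Type*) [TopologicalSpace X] : Type _ := ccSub X

namespace Cc

variable {X : Type*} [TopologicalSpace X]

instance : NonUnitalCommRing (Cc X) := inferInstanceAs (NonUnitalCommRing (ccSub X))
instance : Module ℂ (Cc X) := inferInstanceAs (Module ℂ (ccSub X))
instance : IsScalarTower ℂ (Cc X) (Cc X) := inferInstanceAs (IsScalarTower ℂ (ccSub X) (ccSub X))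
instance : SMulCommClass ℂ (Cc X) (Cc X) := inferInstanceAs (SMulCommClass ℂ (ccSub X) (ccSub X))
instance : FunLike (Cc X) X ℂ where
  coe f := f.1
  coe_injective := Subtype.coe_injective

@[ext] theorem ext {f g : Cc X} (h : ∀ x, f x = g x) : f = g := DFunLike.ext _ _ h
@[simp] theorem add_apply (f g : Cc X) (x : X) : (f + g) x = f x + g x := rfl
@[simp] theorem neg_apply (f : Cc X) (x : X) : (-f) x = - f x := rfl
@[simp] theorem sub_apply (f g : Cc X) (x : X) : (f - g) x = f x - g x := rfl
@[simp] theorem zero_apply (x : X) : (0 : Cc X) x = 0 := rfl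
@[simp] theorem mul_apply (f g : Cc X) (x : X) : (f * g) x = f x * g x := rfl
@[simp] theorem smul_apply (c : ℂ) (f : Cc X) (x : X) : (c • f) x = c * f x := rfl

theorem locConst (f : Cc X) : IsLocallyConstant f := f.2.1
theorem compactSupp (f : Cc X) : HasCompactSupport f := f.2.2

theorem isOpen_support (f : Cc X) : IsOpen (Function.support f) :=
  f.locConst {0}ᶜ

theorem isClosed_support (f : Cc X) : IsClosed (Function.support f) := by
  rw [← isOpen_compl_iff]
  convert f.locConst.isOpen_fiber 0 using 1
  ext x; simp

theorem isCompact_support (f : Cc X) : IsCompact (Function.support f) := by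
  have h : IsCompact (closure (Function.support f)) := f.compactSupp
  rwa [f.isClosed_support.closure_eq] at h

/-- Constructor: a locally constant function vanishing off a compact set. -/
def mk' [T2Space X] (f : X → ℂ) (hf : IsLocallyConstant f) (K : Set X) (hK : IsCompact K)
    (h : ∀ x, x ∉ K → f x = 0) : Cc X :=
  ⟨f, hf, HasCompactSupport.intro hK (fun {x} hx => h x hx)⟩

@[simp] theorem mk'_apply [T2Space X] (f : X → ℂ) (hf : IsLocallyConstant f) (K : Set X)
    (hK : IsCompact K) (h : ∀ x, x ∉ K → f x = 0) (x : X) : mk' f hf K hK h x = f x := rfl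

open Classical in
/-- The characteristic function of a compact open set. -/
def chi [T2Space X] (W : CompactOpens X) : Cc X :=
  mk' (fun x => if x ∈ W then 1 else 0)
    (by
      rw [IsLocallyConstant.iff_exists_open]
      intro x
      by_cases hx : x ∈ W
      · refine ⟨W, W.isOpen, hx, fun y hy => ?_⟩
        have hy' : y ∈ W := hy
        simp [hx, hy']
      · refine ⟨(W : Set X)ᶜ, W.isCompact.isClosed.isOpen_compl, hx, fun y hy => ?_⟩
        have hy' : y ∉ W := hy
        simp [hx, hy'])
    W W.isCompact (fun x hx => by simp at hx; simp [hx])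

open Classical in
theorem chi_apply [T2Space X] (W : CompactOpens X) (x : X) :
    chi W x = if x ∈ W then 1 else 0 := rfl

theorem chi_of_mem [T2Space X] {W : CompactOpens X} {x : X} (h : x ∈ W) : chi W x = 1 := by
  simp [chi_apply, h]

theorem chi_of_notMem [T2Space X] {W : CompactOpens X} {x : X} (h : x ∉ W) : chi W x = 0 := by
  simp [chi_apply, h]

theorem chi_sup [T2Space X] (V W : CompactOpens X) (h : Disjoint V W) :
    chi (V ⊔ W) = chi V + chi W := by
  ext x
  have hd : ¬ (x ∈ V ∧ x ∈ W) := by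
    rintro ⟨h1, h2⟩
    have : x ∈ V ⊓ W := ⟨h1, h2⟩
    rw [h.eq_bot] at this
    exact this
  have hm : x ∈ V ⊔ W ↔ x ∈ V ∨ x ∈ W := Iff.rfl
  simp only [add_apply, chi_apply, hm]
  by_cases h1 : x ∈ V <;> by_cases h2 : x ∈ W <;> simp_all

/-- A family of compact open sets closed under passing to smaller ones and covering `X`.
The characteristic functions of its members span `C_c^∞(X)`, and finitely additive functions
on it extend linearly to `C_c^∞(X)`. -/
structure Family (X : Type*) [TopologicalSpace X] where
  sets : Set (CompactOpens X)
  lower : IsLowerSet sets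
  cover : ∀ x, ∃ W ∈ sets, x ∈ W

section span
variable [T2Space X] (B : Family X)

/-- The part of a compact open set on which a locally constant function takes a value. -/
def fiberIn (f : Cc X) (W : CompactOpens X) (c : ℂ) : CompactOpens X where
  carrier := W ∩ f ⁻¹' {c}
  isCompact' := W.isCompact.inter_right (by
    have h1 := f.locConst.isClosed_fiber c
    exact h1)
  isOpen' := W.isOpen.inter (f.locConst.isOpen_fiber c)

theorem span_aux (s : Finset B.sets) : ∀ f : Cc X,
    (∀ x, f x ≠ 0 → ∃ i ∈ s, x ∈ i.1) →
    f ∈ Submodule.span ℂ {g | ∃ W ∈ B.sets, chi W = g} := by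
  classical
  induction s using Finset.induction with
  | empty =>
    intro f hf
    have : f = 0 := by
      ext x; by_contra h; obtain ⟨i, hi, _⟩ := hf x h; simp at hi
    rw [this]; exact zero_mem _
  | insert j s hj ih =>
    intro f hf
    have h1 : f * chi j.1 ∈ Submodule.span ℂ {g | ∃ W ∈ B.sets, chi W = g} := by
      have hfin : (Set.range fun x : j.1 => f x).Finite := by
        have : CompactSpace j.1 := isCompact_iff_compactSpace.mp j.1.isCompact
        have : IsLocallyConstant (fun x : j.1 => f x) := f.locConst.comp_continuous continuous_subtype_val
        exact this.range_finite
      have : f * chi j.1 = ∑ c ∈ hfin.toFinset, c • chi (fiberIn f j.1 c) := by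
        ext x
        have hsum : ∀ (t : Finset ℂ) (F : ℂ → Cc X), (∑ c ∈ t, F c) x = ∑ c ∈ t, F c x := by
          intro t F
          induction t using Finset.induction with
          | empty => simp
          | insert a t ha iht => simp [Finset.sum_insert ha, iht]
        rw [hsum]
        by_cases hx : x ∈ j.1
        · rw [Finset.sum_eq_single (f x)]
          · rw [mul_apply, smul_apply, chi_of_mem hx, chi_of_mem]
            exact ⟨hx, rfl⟩
          · intro c _ hc
            rw [smul_apply, chi_of_notMem, mul_zero]
            rintro ⟨_, h⟩
            exact hc h.symm
          · intro h
            exfalso; apply h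
            simp only [Set.Finite.mem_toFinset, Set.mem_range]
            exact ⟨⟨x, hx⟩, rfl⟩
        · rw [mul_apply, chi_of_notMem hx, mul_zero, Finset.sum_eq_zero]
          intro c _
          rw [smul_apply, chi_of_notMem, mul_zero]
          exact fun h => hx h.1
      rw [this]
      refine Submodule.sum_mem _ fun c _ => Submodule.smul_mem _ _ (Submodule.subset_span ⟨_, ?_, rfl⟩)
      exact B.lower (show fiberIn f j.1 c ≤ j.1 from fun x hx => hx.1) j.2
    have h2 : f - f * chi j.1 ∈ Submodule.span ℂ {g | ∃ W ∈ B.sets, chi W = g} := by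
      apply ih
      intro x hx
      by_cases hxj : x ∈ j.1
      · simp [chi_of_mem hxj] at hx
      · have : f x ≠ 0 := by simpa [chi_of_notMem hxj] using hx
        obtain ⟨i, hi, hxi⟩ := hf x this
        rcases Finset.mem_insert.mp hi with rfl | hi
        · exact absurd hxi hxj
        · exact ⟨i, hi, hxi⟩
    have := add_mem h1 h2
    simpa using this

theorem mem_span_chi (f : Cc X) : f ∈ Submodule.span ℂ {g | ∃ W ∈ B.sets, chi W = g} := by
  classical
  obtain ⟨t, ht⟩ := f.isCompact_support.elim_finite_subcover
    (fun i : B.sets => (i.1 : Set X)) (fun i => i.1.isOpen) (fun x _ => by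
      obtain ⟨W, hW, hx⟩ := B.cover x
      exact Set.mem_iUnion.mpr ⟨⟨W, hW⟩, hx⟩)
  refine span_aux B t f fun x hx => ?_
  have := ht hx
  simp only [Set.mem_iUnion] at this
  obtain ⟨i, hi, h⟩ := this
  exact ⟨i, hi, h⟩

theorem span_induction {P : Cc X → Prop} (hchi : ∀ W ∈ B.sets, P (chi W)) (h0 : P 0)
    (hadd : ∀ f g, P f → P g → P (f + g)) (hsmul : ∀ (c : ℂ) f, P f → P (c • f)) (f : Cc X) : P f := by
  refine Submodule.span_induction (p := fun f _ => P f) ?_ h0 (fun f g _ _ => hadd f g)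
    (fun c f _ => hsmul c f) (mem_span_chi B f)
  rintro _ ⟨W, hW, rfl⟩
  exact hchi W hW

theorem linearMap_ext {Z : Type*} [AddCommMonoid Z] [Module ℂ Z] {L L' : Cc X →ₗ[ℂ] Z}
    (h : ∀ W ∈ B.sets, L (chi W) = L' (chi W)) : L = L' := by
  ext f
  refine span_induction B (P := fun f => L f = L' f) h (by simp) ?_ ?_ f
  · intro f g hf hg; simp [hf, hg]
  · intro c f hf; simp [hf]

variable {Z : Type*} [AddCommGroup Z] [Module ℂ Z]

theorem nu_split (ν : CompactOpens X → Z)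
    (hν : ∀ V W, V ⊔ W ∈ B.sets → Disjoint V W → ν (V ⊔ W) = ν V + ν W) (V W : CompactOpens X) (hV : V ∈ B.sets) : ν V = ν (V ⊓ W) + ν (V \ W) := by
  have h := sup_inf_sdiff V W
  rw [← hν]
  · rw [h]
  · rwa [h]
  · exact disjoint_inf_sdiff

theorem nu_bot (ν : CompactOpens X → Z)
    (hν : ∀ V W, V ⊔ W ∈ B.sets → Disjoint V W → ν (V ⊔ W) = ν V + ν W) (V : CompactOpens X) (hV : V ∈ B.sets) : ν ⊥ = 0 := by
  have := hν ⊥ ⊥ (B.lower (by simp) hV) disjoint_bot_left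
  simpa using this

theorem ext_aux1 (ν : CompactOpens X → Z)
    (hν : ∀ V W, V ⊔ W ∈ B.sets → Disjoint V W → ν (V ⊔ W) = ν V + ν W) (c : B.sets → ℂ) (s : Finset B.sets) :
    ∀ V ∈ B.sets, ∀ k : ℂ, (∀ x ∈ V, ∑ i ∈ s, c i * chi i.1 x = k) →
      ∑ i ∈ s, c i • ν (i.1 ⊓ V) = k • ν V := by
  classical
  induction s using Finset.induction with
  | empty =>
    intro V hV k hk
    simp only [Finset.sum_empty] at hk ⊢
    by_cases hne : ∃ x, x ∈ V
    · obtain ⟨x, hx⟩ := hne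
      rw [← hk x hx, zero_smul]
    · have : V = ⊥ := by
        ext x; constructor
        · intro h; exact absurd ⟨x, h⟩ hne
        · intro h; exact absurd h (by simp)
      rw [this, nu_bot B ν hν V hV, smul_zero]
  | insert j s hj ih =>
    intro V hV k hk
    have e1 := ih (V ⊓ j.1) (B.lower inf_le_left hV) (k - c j) (by
      intro x hx
      have := hk x hx.1
      rw [Finset.sum_insert hj, chi_of_mem hx.2] at this
      rw [← this]; ring)
    have e2 := ih (V \ j.1) (B.lower sdiff_le hV) k (by
      intro x hx
      have := hk x hx.1
      rwa [Finset.sum_insert hj, chi_of_notMem hx.2, mul_zero, zero_add] at this)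
    rw [Finset.sum_insert hj]
    have e3 : ∑ i ∈ s, c i • ν (i.1 ⊓ V) =
        ∑ i ∈ s, c i • ν (i.1 ⊓ (V ⊓ j.1)) + ∑ i ∈ s, c i • ν (i.1 ⊓ (V \ j.1)) := by
      rw [← Finset.sum_add_distrib]
      refine Finset.sum_congr rfl fun i _ => ?_
      rw [← smul_add, nu_split B ν hν (i.1 ⊓ V) j.1 (B.lower inf_le_left i.2), inf_assoc,
        inf_sdiff_assoc]
    rw [e3, e1, e2, nu_split B ν hν V j.1 hV, inf_comm j.1 V]
    module

theorem ext_aux2 (ν : CompactOpens X → Z)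
    (hν : ∀ V W, V ⊔ W ∈ B.sets → Disjoint V W → ν (V ⊔ W) = ν V + ν W) (c : B.sets → ℂ) (s : Finset B.sets) :
    ∀ C : CompactOpens X, (∀ x ∈ C, ∑ i ∈ s, c i * chi i.1 x = 0) →
      ∑ i ∈ s, c i • ν (i.1 ⊓ C) = 0 := by
  classical
  induction s using Finset.induction with
  | empty => simp
  | insert j s hj ih =>
    intro C hC
    have e1 := ext_aux1 B ν hν c (insert j s) (j.1 ⊓ C) (B.lower inf_le_left j.2) 0
      (fun x hx => hC x hx.2)
    have e2 := ih (C \ j.1) (by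
      intro x hx
      have := hC x hx.1
      rwa [Finset.sum_insert hj, chi_of_notMem hx.2, mul_zero, zero_add] at this)
    have e3 : ∀ i : B.sets, ν (i.1 ⊓ C) = ν (i.1 ⊓ (j.1 ⊓ C)) + ν (i.1 ⊓ (C \ j.1)) := by
      intro i
      rw [nu_split B ν hν (i.1 ⊓ C) j.1 (B.lower inf_le_left i.2), inf_assoc,
        inf_sdiff_assoc, inf_comm C j.1]
    simp only [e3, smul_add, Finset.sum_add_distrib]
    rw [e1, zero_smul, zero_add, Finset.sum_insert hj, e2, add_zero]
    have : j.1 ⊓ (C \ j.1) = ⊥ := inf_sdiff_self_right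
    rw [this, nu_bot B ν hν j.1 j.2, smul_zero]

theorem exists_extension (ν : CompactOpens X → Z)
    (hν : ∀ V W, V ⊔ W ∈ B.sets → Disjoint V W → ν (V ⊔ W) = ν V + ν W) : ∃ L : Cc X →ₗ[ℂ] Z, ∀ W ∈ B.sets, L (chi W) = ν W := by
  classical
  let T := Finsupp.linearCombination ℂ (fun i : B.sets => chi i.1)
  let N := Finsupp.linearCombination ℂ (fun i : B.sets => ν i.1)
  have hT : LinearMap.range T = ⊤ := by
    rw [eq_top_iff]
    rintro f -
    have := mem_span_chi B f
    rw [Finsupp.range_linearCombination]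
    convert this using 2
    ext g; simp
  obtain ⟨S, hS⟩ := T.exists_rightInverse_of_surjective hT
  have hker : ∀ l, T l = 0 → N l = 0 := by
    intro l hl
    rw [Finsupp.linearCombination_apply, Finsupp.sum]
    rw [Finsupp.linearCombination_apply, Finsupp.sum] at hl
    have := ext_aux2 B ν hν l l.support (l.support.sup fun i => i.1) (by
      intro x _
      have h := congrArg (fun g : Cc X => g x) hl
      simp only [zero_apply] at h
      rw [← h]
      have hsum : ∀ (t : Finset B.sets) (F : B.sets → Cc X),
          (∑ c ∈ t, F c) x = ∑ c ∈ t, F c x := by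
        intro t F
        induction t using Finset.induction with
        | empty => simp
        | insert a t ha iht => simp [Finset.sum_insert ha, iht]
      rw [hsum]
      rfl)
    rw [← this]
    refine Finset.sum_congr rfl fun i hi => ?_
    rw [inf_eq_left.mpr (Finset.le_sup (f := fun i : B.sets => i.1) hi)]
  refine ⟨N ∘ₗ S, fun W hW => ?_⟩
  have h1 : T (S (chi W) - Finsupp.single ⟨W, hW⟩ 1) = 0 := by
    rw [map_sub, sub_eq_zero]
    have := LinearMap.congr_fun hS (chi W)
    simp only [LinearMap.comp_apply, LinearMap.id_apply] at this
    rw [this]; simp [T]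
  have h2 := hker _ h1
  rw [map_sub, sub_eq_zero] at h2
  rw [LinearMap.comp_apply, h2]; simp [N]

/-- The linear extension to `C_c^∞(X)` of a finitely additive function on compact open sets. -/
def extend (ν : CompactOpens X → Z)
    (hν : ∀ V W, V ⊔ W ∈ B.sets → Disjoint V W → ν (V ⊔ W) = ν V + ν W) : Cc X →ₗ[ℂ] Z := (exists_extension B ν hν).choose

theorem extend_chi (ν : CompactOpens X → Z)
    (hν : ∀ V W, V ⊔ W ∈ B.sets → Disjoint V W → ν (V ⊔ W) = ν V + ν W) {W : CompactOpens X} (hW : W ∈ B.sets) : extend B ν hν (chi W) = ν W :=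
  (exists_extension B ν hν).choose_spec W hW

end span

end Cc

end AmpleHP

end

noncomputable section

open TopologicalSpace
open scoped TensorProduct

namespace AmpleHP

universe u₁ u₂

/-! ### Ample groupoids -/

/-- An ample groupoid: a locally compact Hausdorff étale groupoid with totally disconnected base
space. The multiplication `mul α β = αβ` is a total function of which only the values on
composable pairs (`src α = rng β`) are constrained, and only these are ever used. -/
structure AmpleGroupoid where
  Obj : Type u₁
  Arr : Type u₂
  [topObj : TopologicalSpace Obj]
  [topArr : TopologicalSpace Arr]
  [t2Obj : T2Space Obj]
  [t2Arr : T2Space Arr]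
  [lcObj : LocallyCompactSpace Obj]
  [lcArr : LocallyCompactSpace Arr]
  [tdObj : TotallyDisconnectedSpace Obj]
  src : Arr → Obj
  rng : Arr → Obj
  unit : Obj → Arr
  inv : Arr → Arr
  mul : Arr → Arr → Arr
  src_unit : ∀ x, src (unit x) = x
  rng_unit : ∀ x, rng (unit x) = x
  src_inv : ∀ α, src (inv α) = rng α
  rng_inv : ∀ α, rng (inv α) = src α
  src_mul : ∀ α β, src α = rng β → src (mul α β) = src β
  rng_mul : ∀ α β, src α = rng β → rng (mul α β) = rng α
  mul_assoc : ∀ α β γ, src α = rng β → src β = rng γ → mul (mul α β) γ = mul α (mul β γ)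
  unit_mul : ∀ α, mul (unit (rng α)) α = α
  mul_unit : ∀ α, mul α (unit (src α)) = α
  inv_mul : ∀ α, mul (inv α) α = unit (src α)
  mul_inv : ∀ α, mul α (inv α) = unit (rng α)
  continuous_src : Continuous src
  continuous_unit : Continuous unit
  continuous_inv : Continuous inv
  continuousOn_mul : ContinuousOn (fun p : Arr × Arr => mul p.1 p.2) {p | src p.1 = rng p.2}
  etale : IsLocalHomeomorph rng

attribute [instance] AmpleGroupoid.topObj AmpleGroupoid.topArr AmpleGroupoid.t2Obj
  AmpleGroupoid.t2Arr AmpleGroupoid.lcObj AmpleGroupoid.lcArr AmpleGroupoid.tdObj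

namespace AmpleGroupoid

variable (𝒢 : AmpleGroupoid.{u₁, u₂})

/-- `(s, r) : G → G⁰ × G⁰` is a proper map. -/
def IsProper : Prop := IsProperMap fun α : 𝒢.Arr => (𝒢.src α, 𝒢.rng α)

/-- Two objects are in the same orbit if there is an arrow between them. -/
def OrbitRel (x y : 𝒢.Obj) : Prop := ∃ α : 𝒢.Arr, 𝒢.src α = x ∧ 𝒢.rng α = y

/-- The orbit space `G \ G⁰`, with the quotient topology. -/
def OrbitSpace : Type u₁ := Quot 𝒢.OrbitRel

instance : TopologicalSpace 𝒢.OrbitSpace := inferInstanceAs (TopologicalSpace (Quot 𝒢.OrbitRel))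

theorem continuous_rng : Continuous 𝒢.rng := 𝒢.etale.continuous

variable {𝒢}

theorem inv_inv (α : 𝒢.Arr) : 𝒢.inv (𝒢.inv α) = α := by
  have h1 : 𝒢.mul (𝒢.inv (𝒢.inv α)) (𝒢.mul (𝒢.inv α) α) = α := by
    rw [← 𝒢.mul_assoc _ _ _ (by rw [𝒢.src_inv]) (by rw [𝒢.src_inv]), 𝒢.inv_mul, 𝒢.src_inv,
      𝒢.unit_mul]
  rw [𝒢.inv_mul] at h1
  have h2 := 𝒢.mul_unit (𝒢.inv (𝒢.inv α))
  rw [𝒢.src_inv, 𝒢.rng_inv, h1] at h2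
  exact h2.symm

theorem inv_unit (x : 𝒢.Obj) : 𝒢.inv (𝒢.unit x) = 𝒢.unit x := by
  have h1 := 𝒢.mul_unit (𝒢.inv (𝒢.unit x))
  rw [𝒢.src_inv, 𝒢.rng_unit, 𝒢.inv_mul, 𝒢.src_unit] at h1
  exact h1.symm

theorem mul_inv_cancel_left {α β : 𝒢.Arr} (h : 𝒢.rng α = 𝒢.rng β) :
    𝒢.mul α (𝒢.mul (𝒢.inv α) β) = β := by
  rw [← 𝒢.mul_assoc _ _ _ (𝒢.rng_inv α).symm (by rw [𝒢.src_inv, h]), 𝒢.mul_inv, h, 𝒢.unit_mul]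

theorem inv_mul_cancel_left {α β : 𝒢.Arr} (h : 𝒢.src α = 𝒢.rng β) :
    𝒢.mul (𝒢.inv α) (𝒢.mul α β) = β := by
  rw [← 𝒢.mul_assoc _ _ _ (𝒢.src_inv α) h, 𝒢.inv_mul, h, 𝒢.unit_mul]

theorem inv_mul_rev {α β : 𝒢.Arr} (h : 𝒢.src α = 𝒢.rng β) :
    𝒢.inv (𝒢.mul α β) = 𝒢.mul (𝒢.inv β) (𝒢.inv α) := by
  have hs : 𝒢.src (𝒢.inv β) = 𝒢.rng (𝒢.inv α) := by rw [𝒢.src_inv, 𝒢.rng_inv, h]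
  have h1 : 𝒢.mul (𝒢.mul α β) (𝒢.mul (𝒢.inv β) (𝒢.inv α)) = 𝒢.unit (𝒢.rng α) := by
    rw [𝒢.mul_assoc _ _ _ h (by rw [𝒢.rng_mul _ _ hs, 𝒢.rng_inv]),
      mul_inv_cancel_left (by rw [𝒢.rng_inv, h]), 𝒢.mul_inv]
  have h2 := inv_mul_cancel_left (α := 𝒢.mul α β) (β := 𝒢.mul (𝒢.inv β) (𝒢.inv α))
    (by rw [𝒢.src_mul _ _ h, 𝒢.rng_mul _ _ hs, 𝒢.rng_inv])
  rw [h1] at h2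
  rw [← h2, ← 𝒢.rng_mul _ _ h, ← 𝒢.src_inv, 𝒢.mul_unit]

theorem isOpenMap_rng : IsOpenMap 𝒢.rng := 𝒢.etale.isOpenMap

theorem isOpenMap_src : IsOpenMap 𝒢.src := by
  intro O hO
  have : 𝒢.src '' O = 𝒢.rng '' (𝒢.inv ⁻¹' O) := by
    ext x; constructor
    · rintro ⟨α, hα, rfl⟩
      exact ⟨𝒢.inv α, by simpa [inv_inv] using hα, 𝒢.rng_inv α⟩
    · rintro ⟨α, hα, rfl⟩
      exact ⟨𝒢.inv α, hα, 𝒢.src_inv α⟩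
  rw [this]
  exact isOpenMap_rng _ (hO.preimage 𝒢.continuous_inv)

end AmpleGroupoid

section zeroDim
variable {X : Type*} [TopologicalSpace X] [T2Space X] [LocallyCompactSpace X]
  [TotallyDisconnectedSpace X]

theorem exists_compactOpen {x : X} {O : Set X} (hO : IsOpen O) (hx : x ∈ O) :
    ∃ V : CompactOpens X, x ∈ V ∧ (V : Set X) ⊆ O := by
  obtain ⟨K, hK, hxK, hKO⟩ := exists_compact_subset hO hx
  obtain ⟨V, hV, hxV, hVK⟩ :=
    loc_compact_Haus_tot_disc_of_zero_dim.exists_subset_of_mem_open hxK isOpen_interior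
  exact ⟨⟨⟨V, hK.of_isClosed_subset hV.isClosed (hVK.trans interior_subset)⟩, hV.isOpen⟩, hxV,
    (hVK.trans interior_subset).trans hKO⟩

theorem exists_compactOpen_superset {K : Set X} (hK : IsCompact K) :
    ∃ V : CompactOpens X, K ⊆ V := by
  classical
  obtain ⟨t, ht⟩ := hK.elim_finite_subcover (fun V : CompactOpens X => (V : Set X))
    (fun V => V.isOpen) (fun x _ => by
      obtain ⟨V, hV, _⟩ := exists_compactOpen isOpen_univ (Set.mem_univ x)
      exact Set.mem_iUnion.mpr ⟨V, hV⟩)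
  refine ⟨t.sup id, fun x hx => ?_⟩
  have := ht hx
  simp only [Set.mem_iUnion] at this
  obtain ⟨V, hV, h⟩ := this
  exact (Finset.le_sup (f := id) hV : V ≤ t.sup id) h

end zeroDim

variable (𝒢 : AmpleGroupoid.{u₁, u₂})

/-- A compact open subset of `G` is a bisection if source and range are injective on it (both maps
are open and continuous, so they then restrict to homeomorphisms onto their images). -/
def IsBis (U : CompactOpens 𝒢.Arr) : Prop :=
  Set.InjOn 𝒢.src U ∧ Set.InjOn 𝒢.rng U

variable {𝒢}

theorem exists_bis {α : 𝒢.Arr} {O : Set 𝒢.Arr} (hO : IsOpen O) (hα : α ∈ O) :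
    ∃ U : CompactOpens 𝒢.Arr, IsBis 𝒢 U ∧ α ∈ U ∧ (U : Set 𝒢.Arr) ⊆ O := by
  obtain ⟨e, he, hre⟩ := 𝒢.etale α
  obtain ⟨e', he', hre'⟩ := 𝒢.etale (𝒢.inv α)
  have hO' : IsOpen (e.source ∩ (O ∩ 𝒢.inv ⁻¹' e'.source)) :=
    e.open_source.inter (hO.inter (e'.open_source.preimage 𝒢.continuous_inv))
  have hW : IsOpen (e '' (e.source ∩ (O ∩ 𝒢.inv ⁻¹' e'.source))) := by
    rw [← hre]; exact AmpleGroupoid.isOpenMap_rng _ hO'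
  obtain ⟨V, hV, hVW⟩ := exists_compactOpen hW (Set.mem_image_of_mem e ⟨he, hα, he'⟩)
  have hVt : (V : Set 𝒢.Obj) ⊆ e.target := by
    intro x hx
    obtain ⟨y, hy, rfl⟩ := hVW hx
    exact e.map_source hy.1
  have hsub : e.symm '' V ⊆ e.source ∩ (O ∩ 𝒢.inv ⁻¹' e'.source) := by
    rintro _ ⟨x, hx, rfl⟩
    obtain ⟨y, hy, rfl⟩ := hVW hx
    rw [e.left_inv hy.1]; exact hy
  refine ⟨⟨⟨e.symm '' V, V.isCompact.image_of_continuousOn (e.continuousOn_symm.mono hVt)⟩,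
    e.symm.isOpen_image_of_subset_source V.isOpen hVt⟩, ⟨?_, ?_⟩, ?_, ?_⟩
  · intro β hβ γ hγ h
    have h1 := (hsub hβ).2.2
    have h2 := (hsub hγ).2.2
    have : 𝒢.inv β = 𝒢.inv γ := e'.injOn h1 h2 (by rw [← hre', 𝒢.rng_inv, 𝒢.rng_inv, h])
    rw [← AmpleGroupoid.inv_inv β, this, AmpleGroupoid.inv_inv]
  · intro β hβ γ hγ h
    exact e.injOn (hsub hβ).1 (hsub hγ).1 (by rw [← hre]; exact h)
  · exact ⟨e α, hV, e.left_inv he⟩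
  · exact fun β hβ => (hsub hβ).2.1

variable (𝒢) in
/-- The family of compact open bisections. -/
def bisFamily : Cc.Family 𝒢.Arr where
  sets := {U | IsBis 𝒢 U}
  lower := fun _ _ hVU hU => ⟨hU.1.mono hVU, hU.2.mono hVU⟩
  cover := fun α => by
    obtain ⟨U, hU, hα, _⟩ := exists_bis isOpen_univ (Set.mem_univ α)
    exact ⟨U, hU, hα⟩

theorem Cc.finite_fiber (f : Cc 𝒢.Arr) (x : 𝒢.Obj) :
    (Function.support fun β : {β : 𝒢.Arr // 𝒢.rng β = x} => f β).Finite := by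
  refine Cc.span_induction (bisFamily 𝒢)
    (P := fun f => (Function.support fun β : {β : 𝒢.Arr // 𝒢.rng β = x} => f β).Finite)
    ?_ ?_ ?_ ?_ f
  · intro U hU
    apply Set.Subsingleton.finite
    intro β hβ γ hγ
    have h1 : β.1 ∈ U := by
      by_contra h; exact hβ (Cc.chi_of_notMem h)
    have h2 : γ.1 ∈ U := by
      by_contra h; exact hγ (Cc.chi_of_notMem h)
    exact Subtype.ext (hU.2 h1 h2 (β.2.trans γ.2.symm))
  · simp
  · intro f g hf hg
    exact (hf.union hg).subset (Function.support_add _ _)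
  · intro c f hf
    exact hf.subset (Function.support_const_smul_subset c _)

/-! ### `G`-spaces and the convolution action -/

variable (𝒢) in
/-- A left action of `G` on a Hausdorff space `X`; only the values `act α x` with
`src α = anchor x` are constrained and used. -/
class GSpace (X : Type*) [TopologicalSpace X] where
  anchor : X → 𝒢.Obj
  act : 𝒢.Arr → X → X
  continuous_anchor : Continuous anchor
  continuousOn_act : ContinuousOn (fun p : 𝒢.Arr × X => act p.1 p.2) {p | 𝒢.src p.1 = anchor p.2}
  anchor_act : ∀ α x, 𝒢.src α = anchor x → anchor (act α x) = 𝒢.rng α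
  act_act : ∀ α β x, 𝒢.src α = 𝒢.rng β → 𝒢.src β = anchor x →
    act α (act β x) = act (𝒢.mul α β) x
  unit_act : ∀ x, act (𝒢.unit (anchor x)) x = x

section conv

variable {X : Type*} [TopologicalSpace X] [T2Space X] [GSpace 𝒢 X]


theorem GSpace.act_inv_act {α : 𝒢.Arr} {x : X} (h : 𝒢.src α = GSpace.anchor (𝒢 := 𝒢) x) :
    GSpace.act (𝒢 := 𝒢) (𝒢.inv α) (GSpace.act (𝒢 := 𝒢) α x) = x := by
  rw [GSpace.act_act _ _ _ (𝒢.src_inv α) h, 𝒢.inv_mul, h, GSpace.unit_act]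

theorem GSpace.act_act_inv {α : 𝒢.Arr} {x : X} (h : 𝒢.rng α = GSpace.anchor (𝒢 := 𝒢) x) :
    GSpace.act (𝒢 := 𝒢) α (GSpace.act (𝒢 := 𝒢) (𝒢.inv α) x) = x := by
  rw [GSpace.act_act _ _ _ (𝒢.rng_inv α).symm (by rw [𝒢.src_inv, h]), 𝒢.mul_inv, h, GSpace.unit_act]

/-- `(f * g)(x) = ∑_β f(β) g(β⁻¹ x)`, a finite sum over the `β` whose range is the anchor of `x`. -/
def convFun (f : Cc 𝒢.Arr) (g : Cc X) (x : X) : ℂ :=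
  ∑ᶠ β : {β : 𝒢.Arr // 𝒢.rng β = GSpace.anchor (𝒢 := 𝒢) x}, f β * g (GSpace.act (𝒢 := 𝒢) (𝒢.inv β) x)

theorem convFun_chi_of_mem {U : CompactOpens 𝒢.Arr} (hU : IsBis 𝒢 U) (g : Cc X) {x : X}
    {β : 𝒢.Arr} (hβ : β ∈ U) (h : 𝒢.rng β = GSpace.anchor (𝒢 := 𝒢) x) :
    convFun (Cc.chi U) g x = g (GSpace.act (𝒢 := 𝒢) (𝒢.inv β) x) := by
  rw [convFun, finsum_eq_single _ (⟨β, h⟩ : {β : 𝒢.Arr // 𝒢.rng β = GSpace.anchor (𝒢 := 𝒢) x})]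
  · simp [Cc.chi_of_mem hβ]
  · rintro ⟨γ, hγ⟩ hne
    rw [Cc.chi_of_notMem, zero_mul]
    intro hm
    exact hne (Subtype.ext (hU.2 hm hβ (hγ.trans h.symm)))

theorem convFun_chi_of_notMem {U : CompactOpens 𝒢.Arr} (g : Cc X) {x : X}
    (h : ∀ β ∈ U, 𝒢.rng β ≠ GSpace.anchor (𝒢 := 𝒢) x) : convFun (Cc.chi U) g x = 0 := by
  rw [convFun]
  apply finsum_eq_zero_of_forall_eq_zero
  rintro ⟨γ, hγ⟩
  rw [Cc.chi_of_notMem, zero_mul]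
  exact fun hm => h γ hm hγ

theorem convFun_support_finite (f : Cc 𝒢.Arr) (g : Cc X) (x : X) :
    (Function.support fun β : {β : 𝒢.Arr // 𝒢.rng β = GSpace.anchor (𝒢 := 𝒢) x} => f β * g (GSpace.act (𝒢 := 𝒢) (𝒢.inv β) x)).Finite :=
  (f.finite_fiber (GSpace.anchor (𝒢 := 𝒢) x)).subset (Function.support_mul_subset_left _ _)

theorem convFun_add_left (f f' : Cc 𝒢.Arr) (g : Cc X) :
    convFun (f + f') g = convFun f g + convFun f' g := by
  ext x
  rw [Pi.add_apply, convFun, convFun, convFun, ← finsum_add_distrib (convFun_support_finite f g x)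
    (convFun_support_finite f' g x)]
  simp only [Cc.add_apply, add_mul]

theorem convFun_smul_left (c : ℂ) (f : Cc 𝒢.Arr) (g : Cc X) :
    convFun (c • f) g = c • convFun f g := by
  ext x
  rw [Pi.smul_apply, convFun, convFun, smul_finsum' _ (convFun_support_finite f g x)]
  simp only [Cc.smul_apply, mul_assoc, smul_eq_mul]

theorem convFun_mem_chi {U : CompactOpens 𝒢.Arr} (hU : IsBis 𝒢 U) (g : Cc X) :
    convFun (Cc.chi U) g ∈ ccSub X := by
  constructor
  · rw [IsLocallyConstant.iff_exists_open]
    intro x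
    by_cases h : ∃ β ∈ U, 𝒢.rng β = GSpace.anchor (𝒢 := 𝒢) x
    · obtain ⟨β, hβ, hx⟩ := h
      have hc : ContinuousOn (fun p : 𝒢.Arr × X => GSpace.act (𝒢 := 𝒢) (𝒢.inv p.1) p.2)
          {p | 𝒢.rng p.1 = GSpace.anchor (𝒢 := 𝒢) p.2} := by
        refine ContinuousOn.comp (t := {p : 𝒢.Arr × X | 𝒢.src p.1 = GSpace.anchor (𝒢 := 𝒢) p.2})
          (f := fun p : 𝒢.Arr × X => (𝒢.inv p.1, p.2)) GSpace.continuousOn_act ?_ ?_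
        · exact ((𝒢.continuous_inv.comp continuous_fst).prodMk continuous_snd).continuousOn
        · intro p hp
          simpa [𝒢.src_inv] using hp
      have hO : IsOpen {y | g y = g (GSpace.act (𝒢 := 𝒢) (𝒢.inv β) x)} := g.locConst.isOpen_fiber _
      have hnh := (hc (β, x) hx).preimage_mem_nhdsWithin (hO.mem_nhds rfl)
      rw [mem_nhdsWithin] at hnh
      obtain ⟨N, hN, hmem, hsub⟩ := hnh
      obtain ⟨N1, N2, hN1, hN2, h1, h2, h12⟩ := isOpen_prod_iff.mp hN β x hmem
      refine ⟨N2 ∩ GSpace.anchor (𝒢 := 𝒢) ⁻¹' (𝒢.rng '' (U ∩ N1)), ?_, ?_, ?_⟩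
      · exact hN2.inter ((AmpleGroupoid.isOpenMap_rng _ (U.isOpen.inter hN1)).preimage
          GSpace.continuous_anchor)
      · exact ⟨h2, β, ⟨hβ, h1⟩, hx⟩
      · rintro y ⟨hy, γ, ⟨hγU, hγN⟩, hγ⟩
        rw [convFun_chi_of_mem hU g hγU hγ, convFun_chi_of_mem hU g hβ hx]
        exact hsub (a := (γ, y)) ⟨h12 ⟨hγN, hy⟩, hγ⟩
    · have hcl : IsClosed (𝒢.rng '' U) := (U.isCompact.image 𝒢.continuous_rng).isClosed
      refine ⟨GSpace.anchor (𝒢 := 𝒢) ⁻¹' (𝒢.rng '' U)ᶜ, hcl.isOpen_compl.preimage GSpace.continuous_anchor, ?_, ?_⟩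
      · rintro ⟨β, hβ, hx⟩
        exact h ⟨β, hβ, hx⟩
      · intro y hy
        rw [convFun_chi_of_notMem, convFun_chi_of_notMem]
        · exact fun β hβ hx => h ⟨β, hβ, hx⟩
        · exact fun β hβ hx => hy ⟨β, hβ, hx⟩
  · have hK : IsCompact ((fun p : 𝒢.Arr × X => GSpace.act (𝒢 := 𝒢) p.1 p.2) ''
        (((U : Set 𝒢.Arr) ×ˢ Function.support g) ∩ {p | 𝒢.src p.1 = GSpace.anchor (𝒢 := 𝒢) p.2})) := by
      apply IsCompact.image_of_continuousOn
      · apply (U.isCompact.prod g.isCompact_support).inter_right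
        exact isClosed_eq (𝒢.continuous_src.comp continuous_fst)
          (GSpace.continuous_anchor.comp continuous_snd)
      · exact GSpace.continuousOn_act.mono Set.inter_subset_right
    refine HasCompactSupport.intro hK fun {x} hx => ?_
    by_contra hne
    by_cases h : ∃ β ∈ U, 𝒢.rng β = GSpace.anchor (𝒢 := 𝒢) x
    · obtain ⟨β, hβ, hβx⟩ := h
      rw [convFun_chi_of_mem hU g hβ hβx] at hne
      have hs : 𝒢.src (𝒢.inv β) = GSpace.anchor (𝒢 := 𝒢) x := by rw [𝒢.src_inv, hβx]
      apply hx
      refine ⟨(β, GSpace.act (𝒢 := 𝒢) (𝒢.inv β) x), ⟨⟨hβ, hne⟩, ?_⟩, GSpace.act_act_inv hβx⟩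
      change 𝒢.src β = GSpace.anchor (𝒢 := 𝒢) (GSpace.act (𝒢 := 𝒢) (𝒢.inv β) x)
      rw [GSpace.anchor_act _ _ hs, 𝒢.rng_inv]
    · exact hne (convFun_chi_of_notMem g (fun β hβ hx => h ⟨β, hβ, hx⟩))

theorem convFun_mem (f : Cc 𝒢.Arr) (g : Cc X) : convFun f g ∈ ccSub X := by
  refine Cc.span_induction (bisFamily 𝒢) (P := fun f => convFun f g ∈ ccSub X) ?_ ?_ ?_ ?_ f
  · exact fun U hU => convFun_mem_chi hU g
  · have : convFun (0 : Cc 𝒢.Arr) g = 0 := by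
      have := convFun_smul_left 0 (0 : Cc 𝒢.Arr) g
      simpa using this
    rw [this]; exact zero_mem _
  · intro f f' h h'
    rw [convFun_add_left]; exact add_mem h h'
  · intro c f h
    rw [convFun_smul_left]; exact SMulMemClass.smul_mem c h

variable (𝒢 X) in
/-- The action of functions on `G` on functions on a `G`-space by convolution. For `X = G` this is
the convolution product of the Steinberg algebra of `G`. -/
def conv : Cc 𝒢.Arr →ₗ[ℂ] Module.End ℂ (Cc X) :=
  LinearMap.mk₂ ℂ (fun f g => (⟨convFun f g, convFun_mem f g⟩ : Cc X))
    (fun f f' g => by ext x; exact congrFun (convFun_add_left f f' g) x)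
    (fun c f g => by ext x; exact congrFun (convFun_smul_left c f g) x)
    (fun f g g' => by
      ext x
      change convFun f (g + g') x = convFun f g x + convFun f g' x
      rw [convFun, convFun, convFun, ← finsum_add_distrib (convFun_support_finite f g x)
        (convFun_support_finite f g' x)]
      simp only [Cc.add_apply, mul_add])
    (fun c f g => by
      ext x
      change convFun f (c • g) x = c * convFun f g x
      rw [convFun, convFun, ← smul_eq_mul, smul_finsum' _ (convFun_support_finite f g x)]
      refine finsum_congr fun β => ?_
      simp only [Cc.smul_apply, smul_eq_mul]; ring)

theorem conv_apply (f : Cc 𝒢.Arr) (g : Cc X) (x : X) :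
    conv 𝒢 X f g x = ∑ᶠ β : {β : 𝒢.Arr // 𝒢.rng β = GSpace.anchor (𝒢 := 𝒢) x}, f β * g (GSpace.act (𝒢 := 𝒢) (𝒢.inv β) x) := rfl

theorem conv_chi_of_mem {U : CompactOpens 𝒢.Arr} (hU : IsBis 𝒢 U) (g : Cc X) {x : X}
    {β : 𝒢.Arr} (hβ : β ∈ U) (h : 𝒢.rng β = GSpace.anchor (𝒢 := 𝒢) x) :
    conv 𝒢 X (Cc.chi U) g x = g (GSpace.act (𝒢 := 𝒢) (𝒢.inv β) x) := convFun_chi_of_mem hU g hβ h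

theorem conv_chi_of_notMem {U : CompactOpens 𝒢.Arr} (g : Cc X) {x : X}
    (h : ∀ β ∈ U, 𝒢.rng β ≠ GSpace.anchor (𝒢 := 𝒢) x) : conv 𝒢 X (Cc.chi U) g x = 0 := convFun_chi_of_notMem g h

end conv

instance : GSpace 𝒢 𝒢.Obj where
  anchor := id
  act := fun α _ => 𝒢.rng α
  continuous_anchor := continuous_id
  continuousOn_act := (𝒢.continuous_rng.comp continuous_fst).continuousOn
  anchor_act := fun _ _ _ => rfl
  act_act := fun α β _ h _ => (𝒢.rng_mul α β h).symm
  unit_act := fun x => 𝒢.rng_unit x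

instance : GSpace 𝒢 𝒢.Arr where
  anchor := 𝒢.rng
  act := 𝒢.mul
  continuous_anchor := 𝒢.continuous_rng
  continuousOn_act := 𝒢.continuousOn_mul
  anchor_act := 𝒢.rng_mul
  act_act := fun α β γ h h' => (𝒢.mul_assoc α β γ h h').symm
  unit_act := 𝒢.unit_mul

/-- The convolution product is associative, and convolution defines an action of it. -/
theorem conv_conv {X : Type*} [TopologicalSpace X] [T2Space X] [GSpace 𝒢 X]
    (f g : Cc 𝒢.Arr) (h : Cc X) :
    conv 𝒢 X (conv 𝒢 𝒢.Arr f g) h = conv 𝒢 X f (conv 𝒢 X g h) := by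
  refine Cc.span_induction (bisFamily 𝒢)
    (P := fun f => conv 𝒢 X (conv 𝒢 𝒢.Arr f g) h = conv 𝒢 X f (conv 𝒢 X g h)) ?_ ?_ ?_ ?_ f
  · intro U hU
    ext x
    by_cases hx : ∃ β ∈ U, 𝒢.rng β = GSpace.anchor (𝒢 := 𝒢) x
    · obtain ⟨β, hβ, hβx⟩ := hx
      rw [conv_chi_of_mem hU _ hβ hβx, conv_apply, conv_apply]
      have hs : 𝒢.src (𝒢.inv β) = GSpace.anchor (𝒢 := 𝒢) x := by rw [𝒢.src_inv, hβx]
      have ha : GSpace.anchor (𝒢 := 𝒢) (GSpace.act (𝒢.inv β) x) = 𝒢.src β := by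
        rw [GSpace.anchor_act _ _ hs, 𝒢.rng_inv]
      let e : {γ : 𝒢.Arr // 𝒢.rng γ = GSpace.anchor (𝒢 := 𝒢) (GSpace.act (𝒢.inv β) x)} ≃
          {γ : 𝒢.Arr // 𝒢.rng γ = GSpace.anchor (𝒢 := 𝒢) x} :=
        { toFun := fun γ => ⟨𝒢.mul β γ, by
            rw [𝒢.rng_mul _ _ (ha.symm.trans γ.2.symm), hβx]⟩
          invFun := fun γ => ⟨𝒢.mul (𝒢.inv β) γ, by
            rw [𝒢.rng_mul _ _ (by rw [𝒢.src_inv, hβx, γ.2]), 𝒢.rng_inv, ha]⟩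
          left_inv := fun γ => Subtype.ext
            (AmpleGroupoid.inv_mul_cancel_left (ha.symm.trans γ.2.symm))
          right_inv := fun γ => Subtype.ext
            (AmpleGroupoid.mul_inv_cancel_left (hβx.trans γ.2.symm)) }
      rw [← finsum_comp_equiv e]
      refine finsum_congr fun γ => ?_
      have hγ : 𝒢.src β = 𝒢.rng γ := ha.symm.trans γ.2.symm
      change conv 𝒢 𝒢.Arr (Cc.chi U) g (𝒢.mul β γ) * h (GSpace.act (𝒢.inv (𝒢.mul β γ)) x) = _
      rw [conv_chi_of_mem hU g hβ (𝒢.rng_mul _ _ hγ).symm, AmpleGroupoid.inv_mul_rev hγ]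
      rw [show GSpace.act (𝒢 := 𝒢) (𝒢.inv β) (𝒢.mul β γ) = γ.1 from
        AmpleGroupoid.inv_mul_cancel_left hγ]
      rw [GSpace.act_act _ _ _ (by rw [𝒢.src_inv, 𝒢.rng_inv, hγ]) hs]
    · have hx' : ∀ β ∈ U, 𝒢.rng β ≠ GSpace.anchor (𝒢 := 𝒢) x := fun β hβ h' => hx ⟨β, hβ, h'⟩
      rw [conv_chi_of_notMem _ hx', conv_apply]
      apply finsum_eq_zero_of_forall_eq_zero
      rintro ⟨γ, hγ⟩
      rw [conv_chi_of_notMem, zero_mul]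
      intro β hβ h'
      exact hx' β hβ (h'.trans hγ)
  · simp
  · intro f f' hf hf'
    simp only [map_add, LinearMap.add_apply, hf, hf']
  · intro c f hf
    simp only [map_smul, LinearMap.smul_apply, hf]

end AmpleHP

end

noncomputable section

open TopologicalSpace
open scoped TensorProduct

namespace AmpleHP

universe u₁ u₂

variable (𝒢 : AmpleGroupoid.{u₁, u₂})

/-! ### Balanced tensor products over `C_c^∞(G⁰)`

A module over the non-unital algebra `C_c^∞(G⁰)` on a complex vector space is the same thing as a
unital module over its unitisation `Base 𝒢`, and `M ⊗[Base 𝒢] N` is the quotient of `M ⊗[ℂ] N` by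
the relations `f m ⊗ n = m ⊗ f n` for `f` in `C_c^∞(G⁰)`. -/

/-- The unitisation `ℂ ⊕ C_c^∞(G⁰)`. -/
def Base : Type u₁ := Unitization ℂ (Cc 𝒢.Obj)

namespace Base

instance : CommRing (Base 𝒢) := inferInstanceAs (CommRing (Unitization ℂ (Cc 𝒢.Obj)))
instance : Algebra ℂ (Base 𝒢) := inferInstanceAs (Algebra ℂ (Unitization ℂ (Cc 𝒢.Obj)))

variable {𝒢}

/-- The inclusion of `C_c^∞(G⁰)`. -/
def of : Cc 𝒢.Obj →ₙₐ[ℂ] Base 𝒢 := Unitization.inrNonUnitalAlgHom ℂ (Cc 𝒢.Obj)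

/-- Non-unital homomorphisms extend uniquely to the unitisation. -/
def lift {C : Type*} [Semiring C] [Algebra ℂ C] : (Cc 𝒢.Obj →ₙₐ[ℂ] C) ≃ (Base 𝒢 →ₐ[ℂ] C) :=
  Unitization.lift

@[simp] theorem lift_of {C : Type*} [Semiring C] [Algebra ℂ C] (φ : Cc 𝒢.Obj →ₙₐ[ℂ] C)
    (h : Cc 𝒢.Obj) : lift φ (of h) = φ h :=
  DFunLike.congr_fun (Unitization.lift.symm_apply_apply φ) h

theorem exists_rep (k : Base 𝒢) : ∃ (z : ℂ) (h : Cc 𝒢.Obj), k = algebraMap ℂ (Base 𝒢) z + of h :=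
  Unitization.ind (P := fun k : Unitization ℂ (Cc 𝒢.Obj) =>
    ∃ (z : ℂ) (h : Cc 𝒢.Obj), k = algebraMap ℂ (Base 𝒢) z + of h)
    (fun z h => ⟨z, h, rfl⟩) k

variable {M N : Type*} [AddCommGroup M] [Module ℂ M] [Module (Base 𝒢) M]
  [IsScalarTower ℂ (Base 𝒢) M] [AddCommGroup N] [Module ℂ N] [Module (Base 𝒢) N]
  [IsScalarTower ℂ (Base 𝒢) N]

/-- A `ℂ`-linear and `C_c^∞(G⁰)`-linear map is linear over the unitisation. -/
def linearOf (f : M →ₗ[ℂ] N) (hf : ∀ (h : Cc 𝒢.Obj) m, f (of h • m) = of h • f m) :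
    M →ₗ[Base 𝒢] N where
  toFun := f
  map_add' := f.map_add
  map_smul' := fun k m => by
    obtain ⟨z, h, rfl⟩ := exists_rep k
    simp only [add_smul, map_add, algebraMap_smul, map_smul, hf, RingHom.id_apply]

@[simp] theorem linearOf_apply (f : M →ₗ[ℂ] N)
    (hf : ∀ (h : Cc 𝒢.Obj) m, f (of h • m) = of h • f m) (m : M) : linearOf f hf m = f m := rfl

end Base

open Base

variable {𝒢}

theorem Cc.exists_chi_eq (h : Cc 𝒢.Obj) : ∃ V : CompactOpens 𝒢.Obj, Cc.chi V * h = h := by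
  obtain ⟨V, hV⟩ := exists_compactOpen_superset h.isCompact_support
  refine ⟨V, Cc.ext fun x => ?_⟩
  by_cases hx : h x = 0
  · simp [hx]
  · have : x ∈ V := hV hx
    simp [Cc.chi_of_mem this]

section CcModule

variable {X : Type*} [TopologicalSpace X] [T2Space X] [GSpace 𝒢 X]

variable (𝒢 X) in
/-- The action of `C_c^∞(G⁰)` on `C_c^∞(X)` by pulling back along the anchor map. -/
def pull : Cc 𝒢.Obj →ₙₐ[ℂ] Module.End ℂ (Cc X) where
  toFun h :=
    { toFun := fun g => Cc.mk' (fun x => h (GSpace.anchor (𝒢 := 𝒢) x) * g x)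
        ((h.locConst.comp_continuous GSpace.continuous_anchor).mul g.locConst)
        (Function.support g) g.isCompact_support
        (fun x hx => by rw [Function.notMem_support.mp hx, mul_zero])
      map_add' := fun f g => by ext x; simp [mul_add]
      map_smul' := fun c f => by ext x; simp [mul_left_comm] }
  map_smul' := fun c h => by ext g x; simp [mul_assoc]
  map_zero' := by ext g x; simp
  map_add' := fun h k => by ext g x; simp [add_mul]
  map_mul' := fun h k => by ext g x; simp [mul_assoc]

instance Cc.baseModule : Module (Base 𝒢) (Cc X) :=
  Module.compHom (Cc X) (Base.lift (pull 𝒢 X)).toRingHom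

theorem Cc.base_smul_def (k : Base 𝒢) (f : Cc X) : k • f = Base.lift (pull 𝒢 X) k f := rfl

@[simp] theorem Cc.of_smul_apply (h : Cc 𝒢.Obj) (f : Cc X) (x : X) :
    (of h • f) x = h (GSpace.anchor (𝒢 := 𝒢) x) * f x := by
  rw [Cc.base_smul_def, lift_of]; rfl

instance : IsScalarTower ℂ (Base 𝒢) (Cc X) where
  smul_assoc z k f := by rw [Cc.base_smul_def, map_smul]; rfl

instance : IsScalarTower (Base 𝒢) (Cc X) (Cc X) where
  smul_assoc k f g := by
    obtain ⟨z, h, rfl⟩ := exists_rep k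
    ext x
    simp [add_smul, algebraMap_smul, add_mul, mul_assoc]

instance : SMulCommClass (Base 𝒢) (Cc X) (Cc X) where
  smul_comm k f g := by
    obtain ⟨z, h, rfl⟩ := exists_rep k
    ext x
    simp [add_smul, algebraMap_smul, mul_add, mul_left_comm]

end CcModule

/-! ### Restriction to the unit space, and operations on bisections -/

theorem isOpen_units : IsOpen {α : 𝒢.Arr | α = 𝒢.unit (𝒢.rng α)} := by
  rw [isOpen_iff_forall_mem_open]
  intro α hα
  obtain ⟨U, hU, hαU, _⟩ := exists_bis isOpen_univ (Set.mem_univ α)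
  refine ⟨U ∩ (fun β => 𝒢.unit (𝒢.rng β)) ⁻¹' U, ?_, ?_, ?_⟩
  · rintro β ⟨h1, h2⟩
    exact hU.2 h1 h2 (by rw [𝒢.rng_unit])
  · exact U.isOpen.inter (U.isOpen.preimage (𝒢.continuous_unit.comp 𝒢.continuous_rng))
  · refine ⟨hαU, ?_⟩
    change 𝒢.unit (𝒢.rng α) ∈ U
    have hα' : α = 𝒢.unit (𝒢.rng α) := hα
    rwa [← hα']

open Classical in
/-- Extension by zero along the inclusion of units `G⁰ → G`. -/
def incl (h : Cc 𝒢.Obj) : Cc 𝒢.Arr :=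
  Cc.mk' (fun α => if α = 𝒢.unit (𝒢.rng α) then h (𝒢.rng α) else 0)
    (by
      rw [IsLocallyConstant.iff_exists_open]
      intro α
      by_cases hα : α = 𝒢.unit (𝒢.rng α)
      · refine ⟨{β | β = 𝒢.unit (𝒢.rng β)} ∩ {β | h (𝒢.rng β) = h (𝒢.rng α)},
          isOpen_units.inter ((h.locConst.isOpen_fiber _).preimage 𝒢.continuous_rng), ⟨hα, rfl⟩, ?_⟩
        rintro β ⟨h1, h2⟩
        have h1' : β = 𝒢.unit (𝒢.rng β) := h1
        rw [if_pos hα, if_pos h1']; exact h2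
      · refine ⟨{β | β = 𝒢.unit (𝒢.rng β)}ᶜ, (isClosed_eq continuous_id
          (𝒢.continuous_unit.comp 𝒢.continuous_rng)).isOpen_compl, hα, ?_⟩
        intro β hβ
        have hβ' : ¬ β = 𝒢.unit (𝒢.rng β) := hβ
        rw [if_neg hα, if_neg hβ'])
    (𝒢.unit '' Function.support h) (h.isCompact_support.image 𝒢.continuous_unit)
    (fun α hα => by
      by_cases h1 : α = 𝒢.unit (𝒢.rng α)
      · rw [if_pos h1]
        by_contra h2
        exact hα ⟨𝒢.rng α, h2, h1.symm⟩
      · rw [if_neg h1])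

theorem incl_apply_unit (h : Cc 𝒢.Obj) {α : 𝒢.Arr} (hα : α = 𝒢.unit (𝒢.rng α)) :
    incl h α = h (𝒢.rng α) := if_pos hα

theorem incl_apply_of_ne (h : Cc 𝒢.Obj) {α : 𝒢.Arr} (hα : α ≠ 𝒢.unit (𝒢.rng α)) :
    incl h α = 0 := if_neg hα

theorem conv_incl {X : Type*} [TopologicalSpace X] [T2Space X] [GSpace 𝒢 X] (h : Cc 𝒢.Obj)
    (g : Cc X) : conv 𝒢 X (incl h) g = of h • g := by
  ext x
  have hu : 𝒢.rng (𝒢.unit (GSpace.anchor (𝒢 := 𝒢) x)) = GSpace.anchor x := 𝒢.rng_unit _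
  rw [conv_apply, finsum_eq_single _ (⟨𝒢.unit (GSpace.anchor x), hu⟩ :
    {β : 𝒢.Arr // 𝒢.rng β = GSpace.anchor (𝒢 := 𝒢) x})]
  · rw [incl_apply_unit _ (by rw [hu]), hu, AmpleGroupoid.inv_unit, GSpace.unit_act,
      Cc.of_smul_apply]
  · rintro ⟨β, hβ⟩ hne
    rw [incl_apply_of_ne, zero_mul]
    intro h'
    exact hne (Subtype.ext (by rw [h', hβ]))

section bisOps

/-- The image of a compact open set under the source map. -/
def srcCO (U : CompactOpens 𝒢.Arr) : CompactOpens 𝒢.Obj :=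
  U.map 𝒢.src 𝒢.continuous_src AmpleGroupoid.isOpenMap_src

/-- The image of a compact open set under the range map. -/
def rngCO (U : CompactOpens 𝒢.Arr) : CompactOpens 𝒢.Obj :=
  U.map 𝒢.rng 𝒢.continuous_rng AmpleGroupoid.isOpenMap_rng

theorem mem_srcCO {U : CompactOpens 𝒢.Arr} {x : 𝒢.Obj} : x ∈ srcCO U ↔ ∃ α ∈ U, 𝒢.src α = x :=
  Iff.rfl

theorem mem_rngCO {U : CompactOpens 𝒢.Arr} {x : 𝒢.Obj} : x ∈ rngCO U ↔ ∃ α ∈ U, 𝒢.rng α = x :=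
  Iff.rfl

/-- `U⁻¹`. -/
def binv (U : CompactOpens 𝒢.Arr) : CompactOpens 𝒢.Arr where
  carrier := 𝒢.inv ⁻¹' U
  isCompact' := by
    have : 𝒢.inv ⁻¹' U = 𝒢.inv '' U := by
      ext α; constructor
      · intro h; exact ⟨𝒢.inv α, h, AmpleGroupoid.inv_inv α⟩
      · rintro ⟨β, hβ, rfl⟩
        simpa [AmpleGroupoid.inv_inv] using hβ
    rw [this]
    exact U.isCompact.image 𝒢.continuous_inv
  isOpen' := U.isOpen.preimage 𝒢.continuous_inv

theorem mem_binv {U : CompactOpens 𝒢.Arr} {α : 𝒢.Arr} : α ∈ binv U ↔ 𝒢.inv α ∈ U := Iff.rfl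

theorem isBis_binv {U : CompactOpens 𝒢.Arr} (hU : IsBis 𝒢 U) : IsBis 𝒢 (binv U) := by
  constructor
  · intro α hα β hβ h
    rw [← AmpleGroupoid.inv_inv α, hU.2 hα hβ (by rw [𝒢.rng_inv, 𝒢.rng_inv, h]),
      AmpleGroupoid.inv_inv]
  · intro α hα β hβ h
    rw [← AmpleGroupoid.inv_inv α, hU.1 hα hβ (by rw [𝒢.src_inv, 𝒢.src_inv, h]),
      AmpleGroupoid.inv_inv]

/-- The product `U V = {α β | α ∈ U, β ∈ V, s α = r β}` of compact open bisections. -/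
theorem exists_bmul {U V : CompactOpens 𝒢.Arr} (hU : IsBis 𝒢 U) (hV : IsBis 𝒢 V) :
    ∃ W : CompactOpens 𝒢.Arr, IsBis 𝒢 W ∧
      conv 𝒢 𝒢.Arr (Cc.chi U) (Cc.chi V) = Cc.chi W := by
  have key : ∀ α, conv 𝒢 𝒢.Arr (Cc.chi U) (Cc.chi V) α ≠ 0 →
      ∃ β ∈ U, 𝒢.rng β = 𝒢.rng α ∧ 𝒢.mul (𝒢.inv β) α ∈ V ∧
        conv 𝒢 𝒢.Arr (Cc.chi U) (Cc.chi V) α = 1 := by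
    intro α hα
    by_cases h : ∃ β ∈ U, 𝒢.rng β = 𝒢.rng α
    · obtain ⟨β, hβ, h⟩ := h
      have e := conv_chi_of_mem (X := 𝒢.Arr) hU (Cc.chi V) hβ h
      have hm : 𝒢.mul (𝒢.inv β) α ∈ V := by
        by_contra hm
        rw [e] at hα
        exact hα (Cc.chi_of_notMem hm)
      exact ⟨β, hβ, h, hm, e.trans (Cc.chi_of_mem hm)⟩
    · exact absurd (conv_chi_of_notMem (X := 𝒢.Arr) _ fun β hβ h' => h ⟨β, hβ, h'⟩) hα
  refine ⟨⟨⟨_, (conv 𝒢 𝒢.Arr (Cc.chi U) (Cc.chi V)).isCompact_support⟩,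
    (conv 𝒢 𝒢.Arr (Cc.chi U) (Cc.chi V)).isOpen_support⟩, ⟨?_, ?_⟩, ?_⟩
  · intro α hα α' hα' h
    obtain ⟨β, hβ, hr, hm, _⟩ := key α hα
    obtain ⟨β', hβ', hr', hm', _⟩ := key α' hα'
    have c : 𝒢.src (𝒢.inv β) = 𝒢.rng α := by rw [𝒢.src_inv, hr]
    have c' : 𝒢.src (𝒢.inv β') = 𝒢.rng α' := by rw [𝒢.src_inv, hr']
    have e : 𝒢.mul (𝒢.inv β) α = 𝒢.mul (𝒢.inv β') α' :=
      hV.1 hm hm' (by rw [𝒢.src_mul _ _ c, 𝒢.src_mul _ _ c', h])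
    have e2 : β = β' := by
      apply hU.1 hβ hβ'
      rw [← 𝒢.rng_inv β, ← 𝒢.rng_inv β', ← 𝒢.rng_mul _ _ c, e, 𝒢.rng_mul _ _ c']
    subst e2
    rw [← AmpleGroupoid.mul_inv_cancel_left hr, e, AmpleGroupoid.mul_inv_cancel_left hr']
  · intro α hα α' hα' h
    obtain ⟨β, hβ, hr, hm, _⟩ := key α hα
    obtain ⟨β', hβ', hr', hm', _⟩ := key α' hα'
    have c : 𝒢.src (𝒢.inv β) = 𝒢.rng α := by rw [𝒢.src_inv, hr]
    have c' : 𝒢.src (𝒢.inv β') = 𝒢.rng α' := by rw [𝒢.src_inv, hr']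
    have e2 : β = β' := hU.2 hβ hβ' (by rw [hr, hr', h])
    subst e2
    have e : 𝒢.mul (𝒢.inv β) α = 𝒢.mul (𝒢.inv β) α' :=
      hV.2 hm hm' (by rw [𝒢.rng_mul _ _ c, 𝒢.rng_mul _ _ c'])
    rw [← AmpleGroupoid.mul_inv_cancel_left hr, e, AmpleGroupoid.mul_inv_cancel_left hr']
  · ext α
    by_cases hα : conv 𝒢 𝒢.Arr (Cc.chi U) (Cc.chi V) α = 0
    · rw [hα, Cc.chi_of_notMem]
      exact fun h => h hα
    · obtain ⟨_, _, _, _, e⟩ := key α hα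
      rw [e, Cc.chi_of_mem]
      exact hα

theorem conv_chi_mul {X : Type*} [TopologicalSpace X] [T2Space X] [GSpace 𝒢 X]
    {U : CompactOpens 𝒢.Arr} (hU : IsBis 𝒢 U) (f g : Cc X) :
    conv 𝒢 X (Cc.chi U) (f * g) = conv 𝒢 X (Cc.chi U) f * conv 𝒢 X (Cc.chi U) g := by
  ext x
  by_cases h : ∃ β ∈ U, 𝒢.rng β = GSpace.anchor (𝒢 := 𝒢) x
  · obtain ⟨β, hβ, h⟩ := h
    rw [Cc.mul_apply, conv_chi_of_mem hU _ hβ h, conv_chi_of_mem hU _ hβ h,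
      conv_chi_of_mem hU _ hβ h, Cc.mul_apply]
  · have h' : ∀ β ∈ U, 𝒢.rng β ≠ GSpace.anchor (𝒢 := 𝒢) x := fun β hβ h' => h ⟨β, hβ, h'⟩
    rw [Cc.mul_apply, conv_chi_of_notMem _ h', conv_chi_of_notMem _ h', zero_mul]

theorem conv_chi_incl {U : CompactOpens 𝒢.Arr} (hU : IsBis 𝒢 U) (h : Cc 𝒢.Obj) :
    conv 𝒢 𝒢.Arr (Cc.chi U) (incl h) =
      (of (conv 𝒢 𝒢.Obj (Cc.chi U) h) • Cc.chi U : Cc 𝒢.Arr) := by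
  ext α
  rw [Cc.of_smul_apply]
  change _ = conv 𝒢 𝒢.Obj (Cc.chi U) h (𝒢.rng α) * Cc.chi U α
  by_cases hx : ∃ β ∈ U, 𝒢.rng β = 𝒢.rng α
  · obtain ⟨β, hβ, hr⟩ := hx
    rw [conv_chi_of_mem hU _ hβ hr, conv_chi_of_mem (X := 𝒢.Obj) (x := 𝒢.rng α) hU _ hβ hr]
    change incl h (𝒢.mul (𝒢.inv β) α) = h (𝒢.rng (𝒢.inv β)) * _
    have c : 𝒢.src (𝒢.inv β) = 𝒢.rng α := by rw [𝒢.src_inv, hr]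
    have e := 𝒢.rng_mul _ _ c
    by_cases hα : α ∈ U
    · have : β = α := hU.2 hβ hα hr
      subst this
      rw [Cc.chi_of_mem hα, mul_one, incl_apply_unit, e]
      rw [e, 𝒢.rng_inv, 𝒢.inv_mul]
    · rw [Cc.chi_of_notMem hα, mul_zero, incl_apply_of_ne]
      intro hu
      apply hα
      have h2 := AmpleGroupoid.mul_inv_cancel_left hr
      rw [hu, e, 𝒢.rng_inv, 𝒢.mul_unit] at h2
      rwa [← h2]
  · have h' : ∀ β ∈ U, 𝒢.rng β ≠ 𝒢.rng α := fun β hβ h' => hx ⟨β, hβ, h'⟩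
    rw [conv_chi_of_notMem _ h', conv_chi_of_notMem (X := 𝒢.Obj) (x := 𝒢.rng α) _ h', zero_mul]

theorem of_chi_smul_chi {V : CompactOpens 𝒢.Obj} {U : CompactOpens 𝒢.Arr} (h : rngCO U ≤ V) :
    (of (Cc.chi V) • Cc.chi U : Cc 𝒢.Arr) = Cc.chi U := by
  ext α
  rw [Cc.of_smul_apply]
  by_cases hα : α ∈ U
  · rw [Cc.chi_of_mem (h ⟨α, hα, rfl⟩ : GSpace.anchor (𝒢 := 𝒢) α ∈ V), one_mul]
  · rw [Cc.chi_of_notMem hα, mul_zero]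

theorem disjoint_iff_CO {X : Type*} [TopologicalSpace X] {V W : CompactOpens X} [T2Space X] :
    Disjoint V W ↔ ∀ x ∈ V, x ∉ W := by
  rw [disjoint_iff]
  constructor
  · intro h x hx hx'
    have : x ∈ V ⊓ W := ⟨hx, hx'⟩
    rw [h] at this; exact this
  · intro h
    ext x
    exact ⟨fun hx => (h x hx.1 hx.2).elim, fun hx => hx.elim⟩

theorem disjoint_rngCO {V W : CompactOpens 𝒢.Arr} (hVW : IsBis 𝒢 (V ⊔ W)) (h : Disjoint V W) :
    Cc.chi (rngCO V) * Cc.chi (rngCO W) = 0 := by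
  ext x
  rw [Cc.mul_apply, Cc.zero_apply]
  by_cases h1 : x ∈ rngCO V
  · by_cases h2 : x ∈ rngCO W
    · obtain ⟨α, hα, rfl⟩ := h1
      obtain ⟨β, hβ, h3⟩ := h2
      have : β = α := hVW.2 (show β ∈ V ⊔ W from Or.inr hβ) (show α ∈ V ⊔ W from Or.inl hα) h3
      subst this
      exact absurd hβ (disjoint_iff_CO.mp h _ hα)
    · rw [Cc.chi_of_notMem h2, mul_zero]
  · rw [Cc.chi_of_notMem h1, zero_mul]

end bisOps

/-! ### `G`-modules -/

variable (𝒢) in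
/-- A (left) `G`-module: an essential left module over the Steinberg algebra `C_c^∞(G)` with
convolution, that is, one with `C_c^∞(G) M = M`. The field `act_incl` says that the
`C_c^∞(G⁰)`-module structure of `M` is the restriction of the action along the inclusion of
`C_c^∞(G⁰)` by extension by zero. -/
class GModule (M : Type*) [AddCommGroup M] [Module ℂ M] [Module (Base 𝒢) M] where
  act : Cc 𝒢.Arr →ₗ[ℂ] Module.End ℂ M
  act_conv : ∀ f g m, act (conv 𝒢 𝒢.Arr f g) m = act f (act g m)
  act_incl : ∀ (h : Cc 𝒢.Obj) m, act (incl h) m = of h • m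
  span_act : Submodule.span ℂ {x : M | ∃ f m, act f m = x} = ⊤

namespace GModule

section basic

theorem chi_smul_of_le {M : Type*} [AddCommGroup M] [Module (Base 𝒢) M] {V W : CompactOpens 𝒢.Obj} (h : V ≤ W) {m : M}
      (hm : of (Cc.chi V) • m = m) : of (Cc.chi W) • m = m := by
  conv_lhs => rw [← hm]
  rw [smul_smul, ← map_mul]
  have : Cc.chi W * Cc.chi V = Cc.chi V := by
    ext x
    by_cases hx : x ∈ V
    · simp [Cc.chi_of_mem hx, Cc.chi_of_mem (h hx)]
    · simp [Cc.chi_of_notMem hx]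
  rw [this, hm]

variable {M : Type*} [AddCommGroup M] [Module ℂ M] [Module (Base 𝒢) M]

section
variable [GModule 𝒢 M]

theorem of_smul_act (h : Cc 𝒢.Obj) (f : Cc 𝒢.Arr) (m : M) :
    of h • act f m = act (𝒢 := 𝒢) (of h • f) m := by
  rw [← act_incl, ← act_conv, conv_incl]

theorem act_chi_smul {U : CompactOpens 𝒢.Arr} (hU : IsBis 𝒢 U) (h : Cc 𝒢.Obj) (m : M) :
    act (Cc.chi U) (of h • m) =
      of (conv 𝒢 𝒢.Obj (Cc.chi U) h) • act (𝒢 := 𝒢) (Cc.chi U) m := by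
  rw [← act_incl, ← act_conv, conv_chi_incl hU, of_smul_act]

theorem chi_rng_smul (U : CompactOpens 𝒢.Arr) (m : M) :
    of (Cc.chi (rngCO U)) • act (𝒢 := 𝒢) (Cc.chi U) m = act (𝒢 := 𝒢) (Cc.chi U) m := by
  rw [of_smul_act, of_chi_smul_chi le_rfl]

variable (𝒢) in
/-- Every element of a `G`-module is fixed by the characteristic function of a compact open
subset of `G⁰`. -/
theorem exists_chi_smul (m : M) [IsScalarTower ℂ (Base 𝒢) M] :
    ∃ V : CompactOpens 𝒢.Obj, of (Cc.chi V) • m = m := by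
  have hm : m ∈ Submodule.span ℂ {x : M | ∃ f m, act (𝒢 := 𝒢) f m = x} := by
    rw [span_act]; trivial
  induction hm using Submodule.span_induction with
  | mem x hx =>
    obtain ⟨f, m, rfl⟩ := hx
    obtain ⟨V, hV⟩ := exists_compactOpen_superset (f.isCompact_support.image 𝒢.continuous_rng)
    refine ⟨V, ?_⟩
    rw [of_smul_act]
    congr 2
    ext α
    rw [Cc.of_smul_apply]
    by_cases hα : f α = 0
    · rw [hα, mul_zero]
    · rw [Cc.chi_of_mem (hV ⟨α, hα, rfl⟩ : GSpace.anchor (𝒢 := 𝒢) α ∈ V), one_mul]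
  | zero => exact ⟨⊥, smul_zero _⟩
  | add x y _ _ hx hy =>
    obtain ⟨V, hV⟩ := hx
    obtain ⟨W, hW⟩ := hy
    exact ⟨V ⊔ W, by rw [smul_add, chi_smul_of_le le_sup_left hV, chi_smul_of_le le_sup_right hW]⟩
  | smul c x _ hx =>
    obtain ⟨V, hV⟩ := hx
    exact ⟨V, by rw [smul_comm, hV]⟩

end

/-- Local units imply that a module is essential. -/
theorem span_act_of (a : Cc 𝒢.Arr →ₗ[ℂ] Module.End ℂ M)
    (hi : ∀ (h : Cc 𝒢.Obj) m, a (incl h) m = of h • m)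
    (hl : ∀ m : M, ∃ V : CompactOpens 𝒢.Obj, of (Cc.chi V) • m = m) :
    Submodule.span ℂ {x : M | ∃ f m, a f m = x} = ⊤ := by
  rw [eq_top_iff]
  intro m _
  obtain ⟨V, hV⟩ := hl m
  exact Submodule.subset_span ⟨_, m, (hi _ m).trans hV⟩

variable [IsScalarTower ℂ (Base 𝒢) M]

/-- Construct a `G`-module from the action of compact open bisections. -/
@[reducible] def ofBis (ρ : CompactOpens 𝒢.Arr → Module.End ℂ M)
    (hadd : ∀ V W, V ⊔ W ∈ (bisFamily 𝒢).sets → Disjoint V W → ρ (V ⊔ W) = ρ V + ρ W)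
    (hmul : ∀ U V W, IsBis 𝒢 U → IsBis 𝒢 V → IsBis 𝒢 W →
      conv 𝒢 𝒢.Arr (Cc.chi U) (Cc.chi V) = Cc.chi W → ∀ m, ρ W m = ρ U (ρ V m))
    (hincl : ∀ U (V : CompactOpens 𝒢.Obj), IsBis 𝒢 U → incl (Cc.chi V) = Cc.chi U →
      ∀ m, ρ U m = of (Cc.chi V) • m)
    (hl : ∀ m : M, ∃ V : CompactOpens 𝒢.Obj, of (Cc.chi V) • m = m) : GModule 𝒢 M :=
  have hi : ∀ (h : Cc 𝒢.Obj) m, Cc.extend (bisFamily 𝒢) ρ hadd (incl h) m = of h • m := by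
    intro h m
    have hlin : ∀ (c : ℂ) (h k : Cc 𝒢.Obj), incl (c • h) = c • incl h ∧
        incl (h + k) = incl h + incl k := by
      intro c h k
      constructor
      · ext α
        by_cases hα : α = 𝒢.unit (𝒢.rng α)
        · simp [incl_apply_unit _ hα]
        · simp [incl_apply_of_ne _ hα]
      · ext α
        by_cases hα : α = 𝒢.unit (𝒢.rng α)
        · simp [incl_apply_unit _ hα]
        · simp [incl_apply_of_ne _ hα]
    refine Cc.span_induction (X := 𝒢.Obj) ⟨Set.univ, fun _ _ _ _ => trivial, fun x => by
      obtain ⟨V, hV, _⟩ := exists_compactOpen isOpen_univ (Set.mem_univ x)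
      exact ⟨V, trivial, hV⟩⟩
      (P := fun h => Cc.extend (bisFamily 𝒢) ρ hadd (incl h) m = of h • m) ?_ ?_ ?_ ?_ h
    · intro V _
      obtain ⟨U, hU, hUV⟩ : ∃ U, IsBis 𝒢 U ∧ incl (Cc.chi V) = Cc.chi U := by
        refine ⟨⟨⟨𝒢.unit '' V, V.isCompact.image 𝒢.continuous_unit⟩, ?_⟩, ⟨?_, ?_⟩, ?_⟩
        · have : 𝒢.unit '' V = {α : 𝒢.Arr | α = 𝒢.unit (𝒢.rng α)} ∩ 𝒢.rng ⁻¹' V := by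
            ext α; constructor
            · rintro ⟨x, hx, rfl⟩
              exact ⟨by simp [𝒢.rng_unit], by simpa [𝒢.rng_unit] using hx⟩
            · rintro ⟨h1, h2⟩
              exact ⟨_, h2, h1.symm⟩
          change IsOpen (𝒢.unit '' V)
          rw [this]
          exact isOpen_units.inter (V.isOpen.preimage 𝒢.continuous_rng)
        · rintro _ ⟨x, _, rfl⟩ _ ⟨y, _, rfl⟩ h
          rw [𝒢.src_unit, 𝒢.src_unit] at h; rw [h]
        · rintro _ ⟨x, _, rfl⟩ _ ⟨y, _, rfl⟩ h
          rw [𝒢.rng_unit, 𝒢.rng_unit] at h; rw [h]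
        · ext α
          by_cases hα : α = 𝒢.unit (𝒢.rng α)
          · rw [incl_apply_unit _ hα]
            by_cases hV : 𝒢.rng α ∈ V
            · rw [Cc.chi_of_mem hV, Cc.chi_of_mem]
              exact ⟨_, hV, hα.symm⟩
            · rw [Cc.chi_of_notMem hV, Cc.chi_of_notMem]
              rintro ⟨x, hx, rfl⟩
              exact hV (by rwa [𝒢.rng_unit])
          · rw [incl_apply_of_ne _ hα, Cc.chi_of_notMem]
            rintro ⟨x, hx, rfl⟩
            exact hα (by rw [𝒢.rng_unit])
      rw [hUV, Cc.extend_chi _ _ _ hU, hincl U V hU hUV]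
    · have := (hlin 0 0 0).1
      simp only [zero_smul] at this
      simp [this]
    · intro f g hf hg
      rw [(hlin 0 f g).2, map_add, LinearMap.add_apply, hf, hg, map_add, add_smul]
    · intro c f hf
      rw [(hlin c f f).1, map_smul, LinearMap.smul_apply, hf, map_smul, smul_assoc]
  { act := Cc.extend (bisFamily 𝒢) ρ hadd
    act_conv := by
      intro f g m
      refine Cc.span_induction (bisFamily 𝒢) (P := fun f =>
        Cc.extend (bisFamily 𝒢) ρ hadd (conv 𝒢 𝒢.Arr f g) m = Cc.extend (bisFamily 𝒢) ρ hadd f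
          (Cc.extend (bisFamily 𝒢) ρ hadd g m)) ?_ ?_ ?_ ?_ f
      · intro U hU
        refine Cc.span_induction (bisFamily 𝒢) (P := fun g =>
          Cc.extend (bisFamily 𝒢) ρ hadd (conv 𝒢 𝒢.Arr (Cc.chi U) g) m =
            Cc.extend (bisFamily 𝒢) ρ hadd (Cc.chi U)
              (Cc.extend (bisFamily 𝒢) ρ hadd g m)) ?_ ?_ ?_ ?_ g
        · intro V hV
          obtain ⟨W, hW, e⟩ := exists_bmul hU hV
          rw [e, Cc.extend_chi _ _ _ hU, Cc.extend_chi _ _ _ hV, Cc.extend_chi _ _ _ hW]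
          exact hmul U V W hU hV hW e m
        · simp
        · intro f g hf hg
          simp only [map_add, LinearMap.add_apply, hf, hg]
        · intro c f hf
          simp only [map_smul, LinearMap.smul_apply, hf]
      · simp
      · intro f g hf hg
        simp only [map_add, LinearMap.add_apply, hf, hg]
      · intro c f hf
        simp only [map_smul, LinearMap.smul_apply, hf]
    act_incl := hi
    span_act := span_act_of _ hi hl }

theorem ofBis_act_chi (ρ : CompactOpens 𝒢.Arr → Module.End ℂ M) (hadd) (hmul) (hincl) (hl)
    {U : CompactOpens 𝒢.Arr} (hU : IsBis 𝒢 U) :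
    (ofBis ρ hadd hmul hincl hl).act (Cc.chi U) = ρ U :=
  Cc.extend_chi (bisFamily 𝒢) ρ hadd hU

end basic

variable (𝒢) in
/-- A linear map between `G`-modules is equivariant if it is linear over `C_c^∞(G)`. -/
def IsEquivariant {M N : Type*} [AddCommGroup M] [Module ℂ M] [Module (Base 𝒢) M] [GModule 𝒢 M]
    [AddCommGroup N] [Module ℂ N] [Module (Base 𝒢) N] [GModule 𝒢 N] (f : M → N) : Prop :=
  ∀ (a : Cc 𝒢.Arr) m, f (act a m) = act a (f m)

theorem isEquivariant_of_chi {M N : Type*} [AddCommGroup M] [Module ℂ M] [Module (Base 𝒢) M]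
    [GModule 𝒢 M] [AddCommGroup N] [Module ℂ N] [Module (Base 𝒢) N] [GModule 𝒢 N] (f : M →ₗ[ℂ] N)
    (h : ∀ U, IsBis 𝒢 U → ∀ m, f (act (Cc.chi U) m) = act (Cc.chi U) (f m)) :
    IsEquivariant 𝒢 f := by
  intro a m
  refine Cc.span_induction (bisFamily 𝒢) (P := fun a => f (act a m) = act a (f m)) ?_ ?_ ?_ ?_ a
  · exact fun U hU => h U hU m
  · simp
  · intro a b ha hb
    simp only [map_add, LinearMap.add_apply, ha, hb]
  · intro c a ha
    simp only [map_smul, LinearMap.smul_apply, ha]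

end GModule

end AmpleHP

end

noncomputable section

open TopologicalSpace
open scoped TensorProduct

namespace AmpleHP

universe u₁ u₂

variable {𝒢 : AmpleGroupoid.{u₁, u₂}}

open Base

namespace GModule

section Cc
variable {X : Type*} [TopologicalSpace X] [T2Space X] [GSpace 𝒢 X]

theorem Cc_local (f : Cc X) : ∃ V : CompactOpens 𝒢.Obj, of (Cc.chi V) • f = f := by
  obtain ⟨V, hV⟩ := exists_compactOpen_superset
    (f.isCompact_support.image (GSpace.continuous_anchor (𝒢 := 𝒢)))
  refine ⟨V, Cc.ext fun x => ?_⟩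
  rw [Cc.of_smul_apply]
  by_cases hx : f x = 0
  · rw [hx, mul_zero]
  · rw [Cc.chi_of_mem (hV ⟨x, hx, rfl⟩ : GSpace.anchor (𝒢 := 𝒢) x ∈ V), one_mul]

/-- Functions on a `G`-space form a `G`-module by convolution. -/
instance instCc : GModule 𝒢 (Cc X) where
  act := conv 𝒢 X
  act_conv := conv_conv
  act_incl := conv_incl
  span_act := span_act_of _ conv_incl Cc_local

end Cc

section sigma

/-- The endomorphism of the unitisation of `C_c^∞(G⁰)` induced by translation with a bisection. -/
def sigma (U : CompactOpens 𝒢.Arr) (hU : IsBis 𝒢 U) : Base 𝒢 →ₐ[ℂ] Base 𝒢 :=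
  Base.lift
    { toFun := fun h => of (conv 𝒢 𝒢.Obj (Cc.chi U) h)
      map_smul' := fun c h => by simp
      map_zero' := by simp
      map_add' := fun h k => by simp
      map_mul' := fun h k => by rw [conv_chi_mul hU, map_mul] }

theorem sigma_of (U : CompactOpens 𝒢.Arr) (hU : IsBis 𝒢 U) (h : Cc 𝒢.Obj) :
    sigma U hU (of h) = of (conv 𝒢 𝒢.Obj (Cc.chi U) h) := by
  rw [sigma, lift_of]; rfl

variable {M : Type*} [AddCommGroup M] [Module ℂ M] [Module (Base 𝒢) M] [IsScalarTower ℂ (Base 𝒢) M]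
  [GModule 𝒢 M]

/-- The action of a bisection as a semilinear map. -/
def actS (U : CompactOpens 𝒢.Arr) (hU : IsBis 𝒢 U) : M →ₛₗ[(sigma U hU).toRingHom] M where
  toFun := act (Cc.chi U)
  map_add' := map_add _
  map_smul' := fun k m => by
    obtain ⟨z, h, rfl⟩ := exists_rep k
    change _ = sigma U hU _ • _
    rw [map_add, AlgHom.commutes, sigma_of, add_smul, add_smul, map_add, act_chi_smul hU,
      algebraMap_smul, algebraMap_smul, map_smul]

@[simp] theorem actS_apply (U : CompactOpens 𝒢.Arr) (hU : IsBis 𝒢 U) (m : M) :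
    actS U hU m = act (Cc.chi U) m := rfl

end sigma

section tensor

variable {M N : Type*} [AddCommGroup M] [Module ℂ M] [Module (Base 𝒢) M]
  [IsScalarTower ℂ (Base 𝒢) M] [GModule 𝒢 M] [AddCommGroup N] [Module ℂ N] [Module (Base 𝒢) N]
  [IsScalarTower ℂ (Base 𝒢) N] [GModule 𝒢 N]

instance : IsScalarTower ℂ (Base 𝒢) (M ⊗[Base 𝒢] N) := inferInstance

open Classical in
variable (M N) in
/-- The diagonal action of a bisection on a tensor product. -/
def tensorRho (U : CompactOpens 𝒢.Arr) : Module.End ℂ (M ⊗[Base 𝒢] N) :=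
  if hU : IsBis 𝒢 U then
    { toFun := TensorProduct.map (actS U hU) (actS U hU)
      map_add' := map_add _
      map_smul' := fun c x => by
        rw [← algebraMap_smul (Base 𝒢) c x, LinearMap.map_smulₛₗ]
        change sigma U hU _ • _ = _
        rw [AlgHom.commutes, algebraMap_smul]; rfl }
  else 0

theorem tensorRho_tmul {U : CompactOpens 𝒢.Arr} (hU : IsBis 𝒢 U) (m : M) (n : N) :
    tensorRho M N U (m ⊗ₜ n) = act (Cc.chi U) m ⊗ₜ act (Cc.chi U) n := by
  rw [tensorRho, dif_pos hU]; rfl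

/-- The diagonal action `χ_U · (m ⊗ n) = χ_U · m ⊗ χ_U · n` on a balanced tensor product. -/
instance instTensor : GModule 𝒢 (M ⊗[Base 𝒢] N) :=
  ofBis (tensorRho M N)
    (by
      intro V W hVW hd
      have hV : IsBis 𝒢 V := (bisFamily 𝒢).lower le_sup_left hVW
      have hW : IsBis 𝒢 W := (bisFamily 𝒢).lower le_sup_right hVW
      have key : ∀ {P Q : Type _} [AddCommGroup P] [Module ℂ P] [Module (Base 𝒢) P]
          [IsScalarTower ℂ (Base 𝒢) P] [GModule 𝒢 P] [AddCommGroup Q] [Module ℂ Q]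
          [Module (Base 𝒢) Q] [IsScalarTower ℂ (Base 𝒢) Q] [GModule 𝒢 Q] (m : P) (n : Q),
          act (𝒢 := 𝒢) (Cc.chi V) m ⊗ₜ[Base 𝒢] act (𝒢 := 𝒢) (Cc.chi W) n = 0 ∧
          act (𝒢 := 𝒢) (Cc.chi W) m ⊗ₜ[Base 𝒢] act (𝒢 := 𝒢) (Cc.chi V) n = 0 := by
        intro P Q _ _ _ _ _ _ _ _ _ _ m n
        constructor
        · rw [← chi_rng_smul V m, ← chi_rng_smul W n, TensorProduct.smul_tmul_smul, ← map_mul,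
            disjoint_rngCO hVW hd, map_zero, zero_smul]
        · rw [← chi_rng_smul V n, ← chi_rng_smul W m, TensorProduct.smul_tmul_smul, ← map_mul,
            mul_comm, disjoint_rngCO hVW hd, map_zero, zero_smul]
      ext x
      induction x with
      | zero => simp
      | add x y hx hy => simp only [map_add, hx, hy]
      | tmul m n =>
        rw [LinearMap.add_apply, tensorRho_tmul hVW, tensorRho_tmul hV, tensorRho_tmul hW,
          Cc.chi_sup _ _ hd, map_add, map_add, LinearMap.add_apply, LinearMap.add_apply,
          TensorProduct.add_tmul, TensorProduct.tmul_add, TensorProduct.tmul_add,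
          (key m n).1, (key m n).2, add_zero, zero_add])
    (by
      intro U V W hU hV hW e x
      induction x with
      | zero => simp
      | add x y hx hy => simp only [map_add, hx, hy]
      | tmul m n =>
        rw [tensorRho_tmul hW, tensorRho_tmul hV, tensorRho_tmul hU, ← e, act_conv, act_conv])
    (by
      intro U V hU e x
      induction x with
      | zero => simp
      | add x y hx hy => simp only [map_add, hx, hy, smul_add]
      | tmul m n =>
        rw [tensorRho_tmul hU, ← e, act_incl, act_incl, TensorProduct.smul_tmul_smul, ← map_mul,
          TensorProduct.smul_tmul']
        congr 3
        ext x
        by_cases hx : x ∈ V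
        · simp [Cc.chi_of_mem hx]
        · simp [Cc.chi_of_notMem hx])
    (by
      intro x
      induction x with
      | zero => exact ⟨⊥, smul_zero _⟩
      | add x y hx hy =>
        obtain ⟨V, hV⟩ := hx
        obtain ⟨W, hW⟩ := hy
        exact ⟨V ⊔ W, by rw [smul_add, chi_smul_of_le le_sup_left hV,
          chi_smul_of_le le_sup_right hW]⟩
      | tmul m n =>
        obtain ⟨V, hV⟩ := exists_chi_smul 𝒢 m
        exact ⟨V, by rw [TensorProduct.smul_tmul', hV]⟩)

@[simp] theorem act_tmul {U : CompactOpens 𝒢.Arr} (hU : IsBis 𝒢 U) (m : M) (n : N) :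
    act (𝒢 := 𝒢) (Cc.chi U) (m ⊗ₜ[Base 𝒢] n) = act (Cc.chi U) m ⊗ₜ act (Cc.chi U) n := by
  rw [← tensorRho_tmul hU]
  unfold instTensor
  rw [ofBis_act_chi _ _ _ _ _ hU]

instance instProd : GModule 𝒢 (M × N) where
  act :=
    { toFun := fun f => (act f).prodMap (act f)
      map_add' := fun f g => by ext <;> simp
      map_smul' := fun c f => by ext <;> simp }
  act_conv := fun f g m => Prod.ext (act_conv f g m.1) (act_conv f g m.2)
  act_incl := fun h m => Prod.ext (act_incl h m.1) (act_incl h m.2)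
  span_act := span_act_of _ (fun h m => Prod.ext (act_incl h m.1) (act_incl h m.2)) (by
    rintro ⟨m, n⟩
    obtain ⟨V, hV⟩ := exists_chi_smul 𝒢 m
    obtain ⟨W, hW⟩ := exists_chi_smul 𝒢 n
    exact ⟨V ⊔ W, Prod.ext (chi_smul_of_le le_sup_left hV) (chi_smul_of_le le_sup_right hW)⟩)

theorem act_prod (f : Cc 𝒢.Arr) (x : M × N) : act f x = (act f x.1, act f x.2) := rfl

/-- The quotient of a `G`-module by a stable submodule. -/
@[reducible] def quotient (p : Submodule (Base 𝒢) M) (hp : ∀ (f : Cc 𝒢.Arr) m, m ∈ p → act f m ∈ p) :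
    GModule 𝒢 (M ⧸ p) where
  act :=
    { toFun := fun f => (p.restrictScalars ℂ).mapQ (p.restrictScalars ℂ) (act f) (hp f)
      map_add' := fun f g => by
        ext x
        change p.mkQ _ = p.mkQ _ + p.mkQ _
        rw [map_add, LinearMap.add_apply, map_add]
      map_smul' := fun c f => by
        ext x
        change p.mkQ _ = c • p.mkQ _
        rw [map_smul, LinearMap.smul_apply]; rfl }
  act_conv := fun f g m => by
    obtain ⟨x, rfl⟩ := p.mkQ_surjective m
    exact congrArg p.mkQ (act_conv f g x)
  act_incl := fun h m => by
    obtain ⟨x, rfl⟩ := p.mkQ_surjective m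
    exact congrArg p.mkQ (act_incl h x)
  span_act := span_act_of _ (fun h m => by
    obtain ⟨x, rfl⟩ := p.mkQ_surjective m
    exact congrArg p.mkQ (act_incl h x)) (fun m => by
    obtain ⟨x, rfl⟩ := p.mkQ_surjective m
    obtain ⟨V, hV⟩ := exists_chi_smul 𝒢 x
    exact ⟨V, by rw [← map_smul, hV]⟩)

end tensor

section directSum

variable {ι : Type*} {M : ι → Type*} [∀ i, AddCommGroup (M i)] [∀ i, Module ℂ (M i)]
  [∀ i, Module (Base 𝒢) (M i)] [∀ i, IsScalarTower ℂ (Base 𝒢) (M i)] [∀ i, GModule 𝒢 (M i)]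

instance : IsScalarTower ℂ (Base 𝒢) (DirectSum ι M) where
  smul_assoc z k x := by
    ext i
    simp only [DirectSum.smul_apply, smul_assoc]

instance instDirectSum : GModule 𝒢 (DirectSum ι M) :=
  have hi : ∀ (h : Cc 𝒢.Obj) (m : DirectSum ι M),
      DirectSum.lmap (fun i => act (𝒢 := 𝒢) (M := M i) (incl h)) m = of h • m := by
    intro h m
    ext i
    rw [DirectSum.lmap_apply, act_incl, DirectSum.smul_apply]
  { act :=
      { toFun := fun f => DirectSum.lmap fun i => act (𝒢 := 𝒢) (M := M i) f
        map_add' := fun f g => by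
          ext1 x; refine DFinsupp.ext fun i => ?_
          simp only [DirectSum.lmap_apply, map_add, LinearMap.add_apply, DirectSum.add_apply]
        map_smul' := fun c f => by
          ext1 x; refine DFinsupp.ext fun i => ?_
          simp only [DirectSum.lmap_apply, map_smul, LinearMap.smul_apply, DirectSum.smul_apply,
            RingHom.id_apply] }
    act_conv := fun f g m => by
      refine DFinsupp.ext fun i => ?_
      exact act_conv f g (m i)
    act_incl := hi
    span_act := span_act_of _ hi (by
      classical
      intro m
      induction m using DirectSum.induction_on with
      | zero => exact ⟨⊥, smul_zero _⟩
      | of i x =>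
        obtain ⟨V, hV⟩ := exists_chi_smul 𝒢 x
        refine ⟨V, ?_⟩
        conv_rhs => rw [← hV]
        exact (map_smul (DirectSum.lof (Base 𝒢) ι M i) _ _).symm
      | add x y hx hy =>
        obtain ⟨V, hV⟩ := hx
        obtain ⟨W, hW⟩ := hy
        exact ⟨V ⊔ W, by rw [smul_add, chi_smul_of_le le_sup_left hV,
          chi_smul_of_le le_sup_right hW]⟩) }

@[simp] theorem act_directSum_apply (f : Cc 𝒢.Arr) (x : DirectSum ι M) (i : ι) :
    (act f x : DirectSum ι M) i = act f (x i) := rfl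

theorem act_lof [DecidableEq ι] (f : Cc 𝒢.Arr) (i : ι) (x : M i) :
    act (𝒢 := 𝒢) f (DirectSum.lof (Base 𝒢) ι M i x) = DirectSum.lof (Base 𝒢) ι M i (act f x) :=
  DirectSum.lmap_lof (R := ℂ) (fun i => act (𝒢 := 𝒢) (M := M i) f) i x

end directSum

end GModule

/-! ### The space of loops -/

variable (𝒢) in
/-- `G_ad = {α ∈ G | r(α) = s(α)}`, with the subspace topology. -/
structure Ad where
  arr : 𝒢.Arr
  loop : 𝒢.rng arr = 𝒢.src arr

namespace Ad

instance : TopologicalSpace (Ad 𝒢) := .induced arr inferInstance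

theorem continuous_arr : Continuous (arr : Ad 𝒢 → 𝒢.Arr) := continuous_induced_dom

theorem arr_injective : Function.Injective (arr : Ad 𝒢 → 𝒢.Arr) := by
  rintro ⟨α, _⟩ ⟨β, _⟩ h; cases h; rfl

instance : T2Space (Ad 𝒢) := .of_injective_continuous arr_injective continuous_arr

/-- `β α β⁻¹` for composable `β`, `α`. -/
def conj (β : 𝒢.Arr) (α : Ad 𝒢) (h : 𝒢.src β = 𝒢.rng α.arr) : Ad 𝒢 where
  arr := 𝒢.mul (𝒢.mul β α.arr) (𝒢.inv β)
  loop := by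
    have h1 : 𝒢.src (𝒢.mul β α.arr) = 𝒢.rng (𝒢.inv β) := by
      rw [𝒢.src_mul _ _ h, 𝒢.rng_inv, h, α.loop]
    rw [𝒢.rng_mul _ _ h1, 𝒢.src_mul _ _ h1, 𝒢.rng_mul _ _ h, 𝒢.src_inv]

theorem rng_conj (β : 𝒢.Arr) (α : Ad 𝒢) (h : 𝒢.src β = 𝒢.rng α.arr) :
    𝒢.rng (conj β α h).arr = 𝒢.rng β := by
  have h1 : 𝒢.src (𝒢.mul β α.arr) = 𝒢.rng (𝒢.inv β) := by
    rw [𝒢.src_mul _ _ h, 𝒢.rng_inv, h, α.loop]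
  change 𝒢.rng (𝒢.mul (𝒢.mul β α.arr) (𝒢.inv β)) = _
  rw [𝒢.rng_mul _ _ h1, 𝒢.rng_mul _ _ h]

open Classical in
/-- `G` acts on `G_ad` by conjugation, `β · α = β α β⁻¹`. -/
instance : GSpace 𝒢 (Ad 𝒢) where
  anchor α := 𝒢.rng α.arr
  act β α := if h : 𝒢.src β = 𝒢.rng α.arr then conj β α h else α
  continuous_anchor := 𝒢.continuous_rng.comp continuous_arr
  continuousOn_act := by
    rw [continuousOn_iff_continuous_domRestrict, continuous_induced_rng]
    have : Continuous fun p : {p : 𝒢.Arr × Ad 𝒢 | 𝒢.src p.1 = 𝒢.rng p.2.arr} =>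
        𝒢.mul (𝒢.mul p.1.1 p.1.2.arr) (𝒢.inv p.1.1) := by
      have c1 : Continuous fun p : {p : 𝒢.Arr × Ad 𝒢 | 𝒢.src p.1 = 𝒢.rng p.2.arr} =>
          𝒢.mul p.1.1 p.1.2.arr :=
        𝒢.continuousOn_mul.comp_continuous
          (f := fun p : {p : 𝒢.Arr × Ad 𝒢 | 𝒢.src p.1 = 𝒢.rng p.2.arr} => (p.1.1, p.1.2.arr))
          ((continuous_fst.comp continuous_subtype_val).prodMk
            (continuous_arr.comp (continuous_snd.comp continuous_subtype_val)))
          (fun p => p.2)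
      refine 𝒢.continuousOn_mul.comp_continuous
          (f := fun p : {p : 𝒢.Arr × Ad 𝒢 | 𝒢.src p.1 = 𝒢.rng p.2.arr} =>
            (𝒢.mul p.1.1 p.1.2.arr, 𝒢.inv p.1.1))
          (c1.prodMk (𝒢.continuous_inv.comp (continuous_fst.comp continuous_subtype_val))) ?_
      intro p
      have hp : 𝒢.src p.1.1 = 𝒢.rng p.1.2.arr := p.2
      change 𝒢.src (𝒢.mul p.1.1 p.1.2.arr) = 𝒢.rng (𝒢.inv p.1.1)
      rw [𝒢.src_mul _ _ hp, 𝒢.rng_inv, hp, p.1.2.loop]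
    convert this using 1
    ext p
    have hp : 𝒢.src p.1.1 = 𝒢.rng p.1.2.arr := p.2
    simp only [Function.comp, Set.domRestrict_apply]
    rw [dif_pos hp]; rfl
  anchor_act := fun β α h => by
    rw [dif_pos h, rng_conj]
  act_act := by
    intro γ β α h h'
    have h2 : 𝒢.src γ = 𝒢.rng (conj β α h').arr := by rw [rng_conj, h]
    have h3 : 𝒢.src (𝒢.mul γ β) = 𝒢.rng α.arr := by rw [𝒢.src_mul _ _ h, h']
    rw [dif_pos h', dif_pos h2, dif_pos h3]
    apply arr_injective
    have h1 : 𝒢.src (𝒢.mul β α.arr) = 𝒢.rng (𝒢.inv β) := by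
      rw [𝒢.src_mul _ _ h', 𝒢.rng_inv, h', α.loop]
    change 𝒢.mul (𝒢.mul γ (𝒢.mul (𝒢.mul β α.arr) (𝒢.inv β))) (𝒢.inv γ) =
      𝒢.mul (𝒢.mul (𝒢.mul γ β) α.arr) (𝒢.inv (𝒢.mul γ β))
    have h4 : 𝒢.src γ = 𝒢.rng (𝒢.mul β α.arr) := by rw [𝒢.rng_mul _ _ h', h]
    have h5 : 𝒢.src (𝒢.mul γ (𝒢.mul β α.arr)) = 𝒢.rng (𝒢.inv β) := by rw [𝒢.src_mul _ _ h4, h1]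
    have h6 : 𝒢.src (𝒢.inv β) = 𝒢.rng (𝒢.inv γ) := by rw [𝒢.src_inv, 𝒢.rng_inv, h]
    rw [AmpleGroupoid.inv_mul_rev h, ← 𝒢.mul_assoc γ _ _ h4 h1, 𝒢.mul_assoc _ _ _ h5 h6,
      𝒢.mul_assoc γ β α.arr h h']
  unit_act := by
    intro α
    have h : 𝒢.src (𝒢.unit (𝒢.rng α.arr)) = 𝒢.rng α.arr := 𝒢.src_unit _
    rw [dif_pos h]
    apply arr_injective
    change 𝒢.mul (𝒢.mul (𝒢.unit (𝒢.rng α.arr)) α.arr) (𝒢.inv (𝒢.unit (𝒢.rng α.arr))) = α.arr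
    rw [𝒢.unit_mul, AmpleGroupoid.inv_unit, α.loop, 𝒢.mul_unit]

end Ad

end AmpleHP

end

noncomputable section

open TopologicalSpace
open scoped TensorProduct

namespace AmpleHP

universe u₁ u₂

variable {𝒢 : AmpleGroupoid.{u₁, u₂}}

open Base GModule

/-! ### `G`-algebras -/

variable (𝒢) in
/-- A `G`-algebra: a `G`-module `A` with an associative multiplication which is balanced over
`C_c^∞(G⁰)` and such that `A ⊗ A → A` is equivariant for the diagonal action. -/
class GAlgebra (A : Type*) [NonUnitalRing A] [Module ℂ A] [Module (Base 𝒢) A]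
    [IsScalarTower ℂ (Base 𝒢) A] [IsScalarTower (Base 𝒢) A A] [SMulCommClass (Base 𝒢) A A]
    extends GModule 𝒢 A where
  mul_equivariant : IsEquivariant 𝒢 (LinearMap.mul' (Base 𝒢) A)

theorem GAlgebra.act_mul {A : Type*} [NonUnitalRing A] [Module ℂ A] [Module (Base 𝒢) A]
    [IsScalarTower ℂ (Base 𝒢) A] [IsScalarTower (Base 𝒢) A A] [SMulCommClass (Base 𝒢) A A]
    [GAlgebra 𝒢 A] {U : CompactOpens 𝒢.Arr} (hU : IsBis 𝒢 U) (a b : A) :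
    act (Cc.chi U) (a * b) = act (Cc.chi U) a * act (𝒢 := 𝒢) (Cc.chi U) b := by
  have := GAlgebra.mul_equivariant (𝒢 := 𝒢) (A := A) (Cc.chi U) (a ⊗ₜ b)
  rw [act_tmul hU] at this
  exact this.symm

theorem GModule.isEquivariant_of_chi' {M N : Type*} [AddCommGroup M] [Module ℂ M]
    [Module (Base 𝒢) M] [IsScalarTower ℂ (Base 𝒢) M] [GModule 𝒢 M] [AddCommGroup N] [Module ℂ N]
    [Module (Base 𝒢) N] [IsScalarTower ℂ (Base 𝒢) N] [GModule 𝒢 N] (f : M →ₗ[Base 𝒢] N)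
    (h : ∀ U, IsBis 𝒢 U → ∀ m, f (act (Cc.chi U) m) = act (Cc.chi U) (f m)) :
    IsEquivariant 𝒢 f :=
  isEquivariant_of_chi (f.restrictScalars ℂ) h

theorem GModule.isEquivariant_tensor {M N P : Type*} [AddCommGroup M] [Module ℂ M]
    [Module (Base 𝒢) M] [IsScalarTower ℂ (Base 𝒢) M] [GModule 𝒢 M] [AddCommGroup N] [Module ℂ N]
    [Module (Base 𝒢) N] [IsScalarTower ℂ (Base 𝒢) N] [GModule 𝒢 N] [AddCommGroup P] [Module ℂ P]
    [Module (Base 𝒢) P] [IsScalarTower ℂ (Base 𝒢) P] [GModule 𝒢 P] (f : M ⊗[Base 𝒢] N →ₗ[Base 𝒢] P)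
    (h : ∀ U, IsBis 𝒢 U → ∀ m n,
      f (act (𝒢 := 𝒢) (Cc.chi U) m ⊗ₜ act (𝒢 := 𝒢) (Cc.chi U) n) = act (Cc.chi U) (f (m ⊗ₜ n))) :
    IsEquivariant 𝒢 f := by
  refine isEquivariant_of_chi' f fun U hU x => ?_
  induction x with
  | zero => simp
  | add x y hx hy => simp only [map_add, hx, hy]
  | tmul m n => rw [act_tmul hU, h U hU]

/-! ### The algebra `K_G` -/

section push

/-- `x ↦ ∑_{α ∈ G^x} f(α)`, a finite sum. -/
def pushFun (f : Cc 𝒢.Arr) (x : 𝒢.Obj) : ℂ := ∑ᶠ α : {α : 𝒢.Arr // 𝒢.rng α = x}, f α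

theorem pushFun_chi {U : CompactOpens 𝒢.Arr} (hU : IsBis 𝒢 U) :
    pushFun (Cc.chi U) = Cc.chi (rngCO U) := by
  ext x
  by_cases hx : x ∈ rngCO U
  · rw [Cc.chi_of_mem hx]
    obtain ⟨α, hα, rfl⟩ := hx
    rw [pushFun, finsum_eq_single _ (⟨α, rfl⟩ : {β : 𝒢.Arr // 𝒢.rng β = 𝒢.rng α}),
      Cc.chi_of_mem hα]
    rintro ⟨β, hβ⟩ hne
    rw [Cc.chi_of_notMem]
    intro h
    exact hne (Subtype.ext (hU.2 h hα hβ))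
  · rw [Cc.chi_of_notMem hx]
    apply finsum_eq_zero_of_forall_eq_zero
    rintro ⟨β, rfl⟩
    rw [Cc.chi_of_notMem]
    exact fun h => hx ⟨β, h, rfl⟩

theorem pushFun_add (f g : Cc 𝒢.Arr) : pushFun (f + g) = pushFun f + pushFun g := by
  ext x
  exact finsum_add_distrib (f.finite_fiber x) (g.finite_fiber x)

theorem pushFun_smul (c : ℂ) (f : Cc 𝒢.Arr) : pushFun (c • f) = c • pushFun f := by
  ext x
  exact (smul_finsum' c (f.finite_fiber x)).symm

theorem pushFun_mem (f : Cc 𝒢.Arr) : pushFun f ∈ ccSub 𝒢.Obj := by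
  refine Cc.span_induction (bisFamily 𝒢) (P := fun f => pushFun f ∈ ccSub 𝒢.Obj) ?_ ?_ ?_ ?_ f
  · intro U hU
    rw [pushFun_chi hU]
    exact (Cc.chi (rngCO U)).2
  · have := pushFun_smul 0 (0 : Cc 𝒢.Arr)
    rw [zero_smul, zero_smul] at this
    rw [this]; exact zero_mem _
  · intro f g hf hg
    rw [pushFun_add]; exact add_mem hf hg
  · intro c f hf
    rw [pushFun_smul]; exact SMulMemClass.smul_mem c hf

variable (𝒢) in
/-- Integration over the fibres of the range map. -/
def push : Cc 𝒢.Arr →ₗ[ℂ] Cc 𝒢.Obj where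
  toFun f := ⟨pushFun f, pushFun_mem f⟩
  map_add' f g := Subtype.ext (pushFun_add f g)
  map_smul' c f := Subtype.ext (pushFun_smul c f)

theorem push_apply (f : Cc 𝒢.Arr) (x : 𝒢.Obj) :
    push 𝒢 f x = ∑ᶠ α : {α : 𝒢.Arr // 𝒢.rng α = x}, f α := rfl

theorem push_smul (h : Cc 𝒢.Obj) (f : Cc 𝒢.Arr) : push 𝒢 (of h • f) = h * push 𝒢 f := by
  ext x
  rw [Cc.mul_apply, push_apply, push_apply, ← smul_eq_mul, smul_finsum' _ (f.finite_fiber x)]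
  refine finsum_congr fun α => ?_
  rw [Cc.of_smul_apply]
  change h (𝒢.rng α) * _ = _
  rw [α.2]; rfl

theorem push_conv {U : CompactOpens 𝒢.Arr} (hU : IsBis 𝒢 U) (f : Cc 𝒢.Arr) :
    push 𝒢 (conv 𝒢 𝒢.Arr (Cc.chi U) f) = conv 𝒢 𝒢.Obj (Cc.chi U) (push 𝒢 f) := by
  ext x
  rw [push_apply]
  by_cases hx : ∃ β ∈ U, 𝒢.rng β = x
  · obtain ⟨β, hβ, rfl⟩ := hx
    rw [conv_chi_of_mem (X := 𝒢.Obj) (x := 𝒢.rng β) hU _ hβ rfl]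
    change _ = push 𝒢 f (𝒢.rng (𝒢.inv β))
    rw [𝒢.rng_inv, push_apply]
    let e : {γ : 𝒢.Arr // 𝒢.rng γ = 𝒢.src β} ≃ {γ : 𝒢.Arr // 𝒢.rng γ = 𝒢.rng β} :=
      { toFun := fun γ => ⟨𝒢.mul β γ, 𝒢.rng_mul _ _ γ.2.symm⟩
        invFun := fun γ => ⟨𝒢.mul (𝒢.inv β) γ, by
          rw [𝒢.rng_mul _ _ (by rw [𝒢.src_inv, γ.2]), 𝒢.rng_inv]⟩
        left_inv := fun γ => Subtype.ext (AmpleGroupoid.inv_mul_cancel_left γ.2.symm)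
        right_inv := fun γ => Subtype.ext (AmpleGroupoid.mul_inv_cancel_left γ.2.symm) }
    rw [← finsum_comp_equiv e]
    refine finsum_congr fun γ => ?_
    rw [conv_chi_of_mem (X := 𝒢.Arr) hU f hβ (e γ).2.symm]
    exact congrArg f (AmpleGroupoid.inv_mul_cancel_left γ.2.symm)
  · have hx' : ∀ β ∈ U, 𝒢.rng β ≠ x := fun β hβ h' => hx ⟨β, hβ, h'⟩
    rw [conv_chi_of_notMem (X := 𝒢.Obj) _ hx']
    apply finsum_eq_zero_of_forall_eq_zero
    rintro ⟨γ, rfl⟩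
    exact conv_chi_of_notMem (X := 𝒢.Arr) _ hx'

end push

variable (𝒢) in
/-- The left regular `G`-module `C_c^∞(G)`, without its pointwise multiplication. -/
def Reg : Type u₂ := Cc 𝒢.Arr

namespace Reg

instance : AddCommGroup (Reg 𝒢) := inferInstanceAs (AddCommGroup (Cc 𝒢.Arr))
instance : Module ℂ (Reg 𝒢) := inferInstanceAs (Module ℂ (Cc 𝒢.Arr))
instance : Module (Base 𝒢) (Reg 𝒢) := inferInstanceAs (Module (Base 𝒢) (Cc 𝒢.Arr))
instance : IsScalarTower ℂ (Base 𝒢) (Reg 𝒢) :=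
  inferInstanceAs (IsScalarTower ℂ (Base 𝒢) (Cc 𝒢.Arr))
instance : GModule 𝒢 (Reg 𝒢) := inferInstanceAs (GModule 𝒢 (Cc 𝒢.Arr))

/-- The function underlying an element of the regular module. -/
def fn : Reg 𝒢 →ₗ[Base 𝒢] Cc 𝒢.Arr := LinearMap.id (R := Base 𝒢) (M := Cc 𝒢.Arr)

theorem fn_act (f : Cc 𝒢.Arr) (g : Reg 𝒢) : fn (act f g) = conv 𝒢 𝒢.Arr f (fn g) := rfl

end Reg

open Reg

variable (𝒢) in
/-- The pairing `λ(f, g)(x) = ∑_{α ∈ G^x} f(α) g(α)` on `C_c^∞(G)`, with values in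
`C_c^∞(G⁰)`. -/
def pairing : Reg 𝒢 →ₗ[Base 𝒢] Reg 𝒢 →ₗ[Base 𝒢] Base 𝒢 :=
  have h1 : ∀ (h : Cc 𝒢.Obj) (f g : Cc 𝒢.Arr),
      of (push 𝒢 ((of h • f) * g)) = of h • of (push 𝒢 (f * g)) := by
    intro h f g
    rw [smul_mul_assoc, push_smul, map_mul, smul_eq_mul]
  have h2 : ∀ (h : Cc 𝒢.Obj) (f g : Cc 𝒢.Arr),
      of (push 𝒢 (f * (of h • g))) = of h • of (push 𝒢 (f * g)) := by
    intro h f g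
    rw [mul_smul_comm, push_smul, map_mul, smul_eq_mul]
  LinearMap.mk₂ (Base 𝒢) (fun f g => of (push 𝒢 (fn f * fn g)))
    (fun f f' g => by rw [map_add, add_mul, map_add, map_add])
    (fun k f g => by
      obtain ⟨z, h, rfl⟩ := exists_rep k
      rw [map_smul, add_smul, add_smul, add_mul, map_add, map_add, h1, algebraMap_smul,
        algebraMap_smul, smul_mul_assoc, map_smul, map_smul])
    (fun f g g' => by rw [map_add, mul_add, map_add, map_add])
    (fun k f g => by
      obtain ⟨z, h, rfl⟩ := exists_rep k
      rw [map_smul, add_smul, add_smul, mul_add, map_add, map_add, h2, algebraMap_smul,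
        algebraMap_smul, mul_smul_comm, map_smul, map_smul])

theorem pairing_apply (f g : Reg 𝒢) : pairing 𝒢 f g = of (push 𝒢 (fn f * fn g)) := rfl

variable (𝒢) in
/-- The algebra `K_G = C_c^∞(G) ⊗ C_c^∞(G)`, with the diagonal action of `G`. -/
abbrev KG : Type _ := Reg 𝒢 ⊗[Base 𝒢] Reg 𝒢

namespace KG

variable (𝒢) in
/-- `f ↦ (e' ⊗ f' ↦ λ(f, e') f')`. -/
def contract : Reg 𝒢 →ₗ[Base 𝒢] KG 𝒢 →ₗ[Base 𝒢] Reg 𝒢 where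
  toFun f := TensorProduct.lift (LinearMap.lsmul (Base 𝒢) (Reg 𝒢) ∘ₗ pairing 𝒢 f)
  map_add' f g := by
    ext1; ext1 a; ext1 b
    simp
  map_smul' k f := by
    ext1; ext1 a; ext1 b
    simp [mul_smul]

@[simp] theorem contract_tmul (f e f' : Reg 𝒢) :
    contract 𝒢 f (e ⊗ₜ f') = pairing 𝒢 f e • f' := rfl

variable (𝒢) in
/-- The multiplication `(e ⊗ f)(e' ⊗ f') = e ⊗ λ(f, e') f'`. -/
def mulMap : KG 𝒢 →ₗ[Base 𝒢] KG 𝒢 →ₗ[Base 𝒢] KG 𝒢 :=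
  TensorProduct.lift
    (LinearMap.mk₂ (Base 𝒢) (fun e f => TensorProduct.mk (Base 𝒢) _ _ e ∘ₗ contract 𝒢 f)
      (fun e e' f => by rw [map_add, LinearMap.add_comp])
      (fun k e f => by rw [map_smul, LinearMap.smul_comp])
      (fun e f f' => by rw [map_add, LinearMap.comp_add])
      (fun k e f => by rw [map_smul, LinearMap.comp_smul]))

@[simp] theorem mulMap_tmul (e f e' f' : Reg 𝒢) :
    mulMap 𝒢 (e ⊗ₜ f) (e' ⊗ₜ f') = e ⊗ₜ (pairing 𝒢 f e' • f') := rfl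

theorem mulMap_assoc (x y z : KG 𝒢) :
    mulMap 𝒢 (mulMap 𝒢 x y) z = mulMap 𝒢 x (mulMap 𝒢 y z) := by
  induction x using TensorProduct.induction_on with
  | zero => simp
  | add x x' hx hx' => simp only [map_add, LinearMap.add_apply, hx, hx']
  | tmul e f =>
    induction y using TensorProduct.induction_on with
    | zero => simp
    | add y y' hy hy' => simp only [map_add, LinearMap.add_apply, hy, hy']
    | tmul e' f' =>
      induction z using TensorProduct.induction_on with
      | zero => simp
      | add z z' hz hz' => simp only [map_add, hz, hz']
      | tmul e'' f'' =>
        simp only [mulMap_tmul, map_smul, LinearMap.smul_apply, smul_eq_mul, mul_smul]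

/-- `K_G` is an associative algebra. -/
instance : NonUnitalRing (KG 𝒢) where
  mul x y := mulMap 𝒢 x y
  left_distrib x y z := map_add (mulMap 𝒢 x) y z
  right_distrib x y z := LinearMap.congr_fun (map_add (mulMap 𝒢) x y) z
  zero_mul x := LinearMap.congr_fun (map_zero (mulMap 𝒢)) x
  mul_zero x := map_zero (mulMap 𝒢 x)
  mul_assoc := mulMap_assoc

theorem mul_def (x y : KG 𝒢) : x * y = mulMap 𝒢 x y := rfl

theorem tmul_mul_tmul (e f e' f' : Reg 𝒢) :
    (e ⊗ₜ f : KG 𝒢) * (e' ⊗ₜ f' : KG 𝒢) = e ⊗ₜ (pairing 𝒢 f e' • f') := rfl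

instance : IsScalarTower (Base 𝒢) (KG 𝒢) (KG 𝒢) where
  smul_assoc k x y := LinearMap.congr_fun (map_smul (mulMap 𝒢) k x) y

instance : SMulCommClass (Base 𝒢) (KG 𝒢) (KG 𝒢) where
  smul_comm k x y := (map_smul (mulMap 𝒢 x) k y).symm

/-- `K_G` is a `G`-algebra for the diagonal action. -/
instance : GAlgebra 𝒢 (KG 𝒢) where
  mul_equivariant := by
    refine isEquivariant_tensor _ fun U hU x y => ?_
    change act (𝒢 := 𝒢) (Cc.chi U) x * act (𝒢 := 𝒢) (Cc.chi U) y = act (𝒢 := 𝒢) (Cc.chi U) (x * y)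
    induction x using TensorProduct.induction_on with
    | zero => simp only [map_zero, zero_mul]
    | add x x' hx hx' => simp only [map_add, add_mul, hx, hx']
    | tmul e f =>
      induction y using TensorProduct.induction_on with
      | zero => simp only [map_zero, mul_zero]
      | add x x' hx hx' => simp only [map_add, mul_add, hx, hx']
      | tmul e' f' =>
        rw [tmul_mul_tmul, act_tmul hU, act_tmul hU, act_tmul hU, tmul_mul_tmul, pairing_apply,
          pairing_apply, act_chi_smul hU, fn_act, fn_act, ← conv_chi_mul hU, push_conv hU]

end KG

/-- The tensor product of `G`-algebras, with `(a ⊗ b)(a' ⊗ b') = aa' ⊗ bb'` and the diagonal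
action. -/
instance GAlgebra.instTensor {A B : Type*} [NonUnitalRing A] [Module ℂ A] [Module (Base 𝒢) A]
    [IsScalarTower ℂ (Base 𝒢) A] [IsScalarTower (Base 𝒢) A A] [SMulCommClass (Base 𝒢) A A]
    [GAlgebra 𝒢 A] [NonUnitalRing B] [Module ℂ B] [Module (Base 𝒢) B]
    [IsScalarTower ℂ (Base 𝒢) B] [IsScalarTower (Base 𝒢) B B] [SMulCommClass (Base 𝒢) B B]
    [GAlgebra 𝒢 B] : GAlgebra 𝒢 (A ⊗[Base 𝒢] B) where
  mul_equivariant := by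
    refine isEquivariant_tensor _ fun U hU x y => ?_
    change act (𝒢 := 𝒢) (Cc.chi U) x * act (𝒢 := 𝒢) (Cc.chi U) y = act (𝒢 := 𝒢) (Cc.chi U) (x * y)
    induction x with
    | zero => simp only [map_zero, zero_mul]
    | add x x' hx hx' => simp only [map_add, add_mul, hx, hx']
    | tmul a b =>
      induction y with
      | zero => simp only [map_zero, mul_zero]
      | add x x' hx hx' => simp only [map_add, mul_add, hx, hx']
      | tmul a' b' =>
        rw [Algebra.TensorProduct.tmul_mul_tmul, act_tmul hU, act_tmul hU, act_tmul hU,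
          Algebra.TensorProduct.tmul_mul_tmul, act_mul hU, act_mul hU]

end AmpleHP

end

noncomputable section

open TopologicalSpace
open scoped TensorProduct

namespace AmpleHP

universe u₁ u₂ v w

open Base GModule

variable (𝒢 : AmpleGroupoid.{u₁, u₂})

/-! ### Bundled modules and algebras -/

/-- A bundled `G`-module. -/
structure GMod where
  carrier : Type v
  [addCommGroup : AddCommGroup carrier]
  [moduleC : Module ℂ carrier]
  [moduleB : Module (Base 𝒢) carrier]
  [tower : IsScalarTower ℂ (Base 𝒢) carrier]
  [gModule : GModule 𝒢 carrier]

instance : CoeSort (GMod.{u₁, u₂, v} 𝒢) (Type v) := ⟨GMod.carrier⟩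

attribute [instance] GMod.addCommGroup GMod.moduleC GMod.moduleB GMod.tower GMod.gModule

/-- A bundled `G`-algebra. -/
structure GAlg where
  carrier : Type v
  [ring : NonUnitalRing carrier]
  [moduleC : Module ℂ carrier]
  [moduleB : Module (Base 𝒢) carrier]
  [tower : IsScalarTower ℂ (Base 𝒢) carrier]
  [smul_assoc : IsScalarTower (Base 𝒢) carrier carrier]
  [smul_comm : SMulCommClass (Base 𝒢) carrier carrier]
  [gAlgebra : GAlgebra 𝒢 carrier]

instance : CoeSort (GAlg.{u₁, u₂, v} 𝒢) (Type v) := ⟨GAlg.carrier⟩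

attribute [instance] GAlg.ring GAlg.moduleC GAlg.moduleB GAlg.tower GAlg.smul_assoc
  GAlg.smul_comm GAlg.gAlgebra

variable {𝒢}

/-- A homomorphism of `G`-algebras: a multiplicative `C_c^∞(G)`-linear map. -/
structure GAlgHom (A : GAlg.{u₁, u₂, v} 𝒢) (B : GAlg.{u₁, u₂, w} 𝒢) where
  toLin : A →ₗ[Base 𝒢] B
  map_mul : ∀ a b, toLin (a * b) = toLin a * toLin b
  equivariant : IsEquivariant 𝒢 toLin

/-! ### Noncommutative differential forms

`Ω⁰(A) = A` and `Ωⁿ(A) = A⁺ ⊗ A^{⊗ n} = A^{⊗ n + 1} ⊕ A^{⊗ n}` for `n > 0`, where the first summand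
consists of the forms `a₀ da₁ … daₙ` and the second one of the forms `da₁ … daₙ`. -/

namespace Forms

/-- The `G`-module `Ωⁿ(A)`. In degree one the pair `(a ⊗ b, c)` stands for `a db + dc`; for `n > 0`
the elementary tensor `ω ⊗ a ∈ Ωⁿ ⊗ A = Ωⁿ⁺¹` stands for `ω da`. -/
def Om (A : GAlg.{u₁, u₂, v} 𝒢) : ℕ → GMod.{u₁, u₂, v} 𝒢
  | 0 => ⟨A⟩
  | 1 => ⟨(A ⊗[Base 𝒢] A) × A⟩
  | n + 2 => ⟨Om A (n + 1) ⊗[Base 𝒢] A⟩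

variable {A : GAlg.{u₁, u₂, v} 𝒢}

variable (A) in
/-- `Ω⁰(A) = A`. -/
def io : A ≃ₗ[Base 𝒢] Om A 0 := LinearEquiv.refl (Base 𝒢) A

variable (A) in
/-- `(ω, a) ↦ ω da`. -/
def mulD : ∀ n, Om A n →ₗ[Base 𝒢] A →ₗ[Base 𝒢] Om A (n + 1)
  | 0 => (LinearMap.llcomp (Base 𝒢) A (A ⊗[Base 𝒢] A) ((A ⊗[Base 𝒢] A) × A)
      (LinearMap.inl (Base 𝒢) (A ⊗[Base 𝒢] A) A)) ∘ₗ TensorProduct.mk (Base 𝒢) A A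
  | n + 1 => TensorProduct.mk (Base 𝒢) (Om A (n + 1)) A

variable (A) in
/-- `dⁿ : Ωⁿ → Ωⁿ⁺¹`, with `d(a₀ da₁ … daₙ) = da₀ da₁ … daₙ` and `d(da₁ … daₙ) = 0`. -/
def dn : ∀ n, Om A n →ₗ[Base 𝒢] Om A (n + 1)
  | 0 => LinearMap.inr (Base 𝒢) (A ⊗[Base 𝒢] A) A
  | 1 => (LinearMap.rTensor A (LinearMap.inr (Base 𝒢) (A ⊗[Base 𝒢] A) A)) ∘ₗ
      LinearMap.fst (Base 𝒢) (A ⊗[Base 𝒢] A) A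
  | n + 2 => LinearMap.rTensor A (dn (n + 1))

section elim

variable {P : Type*} [AddCommGroup P] [Module (Base 𝒢) P]

/-- Linear maps on `Ω¹`. -/
def lift1 (f : Om A 0 →ₗ[Base 𝒢] A →ₗ[Base 𝒢] P) (g : A →ₗ[Base 𝒢] P) : Om A 1 →ₗ[Base 𝒢] P :=
  LinearMap.coprod (M := A ⊗[Base 𝒢] A) (M₂ := A)
    (TensorProduct.lift (M := A) (N := A) (f ∘ₗ (io A).toLinearMap)) g

/-- Linear maps on `Ωⁿ⁺²`. -/
def lift2 (n : ℕ) (f : Om A (n + 1) →ₗ[Base 𝒢] A →ₗ[Base 𝒢] P) : Om A (n + 2) →ₗ[Base 𝒢] P :=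
  TensorProduct.lift (M := Om A (n + 1)) (N := A) f

@[simp] theorem lift1_mulD (f : Om A 0 →ₗ[Base 𝒢] A →ₗ[Base 𝒢] P) (g : A →ₗ[Base 𝒢] P) (x : Om A 0)
    (a : A) : lift1 f g (mulD A 0 x a) = f x a := by
  change TensorProduct.lift (M := A) (N := A) (f ∘ₗ (io A).toLinearMap)
    ((show A from x) ⊗ₜ[Base 𝒢] a) + g 0 = _
  rw [map_zero, add_zero]; rfl

@[simp] theorem lift1_dn (f : Om A 0 →ₗ[Base 𝒢] A →ₗ[Base 𝒢] P) (g : A →ₗ[Base 𝒢] P) (c : A) :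
    lift1 f g (dn A 0 (io A c)) = g c := by
  change TensorProduct.lift (M := A) (N := A) (f ∘ₗ (io A).toLinearMap) 0 + g c = _
  rw [map_zero, zero_add]

@[simp] theorem lift2_mulD (n : ℕ) (f : Om A (n + 1) →ₗ[Base 𝒢] A →ₗ[Base 𝒢] P) (x : Om A (n + 1))
    (a : A) : lift2 n f (mulD A (n + 1) x a) = f x a := rfl

theorem ind1 {p : Om A 1 → Prop} (h0 : p 0) (hadd : ∀ x y, p x → p y → p (x + y))
    (h1 : ∀ b a, p (mulD A 0 (io A b) a)) (h2 : ∀ c, p (dn A 0 (io A c))) (x : Om A 1) : p x := by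
  obtain ⟨t, c⟩ : (A ⊗[Base 𝒢] A) × A := x
  have e : ((t, c) : (A ⊗[Base 𝒢] A) × A) = (t, 0) + (0, c) := by simp
  rw [e]
  refine hadd _ _ ?_ (h2 c)
  induction t with
  | zero => exact h0
  | tmul b a => exact h1 b a
  | add x y hx hy =>
    have e : ((x + y, 0) : (A ⊗[Base 𝒢] A) × A) = (x, 0) + (y, 0) := by simp
    rw [e]; exact hadd _ _ (hx (by simp)) (hy (by simp))

theorem ind2 (n : ℕ) {p : Om A (n + 2) → Prop} (h0 : p 0) (hadd : ∀ x y, p x → p y → p (x + y))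
    (h1 : ∀ x a, p (mulD A (n + 1) x a)) (x : Om A (n + 2)) : p x := by
  have x' : Om A (n + 1) ⊗[Base 𝒢] A := x
  refine TensorProduct.induction_on (M := Om A (n + 1)) (N := A) (motive := p) x h0 h1 hadd

end elim

theorem dn_mulD (n : ℕ) (x : Om A n) (a : A) :
    dn A (n + 1) (mulD A n x a) = mulD A (n + 1) (dn A n x) a := by
  cases n <;> rfl

theorem dn_dn (n : ℕ) (x : Om A n) : dn A (n + 1) (dn A n x) = 0 := by
  induction n with
  | zero =>
    change LinearMap.rTensor A (LinearMap.inr (Base 𝒢) (A ⊗[Base 𝒢] A) A) 0 = 0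
    exact map_zero _
  | succ n ih =>
    cases n with
    | zero =>
      induction x using ind1 with
      | h0 => simp
      | hadd x y hx hy => simp only [map_add, hx, hy, add_zero]
      | h1 b a => rw [dn_mulD, dn_mulD, ih]; simp
      | h2 c => rw [ih, map_zero]
    | succ n =>
      induction x using ind2 with
      | h0 => simp
      | hadd x y hx hy => simp only [map_add, hx, hy, add_zero]
      | h1 x a => rw [dn_mulD, dn_mulD, ih]; simp

theorem act_io (f : Cc 𝒢.Arr) (a : A) : act (𝒢 := 𝒢) f (io A a) = io A (act f a) := rfl

theorem act_mulD (n : ℕ) {U : CompactOpens 𝒢.Arr} (hU : IsBis 𝒢 U) (x : Om A n) (a : A) :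
    act (𝒢 := 𝒢) (Cc.chi U) (mulD A n x a) = mulD A n (act (Cc.chi U) x) (act (Cc.chi U) a) := by
  cases n with
  | zero =>
    change (act (𝒢 := 𝒢) (Cc.chi U) (((show A from x) ⊗ₜ[Base 𝒢] a, 0) : (A ⊗[Base 𝒢] A) × A)) = _
    rw [act_prod]
    refine Prod.ext ?_ ?_
    · exact act_tmul (M := A) hU x a
    · exact map_zero _
  | succ n => exact act_tmul hU x a

theorem act_dn (n : ℕ) (f : Cc 𝒢.Arr) (x : Om A n) :
    act f (dn A n x) = dn A n (act f x) := by
  have key : ∀ n x, ∀ U, IsBis 𝒢 U →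
      act (𝒢 := 𝒢) (Cc.chi U) (dn A n x) = dn A n (act (Cc.chi U) x) := by
    intro n
    induction n with
    | zero =>
      intro x U hU
      change (act (𝒢 := 𝒢) (Cc.chi U) ((0, (show A from x)) : (A ⊗[Base 𝒢] A) × A)) = _
      rw [act_prod]
      refine Prod.ext ?_ rfl
      exact map_zero _
    | succ n ih =>
      intro x U hU
      cases n with
      | zero =>
        induction x using ind1 with
        | h0 => simp
        | hadd x y hx hy => simp only [map_add, hx, hy]
        | h1 b a => rw [dn_mulD, act_mulD _ hU, act_mulD _ hU, dn_mulD, ih _ _ hU]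
        | h2 c => rw [dn_dn, ih _ _ hU, dn_dn, map_zero]
      | succ n =>
        induction x using ind2 with
        | h0 => simp
        | hadd x y hx hy => simp only [map_add, hx, hy]
        | h1 b a => rw [dn_mulD, act_mulD _ hU, act_mulD _ hU, dn_mulD, ih _ _ hU]
  exact (isEquivariant_of_chi' (dn A n) (fun U hU m => (key n m U hU).symm) f x).symm

/-- `(ω, a) ↦ (b ↦ ω d(ab) - (ωa) db)`, which is `(ω da) b` by the Leibniz rule. -/
def leibniz {n : ℕ} (R : Om A n →ₗ[Base 𝒢] A →ₗ[Base 𝒢] Om A n) :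
    Om A n →ₗ[Base 𝒢] A →ₗ[Base 𝒢] A →ₗ[Base 𝒢] Om A (n + 1) :=
  LinearMap.mk₂ (Base 𝒢)
    (fun x a => mulD A n x ∘ₗ LinearMap.mul (Base 𝒢) A a - mulD A n (R x a))
    (fun x y a => by ext b; simp; abel)
    (fun k x a => by ext b; simp [smul_sub])
    (fun x a a' => by ext b; simp; abel)
    (fun k x a => by ext b; simp [smul_sub])

variable (A) in
/-- Right multiplication `(ω, b) ↦ ωb`, determined by the Leibniz rule
`(ω da) b = ω d(ab) - (ωa) db` and `(dc) b = d(cb) - c db`. -/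
def mulR : ∀ n, Om A n →ₗ[Base 𝒢] A →ₗ[Base 𝒢] Om A n
  | 0 => ((LinearMap.mul (Base 𝒢) A).compr₂ (io A).toLinearMap) ∘ₗ (io A).symm.toLinearMap
  | 1 => lift1 (leibniz (mulR 0))
      (((LinearMap.mul (Base 𝒢) A).compr₂ (dn A 0 ∘ₗ (io A).toLinearMap)) -
        mulD A 0 ∘ₗ (io A).toLinearMap)
  | n + 2 => lift2 n (leibniz (mulR (n + 1)))

theorem mulR_io (a b : A) : mulR A 0 (io A a) b = io A (a * b) := rfl

theorem mulR_mulD (n : ℕ) (x : Om A n) (a b : A) :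
    mulR A (n + 1) (mulD A n x a) b = mulD A n x (a * b) - mulD A n (mulR A n x a) b := by
  cases n with
  | zero => exact LinearMap.congr_fun (lift1_mulD (leibniz (mulR A 0)) _ x a) b
  | succ n => rw [mulR, lift2_mulD]; rfl

theorem mulR_dn (c b : A) :
    mulR A 1 (dn A 0 (io A c)) b = dn A 0 (io A (c * b)) - mulD A 0 (io A c) b := by
  rw [mulR, lift1_dn]; rfl

theorem act_mulR (n : ℕ) {U : CompactOpens 𝒢.Arr} (hU : IsBis 𝒢 U) (x : Om A n) (b : A) :
    act (𝒢 := 𝒢) (Cc.chi U) (mulR A n x b) = mulR A n (act (Cc.chi U) x) (act (Cc.chi U) b) := by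
  induction n generalizing b with
  | zero =>
    obtain ⟨a, rfl⟩ := (io A).surjective x
    rw [mulR_io, act_io, act_io, mulR_io, GAlgebra.act_mul hU]
  | succ n ih =>
    have h : ∀ (x : Om A n) (a : A), act (𝒢 := 𝒢) (Cc.chi U) (mulR A (n + 1) (mulD A n x a) b) =
        mulR A (n + 1) (act (Cc.chi U) (mulD A n x a)) (act (Cc.chi U) b) := by
      intro x a
      rw [mulR_mulD, map_sub, act_mulD n hU, act_mulD n hU, act_mulD n hU, mulR_mulD, ih,
        GAlgebra.act_mul hU]
    cases n with
    | zero =>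
      induction x using ind1 with
      | h0 => simp
      | hadd x y hx hy => simp only [map_add, LinearMap.add_apply, hx, hy]
      | h1 c a => exact h _ _
      | h2 c => rw [mulR_dn, map_sub, act_mulD _ hU, act_dn, act_dn, act_io, act_io, mulR_dn,
          GAlgebra.act_mul hU]
    | succ n =>
      induction x using ind2 with
      | h0 => simp
      | hadd x y hx hy => simp only [map_add, LinearMap.add_apply, hx, hy]
      | h1 x a => exact h _ _

theorem mulR_mulR (n : ℕ) (x : Om A n) (a b : A) :
    mulR A n (mulR A n x a) b = mulR A n x (a * b) := by
  induction n generalizing a b with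
  | zero =>
    obtain ⟨c, rfl⟩ := (io A).surjective x
    rw [mulR_io, mulR_io, mulR_io, mul_assoc]
  | succ n ih =>
    have h : ∀ (x : Om A n) (c : A), mulR A (n + 1) (mulR A (n + 1) (mulD A n x c) a) b =
        mulR A (n + 1) (mulD A n x c) (a * b) := by
      intro x c
      rw [mulR_mulD, mulR_mulD, map_sub, LinearMap.sub_apply, mulR_mulD, mulR_mulD, ih, mul_assoc]
      abel
    cases n with
    | zero =>
      induction x using ind1 with
      | h0 => simp
      | hadd x y hx hy => simp only [map_add, LinearMap.add_apply, hx, hy]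
      | h1 c a => exact h _ _
      | h2 c =>
        rw [mulR_dn, map_sub, LinearMap.sub_apply, mulR_dn, mulR_mulD, mulR_dn, mulR_io, mul_assoc]
        abel
    | succ n =>
      induction x using ind2 with
      | h0 => simp
      | hadd x y hx hy => simp only [map_add, LinearMap.add_apply, hx, hy]
      | h1 x a => exact h _ _

/-- `d(ωa) = (dω)a + (-1)ⁿ ω da`. -/
theorem dn_mulR (n : ℕ) (x : Om A n) (a : A) :
    dn A n (mulR A n x a) = mulR A (n + 1) (dn A n x) a + (-1 : Base 𝒢) ^ n • mulD A n x a := by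
  induction n generalizing a with
  | zero =>
    obtain ⟨c, rfl⟩ := (io A).surjective x
    rw [mulR_io, mulR_dn]; simp
  | succ n ih =>
    have h : ∀ (x : Om A n) (c : A), dn A (n + 1) (mulR A (n + 1) (mulD A n x c) a) =
        mulR A (n + 2) (dn A (n + 1) (mulD A n x c)) a +
          (-1 : Base 𝒢) ^ (n + 1) • mulD A (n + 1) (mulD A n x c) a := by
      intro x c
      rw [mulR_mulD, map_sub, dn_mulD, dn_mulD, dn_mulD, mulR_mulD, ih, map_add,
        LinearMap.add_apply, pow_succ]
      rw [map_smul, LinearMap.smul_apply]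
      simp only [mul_neg, mul_one, neg_smul]
      abel
    cases n with
    | zero =>
      induction x using ind1 with
      | h0 => simp
      | hadd x y hx hy => simp only [map_add, LinearMap.add_apply, hx, hy, smul_add]; abel
      | h1 c a => exact h _ _
      | h2 c =>
        rw [mulR_dn, map_sub, dn_dn, dn_dn, dn_mulD]
        simp
    | succ n =>
      induction x using ind2 with
      | h0 => simp
      | hadd x y hx hy => simp only [map_add, LinearMap.add_apply, hx, hy, smul_add]; abel
      | h1 x a => exact h _ _

end Forms

end AmpleHP

end

noncomputable section

open TopologicalSpace
open scoped TensorProduct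

namespace AmpleHP

universe u₁ u₂ v w

open Base GModule

variable {𝒢 : AmpleGroupoid.{u₁, u₂}}

namespace Forms

/-! ### The algebra of all forms -/

/-- `Ω(A) = ⨁ₙ Ωⁿ(A)`. -/
abbrev Tot (A : GAlg.{u₁, u₂, v} 𝒢) : Type v := DirectSum ℕ fun n => (Om A n : Type v)

variable (A : GAlg.{u₁, u₂, v} 𝒢)

/-- The inclusion of the forms of degree `n`. -/
def inn (n : ℕ) : Om A n →ₗ[Base 𝒢] Tot A := DirectSum.lof (Base 𝒢) ℕ (fun n => (Om A n : Type v)) n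

/-- The inclusion of the forms of degree zero. -/
def iA : A →ₗ[Base 𝒢] Tot A := inn A 0 ∘ₗ (io A).toLinearMap

/-- `(ω, a) ↦ ω da`. -/
def totD : Tot A →ₗ[Base 𝒢] A →ₗ[Base 𝒢] Tot A :=
  DirectSum.toModule (Base 𝒢) ℕ _ fun n => (mulD A n).compr₂ (inn A (n + 1))

/-- `(ω, a) ↦ ωa`. -/
def totR : Tot A →ₗ[Base 𝒢] A →ₗ[Base 𝒢] Tot A :=
  DirectSum.toModule (Base 𝒢) ℕ _ fun n => (mulR A n).compr₂ (inn A n)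

/-- The differential `d`. -/
def totd : Tot A →ₗ[Base 𝒢] Tot A :=
  DirectSum.toModule (Base 𝒢) ℕ _ fun n => inn A (n + 1) ∘ₗ dn A n

/-- The grading operator, `ω ↦ (-1)ⁿ ω` for `ω` of degree `n`. -/
def grad : Tot A →ₗ[Base 𝒢] Tot A :=
  DirectSum.toModule (Base 𝒢) ℕ _ fun n => (-1 : Base 𝒢) ^ n • inn A n

variable {A}

@[simp] theorem totD_inn (n : ℕ) (x : Om A n) (a : A) :
    totD A (inn A n x) a = inn A (n + 1) (mulD A n x a) := by
  rw [totD, inn, DirectSum.toModule_lof]; rfl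

@[simp] theorem totR_inn (n : ℕ) (x : Om A n) (a : A) :
    totR A (inn A n x) a = inn A n (mulR A n x a) := by
  rw [totR, inn, DirectSum.toModule_lof]; rfl

@[simp] theorem totd_inn (n : ℕ) (x : Om A n) : totd A (inn A n x) = inn A (n + 1) (dn A n x) := by
  rw [totd, inn, DirectSum.toModule_lof]; rfl

@[simp] theorem grad_inn (n : ℕ) (x : Om A n) :
    grad A (inn A n x) = (-1 : Base 𝒢) ^ n • inn A n x := by
  rw [grad, inn, DirectSum.toModule_lof]; rfl

theorem ind_inn {p : Tot A → Prop} (h0 : p 0) (hadd : ∀ x y, p x → p y → p (x + y))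
    (h : ∀ n x, p (inn A n x)) (x : Tot A) : p x := by
  induction x using DirectSum.induction_on with
  | zero => exact h0
  | of i x => exact h i x
  | add x y hx hy => exact hadd _ _ hx hy

theorem ind_tot {p : Tot A → Prop} (h0 : p 0) (hadd : ∀ x y, p x → p y → p (x + y))
    (h1 : ∀ a, p (iA A a)) (h2 : ∀ c, p (totd A (iA A c))) (h3 : ∀ x a, p x → p (totD A x a))
    (x : Tot A) : p x := by
  refine ind_inn h0 hadd (fun n => ?_) x
  induction n with
  | zero =>
    intro x
    obtain ⟨a, rfl⟩ := (io A).surjective x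
    exact h1 a
  | succ n ih =>
    intro x
    have h : ∀ x a, p (inn A (n + 1) (mulD A n x a)) := by
      intro x a
      rw [← totD_inn]; exact h3 _ _ (ih x)
    cases n with
    | zero =>
      induction x using ind1 with
      | h0 => simpa using h0
      | hadd x y hx hy => rw [map_add]; exact hadd _ _ hx hy
      | h1 c a => exact h _ _
      | h2 c => have := h2 c; rwa [iA, LinearMap.comp_apply, totd_inn] at this
    | succ n =>
      induction x using ind2 with
      | h0 => simpa using h0
      | hadd x y hx hy => rw [map_add]; exact hadd _ _ hx hy
      | h1 x a => exact h _ _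

theorem totd_totd (x : Tot A) : totd A (totd A x) = 0 := by
  induction x using ind_inn with
  | h0 => simp
  | hadd x y hx hy => simp only [map_add, hx, hy, add_zero]
  | h n x => rw [totd_inn, totd_inn, dn_dn, map_zero]

theorem totd_totD (x : Tot A) (a : A) : totd A (totD A x a) = totD A (totd A x) a := by
  induction x using ind_inn with
  | h0 => simp
  | hadd x y hx hy => simp only [map_add, LinearMap.add_apply, hx, hy]
  | h n x => rw [totd_inn, totD_inn, totD_inn, totd_inn, dn_mulD]

theorem totR_totD (x : Tot A) (a b : A) :
    totR A (totD A x a) b = totD A x (a * b) - totD A (totR A x a) b := by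
  induction x using ind_inn with
  | h0 => simp
  | hadd x y hx hy => simp only [map_add, LinearMap.add_apply, hx, hy]; abel
  | h n x => simp only [totR_inn, totD_inn, mulR_mulD, map_sub]

theorem totR_totR (x : Tot A) (a b : A) : totR A (totR A x a) b = totR A x (a * b) := by
  induction x using ind_inn with
  | h0 => simp
  | hadd x y hx hy => simp only [map_add, LinearMap.add_apply, hx, hy]
  | h n x => simp only [totR_inn, mulR_mulR]

theorem totR_iA (a b : A) : totR A (iA A a) b = iA A (a * b) := by
  simp only [iA, LinearMap.comp_apply, totR_inn]
  rfl

theorem totR_totd_iA (c b : A) :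
    totR A (totd A (iA A c)) b = totd A (iA A (c * b)) - totD A (iA A c) b := by
  simp only [iA, LinearMap.comp_apply, totd_inn, totR_inn, totD_inn, ← map_sub]
  exact congrArg _ (mulR_dn c b)

theorem totd_totR (x : Tot A) (a : A) :
    totd A (totR A x a) = totR A (totd A x) a + totD A (grad A x) a := by
  induction x using ind_inn with
  | h0 => simp
  | hadd x y hx hy => simp only [map_add, LinearMap.add_apply, hx, hy]; abel
  | h n x =>
    simp only [totR_inn, totD_inn, totd_inn, grad_inn, map_smul, LinearMap.smul_apply, dn_mulR,
      map_add]

theorem grad_iA (a : A) : grad A (iA A a) = iA A a := by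
  simp only [iA, LinearMap.comp_apply, grad_inn, pow_zero, one_smul]

theorem grad_totd (x : Tot A) : grad A (totd A x) = - totd A (grad A x) := by
  induction x using ind_inn with
  | h0 => simp
  | hadd x y hx hy => simp only [map_add, hx, hy]; abel
  | h n x => simp only [totd_inn, grad_inn, map_smul, pow_succ, mul_neg, mul_one, neg_smul]

theorem grad_totD (x : Tot A) (a : A) : grad A (totD A x a) = - totD A (grad A x) a := by
  induction x using ind_inn with
  | h0 => simp
  | hadd x y hx hy => simp only [map_add, LinearMap.add_apply, hx, hy]; abel
  | h n x =>
    simp only [totD_inn, grad_inn, map_smul, pow_succ, mul_neg, mul_one, neg_smul,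
      LinearMap.smul_apply]

theorem grad_totR (x : Tot A) (a : A) : grad A (totR A x a) = totR A (grad A x) a := by
  induction x using ind_inn with
  | h0 => simp
  | hadd x y hx hy => simp only [map_add, LinearMap.add_apply, hx, hy]
  | h n x => simp only [totR_inn, grad_inn, map_smul, LinearMap.smul_apply]

theorem grad_grad (x : Tot A) : grad A (grad A x) = x := by
  induction x using ind_inn with
  | h0 => simp
  | hadd x y hx hy => simp only [map_add, hx, hy]
  | h n x => rw [grad_inn, map_smul, grad_inn, smul_smul, ← mul_pow]; simp

variable (A) in
/-- Right multiplication by forms of degree `n`, determined by `ω · a = ωa`, `ω · dc = ω dc` and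
`ω · (η da) = (ω · η) da`. -/
def mulN : ∀ n, Om A n →ₗ[Base 𝒢] Tot A →ₗ[Base 𝒢] Tot A
  | 0 => (totR A).flip ∘ₗ (io A).symm.toLinearMap
  | 1 => lift1 ((LinearMap.llcomp (Base 𝒢) (Tot A) (Tot A) (Tot A) ∘ₗ (totD A).flip).flip ∘ₗ mulN 0)
      (totD A).flip
  | n + 2 => lift2 n
      ((LinearMap.llcomp (Base 𝒢) (Tot A) (Tot A) (Tot A) ∘ₗ (totD A).flip).flip ∘ₗ mulN (n + 1))

variable (A) in
/-- The product of forms, `(ω, η) ↦ ωη`. -/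
def mulF : Tot A →ₗ[Base 𝒢] Tot A →ₗ[Base 𝒢] Tot A :=
  (DirectSum.toModule (Base 𝒢) ℕ _ (mulN A)).flip

theorem mulF_inn (x : Tot A) (n : ℕ) (y : Om A n) : mulF A x (inn A n y) = mulN A n y x := by
  rw [mulF, LinearMap.flip_apply, inn, DirectSum.toModule_lof]

theorem mulF_iA (x : Tot A) (a : A) : mulF A x (iA A a) = totR A x a := by
  rw [iA, LinearMap.comp_apply, mulF_inn]; rfl

theorem mulF_totd_iA (x : Tot A) (c : A) : mulF A x (totd A (iA A c)) = totD A x c := by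
  rw [iA, LinearMap.comp_apply, totd_inn, mulF_inn]
  exact LinearMap.congr_fun (lift1_dn _ _ c) x

theorem mulF_totD (x y : Tot A) (a : A) : mulF A x (totD A y a) = totD A (mulF A x y) a := by
  induction y using ind_inn with
  | h0 => simp
  | hadd y y' hx hy => simp only [map_add, LinearMap.add_apply, hx, hy]
  | h n y =>
    rw [totD_inn, mulF_inn, mulF_inn]
    cases n with
    | zero => exact LinearMap.congr_fun (lift1_mulD _ _ y a) x
    | succ n => exact LinearMap.congr_fun (lift2_mulD n _ y a) x

variable (A) in
/-- The Fedosov product `ω ∘ η = ωη - (-1)ᵐ dω dη` for `ω` of degree `m`. -/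
def fed : Tot A →ₗ[Base 𝒢] Tot A →ₗ[Base 𝒢] Tot A :=
  LinearMap.mk₂ (Base 𝒢) (fun x y => mulF A x y - mulF A (totd A (grad A x)) (totd A y))
    (fun x x' y => by simp only [map_add, LinearMap.add_apply]; abel)
    (fun k x y => by simp only [map_smul, LinearMap.smul_apply, smul_sub])
    (fun x y y' => by simp only [map_add]; abel)
    (fun k x y => by simp only [map_smul, smul_sub])

theorem fed_apply (x y : Tot A) :
    fed A x y = mulF A x y - mulF A (totd A (grad A x)) (totd A y) := rfl

theorem fed_iA (x : Tot A) (a : A) :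
    fed A x (iA A a) = totR A x a - totD A (totd A (grad A x)) a := by
  rw [fed_apply, mulF_iA, mulF_totd_iA]

theorem fed_totd_iA (x : Tot A) (c : A) : fed A x (totd A (iA A c)) = totD A x c := by
  rw [fed_apply, mulF_totd_iA, totd_totd, map_zero, sub_zero]

theorem fed_totD (x y : Tot A) (a : A) : fed A x (totD A y a) = totD A (fed A x y) a := by
  rw [fed_apply, fed_apply, mulF_totD, totd_totD, mulF_totD, map_sub, LinearMap.sub_apply]

theorem fed_fed_iA (x : Tot A) (a b : A) :
    fed A (fed A x (iA A a)) (iA A b) = fed A x (iA A (a * b)) - totD A (totD A x a) b := by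
  simp only [fed_iA, map_sub, LinearMap.sub_apply, totR_totR, grad_totR, grad_totD, grad_totd,
    totd_totR, totR_totD, grad_grad, totd_totD, map_neg, LinearMap.neg_apply, totd_totd,
    map_zero, LinearMap.zero_apply, map_add, LinearMap.add_apply]
  abel

theorem fed_totD_iA (x : Tot A) (a b : A) :
    fed A (totD A x a) (iA A b) = totD A x (a * b) - totD A (fed A x (iA A a)) b := by
  simp only [fed_iA, map_sub, LinearMap.sub_apply, totR_totD, grad_totD, totd_totD, map_neg,
    LinearMap.neg_apply]
  abel

theorem fed_assoc_iA (x y : Tot A) (b : A) :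
    fed A (fed A x y) (iA A b) = fed A x (fed A y (iA A b)) := by
  induction y using ind_tot generalizing b with
  | h0 => simp
  | hadd y y' hy hy' => simp only [map_add, LinearMap.add_apply, hy, hy']
  | h1 a =>
    have : fed A (iA A a) (iA A b) = iA A (a * b) - totD A (totd A (iA A a)) b := by
      rw [fed_iA, totR_iA, grad_iA]
    rw [fed_fed_iA, this, map_sub, fed_totD, fed_totd_iA]
  | h2 c =>
    have : fed A (totd A (iA A c)) (iA A b) = totd A (iA A (c * b)) - totD A (iA A c) b := by
      rw [fed_iA, totR_totd_iA, grad_totd, map_neg, totd_totd]; simp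
    rw [fed_totd_iA, this, map_sub, fed_totd_iA, fed_totD, fed_totD_iA]
  | h3 y a hy => rw [fed_totD, fed_totD_iA, fed_totD_iA, hy, map_sub, fed_totD, fed_totD]

/-- The Fedosov product is associative. -/
theorem fed_assoc (x y z : Tot A) : fed A (fed A x y) z = fed A x (fed A y z) := by
  induction z using ind_tot with
  | h0 => simp
  | hadd z z' hz hz' => simp only [map_add, hz, hz']
  | h1 b => exact fed_assoc_iA x y b
  | h2 c => rw [fed_totd_iA, fed_totd_iA, fed_totD]
  | h3 z a hz => rw [fed_totD, fed_totD, fed_totD, hz]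

theorem grad_fed (x y : Tot A) : grad A (fed A x y) = fed A (grad A x) (grad A y) := by
  induction y using ind_tot with
  | h0 => simp
  | hadd z z' hz hz' => simp only [map_add, hz, hz']
  | h1 b =>
    rw [grad_iA, fed_iA, fed_iA, map_sub, grad_totR, grad_totD, grad_totd, grad_grad]
    simp only [map_neg, LinearMap.neg_apply, neg_neg]
  | h2 c => rw [fed_totd_iA, grad_totd, grad_iA, map_neg, fed_totd_iA, grad_totD]
  | h3 z a hz => rw [fed_totD, grad_totD, grad_totD, map_neg, fed_totD, hz]

/-! Forms of degree at least `n`. -/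

variable (A) in
/-- The sum of the `Ωⁱ(A)` with `i ≥ n`. -/
def filt (n : ℕ) : Submodule (Base 𝒢) (Tot A) where
  carrier := {x | ∀ i < n, x i = 0}
  zero_mem' := fun _ _ => rfl
  add_mem' := fun {x y} hx hy i hi => by rw [DirectSum.add_apply, hx i hi, hy i hi, add_zero]
  smul_mem' := fun k x hx i hi => by rw [DirectSum.smul_apply, hx i hi, smul_zero]

theorem filt_mono {m n : ℕ} (h : m ≤ n) {x : Tot A} (hx : x ∈ filt A n) : x ∈ filt A m :=
  fun i hi => hx i (hi.trans_le h)

theorem inn_mem_filt {m n : ℕ} (h : n ≤ m) (x : Om A m) : inn A m x ∈ filt A n := by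
  intro i hi
  exact DFinsupp.single_eq_of_ne (by omega)

theorem filt_ind {n : ℕ} {p : Tot A → Prop} (h0 : p 0) (hadd : ∀ x y, p x → p y → p (x + y))
    (h : ∀ m, n ≤ m → ∀ x, p (inn A m x)) {x : Tot A} (hx : x ∈ filt A n) : p x := by
  classical
  rw [← DirectSum.sum_support_of x]
  refine Finset.sum_induction _ p hadd h0 fun i hi => ?_
  apply h
  by_contra hlt
  rw [DFinsupp.mem_support_iff] at hi
  exact hi (hx i (by omega))

theorem totD_mem {n : ℕ} {x : Tot A} (hx : x ∈ filt A n) (a : A) : totD A x a ∈ filt A (n + 1) := by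
  refine filt_ind (p := fun x => totD A x a ∈ filt A (n + 1)) ?_ ?_ ?_ hx
  · simp
  · intro x y hx hy; simp only [map_add, LinearMap.add_apply]; exact add_mem hx hy
  · intro m hm x; rw [totD_inn]; exact inn_mem_filt (by omega) _

theorem totR_mem {n : ℕ} {x : Tot A} (hx : x ∈ filt A n) (a : A) : totR A x a ∈ filt A n := by
  refine filt_ind (p := fun x => totR A x a ∈ filt A n) ?_ ?_ ?_ hx
  · simp
  · intro x y hx hy; simp only [map_add, LinearMap.add_apply]; exact add_mem hx hy
  · intro m hm x; rw [totR_inn]; exact inn_mem_filt hm _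

theorem totd_mem {n : ℕ} {x : Tot A} (hx : x ∈ filt A n) : totd A x ∈ filt A (n + 1) := by
  refine filt_ind (p := fun x => totd A x ∈ filt A (n + 1)) ?_ ?_ ?_ hx
  · simp
  · intro x y hx hy; simp only [map_add]; exact add_mem hx hy
  · intro m hm x; rw [totd_inn]; exact inn_mem_filt (by omega) _

theorem grad_mem {n : ℕ} {x : Tot A} (hx : x ∈ filt A n) : grad A x ∈ filt A n := by
  refine filt_ind (p := fun x => grad A x ∈ filt A n) ?_ ?_ ?_ hx
  · simp
  · intro x y hx hy; simp only [map_add]; exact add_mem hx hy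
  · intro m hm x; rw [grad_inn]; exact Submodule.smul_mem _ _ (inn_mem_filt hm _)

theorem fed_mem_left {n : ℕ} {x : Tot A} (hx : x ∈ filt A n) (y : Tot A) : fed A x y ∈ filt A n := by
  induction y using ind_tot with
  | h0 => simp
  | hadd z z' hz hz' => simp only [map_add]; exact add_mem hz hz'
  | h1 b =>
    rw [fed_iA]
    exact sub_mem (totR_mem hx b)
      (filt_mono (by omega) (totD_mem (totd_mem (grad_mem hx)) b))
  | h2 c => rw [fed_totd_iA]; exact filt_mono (by omega) (totD_mem hx c)
  | h3 z a hz => rw [fed_totD]; exact filt_mono (by omega) (totD_mem hz a)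

theorem fed_mem_right {n : ℕ} (x : Tot A) {y : Tot A} (hy : y ∈ filt A n) : fed A x y ∈ filt A n := by
  refine filt_ind (p := fun y => fed A x y ∈ filt A n) ?_ ?_ ?_ hy
  · simp
  · intro x y hx hy; simp only [map_add]; exact add_mem hx hy
  · intro m hm y
    refine filt_mono hm ?_
    clear hm hy
    induction m with
    | zero => exact fun i hi => by omega
    | succ m ih =>
      have h : ∀ z a, fed A x (inn A (m + 1) (mulD A m z a)) ∈ filt A (m + 1) := by
        intro z a
        rw [← totD_inn, fed_totD]; exact totD_mem (ih z) a
      cases m with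
      | zero =>
        induction y using ind1 with
        | h0 => simp
        | hadd x y hx hy => simp only [map_add]; exact add_mem hx hy
        | h1 c a => exact h _ _
        | h2 c =>
          have e : inn A 1 (dn A 0 (io A c)) = totd A (iA A c) := by
            rw [iA, LinearMap.comp_apply, totd_inn]; rfl
          have : fed A x (inn A 1 (dn A 0 (io A c))) ∈ filt A 1 := by
            rw [e, fed_totd_iA]; exact totD_mem (fun i hi => by omega) c
          exact this
      | succ m =>
        induction y using ind2 with
        | h0 => simp
        | hadd x y hx hy => simp only [map_add]; exact add_mem hx hy
        | h1 c a => exact h _ _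

theorem act_inn (f : Cc 𝒢.Arr) (n : ℕ) (x : Om A n) :
    act (𝒢 := 𝒢) f (inn A n x) = inn A n (act f x) :=
  act_lof (M := fun n => (Om A n : Type v)) f n x

section act

variable {U : CompactOpens 𝒢.Arr}

theorem act_iA (f : Cc 𝒢.Arr) (a : A) : act (𝒢 := 𝒢) f (iA A a) = iA A (act f a) := act_inn f 0 _

theorem act_totD (hU : IsBis 𝒢 U) (x : Tot A) (a : A) :
    act (𝒢 := 𝒢) (Cc.chi U) (totD A x a) = totD A (act (Cc.chi U) x) (act (Cc.chi U) a) := by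
  induction x using ind_inn with
  | h0 => simp
  | hadd x y hx hy => simp only [map_add, LinearMap.add_apply, hx, hy]
  | h n x => rw [totD_inn, act_inn, act_inn, totD_inn, act_mulD n hU]

theorem act_totR (hU : IsBis 𝒢 U) (x : Tot A) (a : A) :
    act (𝒢 := 𝒢) (Cc.chi U) (totR A x a) = totR A (act (Cc.chi U) x) (act (Cc.chi U) a) := by
  induction x using ind_inn with
  | h0 => simp
  | hadd x y hx hy => simp only [map_add, LinearMap.add_apply, hx, hy]
  | h n x => rw [totR_inn, act_inn, act_inn, totR_inn, act_mulR n hU]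

theorem act_totd (f : Cc 𝒢.Arr) (x : Tot A) :
    act (𝒢 := 𝒢) f (totd A x) = totd A (act f x) := by
  induction x using ind_inn with
  | h0 => simp
  | hadd x y hx hy => simp only [map_add, hx, hy]
  | h n x => rw [totd_inn, act_inn, act_inn, totd_inn, act_dn]

theorem act_grad (f : Cc 𝒢.Arr) (x : Tot A) :
    act (𝒢 := 𝒢) f (grad A x) = grad A (act f x) := by
  induction x using ind_inn with
  | h0 => simp
  | hadd x y hx hy => simp only [map_add, hx, hy]
  | h n x =>
    rw [grad_inn, act_inn, grad_inn]
    rcases neg_one_pow_eq_or (Base 𝒢) n with h | h <;> rw [h] <;> simp [act_inn]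

theorem act_fed (hU : IsBis 𝒢 U) (x y : Tot A) :
    act (𝒢 := 𝒢) (Cc.chi U) (fed A x y) = fed A (act (Cc.chi U) x) (act (Cc.chi U) y) := by
  induction y using ind_tot with
  | h0 => simp
  | hadd z z' hz hz' => simp only [map_add, hz, hz']
  | h1 b => rw [act_iA, fed_iA, fed_iA, map_sub, act_totR hU, act_totD hU, act_totd, act_grad]
  | h2 c => rw [act_totd, act_iA, fed_totd_iA, fed_totd_iA, act_totD hU]
  | h3 z a hz => rw [act_totD hU, fed_totD, fed_totD, act_totD hU, hz]

end act

/-! ### Functoriality -/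

section functoriality

variable {B : GAlg.{u₁, u₂, w} 𝒢}

/-- The map `Ωⁿ(A) → Ωⁿ(B)` induced by a homomorphism. -/
def omMap (φ : GAlgHom A B) : ∀ n, Om A n →ₗ[Base 𝒢] Om B n
  | 0 => φ.toLin
  | 1 => LinearMap.prodMap (TensorProduct.map φ.toLin φ.toLin) φ.toLin
  | n + 2 => TensorProduct.map (omMap φ (n + 1)) φ.toLin

theorem omMap_io (φ : GAlgHom A B) (a : A) : omMap φ 0 (io A a) = io B (φ.toLin a) := rfl

theorem omMap_mulD (φ : GAlgHom A B) (n : ℕ) (x : Om A n) (a : A) :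
    omMap φ (n + 1) (mulD A n x a) = mulD B n (omMap φ n x) (φ.toLin a) := by
  cases n with
  | zero => exact Prod.ext rfl (map_zero φ.toLin)
  | succ n => rfl

theorem omMap_dn (φ : GAlgHom A B) (n : ℕ) (x : Om A n) :
    omMap φ (n + 1) (dn A n x) = dn B n (omMap φ n x) := by
  induction n with
  | zero => exact Prod.ext (map_zero (TensorProduct.map φ.toLin φ.toLin)) rfl
  | succ n ih =>
    cases n with
    | zero =>
      induction x using ind1 with
      | h0 => simp
      | hadd x y hx hy => simp only [map_add, hx, hy]
      | h1 b a => rw [dn_mulD, omMap_mulD, omMap_mulD, dn_mulD, ih]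
      | h2 c => rw [dn_dn, ih, dn_dn, map_zero]
    | succ n =>
      induction x using ind2 with
      | h0 => simp
      | hadd x y hx hy => simp only [map_add, hx, hy]
      | h1 b a => rw [dn_mulD, omMap_mulD, omMap_mulD, dn_mulD, ih]

theorem omMap_mulR (φ : GAlgHom A B) (n : ℕ) (x : Om A n) (b : A) :
    omMap φ n (mulR A n x b) = mulR B n (omMap φ n x) (φ.toLin b) := by
  induction n generalizing b with
  | zero =>
    obtain ⟨a, rfl⟩ := (io A).surjective x
    rw [mulR_io, omMap_io, omMap_io, mulR_io, φ.map_mul]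
  | succ n ih =>
    have h : ∀ (x : Om A n) (a : A), omMap φ (n + 1) (mulR A (n + 1) (mulD A n x a) b) =
        mulR B (n + 1) (omMap φ (n + 1) (mulD A n x a)) (φ.toLin b) := by
      intro x a
      rw [mulR_mulD, map_sub, omMap_mulD, omMap_mulD, omMap_mulD, mulR_mulD, ih, φ.map_mul]
    cases n with
    | zero =>
      induction x using ind1 with
      | h0 => simp
      | hadd x y hx hy => simp only [map_add, LinearMap.add_apply, hx, hy]
      | h1 c a => exact h _ _
      | h2 c => rw [mulR_dn, map_sub, omMap_mulD, omMap_dn, omMap_dn, omMap_io, omMap_io, mulR_dn,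
          φ.map_mul]
    | succ n =>
      induction x using ind2 with
      | h0 => simp
      | hadd x y hx hy => simp only [map_add, LinearMap.add_apply, hx, hy]
      | h1 x a => exact h _ _

theorem act_omMap (φ : GAlgHom A B) (n : ℕ) {U : CompactOpens 𝒢.Arr} (hU : IsBis 𝒢 U)
    (x : Om A n) : omMap φ n (act (Cc.chi U) x) = act (Cc.chi U) (omMap φ n x) := by
  induction n with
  | zero => exact φ.equivariant (Cc.chi U) x
  | succ n ih =>
    have h : ∀ (x : Om A n) (a : A), omMap φ (n + 1) (act (Cc.chi U) (mulD A n x a)) =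
        act (Cc.chi U) (omMap φ (n + 1) (mulD A n x a)) := by
      intro x a
      rw [act_mulD _ hU, omMap_mulD, omMap_mulD, act_mulD _ hU, ih, φ.equivariant]
    cases n with
    | zero =>
      induction x using ind1 with
      | h0 => simp
      | hadd x y hx hy => simp only [map_add, hx, hy]
      | h1 c a => exact h _ _
      | h2 c => rw [act_dn, omMap_dn, omMap_dn, act_dn, ih]
    | succ n =>
      induction x using ind2 with
      | h0 => simp
      | hadd x y hx hy => simp only [map_add, hx, hy]
      | h1 x a => exact h _ _

/-- The map `Ω(A) → Ω(B)` induced by a homomorphism. -/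
def totMap (φ : GAlgHom A B) : Tot A →ₗ[Base 𝒢] Tot B :=
  DirectSum.lmap fun n => omMap φ n

theorem totMap_apply (φ : GAlgHom A B) (x : Tot A) (n : ℕ) : totMap φ x n = omMap φ n (x n) := rfl

theorem totMap_inn (φ : GAlgHom A B) (n : ℕ) (x : Om A n) :
    totMap φ (inn A n x) = inn B n (omMap φ n x) :=
  DirectSum.lmap_lof (R := Base 𝒢) (fun n => omMap φ n) n x

theorem totMap_iA (φ : GAlgHom A B) (a : A) : totMap φ (iA A a) = iA B (φ.toLin a) :=
  totMap_inn φ 0 _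

theorem totMap_totD (φ : GAlgHom A B) (x : Tot A) (a : A) :
    totMap φ (totD A x a) = totD B (totMap φ x) (φ.toLin a) := by
  induction x using ind_inn with
  | h0 => simp
  | hadd x y hx hy => simp only [map_add, LinearMap.add_apply, hx, hy]
  | h n x => rw [totD_inn, totMap_inn, totMap_inn, totD_inn, omMap_mulD]

theorem totMap_totR (φ : GAlgHom A B) (x : Tot A) (a : A) :
    totMap φ (totR A x a) = totR B (totMap φ x) (φ.toLin a) := by
  induction x using ind_inn with
  | h0 => simp
  | hadd x y hx hy => simp only [map_add, LinearMap.add_apply, hx, hy]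
  | h n x => rw [totR_inn, totMap_inn, totMap_inn, totR_inn, omMap_mulR]

theorem totMap_totd (φ : GAlgHom A B) (x : Tot A) :
    totMap φ (totd A x) = totd B (totMap φ x) := by
  induction x using ind_inn with
  | h0 => simp
  | hadd x y hx hy => simp only [map_add, hx, hy]
  | h n x => rw [totd_inn, totMap_inn, totMap_inn, totd_inn, omMap_dn]

theorem totMap_grad (φ : GAlgHom A B) (x : Tot A) :
    totMap φ (grad A x) = grad B (totMap φ x) := by
  induction x using ind_inn with
  | h0 => simp
  | hadd x y hx hy => simp only [map_add, hx, hy]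
  | h n x => rw [grad_inn, totMap_inn, map_smul, totMap_inn, grad_inn]

theorem totMap_fed (φ : GAlgHom A B) (x y : Tot A) :
    totMap φ (fed A x y) = fed B (totMap φ x) (totMap φ y) := by
  induction y using ind_tot with
  | h0 => simp
  | hadd z z' hz hz' => simp only [map_add, hz, hz']
  | h1 b => rw [totMap_iA, fed_iA, fed_iA, map_sub, totMap_totR, totMap_totD, totMap_totd,
      totMap_grad]
  | h2 c => rw [totMap_totd, totMap_iA, fed_totd_iA, fed_totd_iA, totMap_totD]
  | h3 z a hz => rw [totMap_totD, fed_totD, fed_totD, totMap_totD, hz]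

end functoriality

/-! ### The pro-algebra `T A` -/

section TA

variable (A) (N : ℕ)

/-- The `G`-module `A ⊕ Ω²(A) ⊕ … ⊕ Ω²ᴺ(A)`. -/
abbrev EvN : Type v := DirectSum (Fin (N + 1)) fun k => (Om A (2 * k) : Type v)

/-- The inclusion of `A ⊕ Ω²(A) ⊕ … ⊕ Ω²ᴺ(A)` into `Ω(A)`. -/
def evI : EvN A N →ₗ[Base 𝒢] Tot A :=
  DirectSum.toModule (Base 𝒢) (Fin (N + 1)) _ fun k => inn A (2 * k)

/-- The projection of `Ω(A)` onto `A ⊕ Ω²(A) ⊕ … ⊕ Ω²ᴺ(A)`. -/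
def evP : Tot A →ₗ[Base 𝒢] EvN A N :=
  ∑ k : Fin (N + 1), DirectSum.lof (Base 𝒢) (Fin (N + 1)) (fun k => (Om A (2 * k) : Type v)) k ∘ₗ
    DirectSum.component (Base 𝒢) ℕ (fun n => (Om A n : Type v)) (2 * k)

variable {A N}

theorem evP_apply (x : Tot A) (k : Fin (N + 1)) : evP A N x k = x (2 * k) := by
  rw [evP, LinearMap.sum_apply, DFinsupp.finsetSum_apply, Finset.sum_eq_single k]
  · exact DirectSum.lof_apply (Base 𝒢) k _
  · intro j _ hj
    exact DFinsupp.single_eq_of_ne (Ne.symm hj)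
  · intro h; exact absurd (Finset.mem_univ k) h

theorem evI_lof (k : Fin (N + 1)) (x : Om A (2 * k)) :
    evI A N (DirectSum.lof (Base 𝒢) (Fin (N + 1)) (fun k => (Om A (2 * k) : Type v)) k x) =
      inn A (2 * k) x := by
  rw [evI, DirectSum.toModule_lof]

theorem ind_ev {p : EvN A N → Prop} (h0 : p 0) (hadd : ∀ x y, p x → p y → p (x + y))
    (h : ∀ k x, p (DirectSum.lof (Base 𝒢) (Fin (N + 1)) (fun k => (Om A (2 * k) : Type v)) k x))
    (x : EvN A N) : p x := by
  induction x using DirectSum.induction_on with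
  | zero => exact h0
  | of i x => exact h i x
  | add x y hx hy => exact hadd _ _ hx hy

theorem evP_evI (x : EvN A N) : evP A N (evI A N x) = x := by
  induction x using ind_ev with
  | h0 => simp
  | hadd x y hx hy => simp only [map_add, hx, hy]
  | h k x =>
    rw [evI_lof]
    refine DFinsupp.ext fun j => ?_
    rw [evP_apply]
    by_cases hj : k = j
    · subst hj
      exact (DFinsupp.single_eq_same (β := fun n => (Om A n : Type v))).trans
        (DFinsupp.single_eq_same (β := fun k : Fin (N + 1) => (Om A (2 * k) : Type v))).symm
    · exact (DFinsupp.single_eq_of_ne (β := fun n => (Om A n : Type v)) (by omega)).trans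
        (DFinsupp.single_eq_of_ne (β := fun k : Fin (N + 1) => (Om A (2 * k) : Type v))
          (by omega)).symm

theorem grad_evI (x : EvN A N) : grad A (evI A N x) = evI A N x := by
  induction x using ind_ev with
  | h0 => simp
  | hadd x y hx hy => simp only [map_add, hx, hy]
  | h k x => rw [evI_lof, grad_inn, pow_mul]; simp

theorem grad_apply (x : Tot A) (n : ℕ) : grad A x n = (-1 : Base 𝒢) ^ n • x n := by
  induction x using ind_inn with
  | h0 => simp
  | hadd x y hx hy => rw [map_add, DirectSum.add_apply, DirectSum.add_apply, hx, hy, smul_add]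
  | h m x =>
    rw [grad_inn, DirectSum.smul_apply]
    by_cases h : m = n
    · subst h; rfl
    · have : inn A m x n = 0 := DFinsupp.single_eq_of_ne (by omega)
      rw [this, smul_zero, smul_zero]

theorem odd_apply_of_grad {x : Tot A} (hx : grad A x = x) {n : ℕ} (hn : Odd n) : x n = 0 := by
  have h := grad_apply x n
  rw [hx, hn.neg_one_pow, neg_smul, one_smul] at h
  have h2 : (2 : ℂ) • x n = 0 := by
    rw [two_smul]; exact eq_neg_iff_add_eq_zero.mp h
  have h3 := congrArg (fun y => (2⁻¹ : ℂ) • y) h2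
  simpa [smul_smul] using h3

theorem mem_filt_of_evP {x : Tot A} (hx : grad A x = x) (h : evP A N x = 0) :
    x ∈ filt A (2 * N + 1) := by
  intro i hi
  rcases Nat.even_or_odd' i with ⟨k, rfl | rfl⟩
  · have := evP_apply x (⟨k, by omega⟩ : Fin (N + 1))
    rw [h] at this
    exact this.symm
  · exact odd_apply_of_grad hx ⟨k, rfl⟩

theorem evP_of_mem_filt {x : Tot A} (h : x ∈ filt A (2 * N + 1)) : evP A N x = 0 := by
  refine DFinsupp.ext fun k => ?_
  rw [evP_apply]
  exact h _ (by omega)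

theorem sub_mem_filt {x : Tot A} (hx : grad A x = x) :
    x - evI A N (evP A N x) ∈ filt A (2 * N + 1) := by
  apply mem_filt_of_evP
  · rw [map_sub, grad_evI, hx]
  · rw [map_sub, evP_evI, sub_self]

theorem evP_fed_left {x : Tot A} (hx : grad A x = x) (y : Tot A) :
    evP A N (fed A (evI A N (evP A N x)) y) = evP A N (fed A x y) := by
  rw [← sub_eq_zero, ← map_sub, ← LinearMap.sub_apply, ← map_sub, ← neg_sub x, map_neg,
    LinearMap.neg_apply, map_neg, neg_eq_zero]
  exact evP_of_mem_filt (fed_mem_left (sub_mem_filt hx) y)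

theorem evP_fed_right (x : Tot A) {y : Tot A} (hy : grad A y = y) :
    evP A N (fed A x (evI A N (evP A N y))) = evP A N (fed A x y) := by
  rw [← sub_eq_zero, ← map_sub, ← map_sub, ← neg_sub y, map_neg, map_neg, neg_eq_zero]
  exact evP_of_mem_filt (fed_mem_right x (sub_mem_filt hy))

variable (A N) in
/-- The Fedosov product on `A ⊕ Ω²(A) ⊕ … ⊕ Ω²ᴺ(A)`, where forms of degree larger than `2N` are
set to zero. -/
def fedN : EvN A N →ₗ[Base 𝒢] EvN A N →ₗ[Base 𝒢] EvN A N :=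
  ((fed A).compl₁₂ (evI A N) (evI A N)).compr₂ (evP A N)

theorem fedN_apply (x y : EvN A N) :
    fedN A N x y = evP A N (fed A (evI A N x) (evI A N y)) := rfl

theorem fedN_assoc (x y z : EvN A N) :
    fedN A N (fedN A N x y) z = fedN A N x (fedN A N y z) := by
  simp only [fedN_apply]
  rw [evP_fed_left, evP_fed_right, fed_assoc]
  · rw [grad_fed, grad_evI, grad_evI]
  · rw [grad_fed, grad_evI, grad_evI]

theorem act_evI (f : Cc 𝒢.Arr) (x : EvN A N) :
    act (𝒢 := 𝒢) f (evI A N x) = evI A N (act f x) := by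
  induction x using ind_ev with
  | h0 => simp
  | hadd x y hx hy => simp only [map_add, hx, hy]
  | h k x => rw [evI_lof, act_lof, evI_lof, act_inn]

theorem act_evP (f : Cc 𝒢.Arr) (x : Tot A) :
    act (𝒢 := 𝒢) f (evP A N x) = evP A N (act f x) := by
  refine DFinsupp.ext fun k => ?_
  rw [evP_apply, act_directSum_apply, act_directSum_apply, evP_apply]

variable (A N) in
/-- The ring structure given by the Fedosov product. -/
@[reducible] def fedRing : NonUnitalRing (EvN A N) where
  mul x y := fedN A N x y
  left_distrib x y z := map_add (fedN A N x) y z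
  right_distrib x y z := LinearMap.congr_fun (map_add (fedN A N) x y) z
  zero_mul x := LinearMap.congr_fun (map_zero (fedN A N)) x
  mul_zero x := map_zero (fedN A N x)
  mul_assoc := fedN_assoc

end TA

end Forms

open Forms

/-- The `G`-algebra `T A / (J A)ᴺ⁺¹ = A ⊕ Ω²(A) ⊕ … ⊕ Ω²ᴺ(A)` with the Fedosov product. -/
def TA (A : GAlg.{u₁, u₂, v} 𝒢) (N : ℕ) : GAlg.{u₁, u₂, v} 𝒢 :=
  letI := fedRing A N
  haveI h1 : IsScalarTower (Base 𝒢) (EvN A N) (EvN A N) :=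
    ⟨fun k x y => LinearMap.congr_fun (map_smul (fedN A N) k x) y⟩
  haveI h2 : SMulCommClass (Base 𝒢) (EvN A N) (EvN A N) :=
    ⟨fun k x y => (map_smul (fedN A N x) k y).symm⟩
  { carrier := EvN A N
    gAlgebra :=
      { mul_equivariant := by
          refine isEquivariant_tensor _ fun U hU x y => ?_
          change fedN A N (act (𝒢 := 𝒢) (Cc.chi U) x) (act (𝒢 := 𝒢) (Cc.chi U) y) =
            act (𝒢 := 𝒢) (Cc.chi U) (fedN A N x y)
          rw [fedN_apply, fedN_apply, act_evP, act_fed hU, act_evI, act_evI] } }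

theorem TA_mul (A : GAlg.{u₁, u₂, v} 𝒢) (N : ℕ) (x y : TA A N) : x * y = fedN A N x y := rfl

namespace Forms

section

variable {A : GAlg.{u₁, u₂, v} 𝒢} {N : ℕ}

theorem evP_evI_evP {M : ℕ} (h : N ≤ M) (z : Tot A) :
    evP A N (evI A M (evP A M z)) = evP A N z := by
  refine DFinsupp.ext fun k => ?_
  have := evP_apply (N := M) (evI A M (evP A M z)) ⟨k, by omega⟩
  rw [evP_evI, evP_apply] at this
  rw [evP_apply, evP_apply]
  exact this.symm

theorem evP_evI_fedN {M : ℕ} (h : N ≤ M) (x y : EvN A M) : evP A N (evI A M (fedN A M x y)) =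
    fedN A N (evP A N (evI A M x)) (evP A N (evI A M y)) := by
  rw [fedN_apply, fedN_apply, evP_evI_evP h, evP_fed_left, evP_fed_right]
  · rw [grad_evI]
  · rw [grad_evI]

theorem evP_evI_act {M : ℕ} (f : Cc 𝒢.Arr) (x : EvN A M) :
    evP A N (evI A M (act (𝒢 := 𝒢) f x)) = act (𝒢 := 𝒢) f (evP A N (evI A M x)) := by
  rw [act_evP, act_evI]

variable {B : GAlg.{u₁, u₂, w} 𝒢} (φ : GAlgHom A B)

theorem evP_totMap_evP {M : ℕ} (h : N ≤ M) (z : Tot A) :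
    evP B N (totMap φ (evI A M (evP A M z))) = evP B N (totMap φ z) := by
  refine DFinsupp.ext fun k => ?_
  have := evP_apply (N := M) (evI A M (evP A M z)) ⟨k, by omega⟩
  rw [evP_evI, evP_apply] at this
  rw [evP_apply, evP_apply, totMap_apply, totMap_apply]
  exact congrArg _ this.symm

theorem evP_totMap_fedN (x y : EvN A N) : evP B N (totMap φ (evI A N (fedN A N x y))) =
    fedN B N (evP B N (totMap φ (evI A N x))) (evP B N (totMap φ (evI A N y))) := by
  have hg : ∀ z : EvN A N, grad B (totMap φ (evI A N z)) = totMap φ (evI A N z) := by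
    intro z; rw [← totMap_grad, grad_evI]
  rw [fedN_apply, fedN_apply, evP_totMap_evP φ le_rfl, evP_fed_left (hg x), evP_fed_right _ (hg y), totMap_fed]

theorem evP_totMap_act {U : CompactOpens 𝒢.Arr} (hU : IsBis 𝒢 U) (x : EvN A N) :
    evP B N (totMap φ (evI A N (act (𝒢 := 𝒢) (Cc.chi U) x))) =
      act (𝒢 := 𝒢) (Cc.chi U) (evP B N (totMap φ (evI A N x))) := by
  rw [act_evP, ← act_evI]
  congr 1
  refine DFinsupp.ext fun n => ?_
  rw [totMap_apply, act_directSum_apply, act_directSum_apply, act_omMap φ n hU, totMap_apply]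

end

end Forms

/-- The projection `T A / (J A)ᴹ⁺¹ → T A / (J A)ᴺ⁺¹` for `N ≤ M`. -/
def TAproj (A : GAlg.{u₁, u₂, v} 𝒢) {N M : ℕ} (h : N ≤ M) : GAlgHom (TA A M) (TA A N) where
  toLin := evP A N ∘ₗ evI A M
  map_mul := evP_evI_fedN h
  equivariant := evP_evI_act

/-- Functoriality of `A ↦ T A / (J A)ᴺ⁺¹`. -/
def TAmap {A : GAlg.{u₁, u₂, v} 𝒢} {B : GAlg.{u₁, u₂, w} 𝒢} (φ : GAlgHom A B) (N : ℕ) :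
    GAlgHom (TA A N) (TA B N) where
  toLin := evP B N ∘ₗ totMap φ ∘ₗ evI A N
  map_mul := evP_totMap_fedN φ
  equivariant := isEquivariant_of_chi' (M := EvN A N) (N := EvN B N)
    (evP B N ∘ₗ totMap φ ∘ₗ evI A N) fun _ hU x => evP_totMap_act φ hU x

theorem TAproj_self (A : GAlg.{u₁, u₂, v} 𝒢) (N : ℕ) (x : TA A N) :
    (TAproj A le_rfl).toLin x = x := evP_evI x

theorem TAproj_TAproj (A : GAlg.{u₁, u₂, v} 𝒢) {K N M : ℕ} (h : K ≤ N) (h' : N ≤ M) (x : TA A M) :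
    (TAproj A h).toLin ((TAproj A h').toLin x) = (TAproj A (h.trans h')).toLin x :=
  evP_evI_evP h (evI A M x)

theorem TAproj_TAmap {A : GAlg.{u₁, u₂, v} 𝒢} {B : GAlg.{u₁, u₂, w} 𝒢} (φ : GAlgHom A B) {N M : ℕ}
    (h : N ≤ M) (x : TA A M) :
    (TAproj B h).toLin ((TAmap φ M).toLin x) = (TAmap φ N).toLin ((TAproj A h).toLin x) := by
  refine (evP_evI_evP h (totMap φ (evI A M x))).trans ?_
  have := evP_totMap_evP φ (le_refl N) (evI A M x)
  exact this.symm

end AmpleHP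

end

noncomputable section

open TopologicalSpace
open scoped TensorProduct

namespace AmpleHP

universe u₁ u₂ v w

open Base GModule Forms

variable {𝒢 : AmpleGroupoid.{u₁, u₂}}

/-! ### Anti-Yetter-Drinfeld modules -/

variable (𝒢) in
/-- The algebra `O_G = C_c^∞(G_ad)`. -/
abbrev OG : Type u₂ := Cc (Ad 𝒢)

variable (𝒢) in
/-- A `G`-anti-Yetter-Drinfeld module: a `G`-module which is also an essential `O_G`-module such that
`O_G ⊗ M → M` is equivariant. -/
structure AYD extends GMod.{u₁, u₂, v} 𝒢 where
  oact : OG 𝒢 →ₗ[Base 𝒢] carrier →ₗ[Base 𝒢] carrier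
  oact_mul : ∀ f g m, oact (f * g) m = oact f (oact g m)
  span_oact : Submodule.span ℂ {x : carrier | ∃ f m, oact f m = x} = ⊤
  equivariant : IsEquivariant 𝒢 (TensorProduct.lift oact)

/-- The space of morphisms of anti-Yetter-Drinfeld modules: equivariant `O_G`-linear maps. -/
def AYDHom (M : AYD.{u₁, u₂, v} 𝒢) (N : AYD.{u₁, u₂, w} 𝒢) :
    Submodule ℂ (M.toGMod →ₗ[Base 𝒢] N.toGMod) where
  carrier := {φ | IsEquivariant 𝒢 φ ∧ ∀ f m, φ (M.oact f m) = N.oact f (φ m)}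
  zero_mem' := ⟨fun a m => by simp, fun f m => by simp⟩
  add_mem' := fun {φ ψ} hφ hψ =>
    ⟨fun a m => by simp only [LinearMap.add_apply, hφ.1 a m, hψ.1 a m, map_add],
      fun f m => by simp only [LinearMap.add_apply, hφ.2, hψ.2, map_add]⟩
  smul_mem' := fun c φ hφ =>
    ⟨fun a m => by simp only [LinearMap.smul_apply, hφ.1 a m, map_smul],
      fun f m => by
        simp only [LinearMap.smul_apply, hφ.2]
        rw [← algebraMap_smul (Base 𝒢) c, ← algebraMap_smul (Base 𝒢) c, map_smul]⟩

section oTensor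

variable (E : GMod.{u₁, u₂, v} 𝒢)

/-- The action of `O_G` on `O_G ⊗ E` by multiplication on the first factor. -/
def omul : OG 𝒢 →ₗ[Base 𝒢] (OG 𝒢 ⊗[Base 𝒢] E) →ₗ[Base 𝒢] (OG 𝒢 ⊗[Base 𝒢] E) :=
  LinearMap.rTensorHom E ∘ₗ LinearMap.mul (Base 𝒢) (OG 𝒢)

variable {E}

@[simp] theorem omul_tmul (f g : OG 𝒢) (e : E) : omul E f (g ⊗ₜ e) = (f * g) ⊗ₜ e := rfl

theorem exists_chi_mul {X : Type*} [TopologicalSpace X] [T2Space X] (f : Cc X) :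
    ∃ W : CompactOpens X, Cc.chi W * f = f := by
  refine ⟨⟨⟨Function.support f, f.isCompact_support⟩, f.isOpen_support⟩, Cc.ext fun x => ?_⟩
  rw [Cc.mul_apply]
  by_cases h : f x = 0
  · rw [h, mul_zero]
  · rw [Cc.chi_of_mem, one_mul]
    exact h

variable (E) in
/-- The anti-Yetter-Drinfeld module `O_G ⊗ E` with the diagonal action of `G` and the action of
`O_G` by multiplication on the first factor. -/
def oTensor : AYD.{u₁, u₂, max u₂ v} 𝒢 where
  carrier := OG 𝒢 ⊗[Base 𝒢] E
  oact := omul E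
  oact_mul f g m := by
    induction m with
    | zero => simp
    | add x y hx hy => simp only [map_add, hx, hy]
    | tmul h e => simp only [omul_tmul, mul_assoc]
  span_oact := by
    rw [eq_top_iff]
    intro x _
    induction x with
    | zero => exact zero_mem _
    | add x y hx hy => exact add_mem (hx trivial) (hy trivial)
    | tmul h e =>
      obtain ⟨W, hW⟩ := exists_chi_mul h
      exact Submodule.subset_span ⟨Cc.chi W, h ⊗ₜ e, by rw [omul_tmul, hW]⟩
  equivariant := by
    refine isEquivariant_tensor _ fun U hU f x => ?_
    induction x with
    | zero => simp
    | add x y hx hy => simp only [map_add, TensorProduct.tmul_add, hx, hy]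
    | tmul h e =>
      rw [act_tmul hU, TensorProduct.lift.tmul, TensorProduct.lift.tmul, omul_tmul, omul_tmul,
        act_tmul hU]
      congr 1
      exact (conv_chi_mul hU f h).symm

end oTensor

/-! ### The canonical automorphism `T` of `O_G ⊗ E` -/

section twist

theorem isClosedEmbedding_arr : Topology.IsClosedEmbedding (Ad.arr : Ad 𝒢 → 𝒢.Arr) where
  eq_induced := rfl
  injective := Ad.arr_injective
  isClosed_range := by
    have : Set.range (Ad.arr : Ad 𝒢 → 𝒢.Arr) = {α | 𝒢.rng α = 𝒢.src α} := by
      ext α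
      exact ⟨by rintro ⟨α, rfl⟩; exact α.loop, fun h => ⟨⟨α, h⟩, rfl⟩⟩
    rw [this]
    exact isClosed_eq 𝒢.continuous_rng 𝒢.continuous_src

/-- The intersection of a compact open subset of `G` with `G_ad`. -/
def adCO (U : CompactOpens 𝒢.Arr) : CompactOpens (Ad 𝒢) where
  carrier := Ad.arr ⁻¹' U
  isCompact' := isClosedEmbedding_arr.isCompact_preimage U.isCompact
  isOpen' := U.isOpen.preimage Ad.continuous_arr

theorem mem_adCO {U : CompactOpens 𝒢.Arr} {α : Ad 𝒢} : α ∈ adCO U ↔ α.arr ∈ U := Iff.rfl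

variable (𝒢) in
/-- The compact open subsets of `G_ad` which are contained in a compact open bisection. -/
def adFamily : Cc.Family (Ad 𝒢) where
  sets := {W | ∃ U, IsBis 𝒢 U ∧ W ≤ adCO U}
  lower := fun _ _ h ⟨U, hU, hW⟩ => ⟨U, hU, h.trans hW⟩
  cover := fun α => by
    obtain ⟨U, hU, hα, _⟩ := exists_bis isOpen_univ (Set.mem_univ α.arr)
    exact ⟨adCO U, ⟨U, hU, le_rfl⟩, hα⟩

variable {E : GMod.{u₁, u₂, v} 𝒢}

theorem twist_indep_aux {W : CompactOpens (Ad 𝒢)} {U V : CompactOpens 𝒢.Arr} (hU : IsBis 𝒢 U)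
    (hVU : V ≤ U) (hW : W ≤ adCO V) (e : E) :
    (Cc.chi W : OG 𝒢) ⊗ₜ[Base 𝒢] act (𝒢 := 𝒢) (Cc.chi (binv U)) e =
      Cc.chi W ⊗ₜ act (𝒢 := 𝒢) (Cc.chi (binv V)) e := by
  have hd : Disjoint (binv V) (binv (U \ V)) := by
    rw [disjoint_iff_CO]
    intro α h1 h2
    exact h2.2 h1
  have hs : binv U = binv V ⊔ binv (U \ V) := by
    ext α
    constructor
    · intro h
      by_cases hV : 𝒢.inv α ∈ V
      · exact Or.inl hV
      · exact Or.inr ⟨h, hV⟩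
    · rintro (h | h)
      · exact hVU h
      · exact h.1
  rw [hs, Cc.chi_sup _ _ hd, map_add, LinearMap.add_apply, TensorProduct.tmul_add]
  have h0 : (of (Cc.chi (rngCO (binv (U \ V)))) • Cc.chi W : OG 𝒢) = 0 := by
    ext α
    rw [Cc.of_smul_apply, Cc.zero_apply]
    by_cases hα : α ∈ W
    · rw [Cc.chi_of_notMem, zero_mul]
      rintro ⟨β, hβ, h⟩
      have h1 : 𝒢.inv β ∈ U := hβ.1
      have h2 : α.arr ∈ V := hW hα
      have h3 : 𝒢.inv β = α.arr := by
        apply hU.1 h1 (hVU h2)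
        rw [𝒢.src_inv, h]; exact α.loop
      exact hβ.2 (by rw [h3]; exact h2)
    · rw [Cc.chi_of_notMem hα, mul_zero]
  rw [← chi_rng_smul (binv (U \ V)) e, ← TensorProduct.smul_tmul, h0, TensorProduct.zero_tmul,
    add_zero]

theorem twist_indep {W : CompactOpens (Ad 𝒢)} {U V : CompactOpens 𝒢.Arr} (hU : IsBis 𝒢 U)
    (hV : IsBis 𝒢 V) (hWU : W ≤ adCO U) (hW : W ≤ adCO V) (e : E) :
    (Cc.chi W : OG 𝒢) ⊗ₜ[Base 𝒢] act (𝒢 := 𝒢) (Cc.chi (binv U)) e =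
      Cc.chi W ⊗ₜ act (𝒢 := 𝒢) (Cc.chi (binv V)) e := by
  have h : W ≤ adCO (U ⊓ V) := fun α hα => ⟨hWU hα, hW hα⟩
  rw [twist_indep_aux hU inf_le_left h, twist_indep_aux hV inf_le_right h]

open Classical in
variable (E) in
/-- `W ↦ (e ↦ χ_W ⊗ χ_{U⁻¹} · e)` where `U` is any compact open bisection containing `W`. -/
def twistNu (W : CompactOpens (Ad 𝒢)) : E →ₗ[ℂ] OG 𝒢 ⊗[Base 𝒢] E :=
  if h : ∃ U, IsBis 𝒢 U ∧ W ≤ adCO U then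
    (TensorProduct.mk (Base 𝒢) (OG 𝒢) E (Cc.chi W)).restrictScalars ℂ ∘ₗ
      act (𝒢 := 𝒢) (Cc.chi (binv h.choose))
  else 0

theorem twistNu_apply {W : CompactOpens (Ad 𝒢)} {U : CompactOpens 𝒢.Arr} (hU : IsBis 𝒢 U)
    (hW : W ≤ adCO U) (e : E) :
    twistNu E W e = Cc.chi W ⊗ₜ act (𝒢 := 𝒢) (Cc.chi (binv U)) e := by
  have h : ∃ U, IsBis 𝒢 U ∧ W ≤ adCO U := ⟨U, hU, hW⟩
  rw [twistNu, dif_pos h]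
  exact twist_indep h.choose_spec.1 hU h.choose_spec.2 hW e

variable (E) in
/-- The extension of `twistNu` to `O_G`. -/
def twist₀ : OG 𝒢 →ₗ[ℂ] E →ₗ[ℂ] OG 𝒢 ⊗[Base 𝒢] E :=
  Cc.extend (adFamily 𝒢) (twistNu E) (by
    rintro V W ⟨U, hU, hVW⟩ hd
    ext e
    rw [LinearMap.add_apply, twistNu_apply hU hVW, twistNu_apply hU (le_sup_left.trans hVW),
      twistNu_apply hU (le_sup_right.trans hVW), Cc.chi_sup _ _ hd, TensorProduct.add_tmul])

theorem twist₀_chi {W : CompactOpens (Ad 𝒢)} {U : CompactOpens 𝒢.Arr} (hU : IsBis 𝒢 U)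
    (hW : W ≤ adCO U) (e : E) :
    twist₀ E (Cc.chi W) e = Cc.chi W ⊗ₜ act (𝒢 := 𝒢) (Cc.chi (binv U)) e := by
  rw [twist₀, Cc.extend_chi (adFamily 𝒢) _ _ ⟨U, hU, hW⟩, twistNu_apply hU hW]

theorem twist₀_mul (g f : OG 𝒢) (e : E) : twist₀ E (g * f) e = omul E g (twist₀ E f e) := by
  refine Cc.span_induction (adFamily 𝒢)
    (P := fun f => twist₀ E (g * f) e = omul E g (twist₀ E f e)) ?_ ?_ ?_ ?_ f
  · rintro W ⟨U, hU, hW⟩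
    refine Cc.span_induction (adFamily 𝒢)
      (P := fun g => twist₀ E (g * Cc.chi W) e = omul E g (twist₀ E (Cc.chi W) e)) ?_ ?_ ?_ ?_ g
    · rintro V -
      have : (Cc.chi V * Cc.chi W : OG 𝒢) = Cc.chi (V ⊓ W) := by
        ext α
        have : α ∈ V ⊓ W ↔ α ∈ V ∧ α ∈ W := Iff.rfl
        rw [Cc.mul_apply, Cc.chi_apply, Cc.chi_apply, Cc.chi_apply]
        by_cases h1 : α ∈ V <;> by_cases h2 : α ∈ W <;> simp [this, h1, h2]
      rw [this, twist₀_chi hU (inf_le_right.trans hW), twist₀_chi hU hW, omul_tmul, this]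
    · simp
    · intro a b ha hb
      rw [add_mul, map_add, LinearMap.add_apply, ha, hb, map_add, LinearMap.add_apply]
    · intro c a ha
      rw [smul_mul_assoc, map_smul, LinearMap.smul_apply, ha, ← algebraMap_smul (Base 𝒢) c a,
        map_smul, LinearMap.smul_apply, algebraMap_smul]
  · simp
  · intro a b ha hb
    simp only [mul_add, map_add, LinearMap.add_apply, ha, hb]
  · intro c a ha
    rw [mul_smul_comm, map_smul, LinearMap.smul_apply, ha, map_smul, LinearMap.smul_apply,
      ← algebraMap_smul (Base 𝒢) c, ← algebraMap_smul (Base 𝒢) c, map_smul]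

theorem twist₀_smul_left (h : Cc 𝒢.Obj) (f : OG 𝒢) (e : E) :
    twist₀ E (of h • f) e = of h • twist₀ E f e := by
  obtain ⟨W, hW⟩ := exists_chi_mul f
  have h1 : of h • f = (of h • Cc.chi W) * f := by rw [smul_mul_assoc, hW]
  rw [h1, twist₀_mul, map_smul, LinearMap.smul_apply, ← twist₀_mul, hW]

theorem twist₀_smul_right (h : Cc 𝒢.Obj) (f : OG 𝒢) (e : E) :
    twist₀ E f (of h • e) = of h • twist₀ E f e := by
  refine Cc.span_induction (adFamily 𝒢)
    (P := fun f => twist₀ E f (of h • e) = of h • twist₀ E f e) ?_ ?_ ?_ ?_ f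
  · rintro W ⟨U, hU, hW⟩
    rw [twist₀_chi hU hW, twist₀_chi hU hW, act_chi_smul (isBis_binv hU), ← TensorProduct.smul_tmul,
      TensorProduct.smul_tmul']
    congr 1
    ext α
    rw [Cc.of_smul_apply, Cc.of_smul_apply]
    by_cases hα : α ∈ W
    · have h1 : 𝒢.inv α.arr ∈ binv U := by
        rw [mem_binv, AmpleGroupoid.inv_inv]; exact hW hα
      have h2 : 𝒢.rng (𝒢.inv α.arr) = 𝒢.rng α.arr := by rw [𝒢.rng_inv, α.loop]
      congr 1
      change conv 𝒢 𝒢.Obj (Cc.chi (binv U)) h (𝒢.rng α.arr) = h (𝒢.rng α.arr)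
      rw [conv_chi_of_mem (X := 𝒢.Obj) (x := 𝒢.rng α.arr) (isBis_binv hU) h h1 h2]
      change h (𝒢.rng (𝒢.inv (𝒢.inv α.arr))) = _
      rw [AmpleGroupoid.inv_inv]
    · rw [Cc.chi_of_notMem hα, mul_zero, mul_zero]
  · simp
  · intro a b ha hb
    simp only [map_add, LinearMap.add_apply, ha, hb, smul_add]
  · intro c a ha
    have e₁ : ∀ y, twist₀ E (c • a) y = c • twist₀ E a y := fun y => by
      rw [LinearMap.map_smul, LinearMap.smul_apply]
    rw [e₁, e₁, ha, smul_comm]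

variable (E) in
/-- The canonical automorphism `T(χ_U ⊗ e) = χ_U ⊗ χ_{U⁻¹} · e` of `O_G ⊗ E`. -/
def twist : OG 𝒢 ⊗[Base 𝒢] E →ₗ[Base 𝒢] OG 𝒢 ⊗[Base 𝒢] E :=
  TensorProduct.lift (LinearMap.mk₂ (Base 𝒢) (fun f e => twist₀ E f e)
    (fun f f' e => by rw [map_add, LinearMap.add_apply])
    (fun k f e => by
      obtain ⟨z, h, rfl⟩ := exists_rep k
      rw [add_smul, add_smul, map_add, LinearMap.add_apply, twist₀_smul_left, algebraMap_smul,
        algebraMap_smul, map_smul, LinearMap.smul_apply])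
    (fun f e e' => by rw [map_add])
    (fun k f e => by
      obtain ⟨z, h, rfl⟩ := exists_rep k
      rw [add_smul, add_smul, map_add, twist₀_smul_right, algebraMap_smul,
        algebraMap_smul, map_smul]))

theorem twist_tmul (f : OG 𝒢) (e : E) : twist E (f ⊗ₜ e) = twist₀ E f e := rfl

theorem twist_chi {W : CompactOpens (Ad 𝒢)} {U : CompactOpens 𝒢.Arr} (hU : IsBis 𝒢 U)
    (hW : W ≤ adCO U) (e : E) :
    twist E (Cc.chi W ⊗ₜ e) = Cc.chi W ⊗ₜ act (𝒢 := 𝒢) (Cc.chi (binv U)) e := twist₀_chi hU hW e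

theorem twist_omul (f : OG 𝒢) (x : OG 𝒢 ⊗[Base 𝒢] E) : twist E (omul E f x) = omul E f (twist E x) := by
  induction x with
  | zero => simp
  | add x y hx hy => simp only [map_add, hx, hy]
  | tmul g e => rw [omul_tmul, twist_tmul, twist_tmul, twist₀_mul]

theorem twist_of_support {f : OG 𝒢} {U : CompactOpens 𝒢.Arr} (hU : IsBis 𝒢 U)
    (hf : ∀ α, f α ≠ 0 → α.arr ∈ U) (e : E) :
    twist E (f ⊗ₜ e) = f ⊗ₜ act (𝒢 := 𝒢) (Cc.chi (binv U)) e := by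
  have h : f * Cc.chi (adCO U) = f := by
    ext α
    rw [Cc.mul_apply]
    by_cases h : f α = 0
    · rw [h, zero_mul]
    · rw [Cc.chi_of_mem (show α ∈ adCO U from hf α h), mul_one]
  conv_lhs => rw [← h]
  rw [← omul_tmul, twist_omul, twist_chi hU le_rfl, omul_tmul, h]

theorem binv_binv (U : CompactOpens 𝒢.Arr) : binv (binv U) = U := by
  ext α
  change 𝒢.inv (𝒢.inv α) ∈ U ↔ _
  rw [AmpleGroupoid.inv_inv]; rfl

/-- `χ_{V⁻¹} * χ_V` is the characteristic function of the source of `V`. -/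
theorem conv_binv {V : CompactOpens 𝒢.Arr} (hV : IsBis 𝒢 V) :
    conv 𝒢 𝒢.Arr (Cc.chi (binv V)) (Cc.chi V) = incl (Cc.chi (srcCO V)) := by
  ext α
  by_cases h : ∃ β ∈ binv V, 𝒢.rng β = 𝒢.rng α
  · obtain ⟨β, hβ, hr⟩ := h
    rw [conv_chi_of_mem (X := 𝒢.Arr) (isBis_binv hV) _ hβ hr]
    change Cc.chi V (𝒢.mul (𝒢.inv β) α) = _
    have c : 𝒢.src (𝒢.inv β) = 𝒢.rng α := by rw [𝒢.src_inv, hr]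
    have hβ' : 𝒢.inv β ∈ V := hβ
    by_cases hα : α = 𝒢.unit (𝒢.rng α)
    · rw [incl_apply_unit _ hα, Cc.chi_of_mem (show 𝒢.rng α ∈ srcCO V from ⟨_, hβ', c⟩), hα, ← c,
        𝒢.mul_unit, Cc.chi_of_mem hβ']
    · rw [incl_apply_of_ne _ hα, Cc.chi_of_notMem]
      intro hm
      have h1 : 𝒢.mul (𝒢.inv β) α = 𝒢.inv β := hV.2 hm hβ' (𝒢.rng_mul _ _ c)
      apply hα
      have h2 := AmpleGroupoid.mul_inv_cancel_left hr
      rw [h1, 𝒢.mul_inv] at h2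
      rw [← h2, 𝒢.rng_unit]
  · have h' : ∀ β ∈ binv V, 𝒢.rng β ≠ 𝒢.rng α := fun β hβ h' => h ⟨β, hβ, h'⟩
    rw [conv_chi_of_notMem (X := 𝒢.Arr) _ h']
    by_cases hα : α = 𝒢.unit (𝒢.rng α)
    · rw [incl_apply_unit _ hα, Cc.chi_of_notMem]
      rintro ⟨β, hβ, e⟩
      refine h ⟨𝒢.inv β, ?_, by rw [𝒢.rng_inv, e]⟩
      rw [mem_binv, AmpleGroupoid.inv_inv]; exact hβ
    · rw [incl_apply_of_ne _ hα]

theorem conv_incl_src {V : CompactOpens 𝒢.Arr} (hV : IsBis 𝒢 V) :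
    conv 𝒢 𝒢.Arr (Cc.chi V) (incl (Cc.chi (srcCO V))) = Cc.chi V := by
  rw [conv_chi_incl hV]
  ext α
  rw [Cc.of_smul_apply]
  change conv 𝒢 𝒢.Obj (Cc.chi V) (Cc.chi (srcCO V)) (𝒢.rng α) * _ = _
  by_cases hα : α ∈ V
  · rw [conv_chi_of_mem (X := 𝒢.Obj) (x := 𝒢.rng α) hV _ hα rfl]
    change Cc.chi (srcCO V) (𝒢.rng (𝒢.inv α)) * _ = _
    rw [𝒢.rng_inv, Cc.chi_of_mem (show 𝒢.src α ∈ srcCO V from ⟨α, hα, rfl⟩), one_mul]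
  · rw [Cc.chi_of_notMem hα, mul_zero]

theorem twist_equivariant : IsEquivariant 𝒢 (twist E) := by
  refine isEquivariant_tensor _ fun V hV f e => ?_
  refine Cc.span_induction (adFamily 𝒢) (P := fun f =>
    twist E (act (𝒢 := 𝒢) (Cc.chi V) f ⊗ₜ act (𝒢 := 𝒢) (Cc.chi V) e) =
      act (𝒢 := 𝒢) (Cc.chi V) (twist E (f ⊗ₜ e))) ?_ ?_ ?_ ?_ f
  · rintro W ⟨U, hU, hW⟩
    obtain ⟨Z₁, hZ₁, e₁⟩ := exists_bmul (isBis_binv hU) (isBis_binv hV)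
    obtain ⟨Z, hZ, e₂⟩ := exists_bmul hV hZ₁
    have hsupp : ∀ α : Ad 𝒢, (act (𝒢 := 𝒢) (Cc.chi V) (Cc.chi W : OG 𝒢) : OG 𝒢) α ≠ 0 →
        α.arr ∈ binv Z := by
      intro α hα
      change conv 𝒢 (Ad 𝒢) (Cc.chi V) (Cc.chi W) α ≠ 0 at hα
      by_cases h : ∃ β ∈ V, 𝒢.rng β = 𝒢.rng α.arr
      · obtain ⟨β, hβ, hr⟩ := h
        rw [conv_chi_of_mem (X := Ad 𝒢) hV _ hβ hr] at hα
        have c : 𝒢.src (𝒢.inv β) = 𝒢.rng α.arr := by rw [𝒢.src_inv, hr]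
        have hW' : GSpace.act (𝒢.inv β) α ∈ W := by
          by_contra h; exact hα (Cc.chi_of_notMem h)
        have hU' := hW hW'
        have hconj : (GSpace.act (𝒢.inv β) α : Ad 𝒢) = Ad.conj (𝒢.inv β) α c := dif_pos c
        rw [hconj, mem_adCO] at hU'
        change 𝒢.mul (𝒢.mul (𝒢.inv β) α.arr) (𝒢.inv (𝒢.inv β)) ∈ U at hU'
        rw [AmpleGroupoid.inv_inv] at hU'
        set γ := 𝒢.mul (𝒢.mul (𝒢.inv β) α.arr) β with hγ
        have c1 : 𝒢.src (𝒢.mul (𝒢.inv β) α.arr) = 𝒢.rng β := by rw [𝒢.src_mul _ _ c, hr, α.loop]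
        have hγr : 𝒢.rng γ = 𝒢.src β := by rw [hγ, 𝒢.rng_mul _ _ c1, 𝒢.rng_mul _ _ c, 𝒢.rng_inv]
        have hγs : 𝒢.src γ = 𝒢.src β := by rw [hγ, 𝒢.src_mul _ _ c1]
        rw [mem_binv]
        by_contra hz
        have hz0 : (Cc.chi Z : Cc 𝒢.Arr) (𝒢.inv α.arr) = 0 := Cc.chi_of_notMem hz
        have r1 : 𝒢.rng β = 𝒢.rng (𝒢.inv α.arr) := by rw [𝒢.rng_inv, ← α.loop, hr]
        rw [← e₂, conv_chi_of_mem (X := 𝒢.Arr) hV _ hβ r1] at hz0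
        change (Cc.chi Z₁ : Cc 𝒢.Arr) (𝒢.mul (𝒢.inv β) (𝒢.inv α.arr)) = 0 at hz0
        have c2 : 𝒢.src (𝒢.inv β) = 𝒢.rng (𝒢.inv α.arr) := by rw [𝒢.src_inv, r1]
        have hγi : 𝒢.inv γ ∈ binv U := by rw [mem_binv, AmpleGroupoid.inv_inv]; exact hU'
        have r2 : 𝒢.rng (𝒢.inv γ) = 𝒢.rng (𝒢.mul (𝒢.inv β) (𝒢.inv α.arr)) := by
          rw [𝒢.rng_inv, hγs, 𝒢.rng_mul _ _ c2, 𝒢.rng_inv]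
        rw [← e₁, conv_chi_of_mem (X := 𝒢.Arr) (isBis_binv hU) _ hγi r2] at hz0
        change (Cc.chi (binv V) : Cc 𝒢.Arr)
          (𝒢.mul (𝒢.inv (𝒢.inv γ)) (𝒢.mul (𝒢.inv β) (𝒢.inv α.arr))) = 0 at hz0
        rw [AmpleGroupoid.inv_inv] at hz0
        have c3 : 𝒢.src (𝒢.mul (𝒢.inv β) α.arr) = 𝒢.rng (𝒢.mul β (𝒢.mul (𝒢.inv β) (𝒢.inv α.arr))) := by
          rw [AmpleGroupoid.mul_inv_cancel_left r1, 𝒢.rng_inv, 𝒢.src_mul _ _ c]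
        have c4 : 𝒢.src β = 𝒢.rng (𝒢.mul (𝒢.inv β) (𝒢.inv α.arr)) := by
          rw [𝒢.rng_mul _ _ c2, 𝒢.rng_inv]
        have key : 𝒢.mul γ (𝒢.mul (𝒢.inv β) (𝒢.inv α.arr)) = 𝒢.inv β := by
          rw [hγ, 𝒢.mul_assoc _ _ _ c1 c4, AmpleGroupoid.mul_inv_cancel_left r1,
            𝒢.mul_assoc _ _ _ c (𝒢.rng_inv _).symm, 𝒢.mul_inv, ← c, 𝒢.mul_unit]
        rw [key, Cc.chi_of_mem] at hz0
        · exact one_ne_zero hz0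
        · rw [mem_binv, AmpleGroupoid.inv_inv]; exact hβ
      · exact absurd (conv_chi_of_notMem (X := Ad 𝒢) _ (fun β hβ h' => h ⟨β, hβ, h'⟩)) hα
    rw [twist_of_support (isBis_binv hZ) hsupp, binv_binv, ← e₂, ← e₁, act_conv, act_conv,
      ← act_conv (Cc.chi (binv V)), conv_binv hV, act_incl, ← act_tmul hV, ← twist_chi hU hW,
      TensorProduct.tmul_smul, map_smul, ← act_incl, ← act_conv, conv_incl_src hV]
  · simp
  · intro a b ha hb
    simp only [map_add, TensorProduct.add_tmul, ha, hb]
  · intro c a ha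
    have e₁ : ∀ (x : OG 𝒢) (y : E), (c • x) ⊗ₜ[Base 𝒢] y = algebraMap ℂ (Base 𝒢) c • (x ⊗ₜ y) :=
      fun x y => by rw [TensorProduct.smul_tmul', algebraMap_smul]
    rw [LinearMap.map_smul, e₁, e₁, LinearMap.map_smul, LinearMap.map_smul, ha, algebraMap_smul,
      algebraMap_smul, LinearMap.map_smul]

/-- Naturality of `T`. -/
theorem twist_lTensor {F : GMod.{u₁, u₂, w} 𝒢} (φ : E →ₗ[Base 𝒢] F) (hφ : IsEquivariant 𝒢 φ)
    (x : OG 𝒢 ⊗[Base 𝒢] E) :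
    twist F (φ.lTensor (OG 𝒢) x) = φ.lTensor (OG 𝒢) (twist E x) := by
  induction x with
  | zero => simp
  | add x y hx hy => simp only [map_add, hx, hy]
  | tmul f e =>
    rw [LinearMap.lTensor_tmul]
    refine Cc.span_induction (adFamily 𝒢) (P := fun f =>
      twist F (f ⊗ₜ φ e) = φ.lTensor (OG 𝒢) (twist E (f ⊗ₜ e))) ?_ ?_ ?_ ?_ f
    · rintro W ⟨U, hU, hW⟩
      rw [twist_chi hU hW, twist_chi hU hW, LinearMap.lTensor_tmul, hφ]
    · simp
    · intro a b ha hb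
      simp only [map_add, TensorProduct.add_tmul, ha, hb]
    · intro c a ha
      rw [← algebraMap_smul (Base 𝒢) c, ← TensorProduct.smul_tmul', ← TensorProduct.smul_tmul',
        LinearMap.map_smul, LinearMap.map_smul, LinearMap.map_smul, ha]

end twist

end AmpleHP

end

noncomputable section

open TopologicalSpace
open scoped TensorProduct

namespace AmpleHP

universe u₁ u₂ v w x

open Base GModule Forms

variable {𝒢 : AmpleGroupoid.{u₁, u₂}}

/-! ### The equivariant X-complex -/

namespace Forms

variable {A : GAlg.{u₁, u₂, v} 𝒢}

/-- `(ω, a) ↦ (a' ↦ (a'ω) da)`. -/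
def leftD {n : ℕ} (L : Om A n →ₗ[Base 𝒢] A →ₗ[Base 𝒢] Om A n) :
    Om A n →ₗ[Base 𝒢] A →ₗ[Base 𝒢] A →ₗ[Base 𝒢] Om A (n + 1) :=
  LinearMap.mk₂ (Base 𝒢) (fun ω a => (mulD A n).flip a ∘ₗ L ω)
    (fun x y a => by ext b; simp)
    (fun k x a => by ext b; simp)
    (fun x a a' => by ext b; simp)
    (fun k x a => by ext b; simp)

variable (A) in
/-- Left multiplication `(ω, a) ↦ aω`. -/
def mulL : ∀ n, Om A n →ₗ[Base 𝒢] A →ₗ[Base 𝒢] Om A n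
  | 0 => ((LinearMap.mul (Base 𝒢) A).flip.compr₂ (io A).toLinearMap) ∘ₗ (io A).symm.toLinearMap
  | 1 => lift1 (leftD (mulL 0)) (mulD A 0 ∘ₗ (io A).toLinearMap).flip
  | n + 2 => lift2 n (leftD (mulL (n + 1)))

theorem mulL_io (a b : A) : mulL A 0 (io A b) a = io A (a * b) := rfl

theorem mulL_mulD (n : ℕ) (ω : Om A n) (a b : A) :
    mulL A (n + 1) (mulD A n ω b) a = mulD A n (mulL A n ω a) b := by
  cases n with
  | zero => exact LinearMap.congr_fun (lift1_mulD (leftD (mulL A 0)) _ ω b) a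
  | succ n => rw [mulL, lift2_mulD]; rfl

theorem mulL_dn (a c : A) : mulL A 1 (dn A 0 (io A c)) a = mulD A 0 (io A a) c := by
  rw [mulL, lift1_dn]; rfl

theorem act_mulL (n : ℕ) {U : CompactOpens 𝒢.Arr} (hU : IsBis 𝒢 U) (ω : Om A n) (a : A) :
    act (𝒢 := 𝒢) (Cc.chi U) (mulL A n ω a) = mulL A n (act (Cc.chi U) ω) (act (Cc.chi U) a) := by
  induction n with
  | zero =>
    obtain ⟨b, rfl⟩ := (io A).surjective ω
    rw [mulL_io, act_io, act_io, mulL_io, GAlgebra.act_mul hU]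
  | succ n ih =>
    have h : ∀ (ω : Om A n) (b : A), act (𝒢 := 𝒢) (Cc.chi U) (mulL A (n + 1) (mulD A n ω b) a) =
        mulL A (n + 1) (act (Cc.chi U) (mulD A n ω b)) (act (Cc.chi U) a) := by
      intro ω b
      rw [mulL_mulD, act_mulD n hU, act_mulD n hU, mulL_mulD, ih]
    cases n with
    | zero =>
      induction ω using ind1 with
      | h0 => simp
      | hadd x y hx hy => simp only [map_add, LinearMap.add_apply, hx, hy]
      | h1 c b => exact h _ _
      | h2 c => rw [mulL_dn, act_mulD _ hU, act_dn, act_io, act_io, mulL_dn]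
    | succ n =>
      induction ω using ind2 with
      | h0 => simp
      | hadd x y hx hy => simp only [map_add, LinearMap.add_apply, hx, hy]
      | h1 ω b => exact h _ _

theorem omMap_mulL {B : GAlg.{u₁, u₂, w} 𝒢} (φ : GAlgHom A B) (n : ℕ) (ω : Om A n) (a : A) :
    omMap φ n (mulL A n ω a) = mulL B n (omMap φ n ω) (φ.toLin a) := by
  induction n with
  | zero =>
    obtain ⟨b, rfl⟩ := (io A).surjective ω
    rw [mulL_io, omMap_io, omMap_io, mulL_io, φ.map_mul]
  | succ n ih =>
    have h : ∀ (ω : Om A n) (b : A), omMap φ (n + 1) (mulL A (n + 1) (mulD A n ω b) a) =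
        mulL B (n + 1) (omMap φ (n + 1) (mulD A n ω b)) (φ.toLin a) := by
      intro ω b
      rw [mulL_mulD, omMap_mulD, omMap_mulD, mulL_mulD, ih]
    cases n with
    | zero =>
      induction ω using ind1 with
      | h0 => simp
      | hadd x y hx hy => simp only [map_add, LinearMap.add_apply, hx, hy]
      | h1 c b => exact h _ _
      | h2 c => rw [mulL_dn, omMap_mulD, omMap_dn, omMap_io, omMap_io, mulL_dn]
    | succ n =>
      induction ω using ind2 with
      | h0 => simp
      | hadd x y hx hy => simp only [map_add, LinearMap.add_apply, hx, hy]
      | h1 ω b => exact h _ _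

end Forms

/-- Linear maps on `O_G ⊗ E` are determined by their values on `χ_W ⊗ e`, where `W` is contained in
a compact open bisection. -/
theorem oTensor_ext {E : GMod.{u₁, u₂, v} 𝒢} {P : Type*} [AddCommGroup P] [Module (Base 𝒢) P]
    {f g : OG 𝒢 ⊗[Base 𝒢] E →ₗ[Base 𝒢] P}
    (h : ∀ (U : CompactOpens 𝒢.Arr) (W : CompactOpens (Ad 𝒢)), IsBis 𝒢 U → W ≤ adCO U →
      ∀ e : E, f (Cc.chi W ⊗ₜ e) = g (Cc.chi W ⊗ₜ e)) : f = g := by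
  ext1; ext1 k; ext1 e
  change f (k ⊗ₜ e) = g (k ⊗ₜ e)
  refine Cc.span_induction (adFamily 𝒢) (P := fun k => f (k ⊗ₜ e) = g (k ⊗ₜ e)) ?_ ?_ ?_ ?_ k
  · rintro W ⟨U, hU, hW⟩
    exact h U W hU hW e
  · simp
  · intro a b ha hb
    simp only [map_add, TensorProduct.add_tmul, ha, hb]
  · intro c a ha
    rw [← algebraMap_smul (Base 𝒢) c, ← TensorProduct.smul_tmul', map_smul, map_smul, ha]

theorem lTensor_omul {E : GMod.{u₁, u₂, v} 𝒢} {F : GMod.{u₁, u₂, w} 𝒢} (φ : E →ₗ[Base 𝒢] F)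
    (f : OG 𝒢) (x : OG 𝒢 ⊗[Base 𝒢] E) :
    φ.lTensor (OG 𝒢) (omul E f x) = omul F f (φ.lTensor (OG 𝒢) x) := by
  induction x with
  | zero => simp
  | add x y hx hy => simp only [map_add, hx, hy]
  | tmul g e => rfl

theorem isEquivariant_lTensor {E : GMod.{u₁, u₂, v} 𝒢} {F : GMod.{u₁, u₂, w} 𝒢}
    (φ : E →ₗ[Base 𝒢] F)
    (hφ : ∀ U, IsBis 𝒢 U → ∀ m, φ (act (𝒢 := 𝒢) (Cc.chi U) m) = act (𝒢 := 𝒢) (Cc.chi U) (φ m)) :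
    IsEquivariant 𝒢 (φ.lTensor (OG 𝒢)) :=
  isEquivariant_tensor _ fun U hU m n => by
    rw [LinearMap.lTensor_tmul, LinearMap.lTensor_tmul, act_tmul hU, hφ U hU]

section Hochschild

variable (A : GAlg.{u₁, u₂, v} 𝒢)

/-- `(ω, x) ↦ (id ⊗ μ)(x ⊗ ω)`, that is, `(ω, f ⊗ a) ↦ f ⊗ aω`. -/
def muL (n : ℕ) : Om A n →ₗ[Base 𝒢] OG 𝒢 ⊗[Base 𝒢] A →ₗ[Base 𝒢] OG 𝒢 ⊗[Base 𝒢] Om A n :=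
  LinearMap.lTensorHom (OG 𝒢) ∘ₗ mulL A n

/-- `(ω, a) ↦ (f ↦ (-1)ⁿ (f ⊗ ωa - (id ⊗ μ)(T(f ⊗ a) ⊗ ω)))` for `ω` of degree `n`. -/
def bForm (n : ℕ) : Om A n →ₗ[Base 𝒢] A →ₗ[Base 𝒢] OG 𝒢 →ₗ[Base 𝒢] OG 𝒢 ⊗[Base 𝒢] Om A n :=
  LinearMap.mk₂ (Base 𝒢)
    (fun ω a => (-1 : Base 𝒢) ^ n • ((TensorProduct.mk (Base 𝒢) (OG 𝒢) (Om A n)).flip (mulR A n ω a) -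
      muL A n ω ∘ₗ twist ⟨A⟩ ∘ₗ (TensorProduct.mk (Base 𝒢) (OG 𝒢) A).flip a))
    (fun ω ω' a => by
      rw [← smul_add]; congr 1; ext f
      simp; abel)
    (fun k ω a => by
      rw [smul_comm k]; congr 1; ext f
      simp [smul_sub])
    (fun ω a a' => by
      rw [← smul_add]; congr 1; ext f
      simp; abel)
    (fun k ω a => by
      rw [smul_comm k]; congr 1; ext f
      simp [smul_sub])

/-- `c ↦ (f ↦ f ⊗ c - T(f ⊗ c))`. -/
def bUnit : A →ₗ[Base 𝒢] OG 𝒢 →ₗ[Base 𝒢] OG 𝒢 ⊗[Base 𝒢] Om A 0 :=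
  (TensorProduct.mk (Base 𝒢) (OG 𝒢) (Om A 0)).flip ∘ₗ (io A).toLinearMap -
    (LinearMap.llcomp (Base 𝒢) (OG 𝒢) _ _ (twist (Om A 0))) ∘ₗ
      (TensorProduct.mk (Base 𝒢) (OG 𝒢) (Om A 0)).flip ∘ₗ (io A).toLinearMap

/-- The equivariant Hochschild boundary `b_G : Ωⁿ⁺¹_G(A) → Ωⁿ_G(A)`, where
`Ωⁿ_G(A) = O_G ⊗ Ωⁿ(A)`:
`b_G(f ⊗ ω da) = (-1)ⁿ (f ⊗ ωa - (id ⊗ μ)(T(f ⊗ a) ⊗ ω))` for `ω` of degree `n`, and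
`b_G(f ⊗ dc) = f ⊗ c - T(f ⊗ c)`. -/
def bG : ∀ n, OG 𝒢 ⊗[Base 𝒢] Om A (n + 1) →ₗ[Base 𝒢] OG 𝒢 ⊗[Base 𝒢] Om A n
  | 0 => TensorProduct.lift (lift1 (bForm A 0) (bUnit A)).flip
  | n + 1 => TensorProduct.lift (lift2 n (bForm A (n + 1))).flip

variable {A}

theorem bForm_apply (n : ℕ) (f : OG 𝒢) (ω : Om A n) (a : A) : bForm A n ω a f =
    (-1 : Base 𝒢) ^ n • (f ⊗ₜ mulR A n ω a - muL A n ω (twist ⟨A⟩ (f ⊗ₜ a))) := rfl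

theorem bG_mulD (n : ℕ) (f : OG 𝒢) (ω : Om A n) (a : A) :
    bG A n (f ⊗ₜ mulD A n ω a) =
      (-1 : Base 𝒢) ^ n • (f ⊗ₜ mulR A n ω a - muL A n ω (twist ⟨A⟩ (f ⊗ₜ a))) := by
  rw [← bForm_apply]
  cases n with
  | zero => exact LinearMap.congr_fun (lift1_mulD (bForm A 0) _ ω a) f
  | succ n => exact LinearMap.congr_fun (lift2_mulD n (bForm A (n + 1)) ω a) f

theorem bG_dn (f : OG 𝒢) (c : A) : bG A 0 (f ⊗ₜ dn A 0 (io A c)) =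
    f ⊗ₜ io A c - twist (Om A 0) (f ⊗ₜ io A c) :=
  LinearMap.congr_fun (lift1_dn (bForm A 0) (bUnit A) c) f

variable {U : CompactOpens 𝒢.Arr} {W : CompactOpens (Ad 𝒢)}

theorem bG_mulD_chi (hU : IsBis 𝒢 U) (hW : W ≤ adCO U) (n : ℕ) (ω : Om A n) (a : A) :
    bG A n ((Cc.chi W : OG 𝒢) ⊗ₜ mulD A n ω a) = (-1 : Base 𝒢) ^ n •
      ((Cc.chi W : OG 𝒢) ⊗ₜ (mulR A n ω a - mulL A n ω (act (𝒢 := 𝒢) (Cc.chi (binv U)) a))) := by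
  rw [bG_mulD, TensorProduct.tmul_sub]
  congr 2
  exact congrArg (muL A n ω) (twist_chi (E := ⟨A⟩) hU hW a)

theorem bG_dn_chi (hU : IsBis 𝒢 U) (hW : W ≤ adCO U) (c : A) :
    bG A 0 ((Cc.chi W : OG 𝒢) ⊗ₜ dn A 0 (io A c)) =
      (Cc.chi W : OG 𝒢) ⊗ₜ (io A (c - act (𝒢 := 𝒢) (Cc.chi (binv U)) c)) := by
  rw [bG_dn, twist_chi hU hW, map_sub, TensorProduct.tmul_sub]; rfl

theorem bG_omul (n : ℕ) (f : OG 𝒢) (x : OG 𝒢 ⊗[Base 𝒢] Om A (n + 1)) :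
    bG A n (omul _ f x) = omul _ f (bG A n x) := by
  induction x with
  | zero => simp
  | add x y hx hy => simp only [map_add, hx, hy]
  | tmul g ω =>
    rw [omul_tmul]
    have h : ∀ (ω : Om A n) (a : A), bG A n ((f * g) ⊗ₜ mulD A n ω a) =
        omul _ f (bG A n (g ⊗ₜ mulD A n ω a)) := by
      intro ω a
      rw [bG_mulD, bG_mulD, map_smul, map_sub, omul_tmul]
      congr 2
      rw [← omul_tmul (E := ⟨A⟩), twist_omul]
      exact lTensor_omul (E := ⟨A⟩) (mulL A n ω) f _
    cases n with
    | zero =>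
      induction ω using ind1 with
      | h0 => simp
      | hadd x y hx hy => simp only [map_add, TensorProduct.tmul_add, hx, hy]
      | h1 b a => exact h _ _
      | h2 c => rw [bG_dn, bG_dn, map_sub, omul_tmul, ← omul_tmul, twist_omul]
    | succ n =>
      induction ω using ind2 with
      | h0 => simp
      | hadd x y hx hy => simp only [map_add, TensorProduct.tmul_add, hx, hy]
      | h1 b a => exact h _ _

theorem act_muL (hU : IsBis 𝒢 U) (n : ℕ) (ω : Om A n) (x : OG 𝒢 ⊗[Base 𝒢] A) :
    act (𝒢 := 𝒢) (Cc.chi U) (muL A n ω x) =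
      muL A n (act (𝒢 := 𝒢) (Cc.chi U) ω) (act (𝒢 := 𝒢) (Cc.chi U) x) := by
  induction x with
  | zero => simp
  | add x y hx hy => simp only [map_add, hx, hy]
  | tmul g a =>
    rw [act_tmul hU]
    change act (𝒢 := 𝒢) (Cc.chi U) (g ⊗ₜ mulL A n ω a) = act (𝒢 := 𝒢) (Cc.chi U) g ⊗ₜ mulL A n _ _
    rw [act_tmul hU, act_mulL n hU]

theorem act_neg_one_pow {M : Type*} [AddCommGroup M] [Module ℂ M] [Module (Base 𝒢) M]
    [GModule 𝒢 M] (n : ℕ) (f : Cc 𝒢.Arr) (m : M) :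
    act (𝒢 := 𝒢) f ((-1 : Base 𝒢) ^ n • m) = (-1 : Base 𝒢) ^ n • act (𝒢 := 𝒢) f m := by
  rcases neg_one_pow_eq_or (Base 𝒢) n with h | h <;> rw [h] <;> simp

theorem bG_equivariant (n : ℕ) : IsEquivariant 𝒢 (bG A n) := by
  refine isEquivariant_tensor _ fun U hU f ω => ?_
  have h : ∀ (ω : Om A n) (a : A), bG A n (act (𝒢 := 𝒢) (Cc.chi U) f ⊗ₜ
      act (𝒢 := 𝒢) (Cc.chi U) (mulD A n ω a)) =
        act (𝒢 := 𝒢) (Cc.chi U) (bG A n (f ⊗ₜ mulD A n ω a)) := by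
    intro ω a
    rw [act_mulD n hU, bG_mulD, bG_mulD, act_neg_one_pow, map_sub, act_tmul hU, act_mulR n hU,
      act_muL hU]
    congr 3
    rw [← twist_equivariant (E := ⟨A⟩) (Cc.chi U) (f ⊗ₜ[Base 𝒢] a)]
    congr 1
    exact (act_tmul hU f a).symm
  cases n with
  | zero =>
    induction ω using ind1 with
    | h0 => simp
    | hadd x y hx hy => simp only [map_add, TensorProduct.tmul_add, hx, hy]
    | h1 b a => exact h _ _
    | h2 c =>
      rw [act_dn, act_io, bG_dn, bG_dn, map_sub, ← twist_equivariant, act_tmul hU, act_io]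
  | succ n =>
    induction ω using ind2 with
    | h0 => simp
    | hadd x y hx hy => simp only [map_add, TensorProduct.tmul_add, hx, hy]
    | h1 b a => exact h _ _

theorem bG_omMap {B : GAlg.{u₁, u₂, w} 𝒢} (φ : GAlgHom A B) (n : ℕ)
    (x : OG 𝒢 ⊗[Base 𝒢] Om A (n + 1)) :
    bG B n ((omMap φ (n + 1)).lTensor (OG 𝒢) x) = (omMap φ n).lTensor (OG 𝒢) (bG A n x) := by
  suffices h : bG B n ∘ₗ (omMap φ (n + 1)).lTensor (OG 𝒢) = (omMap φ n).lTensor (OG 𝒢) ∘ₗ bG A n from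
    LinearMap.congr_fun h x
  refine oTensor_ext fun U W hU hW ω => ?_
  rw [LinearMap.comp_apply, LinearMap.comp_apply, LinearMap.lTensor_tmul]
  have h : ∀ (ω : Om A n) (a : A), bG B n ((Cc.chi W : OG 𝒢) ⊗ₜ omMap φ (n + 1) (mulD A n ω a)) =
        (omMap φ n).lTensor (OG 𝒢) (bG A n ((Cc.chi W : OG 𝒢) ⊗ₜ mulD A n ω a)) := by
    intro ω a
    rw [omMap_mulD, bG_mulD_chi hU hW, bG_mulD_chi hU hW, map_smul, LinearMap.lTensor_tmul, map_sub,
      omMap_mulR, omMap_mulL, φ.equivariant]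
  cases n with
  | zero =>
    induction ω using ind1 with
    | h0 => simp
    | hadd x y hx hy => simp only [map_add, TensorProduct.tmul_add, hx, hy]
    | h1 b a => exact h _ _
    | h2 c =>
      rw [omMap_dn, omMap_io, bG_dn_chi hU hW, bG_dn_chi hU hW, LinearMap.lTensor_tmul, omMap_io,
        map_sub φ.toLin, φ.equivariant]
  | succ n =>
    induction ω using ind2 with
    | h0 => simp
    | hadd x y hx hy => simp only [map_add, TensorProduct.tmul_add, hx, hy]
    | h1 b a => exact h _ _

theorem bG_bG (x : OG 𝒢 ⊗[Base 𝒢] Om A 2) : bG A 0 (bG A 1 x) = 0 := by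
  suffices h : bG A 0 ∘ₗ bG A 1 = 0 from LinearMap.congr_fun h x
  refine oTensor_ext fun U W hU hW ω => ?_
  rw [LinearMap.comp_apply, LinearMap.zero_apply]
  induction ω using ind2 with
  | h0 => simp
  | hadd x y hx hy => simp only [map_add, TensorProduct.tmul_add, hx, hy, add_zero]
  | h1 ω a =>
    rw [bG_mulD_chi hU hW]
    induction ω using ind1 with
    | h0 => simp
    | hadd x y hx hy =>
      have e : (Cc.chi W : OG 𝒢) ⊗ₜ[Base 𝒢] (mulR A 1 (x + y) a -
          mulL A 1 (x + y) (act (𝒢 := 𝒢) (Cc.chi (binv U)) a)) =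
          (Cc.chi W : OG 𝒢) ⊗ₜ[Base 𝒢] (mulR A 1 x a -
            mulL A 1 x (act (𝒢 := 𝒢) (Cc.chi (binv U)) a)) +
          (Cc.chi W : OG 𝒢) ⊗ₜ[Base 𝒢] (mulR A 1 y a -
            mulL A 1 y (act (𝒢 := 𝒢) (Cc.chi (binv U)) a)) := by
        rw [← TensorProduct.tmul_add]
        congr 1
        simp only [map_add, LinearMap.add_apply]
        abel
      rw [e, smul_add, map_add, hx, hy, add_zero]
    | h1 b c =>
      rw [mulR_mulD, mulL_mulD, mulR_io, mulL_io, map_smul]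
      simp only [TensorProduct.tmul_sub, map_sub]
      rw [bG_mulD_chi hU hW, bG_mulD_chi hU hW, bG_mulD_chi hU hW]
      simp only [mulR_io, mulL_io, GAlgebra.act_mul (isBis_binv hU), TensorProduct.tmul_sub,
        mul_assoc, pow_zero, one_smul]
      rw [smul_eq_zero_of_right]
      abel
    | h2 c =>
      rw [mulR_dn, mulL_dn, map_smul]
      simp only [TensorProduct.tmul_sub, map_sub]
      rw [bG_mulD_chi hU hW, bG_mulD_chi hU hW, bG_dn_chi hU hW]
      simp only [mulR_io, mulL_io, GAlgebra.act_mul (isBis_binv hU), TensorProduct.tmul_sub,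
        map_sub, pow_zero, one_smul]
      rw [smul_eq_zero_of_right]
      abel

end Hochschild

/-- The quotient of an anti-Yetter-Drinfeld module by a stable submodule. -/
def AYD.quotient (M : AYD.{u₁, u₂, v} 𝒢) (p : Submodule (Base 𝒢) M.toGMod)
    (hp : ∀ (f : Cc 𝒢.Arr) (m : M.toGMod), m ∈ p → act f m ∈ p)
    (ho : ∀ f m, m ∈ p → M.oact f m ∈ p) : AYD.{u₁, u₂, v} 𝒢 :=
  letI : GModule 𝒢 (M.toGMod ⧸ p) := GModule.quotient p hp
  { carrier := M.toGMod ⧸ p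
    oact :=
      { toFun := fun f => p.mapQ p (M.oact f) (ho f)
        map_add' := fun f g => by ext x; simp
        map_smul' := fun k f => by ext x; simp }
    oact_mul := fun f g m => by
      obtain ⟨x, rfl⟩ := p.mkQ_surjective m
      exact congrArg p.mkQ (M.oact_mul f g x)
    span_oact := by
      rw [eq_top_iff]
      intro m _
      obtain ⟨x, rfl⟩ := p.mkQ_surjective m
      have hx : x ∈ Submodule.span ℂ {x : M.toGMod | ∃ f m, M.oact f m = x} := by
        rw [M.span_oact]; trivial
      induction hx using Submodule.span_induction with
      | mem x hx =>
        obtain ⟨f, m, rfl⟩ := hx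
        exact Submodule.subset_span ⟨f, p.mkQ m, rfl⟩
      | zero => rw [map_zero]; exact zero_mem _
      | add x y _ _ hx hy => rw [map_add]; exact add_mem (hx trivial) (hy trivial)
      | smul c x _ hx => exact Submodule.smul_mem _ c (hx trivial)
    equivariant := by
      refine isEquivariant_tensor _ fun U hU f m => ?_
      obtain ⟨x, rfl⟩ := p.mkQ_surjective m
      have := M.equivariant (Cc.chi U) (f ⊗ₜ x)
      rw [act_tmul hU] at this
      exact congrArg p.mkQ this }

section XComplex

variable (A : GAlg.{u₁, u₂, v} 𝒢)

/-- The even part `Ω⁰_G(A)` of the equivariant X-complex. -/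
def XE : AYD.{u₁, u₂, max u₂ v} 𝒢 := oTensor (Om A 0)

/-- The odd part `Ω¹_G(A) / b_G(Ω²_G(A))` of the equivariant X-complex. -/
def XO : AYD.{u₁, u₂, max u₂ v} 𝒢 :=
  (oTensor (Om A 1)).quotient (LinearMap.range (bG A 1))
    (by rintro f _ ⟨x, rfl⟩; exact ⟨act f x, bG_equivariant 1 f x⟩)
    (by rintro f _ ⟨x, rfl⟩; exact ⟨omul _ f x, bG_omul 1 f x⟩)

/-- The quotient map `♮ : Ω¹_G(A) → Ω¹_G(A) / b_G(Ω²_G(A))`. -/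
def natural : AYDHom (oTensor (Om A 1)) (XO A) :=
  ⟨(LinearMap.range (bG A 1)).mkQ, fun _ _ => rfl, fun _ _ => rfl⟩

theorem natural_surjective : Function.Surjective (natural A).1 :=
  (LinearMap.range (bG A 1)).mkQ_surjective

/-- `id ⊗ φ` for an equivariant map `φ`. -/
def oTensorMap {E : GMod.{u₁, u₂, v} 𝒢} {F : GMod.{u₁, u₂, w} 𝒢} (φ : E →ₗ[Base 𝒢] F)
    (hφ : ∀ U, IsBis 𝒢 U → ∀ m, φ (act (𝒢 := 𝒢) (Cc.chi U) m) = act (𝒢 := 𝒢) (Cc.chi U) (φ m)) :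
    AYDHom (oTensor E) (oTensor F) :=
  ⟨φ.lTensor (OG 𝒢), isEquivariant_lTensor φ hφ, lTensor_omul φ⟩

/-- Composition of morphisms of anti-Yetter-Drinfeld modules. -/
def AYD.comp {M : AYD.{u₁, u₂, v} 𝒢} {N : AYD.{u₁, u₂, w} 𝒢} {P : AYD.{u₁, u₂, x} 𝒢}
    (g : AYDHom N P) (f : AYDHom M N) : AYDHom M P :=
  ⟨g.1 ∘ₗ f.1, fun a m => by rw [LinearMap.comp_apply, f.2.1, g.2.1, LinearMap.comp_apply],
    fun a m => by rw [LinearMap.comp_apply, f.2.2, g.2.2, LinearMap.comp_apply]⟩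

/-- `∂₀ = ♮ d_G : Ω⁰_G(A) → Ω¹_G(A) / b_G(Ω²_G(A))`, where `d_G = id ⊗ d`. -/
def Xd0 : AYDHom (XE A) (XO A) :=
  AYD.comp (natural A) (oTensorMap (dn A 0) fun _ _ m => (act_dn 0 _ m).symm)

/-- `∂₁ : Ω¹_G(A) / b_G(Ω²_G(A)) → Ω⁰_G(A)`, induced by `b_G`. -/
def Xd1 : AYDHom (XO A) (XE A) :=
  ⟨(LinearMap.range (bG A 1)).liftQ (bG A 0) (by rintro _ ⟨x, rfl⟩; exact bG_bG x),
    fun a m => by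
      obtain ⟨x, rfl⟩ := natural_surjective A m
      exact bG_equivariant 0 a x,
    fun a m => by
      obtain ⟨x, rfl⟩ := natural_surjective A m
      exact bG_omul 0 a x⟩

variable {A} {B : GAlg.{u₁, u₂, w} 𝒢} (φ : GAlgHom A B)

/-- Functoriality of the even part of the X-complex. -/
def XEmap : AYDHom (XE A) (XE B) := oTensorMap (omMap φ 0) fun _ hU m => act_omMap φ 0 hU m

/-- Functoriality of the odd part of the X-complex. -/
def XOmap : AYDHom (XO A) (XO B) :=
  ⟨(LinearMap.range (bG A 1)).mapQ (LinearMap.range (bG B 1)) ((omMap φ 1).lTensor (OG 𝒢)) (by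
      rintro _ ⟨x, rfl⟩
      exact ⟨(omMap φ 2).lTensor (OG 𝒢) x, bG_omMap φ 1 x⟩),
    fun a m => by
      obtain ⟨x, rfl⟩ := natural_surjective A m
      exact congrArg (natural B).1
        (isEquivariant_lTensor (omMap φ 1) (fun _ hU m => act_omMap φ 1 hU m) a x),
    fun a m => by
      obtain ⟨x, rfl⟩ := natural_surjective A m
      exact congrArg (natural B).1 (lTensor_omul (omMap φ 1) a x)⟩

theorem lTensor_dn_omMap (x : OG 𝒢 ⊗[Base 𝒢] Om A 0) :
    (dn B 0).lTensor (OG 𝒢) ((omMap φ 0).lTensor (OG 𝒢) x) =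
      (omMap φ 1).lTensor (OG 𝒢) ((dn A 0).lTensor (OG 𝒢) x) := by
  rw [← LinearMap.lTensor_comp_apply, ← LinearMap.lTensor_comp_apply,
    LinearMap.ext (f := dn B 0 ∘ₗ omMap φ 0) (g := omMap φ 1 ∘ₗ dn A 0)
      fun y => (omMap_dn φ 0 y).symm]

theorem Xd0_map : AYD.comp (Xd0 B) (XEmap φ) = AYD.comp (XOmap φ) (Xd0 A) :=
  Subtype.ext (LinearMap.ext fun x => congrArg (natural B).1 (lTensor_dn_omMap φ x))

theorem Xd1_map : AYD.comp (Xd1 B) (XOmap φ) = AYD.comp (XEmap φ) (Xd1 A) := by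
  refine Subtype.ext (LinearMap.ext fun m => ?_)
  obtain ⟨x, rfl⟩ := natural_surjective A m
  exact bG_omMap φ 0 x

end XComplex

end AmpleHP

end

noncomputable section

open TopologicalSpace
open scoped TensorProduct

namespace AmpleHP

universe u₁ u₂ v w x y

open Base GModule Forms

variable {𝒢 : AmpleGroupoid.{u₁, u₂}}

section functorX

variable {A : GAlg.{u₁, u₂, v} 𝒢} {B : GAlg.{u₁, u₂, w} 𝒢} {C : GAlg.{u₁, u₂, x} 𝒢}

theorem omMap_comp (φ : GAlgHom A B) (ψ : GAlgHom B C) (χ : GAlgHom A C)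
    (h : ∀ a, ψ.toLin (φ.toLin a) = χ.toLin a) (n : ℕ) (ω : Om A n) :
    omMap ψ n (omMap φ n ω) = omMap χ n ω := by
  induction n with
  | zero => exact h ω
  | succ n ih =>
    have h' : ∀ (ω : Om A n) (a : A), omMap ψ (n + 1) (omMap φ (n + 1) (mulD A n ω a)) =
        omMap χ (n + 1) (mulD A n ω a) := by
      intro ω a
      rw [omMap_mulD, omMap_mulD, omMap_mulD, ih, h]
    cases n with
    | zero =>
      induction ω using ind1 with
      | h0 => simp
      | hadd x y hx hy => simp only [map_add, hx, hy]
      | h1 c b => exact h' _ _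
      | h2 c => rw [omMap_dn, omMap_dn, omMap_dn, ih]
    | succ n =>
      induction ω using ind2 with
      | h0 => simp
      | hadd x y hx hy => simp only [map_add, hx, hy]
      | h1 ω b => exact h' _ _

theorem omMap_id (φ : GAlgHom A A) (h : ∀ a, φ.toLin a = a) (n : ℕ) (ω : Om A n) :
    omMap φ n ω = ω := by
  induction n with
  | zero => exact h ω
  | succ n ih =>
    have h' : ∀ (ω : Om A n) (a : A), omMap φ (n + 1) (mulD A n ω a) = mulD A n ω a := by
      intro ω a
      rw [omMap_mulD, ih, h]
    cases n with
    | zero =>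
      induction ω using ind1 with
      | h0 => simp
      | hadd x y hx hy => simp only [map_add, hx, hy]
      | h1 c b => exact h' _ _
      | h2 c => rw [omMap_dn, ih]
    | succ n =>
      induction ω using ind2 with
      | h0 => simp
      | hadd x y hx hy => simp only [map_add, hx, hy]
      | h1 ω b => exact h' _ _

theorem lTensor_omMap_comp (φ : GAlgHom A B) (ψ : GAlgHom B C) (χ : GAlgHom A C)
    (h : ∀ a, ψ.toLin (φ.toLin a) = χ.toLin a) (n : ℕ) (z : OG 𝒢 ⊗[Base 𝒢] Om A n) :
    (omMap ψ n).lTensor (OG 𝒢) ((omMap φ n).lTensor (OG 𝒢) z) =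
      (omMap χ n).lTensor (OG 𝒢) z := by
  rw [← LinearMap.lTensor_comp_apply,
    LinearMap.ext (f := omMap ψ n ∘ₗ omMap φ n) (g := omMap χ n) (omMap_comp φ ψ χ h n)]

theorem lTensor_omMap_id (φ : GAlgHom A A) (h : ∀ a, φ.toLin a = a) (n : ℕ)
    (z : OG 𝒢 ⊗[Base 𝒢] Om A n) : (omMap φ n).lTensor (OG 𝒢) z = z := by
  rw [LinearMap.ext (f := omMap φ n) (g := LinearMap.id) (omMap_id φ h n), LinearMap.lTensor_id,
    LinearMap.id_apply]

theorem XEmap_comp (φ : GAlgHom A B) (ψ : GAlgHom B C) (χ : GAlgHom A C)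
    (h : ∀ a, ψ.toLin (φ.toLin a) = χ.toLin a) :
    AYD.comp (XEmap ψ) (XEmap φ) = XEmap χ :=
  Subtype.ext (LinearMap.ext (lTensor_omMap_comp φ ψ χ h 0))

theorem XOmap_comp (φ : GAlgHom A B) (ψ : GAlgHom B C) (χ : GAlgHom A C)
    (h : ∀ a, ψ.toLin (φ.toLin a) = χ.toLin a) :
    AYD.comp (XOmap ψ) (XOmap φ) = XOmap χ :=
  Subtype.ext (LinearMap.ext fun m => by
    obtain ⟨z, rfl⟩ := natural_surjective A m
    exact congrArg (natural C).1 (lTensor_omMap_comp φ ψ χ h 1 z))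

/-- The identity morphism. -/
def AYD.id (M : AYD.{u₁, u₂, v} 𝒢) : AYDHom M M :=
  ⟨LinearMap.id, fun _ _ => rfl, fun _ _ => rfl⟩

theorem XEmap_id (φ : GAlgHom A A) (h : ∀ a, φ.toLin a = a) : XEmap φ = AYD.id _ :=
  Subtype.ext (LinearMap.ext (lTensor_omMap_id φ h 0))

theorem XOmap_id (φ : GAlgHom A A) (h : ∀ a, φ.toLin a = a) : XOmap φ = AYD.id _ :=
  Subtype.ext (LinearMap.ext fun m => by
    obtain ⟨z, rfl⟩ := natural_surjective A m
    exact congrArg (natural A).1 (lTensor_omMap_id φ h 1 z))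

end functorX

/-! ### Pro-objects -/

/-- Precomposition with a morphism. -/
def AYD.precomp {M : AYD.{u₁, u₂, v} 𝒢} {M' : AYD.{u₁, u₂, w} 𝒢} (f : AYDHom M M')
    (N : AYD.{u₁, u₂, x} 𝒢) : AYDHom M' N →ₗ[ℂ] AYDHom M N where
  toFun g := AYD.comp g f
  map_add' _ _ := rfl
  map_smul' _ _ := rfl

/-- Postcomposition with a morphism. -/
def AYD.postcomp (M : AYD.{u₁, u₂, v} 𝒢) {N : AYD.{u₁, u₂, w} 𝒢} {N' : AYD.{u₁, u₂, x} 𝒢}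
    (g : AYDHom N N') : AYDHom M N →ₗ[ℂ] AYDHom M N' where
  toFun f := AYD.comp g f
  map_add' _ _ := Subtype.ext (LinearMap.ext fun _ => map_add g.1 _ _)
  map_smul' c f := Subtype.ext (LinearMap.ext fun m => LinearMap.map_smul_of_tower g.1 c (f.1 m))

variable (𝒢) in
/-- A projective system of anti-Yetter-Drinfeld modules indexed by the natural numbers. -/
structure ProAYD where
  obj : ℕ → AYD.{u₁, u₂, v} 𝒢
  map : ∀ {i j : ℕ}, i ≤ j → AYDHom (obj j) (obj i)
  map_self : ∀ i, map (le_refl i) = AYD.id (obj i)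
  map_comp : ∀ {i j k : ℕ} (h : i ≤ j) (h' : j ≤ k),
    AYD.comp (map h) (map h') = map (h.trans h')

/-- A morphism of projective systems which is given levelwise. -/
structure LevelHom (V : ProAYD.{u₁, u₂, v} 𝒢) (W : ProAYD.{u₁, u₂, w} 𝒢) where
  app : ∀ i, AYDHom (V.obj i) (W.obj i)
  comm : ∀ {i j : ℕ} (h : i ≤ j), AYD.comp (W.map h) (app j) = AYD.comp (app i) (V.map h)

/-- `colim_i Hom(V_i, N)`. -/
def ColimHom (V : ProAYD.{u₁, u₂, v} 𝒢) (N : AYD.{u₁, u₂, w} 𝒢) : Type (max v w) :=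
  Module.DirectLimit (R := ℂ) (fun i : ℕ => AYDHom (V.obj i) N)
    (fun _ _ h => AYD.precomp (V.map h) N)

instance (V : ProAYD.{u₁, u₂, v} 𝒢) (N : AYD.{u₁, u₂, w} 𝒢) : AddCommGroup (ColimHom V N) :=
  Module.DirectLimit.addCommGroup (fun i : ℕ => AYDHom (V.obj i) N)
    (fun _ _ h => AYD.precomp (V.map h) N)

instance (V : ProAYD.{u₁, u₂, v} 𝒢) (N : AYD.{u₁, u₂, w} 𝒢) : Module ℂ (ColimHom V N) :=
  Module.DirectLimit.module (fun i : ℕ => AYDHom (V.obj i) N)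
    (fun _ _ h => AYD.precomp (V.map h) N)

/-- The map `colim_i Hom(V_i, N) → colim_i Hom(V_i, N')` given by a morphism `N → N'`. -/
def ColimHom.post (V : ProAYD.{u₁, u₂, v} 𝒢) {N : AYD.{u₁, u₂, w} 𝒢} {N' : AYD.{u₁, u₂, x} 𝒢}
    (g : AYDHom N N') : ColimHom V N →ₗ[ℂ] ColimHom V N' :=
  Module.DirectLimit.map (fun i => AYD.postcomp (V.obj i) g) fun _ _ _ => rfl

/-- The map `colim_i Hom(V'_i, N) → colim_i Hom(V_i, N)` given by a levelwise morphism `V → V'`. -/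
def ColimHom.pre {V : ProAYD.{u₁, u₂, v} 𝒢} {V' : ProAYD.{u₁, u₂, w} 𝒢} (F : LevelHom V V')
    (N : AYD.{u₁, u₂, x} 𝒢) : ColimHom V' N →ₗ[ℂ] ColimHom V N :=
  Module.DirectLimit.map (fun i => AYD.precomp (F.app i) N) fun i j h => by
    ext1 f
    change AYD.comp (AYD.comp f (V'.map h)) (F.app j) = AYD.comp (AYD.comp f (F.app i)) (V.map h)
    exact congrArg (AYD.comp f) (F.comm h)

/-- The canonical map `Hom(V_i, N) → colim_i Hom(V_i, N)`. -/
def ColimHom.of (V : ProAYD.{u₁, u₂, v} 𝒢) (N : AYD.{u₁, u₂, w} 𝒢) (i : ℕ) :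
    AYDHom (V.obj i) N →ₗ[ℂ] ColimHom V N :=
  Module.DirectLimit.of ℂ ℕ (fun i : ℕ => AYDHom (V.obj i) N)
    (fun _ _ h => AYD.precomp (V.map h) N) i

theorem ColimHom.post_of (V : ProAYD.{u₁, u₂, v} 𝒢) {N : AYD.{u₁, u₂, w} 𝒢}
    {N' : AYD.{u₁, u₂, x} 𝒢} (g : AYDHom N N') (i : ℕ) (f : AYDHom (V.obj i) N) :
    ColimHom.post V g (ColimHom.of V N i f) = ColimHom.of V N' i (AYD.comp g f) :=
  Module.DirectLimit.map_apply_of (fun i => AYD.postcomp (V.obj i) g) _ f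

theorem ColimHom.pre_of {V : ProAYD.{u₁, u₂, v} 𝒢} {V' : ProAYD.{u₁, u₂, w} 𝒢}
    (F : LevelHom V V') (N : AYD.{u₁, u₂, x} 𝒢) (i : ℕ) (f : AYDHom (V'.obj i) N) :
    ColimHom.pre F N (ColimHom.of V' N i f) = ColimHom.of V N i (AYD.comp f (F.app i)) :=
  Module.DirectLimit.map_apply_of (fun i => AYD.precomp (F.app i) N) _ f

theorem ColimHom.ind {V : ProAYD.{u₁, u₂, v} 𝒢} {N : AYD.{u₁, u₂, w} 𝒢} {p : ColimHom V N → Prop}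
    (h : ∀ i f, p (ColimHom.of V N i f)) (z : ColimHom V N) : p z :=
  Module.DirectLimit.induction_on z h

theorem ColimHom.post_post (V : ProAYD.{u₁, u₂, v} 𝒢) {N : AYD.{u₁, u₂, w} 𝒢}
    {N' : AYD.{u₁, u₂, x} 𝒢} {N'' : AYD.{u₁, u₂, y} 𝒢} (g : AYDHom N N') (g' : AYDHom N' N'')
    (z : ColimHom V N) :
    ColimHom.post V g' (ColimHom.post V g z) = ColimHom.post V (AYD.comp g' g) z := by
  refine ColimHom.ind (p := fun z =>
    ColimHom.post V g' (ColimHom.post V g z) = ColimHom.post V (AYD.comp g' g) z) (fun i f => ?_) z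
  rw [post_of, post_of, post_of]; rfl

theorem ColimHom.post_pre {V : ProAYD.{u₁, u₂, v} 𝒢} {V' : ProAYD.{u₁, u₂, w} 𝒢}
    (F : LevelHom V V') {N : AYD.{u₁, u₂, x} 𝒢} {N' : AYD.{u₁, u₂, y} 𝒢} (g : AYDHom N N')
    (z : ColimHom V' N) :
    ColimHom.post V g (ColimHom.pre F N z) = ColimHom.pre F N' (ColimHom.post V' g z) := by
  refine ColimHom.ind (p := fun z =>
    ColimHom.post V g (ColimHom.pre F N z) = ColimHom.pre F N' (ColimHom.post V' g z))
    (fun i f => ?_) z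
  rw [pre_of, post_of, post_of, pre_of]; rfl

/-- The space `lim_j colim_i Hom(V_i, W_j)` of morphisms of pro-objects. -/
def ProHom (V : ProAYD.{u₁, u₂, v} 𝒢) (W : ProAYD.{u₁, u₂, w} 𝒢) :
    Submodule ℂ (∀ j, ColimHom V (W.obj j)) where
  carrier := {φ | ∀ {i j : ℕ} (h : i ≤ j), ColimHom.post V (W.map h) (φ j) = φ i}
  zero_mem' := fun _ => map_zero _
  add_mem' := fun hφ hψ i j h => by rw [Pi.add_apply, map_add, hφ h, hψ h]; rfl
  smul_mem' := fun c φ hφ i j h => by rw [Pi.smul_apply, map_smul, hφ h]; rfl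

instance (V : ProAYD.{u₁, u₂, v} 𝒢) (W : ProAYD.{u₁, u₂, w} 𝒢) : AddCommGroup (ProHom V W) :=
  Submodule.addCommGroup _

instance (V : ProAYD.{u₁, u₂, v} 𝒢) (W : ProAYD.{u₁, u₂, w} 𝒢) : Module ℂ (ProHom V W) :=
  Submodule.module _

/-- Composition `φ ↦ g φ` with a levelwise morphism `g`. -/
def ProHom.post (V : ProAYD.{u₁, u₂, v} 𝒢) {W : ProAYD.{u₁, u₂, w} 𝒢} {W' : ProAYD.{u₁, u₂, x} 𝒢}
    (g : LevelHom W W') : ProHom V W →ₗ[ℂ] ProHom V W' where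
  toFun φ := ⟨fun j => ColimHom.post V (g.app j) (φ.1 j), fun {i j} h => by
    rw [ColimHom.post_post, g.comm, ← ColimHom.post_post, φ.2]⟩
  map_add' _ _ := Subtype.ext (funext fun j => map_add (ColimHom.post V (g.app j)) _ _)
  map_smul' _ _ := Subtype.ext (funext fun j => map_smul (ColimHom.post V (g.app j)) _ _)

/-- Composition `φ ↦ φ f` with a levelwise morphism `f`. -/
def ProHom.pre {V : ProAYD.{u₁, u₂, v} 𝒢} {V' : ProAYD.{u₁, u₂, w} 𝒢} (f : LevelHom V V')
    (W : ProAYD.{u₁, u₂, x} 𝒢) : ProHom V' W →ₗ[ℂ] ProHom V W where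
  toFun φ := ⟨fun j => ColimHom.pre f (W.obj j) (φ.1 j), fun {i j} h => by
    rw [ColimHom.post_pre, φ.2]⟩
  map_add' _ _ := Subtype.ext (funext fun j => map_add (ColimHom.pre f (W.obj j)) _ _)
  map_smul' _ _ := Subtype.ext (funext fun j => map_smul (ColimHom.pre f (W.obj j)) _ _)

end AmpleHP

end

noncomputable section

open TopologicalSpace
open scoped TensorProduct

namespace AmpleHP

universe u₁ u₂ v w x y z

open Base GModule Forms

variable {𝒢 : AmpleGroupoid.{u₁, u₂}}

namespace ProHom

theorem post_pre {V : ProAYD.{u₁, u₂, v} 𝒢} {V' : ProAYD.{u₁, u₂, w} 𝒢} (f : LevelHom V V')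
    {W : ProAYD.{u₁, u₂, x} 𝒢} {W' : ProAYD.{u₁, u₂, y} 𝒢} (g : LevelHom W W') (φ : ProHom V' W) :
    ProHom.post V g (ProHom.pre f W φ) = ProHom.pre f W' (ProHom.post V' g φ) :=
  Subtype.ext (funext fun j => ColimHom.post_pre f (g.app j) (φ.1 j))

theorem post_square {V : ProAYD.{u₁, u₂, v} 𝒢} {W : ProAYD.{u₁, u₂, w} 𝒢}
    {W₁ : ProAYD.{u₁, u₂, x} 𝒢} {W₂ : ProAYD.{u₁, u₂, y} 𝒢} {W' : ProAYD.{u₁, u₂, z} 𝒢} {g : LevelHom W W₁} {g' : LevelHom W₁ W'} {k : LevelHom W W₂}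
    {k' : LevelHom W₂ W'} (h : ∀ i, AYD.comp (g'.app i) (g.app i) = AYD.comp (k'.app i) (k.app i))
    (φ : ProHom V W) : ProHom.post V g' (ProHom.post V g φ) = ProHom.post V k' (ProHom.post V k φ) :=
  Subtype.ext (funext fun j => (ColimHom.post_post V (g.app j) (g'.app j) (φ.1 j)).trans
    ((congrArg (fun t => ColimHom.post V t (φ.1 j)) (h j)).trans
      (ColimHom.post_post V (k.app j) (k'.app j) (φ.1 j)).symm))

theorem pre_square {W : ProAYD.{u₁, u₂, v} 𝒢} {V : ProAYD.{u₁, u₂, w} 𝒢}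
    {V₁ : ProAYD.{u₁, u₂, x} 𝒢} {V₂ : ProAYD.{u₁, u₂, y} 𝒢} {V' : ProAYD.{u₁, u₂, z} 𝒢} {g : LevelHom V V₁} {g' : LevelHom V₁ V'} {k : LevelHom V V₂}
    {k' : LevelHom V₂ V'} (h : ∀ i, AYD.comp (g'.app i) (g.app i) = AYD.comp (k'.app i) (k.app i))
    (φ : ProHom V' W) : ProHom.pre g W (ProHom.pre g' W φ) = ProHom.pre k W (ProHom.pre k' W φ) :=
  Subtype.ext (funext fun j => by
    change ColimHom.pre g _ (ColimHom.pre g' _ (φ.1 j)) = ColimHom.pre k _ (ColimHom.pre k' _ (φ.1 j))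
    refine ColimHom.ind (p := fun z => ColimHom.pre g _ (ColimHom.pre g' _ z) =
      ColimHom.pre k _ (ColimHom.pre k' _ z)) (fun i f => ?_) (φ.1 j)
    rw [ColimHom.pre_of, ColimHom.pre_of, ColimHom.pre_of, ColimHom.pre_of]
    exact congrArg (ColimHom.of V (W.obj j) i) (congrArg (AYD.comp f) (h i)))

end ProHom

/-! ### The complex of homomorphisms -/

variable (𝒢) in
/-- A `ℤ/2`-graded pro-anti-Yetter-Drinfeld module with an odd endomorphism. -/
structure GradedAYD where
  even : ProAYD.{u₁, u₂, v} 𝒢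
  odd : ProAYD.{u₁, u₂, v} 𝒢
  d0 : LevelHom even odd
  d1 : LevelHom odd even

/-- An even map commuting with the odd endomorphisms. -/
structure GradedMap (V : GradedAYD.{u₁, u₂, v} 𝒢) (W : GradedAYD.{u₁, u₂, w} 𝒢) where
  even : LevelHom V.even W.even
  odd : LevelHom V.odd W.odd
  comm0 : ∀ i, AYD.comp (W.d0.app i) (even.app i) = AYD.comp (odd.app i) (V.d0.app i)
  comm1 : ∀ i, AYD.comp (W.d1.app i) (odd.app i) = AYD.comp (even.app i) (V.d1.app i)

namespace GradedAYD

/-- The even part of the complex `Hom(V, W)`. -/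
abbrev HomEven (V : GradedAYD.{u₁, u₂, v} 𝒢) (W : GradedAYD.{u₁, u₂, w} 𝒢) : Type (max v w) :=
  ProHom V.even W.even × ProHom V.odd W.odd

instance (V : GradedAYD.{u₁, u₂, v} 𝒢) (W : GradedAYD.{u₁, u₂, w} 𝒢) :
    AddCommGroup (HomEven V W) := Prod.instAddCommGroup

instance (V : GradedAYD.{u₁, u₂, v} 𝒢) (W : GradedAYD.{u₁, u₂, w} 𝒢) :
    Module ℂ (HomEven V W) := Prod.instModule

/-- The odd part of the complex `Hom(V, W)`. -/
abbrev HomOdd (V : GradedAYD.{u₁, u₂, v} 𝒢) (W : GradedAYD.{u₁, u₂, w} 𝒢) : Type (max v w) :=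
  ProHom V.even W.odd × ProHom V.odd W.even

instance (V : GradedAYD.{u₁, u₂, v} 𝒢) (W : GradedAYD.{u₁, u₂, w} 𝒢) :
    AddCommGroup (HomOdd V W) := Prod.instAddCommGroup

instance (V : GradedAYD.{u₁, u₂, v} 𝒢) (W : GradedAYD.{u₁, u₂, w} 𝒢) :
    Module ℂ (HomOdd V W) := Prod.instModule

section

variable (V : GradedAYD.{u₁, u₂, v} 𝒢) (W : GradedAYD.{u₁, u₂, w} 𝒢)

/-- The boundary `∂(φ) = φ ∂ - ∂ φ` of even homomorphisms. -/
def dEven : HomEven V W →ₗ[ℂ] HomOdd V W where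
  toFun φ := (ProHom.pre V.d0 W.odd φ.2 - ProHom.post V.even W.d0 φ.1,
    ProHom.pre V.d1 W.even φ.1 - ProHom.post V.odd W.d1 φ.2)
  map_add' φ ψ := by
    refine Prod.ext ?_ ?_
    · simp only [Prod.fst_add, Prod.snd_add, map_add]; abel
    · simp only [Prod.fst_add, Prod.snd_add, map_add]; abel
  map_smul' c φ := by
    refine Prod.ext ?_ ?_
    · simp only [Prod.smul_fst, Prod.smul_snd, map_smul, smul_sub, RingHom.id_apply]
    · simp only [Prod.smul_fst, Prod.smul_snd, map_smul, smul_sub, RingHom.id_apply]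

/-- The boundary `∂(φ) = φ ∂ + ∂ φ` of odd homomorphisms. -/
def dOdd : HomOdd V W →ₗ[ℂ] HomEven V W where
  toFun φ := (ProHom.pre V.d0 W.even φ.2 + ProHom.post V.even W.d1 φ.1,
    ProHom.pre V.d1 W.odd φ.1 + ProHom.post V.odd W.d0 φ.2)
  map_add' φ ψ := by
    refine Prod.ext ?_ ?_
    · simp only [Prod.fst_add, Prod.snd_add, map_add]; abel
    · simp only [Prod.fst_add, Prod.snd_add, map_add]; abel
  map_smul' c φ := by
    refine Prod.ext ?_ ?_
    · simp only [Prod.smul_fst, Prod.smul_snd, map_smul, smul_add, RingHom.id_apply]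
    · simp only [Prod.smul_fst, Prod.smul_snd, map_smul, smul_add, RingHom.id_apply]

end

/-- The homology `ker g / im f` at `N` of `f : M → N` and `g : N → M`; formally `ker g / (im f ∩ ker g)`,
which is the same thing if `g f = 0`. -/
def Homology {M : Type v} {N : Type w} [AddCommGroup M] [Module ℂ M] [AddCommGroup N] [Module ℂ N]
    (f : M →ₗ[ℂ] N) (g : N →ₗ[ℂ] M) : Type w :=
  LinearMap.ker g ⧸ (LinearMap.range f).submoduleOf (LinearMap.ker g)

section

variable {M : Type v} {N : Type w} [AddCommGroup M] [Module ℂ M] [AddCommGroup N] [Module ℂ N]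
  (f : M →ₗ[ℂ] N) (g : N →ₗ[ℂ] M)

instance : AddCommGroup (Homology f g) :=
  inferInstanceAs (AddCommGroup
    (LinearMap.ker g ⧸ (LinearMap.range f).submoduleOf (LinearMap.ker g)))

instance : Module ℂ (Homology f g) :=
  inferInstanceAs (Module ℂ
    (LinearMap.ker g ⧸ (LinearMap.range f).submoduleOf (LinearMap.ker g)))

end

/-- The map on homology induced by a chain map. -/
def Homology.map {M N M' N' : Type*} [AddCommGroup M] [Module ℂ M] [AddCommGroup N] [Module ℂ N]
    [AddCommGroup M'] [Module ℂ M'] [AddCommGroup N'] [Module ℂ N']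
    {f : M →ₗ[ℂ] N} {g : N →ₗ[ℂ] M} {f' : M' →ₗ[ℂ] N'} {g' : N' →ₗ[ℂ] M'}
    (a : M →ₗ[ℂ] M') (b : N →ₗ[ℂ] N') (h : ∀ x, b (f x) = f' (a x)) (h' : ∀ y, a (g y) = g' (b y)) :
    Homology f g →ₗ[ℂ] Homology f' g' :=
  Submodule.mapQ ((LinearMap.range f).submoduleOf (LinearMap.ker g))
    ((LinearMap.range f').submoduleOf (LinearMap.ker g'))
    (b.restrict (p := LinearMap.ker g) (q := LinearMap.ker g') fun y hy => by
      rw [LinearMap.mem_ker, ← h', LinearMap.mem_ker.mp hy, map_zero])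
    (by
      rintro ⟨_, _⟩ ⟨x, rfl⟩
      exact ⟨a x, (h x).symm⟩)

section

variable (V : GradedAYD.{u₁, u₂, v} 𝒢) (W : GradedAYD.{u₁, u₂, w} 𝒢)

/-- The even homology `H_0(Hom(V, W))`. -/
abbrev H0 : Type (max v w) :=
  Homology (M := HomOdd V W) (N := HomEven V W) (dOdd V W) (dEven V W)

/-- The odd homology `H_1(Hom(V, W))`. -/
abbrev H1 : Type (max v w) :=
  Homology (M := HomEven V W) (N := HomOdd V W) (dEven V W) (dOdd V W)

end

section post

variable (V : GradedAYD.{u₁, u₂, v} 𝒢) {W : GradedAYD.{u₁, u₂, w} 𝒢} {W' : GradedAYD.{u₁, u₂, x} 𝒢}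
  (G : GradedMap W W')

/-- Composition `φ ↦ G φ` of even homomorphisms with a map `G : W → W'`. -/
def postEven : HomEven V W →ₗ[ℂ] HomEven V W' :=
  LinearMap.prodMap (ProHom.post V.even G.even) (ProHom.post V.odd G.odd)

/-- Composition `φ ↦ G φ` of odd homomorphisms with a map `G : W → W'`. -/
def postOdd : HomOdd V W →ₗ[ℂ] HomOdd V W' :=
  LinearMap.prodMap (ProHom.post V.even G.odd) (ProHom.post V.odd G.even)

theorem postEven_dOdd (φ : HomOdd V W) : postEven V G (dOdd V W φ) = dOdd V W' (postOdd V G φ) := by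
  refine Prod.ext ?_ ?_
  · change ProHom.post V.even G.even (ProHom.pre V.d0 W.even φ.2 + ProHom.post V.even W.d1 φ.1) =
      ProHom.pre V.d0 W'.even (ProHom.post V.odd G.even φ.2) +
        ProHom.post V.even W'.d1 (ProHom.post V.even G.odd φ.1)
    rw [map_add, ProHom.post_pre, ← ProHom.post_square G.comm1]
  · change ProHom.post V.odd G.odd (ProHom.pre V.d1 W.odd φ.1 + ProHom.post V.odd W.d0 φ.2) =
      ProHom.pre V.d1 W'.odd (ProHom.post V.even G.odd φ.1) +
        ProHom.post V.odd W'.d0 (ProHom.post V.odd G.even φ.2)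
    rw [map_add, ProHom.post_pre, ← ProHom.post_square G.comm0]

theorem postOdd_dEven (φ : HomEven V W) :
    postOdd V G (dEven V W φ) = dEven V W' (postEven V G φ) := by
  refine Prod.ext ?_ ?_
  · change ProHom.post V.even G.odd (ProHom.pre V.d0 W.odd φ.2 - ProHom.post V.even W.d0 φ.1) =
      ProHom.pre V.d0 W'.odd (ProHom.post V.odd G.odd φ.2) -
        ProHom.post V.even W'.d0 (ProHom.post V.even G.even φ.1)
    rw [map_sub, ProHom.post_pre, ← ProHom.post_square G.comm0]
  · change ProHom.post V.odd G.even (ProHom.pre V.d1 W.even φ.1 - ProHom.post V.odd W.d1 φ.2) =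
      ProHom.pre V.d1 W'.even (ProHom.post V.even G.even φ.1) -
        ProHom.post V.odd W'.d1 (ProHom.post V.odd G.odd φ.2)
    rw [map_sub, ProHom.post_pre, ← ProHom.post_square G.comm1]

/-- Covariant functoriality of `H_0(Hom(V, W))` in `W`. -/
def H0.post : H0 V W →ₗ[ℂ] H0 V W' :=
  Homology.map (M := HomOdd V W) (N := HomEven V W) (M' := HomOdd V W') (N' := HomEven V W')
    (postOdd V G) (postEven V G) (postEven_dOdd V G) (postOdd_dEven V G)

/-- Covariant functoriality of `H_1(Hom(V, W))` in `W`. -/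
def H1.post : H1 V W →ₗ[ℂ] H1 V W' :=
  Homology.map (M := HomEven V W) (N := HomOdd V W) (M' := HomEven V W') (N' := HomOdd V W')
    (postEven V G) (postOdd V G) (postOdd_dEven V G) (postEven_dOdd V G)

end post

section pre

variable {V : GradedAYD.{u₁, u₂, v} 𝒢} {V' : GradedAYD.{u₁, u₂, w} 𝒢} (F : GradedMap V V')
  (W : GradedAYD.{u₁, u₂, x} 𝒢)

/-- Composition `φ ↦ φ F` of even homomorphisms with a map `F : V → V'`. -/
def preEven : HomEven V' W →ₗ[ℂ] HomEven V W :=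
  LinearMap.prodMap (ProHom.pre F.even W.even) (ProHom.pre F.odd W.odd)

/-- Composition `φ ↦ φ F` of odd homomorphisms with a map `F : V → V'`. -/
def preOdd : HomOdd V' W →ₗ[ℂ] HomOdd V W :=
  LinearMap.prodMap (ProHom.pre F.even W.odd) (ProHom.pre F.odd W.even)

theorem preEven_dOdd (φ : HomOdd V' W) : preEven F W (dOdd V' W φ) = dOdd V W (preOdd F W φ) := by
  refine Prod.ext ?_ ?_
  · change ProHom.pre F.even W.even (ProHom.pre V'.d0 W.even φ.2 + ProHom.post V'.even W.d1 φ.1) =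
      ProHom.pre V.d0 W.even (ProHom.pre F.odd W.even φ.2) +
        ProHom.post V.even W.d1 (ProHom.pre F.even W.odd φ.1)
    rw [map_add, ProHom.post_pre, ProHom.pre_square F.comm0]
  · change ProHom.pre F.odd W.odd (ProHom.pre V'.d1 W.odd φ.1 + ProHom.post V'.odd W.d0 φ.2) =
      ProHom.pre V.d1 W.odd (ProHom.pre F.even W.odd φ.1) +
        ProHom.post V.odd W.d0 (ProHom.pre F.odd W.even φ.2)
    rw [map_add, ProHom.post_pre, ProHom.pre_square F.comm1]

theorem preOdd_dEven (φ : HomEven V' W) :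
    preOdd F W (dEven V' W φ) = dEven V W (preEven F W φ) := by
  refine Prod.ext ?_ ?_
  · change ProHom.pre F.even W.odd (ProHom.pre V'.d0 W.odd φ.2 - ProHom.post V'.even W.d0 φ.1) =
      ProHom.pre V.d0 W.odd (ProHom.pre F.odd W.odd φ.2) -
        ProHom.post V.even W.d0 (ProHom.pre F.even W.even φ.1)
    rw [map_sub, ProHom.post_pre, ProHom.pre_square F.comm0]
  · change ProHom.pre F.odd W.even (ProHom.pre V'.d1 W.even φ.1 - ProHom.post V'.odd W.d1 φ.2) =
      ProHom.pre V.d1 W.even (ProHom.pre F.even W.even φ.1) -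
        ProHom.post V.odd W.d1 (ProHom.pre F.odd W.odd φ.2)
    rw [map_sub, ProHom.post_pre, ProHom.pre_square F.comm1]

/-- Contravariant functoriality of `H_0(Hom(V, W))` in `V`. -/
def H0.pre : H0 V' W →ₗ[ℂ] H0 V W :=
  Homology.map (M := HomOdd V' W) (N := HomEven V' W) (M' := HomOdd V W) (N' := HomEven V W)
    (preOdd F W) (preEven F W) (preEven_dOdd F W) (preOdd_dEven F W)

/-- Contravariant functoriality of `H_1(Hom(V, W))` in `V`. -/
def H1.pre : H1 V' W →ₗ[ℂ] H1 V W :=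
  Homology.map (M := HomEven V' W) (N := HomOdd V' W) (M' := HomEven V W) (N' := HomOdd V W)
    (preEven F W) (preOdd F W) (preOdd_dEven F W) (preEven_dOdd F W)

end pre

end GradedAYD

/-! ### Equivariant periodic cyclic homology -/

/-- The pro-object `X_G(T A) = (X_G(T A / (J A)ᴺ⁺¹))_N`. -/
def XT (A : GAlg.{u₁, u₂, v} 𝒢) : GradedAYD.{u₁, u₂, max u₂ v} 𝒢 where
  even :=
    { obj := fun N => XE (TA A N)
      map := fun h => XEmap (TAproj A h)
      map_self := fun N => XEmap_id _ (TAproj_self A N)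
      map_comp := fun h h' => XEmap_comp _ _ _ (TAproj_TAproj A h h') }
  odd :=
    { obj := fun N => XO (TA A N)
      map := fun h => XOmap (TAproj A h)
      map_self := fun N => XOmap_id _ (TAproj_self A N)
      map_comp := fun h h' => XOmap_comp _ _ _ (TAproj_TAproj A h h') }
  d0 :=
    { app := fun N => Xd0 (TA A N)
      comm := fun h => (Xd0_map (TAproj A h)).symm }
  d1 :=
    { app := fun N => Xd1 (TA A N)
      comm := fun h => (Xd1_map (TAproj A h)).symm }

/-- Composition of homomorphisms. -/
def GAlgHom.comp {A : GAlg.{u₁, u₂, v} 𝒢} {B : GAlg.{u₁, u₂, w} 𝒢} {C : GAlg.{u₁, u₂, x} 𝒢}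
    (ψ : GAlgHom B C) (φ : GAlgHom A B) : GAlgHom A C where
  toLin := ψ.toLin ∘ₗ φ.toLin
  map_mul a b := by simp only [LinearMap.comp_apply, φ.map_mul, ψ.map_mul]
  equivariant f a := by
    rw [LinearMap.comp_apply, φ.equivariant, ψ.equivariant, LinearMap.comp_apply]

/-- Functoriality of `X_G(T A)`. -/
def XTmap {A : GAlg.{u₁, u₂, v} 𝒢} {B : GAlg.{u₁, u₂, w} 𝒢} (φ : GAlgHom A B) :
    GradedMap (XT A) (XT B) where
  even :=
    { app := fun N => XEmap (TAmap φ N)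
      comm := fun {N M} h => by
        refine (XEmap_comp _ _ (GAlgHom.comp (TAmap φ N) (TAproj A h)) fun a => ?_).trans
          (XEmap_comp (TAproj A h) (TAmap φ N) _ fun a => rfl).symm
        exact TAproj_TAmap φ h a }
  odd :=
    { app := fun N => XOmap (TAmap φ N)
      comm := fun {N M} h => by
        refine (XOmap_comp _ _ (GAlgHom.comp (TAmap φ N) (TAproj A h)) fun a => ?_).trans
          (XOmap_comp (TAproj A h) (TAmap φ N) _ fun a => rfl).symm
        exact TAproj_TAmap φ h a }
  comm0 N := Xd0_map (TAmap φ N)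
  comm1 N := Xd1_map (TAmap φ N)

/-- The stabilisation `A ⊗ K_G`. -/
def stab (A : GAlg.{u₁, u₂, v} 𝒢) : GAlg.{u₁, u₂, max u₂ v} 𝒢 := ⟨A ⊗[Base 𝒢] KG 𝒢⟩

/-- Functoriality of the stabilisation, `φ ⊗ id`. -/
def stabMap {A : GAlg.{u₁, u₂, v} 𝒢} {B : GAlg.{u₁, u₂, w} 𝒢} (φ : GAlgHom A B) :
    GAlgHom (stab A) (stab B) where
  toLin := φ.toLin.rTensor (KG 𝒢)
  map_mul x y := by
    change A ⊗[Base 𝒢] KG 𝒢 at x y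
    change φ.toLin.rTensor (KG 𝒢) (x * y) =
      φ.toLin.rTensor (KG 𝒢) x * φ.toLin.rTensor (KG 𝒢) y
    induction x with
    | zero => simp only [map_zero, zero_mul]
    | add x x' hx hx' => simp only [map_add, add_mul, hx, hx']
    | tmul a k =>
      induction y with
      | zero => simp only [map_zero, mul_zero]
      | add x x' hx hx' => simp only [map_add, mul_add, hx, hx']
      | tmul a' k' =>
        rw [Algebra.TensorProduct.tmul_mul_tmul, LinearMap.rTensor_tmul, LinearMap.rTensor_tmul,
          LinearMap.rTensor_tmul, Algebra.TensorProduct.tmul_mul_tmul, φ.map_mul]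
  equivariant := isEquivariant_tensor (M := A) (N := KG 𝒢) (P := B ⊗[Base 𝒢] KG 𝒢)
    (φ.toLin.rTensor (KG 𝒢)) fun U hU a k => by
      rw [LinearMap.rTensor_tmul, LinearMap.rTensor_tmul, act_tmul hU, φ.equivariant]

section HP

open GradedAYD

variable (A : GAlg.{u₁, u₂, v} 𝒢) (B : GAlg.{u₁, u₂, w} 𝒢)

/-- `HP^G_0(A, B) = H_0(Hom(X_G(T(A ⊗ K_G)), X_G(T(B ⊗ K_G))))`. -/
abbrev HP0 : Type (max u₂ v w) := H0 (XT (stab A)) (XT (stab B))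

/-- `HP^G_1(A, B) = H_1(Hom(X_G(T(A ⊗ K_G)), X_G(T(B ⊗ K_G))))`. -/
abbrev HP1 : Type (max u₂ v w) := H1 (XT (stab A)) (XT (stab B))

variable {A} {A' : GAlg.{u₁, u₂, x} 𝒢} {B} {B' : GAlg.{u₁, u₂, y} 𝒢}

/-- Contravariant functoriality of `HP^G_0(A, B)` in `A`. -/
def HP0.pre (φ : GAlgHom A A') (B : GAlg.{u₁, u₂, w} 𝒢) : HP0 A' B →ₗ[ℂ] HP0 A B :=
  H0.pre (XTmap (stabMap φ)) (XT (stab B))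

/-- Contravariant functoriality of `HP^G_1(A, B)` in `A`. -/
def HP1.pre (φ : GAlgHom A A') (B : GAlg.{u₁, u₂, w} 𝒢) : HP1 A' B →ₗ[ℂ] HP1 A B :=
  H1.pre (XTmap (stabMap φ)) (XT (stab B))

/-- Covariant functoriality of `HP^G_0(A, B)` in `B`. -/
def HP0.post (A : GAlg.{u₁, u₂, v} 𝒢) (ψ : GAlgHom B B') : HP0 A B →ₗ[ℂ] HP0 A B' :=
  H0.post (XT (stab A)) (XTmap (stabMap ψ))

/-- Covariant functoriality of `HP^G_1(A, B)` in `B`. -/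
def HP1.post (A : GAlg.{u₁, u₂, v} 𝒢) (ψ : GAlgHom B B') : HP1 A B →ₗ[ℂ] HP1 A B' :=
  H1.post (XT (stab A)) (XTmap (stabMap ψ))

end HP

end AmpleHP

end

universe u₁ u₂ v

open AmpleHP

set_option linter.unusedSectionVars false

noncomputable section

open TopologicalSpace
open scoped TensorProduct

namespace AmpleHP

universe w x y z

open Base GModule Forms

variable {𝒢 : AmpleGroupoid.{u₁, u₂}}

namespace Forms

section universalProperty

variable {A : GAlg.{u₁, u₂, v} 𝒢} {S : Type w} [NonUnitalRing S] [Module (Base 𝒢) S]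
  [IsScalarTower (Base 𝒢) S S] [SMulCommClass (Base 𝒢) S S]

/-- The curvature `ρ(ab) - ρ(a)ρ(b)` of a linear map. -/
def curv (ρ : A →ₗ[Base 𝒢] S) : A →ₗ[Base 𝒢] A →ₗ[Base 𝒢] S :=
  (LinearMap.mul (Base 𝒢) A).compr₂ ρ - (LinearMap.mul (Base 𝒢) S).compl₁₂ ρ ρ

theorem curv_apply (ρ : A →ₗ[Base 𝒢] S) (a b : A) : curv ρ a b = ρ (a * b) - ρ a * ρ b := rfl

/-- The cocycle identity of the curvature. -/
theorem curv_cocycle (ρ : A →ₗ[Base 𝒢] S) (a b c : A) :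
    curv ρ (a * b) c - ρ a * curv ρ b c = curv ρ a (b * c) - curv ρ a b * ρ c := by
  simp only [curv_apply, mul_sub, sub_mul, mul_assoc]
  abel

/-- `((s, q), a) ↦ (q(a), b ↦ s ω(a, b))`. -/
def extStep (ρ : A →ₗ[Base 𝒢] S) :
    S × (A →ₗ[Base 𝒢] S) →ₗ[Base 𝒢] A →ₗ[Base 𝒢] S × (A →ₗ[Base 𝒢] S) :=
  LinearMap.mk₂ (Base 𝒢) (fun z a => (z.2 a, LinearMap.mulLeft (Base 𝒢) z.1 ∘ₗ curv ρ a))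
    (fun z z' a => Prod.ext rfl (by ext b; simp [add_mul]))
    (fun k z a => Prod.ext rfl (by ext b; simp [smul_mul_assoc]))
    (fun z a a' => Prod.ext (by simp) (by ext b; simp [mul_add]))
    (fun k z a => Prod.ext (by simp) (by ext b; simp))

/-- The components of `extTot`. -/
def extN (ρ : A →ₗ[Base 𝒢] S) : ∀ n, Om A n →ₗ[Base 𝒢] S × (A →ₗ[Base 𝒢] S)
  | 0 => LinearMap.inl (Base 𝒢) S (A →ₗ[Base 𝒢] S) ∘ₗ ρ ∘ₗ (io A).symm.toLinearMap
  | 1 => lift1 (extStep ρ ∘ₗ extN ρ 0) (LinearMap.inr (Base 𝒢) S (A →ₗ[Base 𝒢] S) ∘ₗ curv ρ)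
  | n + 2 => lift2 n (extStep ρ ∘ₗ extN ρ (n + 1))

/-- The extension of `ρ` to forms with `a₀ da₁ ⋯ da₂ₙ ↦ ρ(a₀) ω(a₁, a₂) ⋯ ω(a₂ₙ₋₁, a₂ₙ)`, together with
the linear maps `b ↦ (value at x db)`. -/
def extTot (ρ : A →ₗ[Base 𝒢] S) : Tot A →ₗ[Base 𝒢] S × (A →ₗ[Base 𝒢] S) :=
  DirectSum.toModule (Base 𝒢) ℕ _ (extN ρ)

variable (ρ : A →ₗ[Base 𝒢] S)

theorem extTot_inn (n : ℕ) (x : Om A n) : extTot ρ (inn A n x) = extN ρ n x := by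
  rw [extTot, inn, DirectSum.toModule_lof]

theorem extTot_iA (a : A) : extTot ρ (iA A a) = (ρ a, 0) := by
  rw [iA, LinearMap.comp_apply, extTot_inn]; rfl

theorem extTot_totd_iA (a : A) : extTot ρ (totd A (iA A a)) = (0, curv ρ a) := by
  rw [iA, LinearMap.comp_apply, totd_inn, extTot_inn]
  exact lift1_dn _ _ a

theorem extTot_totD (x : Tot A) (a : A) :
    extTot ρ (totD A x a) = extStep ρ (extTot ρ x) a := by
  induction x using ind_inn with
  | h0 => simp
  | hadd x y hx hy => simp only [map_add, LinearMap.add_apply, hx, hy]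
  | h n x =>
    rw [totD_inn, extTot_inn, extTot_inn]
    cases n with
    | zero => exact lift1_mulD _ _ x a
    | succ n => exact lift2_mulD n _ x a

theorem extTot_totD_fst (x : Tot A) (a : A) :
    (extTot ρ (totD A x a)).1 = (extTot ρ x).2 a := by rw [extTot_totD]; rfl

theorem extTot_totD_snd (x : Tot A) (a b : A) :
    (extTot ρ (totD A x a)).2 b = (extTot ρ x).1 * curv ρ a b := by rw [extTot_totD]; rfl

theorem extTot_fed_iA (x : Tot A) (b : A) :
    (extTot ρ (fed A x (iA A b))).1 = (extTot ρ x).1 * ρ b ∧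
    ∀ c, (extTot ρ (fed A x (iA A b))).2 c =
      (extTot ρ x).2 (b * c) - (extTot ρ x).2 b * ρ c := by
  induction x using ind_tot generalizing b with
  | h0 => simp
  | hadd x y hx hy =>
    refine ⟨?_, fun c => ?_⟩
    · simp only [map_add, LinearMap.add_apply, Prod.fst_add, (hx b).1, (hy b).1, add_mul]
    · simp only [map_add, LinearMap.add_apply, Prod.snd_add, (hx b).2, (hy b).2, add_mul]; abel
  | h1 a =>
    rw [fed_iA, grad_iA, totR_iA]
    refine ⟨?_, fun c => ?_⟩
    · rw [map_sub, Prod.fst_sub, extTot_totD_fst, extTot_iA, extTot_totd_iA, extTot_iA, curv_apply]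
      simp
    · rw [map_sub, Prod.snd_sub, LinearMap.sub_apply, extTot_totD_snd, extTot_iA, extTot_totd_iA,
        extTot_iA]
      simp
  | h2 d =>
    rw [fed_iA, grad_totd, map_neg, totd_totd, neg_zero, map_zero, LinearMap.zero_apply, sub_zero,
      totR_totd_iA]
    refine ⟨?_, fun c => ?_⟩
    · rw [map_sub, Prod.fst_sub, extTot_totD_fst, extTot_iA, extTot_totd_iA, extTot_totd_iA]
      simp
    · rw [map_sub, Prod.snd_sub, LinearMap.sub_apply, extTot_totD_snd, extTot_iA, extTot_totd_iA,
        extTot_totd_iA]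
      exact curv_cocycle ρ d b c
  | h3 x a hx =>
    rw [fed_totD_iA]
    refine ⟨?_, fun c => ?_⟩
    · rw [map_sub, Prod.fst_sub, extTot_totD_fst, extTot_totD_fst, (hx a).2, extTot_totD_fst]
      abel
    · rw [map_sub, Prod.snd_sub, LinearMap.sub_apply, extTot_totD_snd, extTot_totD_snd, (hx a).1,
        extTot_totD_snd, extTot_totD_snd, mul_assoc, mul_assoc, ← mul_sub, ← mul_sub,
        curv_cocycle]

theorem eq_zero_of_eq_neg {M : Type*} [AddCommGroup M] [Module (Base 𝒢) M] {m : M} (h : m = -m) :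
    m = 0 := by
  have h1 : (algebraMap ℂ (Base 𝒢) 2) • m = 0 := by
    rw [map_ofNat, ofNat_smul_eq_nsmul, two_nsmul]
    nth_rewrite 1 [h]
    exact neg_add_cancel _
  have h2 := congrArg (fun z => (algebraMap ℂ (Base 𝒢) (2⁻¹)) • z) h1
  simpa only [smul_smul, ← map_mul, inv_mul_cancel₀ (two_ne_zero' ℂ), map_one, one_smul,
    smul_zero] using h2

theorem extTot_grad (x : Tot A) : (extTot ρ (grad A x)).1 = (extTot ρ x).1 ∧
    (extTot ρ (grad A x)).2 = - (extTot ρ x).2 := by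
  induction x using ind_tot with
  | h0 => simp
  | hadd x y hx hy =>
    refine ⟨?_, ?_⟩
    · simp only [map_add, Prod.fst_add, hx.1, hy.1]
    · rw [map_add, map_add, map_add, Prod.snd_add, Prod.snd_add, hx.2, hy.2, neg_add]
  | h1 a => rw [grad_iA, extTot_iA]; simp
  | h2 c => rw [grad_totd, grad_iA, map_neg, extTot_totd_iA]; simp
  | h3 x a hx =>
    rw [grad_totD, map_neg]
    refine ⟨?_, ?_⟩
    · rw [Prod.fst_neg, extTot_totD_fst, extTot_totD_fst, hx.2]; simp
    · ext b
      rw [Prod.snd_neg, LinearMap.neg_apply, LinearMap.neg_apply, extTot_totD_snd,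
        extTot_totD_snd, hx.1]

/-- Forms of even degree have no odd component. -/
theorem extTot_snd_of_grad {x : Tot A} (hx : grad A x = x) : (extTot ρ x).2 = 0 := by
  have h := (extTot_grad ρ x).2
  rw [hx] at h
  exact eq_zero_of_eq_neg (𝒢 := 𝒢) h

theorem extTot_fed {x : Tot A} (hx : grad A x = x) (y : Tot A) :
    (extTot ρ (fed A x y)).1 = (extTot ρ x).1 * (extTot ρ y).1 ∧
    ∀ c, (extTot ρ (fed A x y)).2 c = (extTot ρ x).1 * (extTot ρ y).2 c := by
  induction y using ind_tot with
  | h0 => simp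
  | hadd y y' hy hy' =>
    refine ⟨?_, fun c => ?_⟩
    · simp only [map_add, Prod.fst_add, hy.1, hy'.1, mul_add]
    · simp only [map_add, Prod.snd_add, LinearMap.add_apply, hy.2, hy'.2, mul_add]
  | h1 a =>
    refine ⟨?_, fun c => ?_⟩
    · rw [(extTot_fed_iA ρ x a).1, extTot_iA]
    · rw [(extTot_fed_iA ρ x a).2, extTot_iA, extTot_snd_of_grad ρ hx]; simp
  | h2 c =>
    rw [fed_totd_iA]
    refine ⟨?_, fun b => ?_⟩
    · rw [extTot_totD_fst, extTot_totd_iA, extTot_snd_of_grad ρ hx]; simp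
    · rw [extTot_totD_snd, extTot_totd_iA]
  | h3 y a hy =>
    rw [fed_totD]
    refine ⟨?_, fun c => ?_⟩
    · rw [extTot_totD_fst, extTot_totD_fst, hy.2]
    · rw [extTot_totD_snd, extTot_totD_snd, hy.1, mul_assoc]

/-- A decreasing sequence of submodules which measures the nilpotency of the curvature of `ρ`. -/
structure CurvFilt (ρ : A →ₗ[Base 𝒢] S) (N : ℕ) where
  F : ℕ → Submodule (Base 𝒢) S
  mem_zero : ∀ a, ρ a ∈ F 0
  curv_mem : ∀ a b, curv ρ a b ∈ F 1
  mul_curv : ∀ k, ∀ s ∈ F k, ∀ a b, s * curv ρ a b ∈ F (k + 1)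
  eq_zero : ∀ s ∈ F (N + 1), s = 0

theorem ind_om_even {p : ℕ → Tot A → Prop} (h0 : ∀ k, p k 0)
    (hadd : ∀ k x y, p k x → p k y → p k (x + y)) (h1 : ∀ a, p 0 (iA A a))
    (h2 : ∀ a b, p 1 (totD A (totd A (iA A a)) b))
    (h3 : ∀ k x a b, grad A x = x → p k x → p (k + 1) (totD A (totD A x a) b)) (k : ℕ)
    (x : Om A (2 * k)) : p k (inn A (2 * k) x) := by
  induction k with
  | zero => exact h1 x
  | succ k ih =>
    have hk : 2 * (k + 1) = 2 * k + 1 + 1 := by ring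
    have gen : ∀ z : Om A (2 * k + 1 + 1), p (k + 1) (inn A (2 * k + 1 + 1) z) := by
      intro z
      induction z using ind2 with
      | h0 => rw [map_zero]; exact h0 _
      | hadd x y hx hy => rw [map_add]; exact hadd _ _ _ hx hy
      | h1 z b =>
        rw [← totD_inn]
        cases k with
        | zero =>
          induction z using ind1 with
          | h0 => simpa using h0 1
          | hadd x y hx hy => simp only [map_add, LinearMap.add_apply]; exact hadd _ _ _ hx hy
          | h1 c a =>
            have := h3 0 _ a b (grad_iA c) (h1 c)
            rwa [iA, LinearMap.comp_apply, totD_inn] at this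
          | h2 c =>
            have := h2 c b
            rwa [iA, LinearMap.comp_apply, totd_inn] at this
        | succ k =>
          have gen' : ∀ z : Om A (2 * k + 1 + 1 + 1),
              p (k + 1 + 1) (totD A (inn A (2 * k + 1 + 1 + 1) z) b) := by
            intro z
            induction z using ind2 with
            | h0 => simpa using h0 _
            | hadd x y hx hy => simp only [map_add, LinearMap.add_apply]; exact hadd _ _ _ hx hy
            | h1 x a =>
              rw [← totD_inn]
              refine h3 (k + 1) _ a b ?_ (ih x)
              rw [grad_inn, Even.neg_one_pow ⟨k + 1, by ring⟩, one_smul]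
          exact gen' z
    exact gen x

theorem extTot_mem {N : ℕ} (hF : CurvFilt ρ N) (k : ℕ) (x : Om A (2 * k)) :
    (extTot ρ (inn A (2 * k) x)).1 ∈ hF.F k ∧
      (N + 1 ≤ k → (extTot ρ (inn A (2 * k) x)).1 = 0) := by
  refine ind_om_even (p := fun k x => (extTot ρ x).1 ∈ hF.F k ∧
    (N + 1 ≤ k → (extTot ρ x).1 = 0)) ?_ ?_ ?_ ?_ ?_ k x
  · intro k
    rw [map_zero]
    exact ⟨zero_mem _, fun _ => rfl⟩
  · intro k x y hx hy
    rw [map_add]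
    exact ⟨add_mem hx.1 hy.1, fun h => by rw [Prod.fst_add, hx.2 h, hy.2 h, add_zero]⟩
  · intro a
    rw [extTot_iA]
    exact ⟨hF.mem_zero a, fun h => absurd h (by omega)⟩
  · intro a b
    rw [extTot_totD_fst, extTot_totd_iA]
    exact ⟨hF.curv_mem a b, fun h => hF.eq_zero _ (by
      obtain rfl : N = 0 := by omega
      exact hF.curv_mem a b)⟩
  · intro k x a b _ hx
    rw [extTot_totD_fst, extTot_totD_snd]
    refine ⟨hF.mul_curv k _ hx.1 a b, fun h => ?_⟩
    rcases Nat.lt_or_ge k (N + 1) with hk | hk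
    · obtain rfl : k = N := by omega
      exact hF.eq_zero _ (hF.mul_curv k _ hx.1 a b)
    · rw [hx.2 hk, zero_mul]

theorem extTot_filt {N : ℕ} (hF : CurvFilt ρ N) {x : Tot A} (hx : x ∈ filt A (2 * N + 1)) :
    (extTot ρ x).1 = 0 := by
  refine filt_ind (p := fun x => (extTot ρ x).1 = 0) (by simp) ?_ ?_ hx
  · intro x y hx hy
    rw [map_add, Prod.fst_add, hx, hy, add_zero]
  · intro m hm x
    rcases Nat.even_or_odd m with h | h
    · obtain ⟨k, rfl⟩ := h.exists_two_nsmul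
      exact (extTot_mem ρ hF k x).2 (by simp only [smul_eq_mul] at hm; omega)
    · have := (extTot_grad ρ (inn A m x)).1
      rw [grad_inn, h.neg_one_pow, neg_smul, one_smul, map_neg] at this
      exact eq_zero_of_eq_neg (𝒢 := 𝒢) this.symm

variable (A) in
/-- The inclusion of `T A / (J A)ᴺ⁺¹ = A ⊕ Ω²(A) ⊕ … ⊕ Ω²ᴺ(A)` into `Ω(A)`. -/
def toTot (N : ℕ) : TA A N →ₗ[Base 𝒢] Tot A := evI A N

variable (A) in
/-- The projection of `Ω(A)` onto `T A / (J A)ᴺ⁺¹ = A ⊕ Ω²(A) ⊕ … ⊕ Ω²ᴺ(A)`. -/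
def ofTot (N : ℕ) : Tot A →ₗ[Base 𝒢] TA A N := evP A N

theorem ofTot_toTot {N : ℕ} (x : TA A N) : ofTot A N (toTot A N x) = x := evP_evI x

theorem grad_toTot {N : ℕ} (x : TA A N) : grad A (toTot A N x) = toTot A N x := grad_evI x

theorem mul_eq_ofTot {N : ℕ} (x y : TA A N) :
    x * y = ofTot A N (fed A (toTot A N x) (toTot A N y)) := rfl

theorem toTot_ofTot_sub {N : ℕ} {x : Tot A} (hx : grad A x = x) :
    x - toTot A N (ofTot A N x) ∈ filt A (2 * N + 1) := sub_mem_filt hx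

theorem ofTot_of_mem_filt {N : ℕ} {x : Tot A} (h : x ∈ filt A (2 * N + 1)) : ofTot A N x = 0 :=
  evP_of_mem_filt h

variable (A) in
/-- The inclusion `A → T A / (J A)ᴺ⁺¹`. -/
def gen (N : ℕ) : A →ₗ[Base 𝒢] TA A N := ofTot A N ∘ₗ iA A

theorem gen_eq {N : ℕ} (a : A) : gen A N a = ofTot A N (iA A a) := rfl

theorem ofTot_mul_gen {N : ℕ} {x : Tot A} (hx : grad A x = x) (a : A) :
    ofTot A N x * gen A N a = ofTot A N (fed A x (iA A a)) := by
  rw [mul_eq_ofTot, gen_eq]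
  exact (evP_fed_right _ (grad_iA a)).trans (evP_fed_left hx _)

/-- The universal property of `T A / (J A)ᴺ⁺¹`: a linear map whose curvature is nilpotent of order
`N + 1` extends to an algebra homomorphism. -/
theorem exists_ext {N : ℕ} (hF : CurvFilt ρ N) : ∃ φ : TA A N →ₗ[Base 𝒢] S,
    (∀ a, φ (gen A N a) = ρ a) ∧ ∀ x y, φ (x * y) = φ x * φ y := by
  have key : ∀ z : Tot A, grad A z = z →
      (extTot ρ (toTot A N (ofTot A N z))).1 = (extTot ρ z).1 := by
    intro z hz
    have := extTot_filt ρ hF (toTot_ofTot_sub (N := N) hz)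
    rw [map_sub, Prod.fst_sub, sub_eq_zero] at this
    exact this.symm
  refine ⟨LinearMap.fst (Base 𝒢) _ _ ∘ₗ extTot ρ ∘ₗ toTot A N, fun a => ?_, fun x y => ?_⟩
  · exact (key _ (grad_iA a)).trans (by rw [extTot_iA])
  · rw [LinearMap.comp_apply, LinearMap.comp_apply, mul_eq_ofTot]
    refine (key _ (by rw [grad_fed, grad_toTot, grad_toTot])).trans ?_
    exact (extTot_fed ρ (grad_toTot x) (toTot A N y)).1

theorem ofTot_totD_totD {N : ℕ} {x : Tot A} (hx : grad A x = x) (a b : A) :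
    ofTot A N (totD A (totD A x a) b) = ofTot A N x * curv (gen A N) a b := by
  rw [curv_apply, mul_sub, ← mul_assoc, ofTot_mul_gen hx, ofTot_mul_gen hx, ofTot_mul_gen
    (by rw [grad_fed, hx, grad_iA]), fed_fed_iA, map_sub, sub_sub_cancel]

theorem ofTot_totD_totd {N : ℕ} (a b : A) :
    ofTot A N (totD A (totd A (iA A a)) b) = curv (gen A N) a b := by
  rw [curv_apply, gen_eq a, ofTot_mul_gen (grad_iA a), fed_iA, grad_iA, totR_iA, map_sub, gen_eq,
    sub_sub_cancel]

/-- `T A / (J A)ᴺ⁺¹` is spanned by products of elements of `A`. -/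
theorem TA_ind {N : ℕ} {p : ℕ → TA A N → Prop} (h0 : ∀ k, p k 0)
    (hsub : ∀ k x y, p k x → p k y → p k (x - y)) (hs : ∀ k x, p k x → p (k + 1) x)
    (h1 : ∀ a, p 0 (gen A N a)) (h2 : ∀ k x a, p k x → p (k + 1) (x * gen A N a)) (x : TA A N) :
    p (2 * N) x := by
  have hadd : ∀ k x y, p k x → p k y → p k (x + y) := fun k x y hx hy => by
    have := hsub k x _ hx (hsub k 0 y (h0 k) hy)
    rwa [zero_sub, sub_neg_eq_add] at this
  have hle : ∀ k l x, k ≤ l → p k x → p l x := fun k l x h hx => by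
    induction l, h using Nat.le_induction with
    | base => exact hx
    | succ l _ ih => exact hs l x ih
  have key : ∀ k (x : Om A (2 * k)), p (2 * k) (ofTot A N (inn A (2 * k) x)) := by
    intro k x
    refine (ind_om_even (p := fun k x => grad A x = x ∧ p (2 * k) (ofTot A N x)) ?_ ?_ ?_ ?_ ?_ k x).2
    · intro k
      rw [map_zero, map_zero]
      exact ⟨rfl, h0 _⟩
    · intro k x y hx hy
      rw [map_add, map_add, hx.1, hy.1]
      exact ⟨rfl, hadd _ _ _ hx.2 hy.2⟩
    · exact fun a => ⟨grad_iA a, h1 a⟩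
    · intro a b
      refine ⟨by rw [grad_totD, grad_totd, grad_iA, map_neg, LinearMap.neg_apply, neg_neg], ?_⟩
      rw [ofTot_totD_totd, curv_apply]
      exact hsub _ _ _ (hle 0 _ _ (by omega) (h1 _)) (hs 1 _ (h2 0 _ _ (h1 _)))
    · intro k x a b hg hx
      refine ⟨by rw [grad_totD, grad_totD, hx.1, map_neg, LinearMap.neg_apply, neg_neg], ?_⟩
      rw [ofTot_totD_totD hg, curv_apply, mul_sub, ← mul_assoc]
      exact hsub _ _ _ (hs _ _ (h2 _ _ _ hx.2)) (h2 _ _ _ (h2 _ _ _ hx.2))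
  rw [← ofTot_toTot x]
  refine ind_ev (p := fun x => p (2 * N) (ofTot A N (evI A N x))) ?_ ?_ ?_ x
  · rw [map_zero, map_zero]; exact h0 _
  · intro x y hx hy
    rw [map_add, map_add]; exact hadd _ _ _ hx hy
  · intro k x
    rw [evI_lof]
    exact hle _ _ _ (by have := k.2; omega) (key k x)

/-- `T A / (J A)ᴺ⁺¹` is generated by `A`. -/
theorem TA_ind' {N : ℕ} {p : TA A N → Prop} (h0 : p 0) (hsub : ∀ x y, p x → p y → p (x - y))
    (h1 : ∀ a, p (gen A N a)) (h2 : ∀ x a, p x → p (x * gen A N a)) (x : TA A N) : p x :=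
  TA_ind (p := fun _ => p) (fun _ => h0) (fun _ => hsub) (fun _ _ h => h) h1 (fun _ => h2) x

/-- The powers of the ideal `J A` in `T A / (J A)ᴺ⁺¹`. -/
def JA (A : GAlg.{u₁, u₂, v} 𝒢) (N : ℕ) : ℕ → Submodule (Base 𝒢) (TA A N)
  | 0 => ⊤
  | k + 1 => Submodule.span (Base 𝒢) ({z | k = 0 ∧ ∃ a b, curv (gen A N) a b = z} ∪
      {z | ∃ x ∈ JA A N k, ∃ a b, x * curv (gen A N) a b = z})

theorem curv_mem_JA {N : ℕ} (a b : A) : curv (gen A N) a b ∈ JA A N 1 :=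
  Submodule.subset_span (Or.inl ⟨rfl, a, b, rfl⟩)

theorem mul_curv_mem_JA {N k : ℕ} {x : TA A N} (hx : x ∈ JA A N k) (a b : A) :
    x * curv (gen A N) a b ∈ JA A N (k + 1) :=
  Submodule.subset_span (Or.inr ⟨x, hx, a, b, rfl⟩)

theorem JA_ind {N : ℕ} {p : ℕ → TA A N → Prop} (h0 : ∀ k, p k 0)
    (hadd : ∀ k x y, p k x → p k y → p k (x + y)) (hsmul : ∀ k (r : Base 𝒢) x, p k x → p k (r • x))
    (ht : ∀ x, p 0 x) (h1 : ∀ a b, p 1 (curv (gen A N) a b))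
    (h2 : ∀ k x a b, x ∈ JA A N k → p k x → p (k + 1) (x * curv (gen A N) a b)) (k : ℕ) (x : TA A N)
    (hx : x ∈ JA A N k) : p k x := by
  induction k generalizing x with
  | zero => exact ht x
  | succ k ih =>
    refine Submodule.span_induction (p := fun x _ => p (k + 1) x) ?_ (h0 _)
      (fun x y _ _ => hadd _ x y) (fun r x _ => hsmul _ r x) hx
    rintro z (⟨rfl, a, b, rfl⟩ | ⟨x, hx, a, b, rfl⟩)
    · exact h1 a b
    · exact h2 k x a b hx (ih x hx)

theorem mul_mem_JA {N k : ℕ} (z : TA A N) {x : TA A N} (hx : x ∈ JA A N k) : z * x ∈ JA A N k := by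
  refine JA_ind (p := fun k x => z * x ∈ JA A N k) (fun k => by simp) ?_ ?_ (fun _ => trivial) ?_ ?_ k x hx
  · intro k x y hx hy
    rw [mul_add]; exact add_mem hx hy
  · intro k r x hx
    rw [mul_smul_comm]; exact Submodule.smul_mem _ _ hx
  · intro a b
    exact mul_curv_mem_JA (k := 0) trivial a b
  · intro k x a b _ hx
    rw [← mul_assoc]; exact mul_curv_mem_JA hx a b

theorem curv_mul_gen {N : ℕ} (a b c : A) : curv (gen A N) a b * gen A N c =
    curv (gen A N) a (b * c) - curv (gen A N) (a * b) c + gen A N a * curv (gen A N) b c := by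
  rw [sub_add, curv_cocycle]; abel

theorem mul_gen_mem_JA {N k : ℕ} {x : TA A N} (hx : x ∈ JA A N k) (c : A) :
    x * gen A N c ∈ JA A N k := by
  refine JA_ind (p := fun k x => ∀ c, x * gen A N c ∈ JA A N k) (fun k => by simp) ?_ ?_
    (fun _ _ => trivial) ?_ ?_ k x hx c
  · intro k x y hx hy c
    rw [add_mul]; exact add_mem (hx c) (hy c)
  · intro k r x hx c
    rw [smul_mul_assoc]; exact Submodule.smul_mem _ _ (hx c)
  · intro a b c
    rw [curv_mul_gen]
    exact add_mem (sub_mem (curv_mem_JA _ _) (curv_mem_JA _ _)) (mul_mem_JA _ (curv_mem_JA _ _))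
  · intro k x a b hx h c
    rw [mul_assoc, curv_mul_gen, mul_add, mul_sub, ← mul_assoc]
    exact add_mem (sub_mem (mul_curv_mem_JA hx _ _) (mul_curv_mem_JA hx _ _))
      (mul_curv_mem_JA (h a) _ _)

theorem mem_JA_mul {N k : ℕ} {x : TA A N} (hx : x ∈ JA A N k) (z : TA A N) :
    x * z ∈ JA A N k := by
  induction z using TA_ind' with
  | h0 => simp
  | hsub y z hy hz => rw [mul_sub]; exact sub_mem hy hz
  | h1 a => exact mul_gen_mem_JA hx a
  | h2 z a hz => rw [← mul_assoc]; exact mul_gen_mem_JA hz a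

theorem toTot_ofTot_mem_filt {N k : ℕ} {z : Tot A} (hz : z ∈ filt A k) :
    toTot A N (ofTot A N z) ∈ filt A k := by
  classical
  have h : ∀ w : EvN A N, (∀ i : Fin (N + 1), 2 * i.1 < k → w i = 0) → evI A N w ∈ filt A k := by
    intro w hw
    rw [← DirectSum.sum_support_of w, map_sum]
    refine Submodule.sum_mem _ fun i _ => ?_
    change evI A N (DirectSum.lof (Base 𝒢) _ _ i (w i)) ∈ _
    rw [evI_lof]
    rcases Nat.lt_or_ge (2 * i.1) k with h | h
    · rw [hw i h, map_zero]; exact zero_mem _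
    · exact inn_mem_filt h _
  exact h (evP A N z) fun i hi => by rw [evP_apply]; exact hz _ hi

theorem mem_filt_of_mem_JA {N k : ℕ} {x : TA A N} (hx : x ∈ JA A N k) :
    toTot A N x ∈ filt A (2 * k) := by
  refine JA_ind (p := fun k x => toTot A N x ∈ filt A (2 * k)) (fun k => by simp) ?_ ?_
    (fun _ => fun i hi => absurd hi (by omega)) ?_ ?_ k x hx
  · intro k x y hx hy
    rw [map_add]; exact add_mem hx hy
  · intro k r x hx
    rw [map_smul]; exact Submodule.smul_mem _ _ hx
  · intro a b
    rw [← ofTot_totD_totd]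
    exact toTot_ofTot_mem_filt (totD_mem (totd_mem (n := 0) (fun i hi => absurd hi (by omega))) b)
  · intro k x a b _ hx
    rw [← ofTot_toTot x, ← ofTot_totD_totD (grad_toTot x)]
    exact toTot_ofTot_mem_filt (totD_mem (totD_mem hx a) b)

theorem JA_eq_zero {N k : ℕ} (hk : N < k) {x : TA A N} (hx : x ∈ JA A N k) : x = 0 := by
  rw [← ofTot_toTot x]
  exact ofTot_of_mem_filt (filt_mono (by omega) (mem_filt_of_mem_JA hx))

end universalProperty

end Forms

/-! ### Twisted derivations on the truncated tensor algebra -/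

namespace Forms

section cochain

/-- Two commuting actions of a ring together with a `2`-cocycle. -/
structure CocycleData (P : Type v) [NonUnitalRing P] [Module (Base 𝒢) P] (X : Type w)
    [AddCommGroup X] [Module (Base 𝒢) X] where
  lm : P →ₗ[Base 𝒢] X →ₗ[Base 𝒢] X
  rm : P →ₗ[Base 𝒢] X →ₗ[Base 𝒢] X
  dl : P →ₗ[Base 𝒢] P →ₗ[Base 𝒢] X
  lm_mul : ∀ x y m, lm (x * y) m = lm x (lm y m)
  rm_mul : ∀ x y m, rm (x * y) m = rm y (rm x m)
  lm_rm : ∀ x y m, lm x (rm y m) = rm y (lm x m)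
  cocycle : ∀ x y z, rm z (dl x y) + dl (x * y) z = lm x (dl y z) + dl x (y * z)

variable {P : Type v} [NonUnitalRing P] [Module (Base 𝒢) P] {X : Type w}
    [AddCommGroup X] [Module (Base 𝒢) X]

/-- The extension of `P` by `X` attached to a cocycle. -/
def CocycleData.Ext (_ : CocycleData (𝒢 := 𝒢) P X) : Type (max v w) := P × X

namespace CocycleData

variable (d : CocycleData (𝒢 := 𝒢) P X)

instance : AddCommGroup d.Ext := inferInstanceAs (AddCommGroup (P × X))
instance : Module (Base 𝒢) d.Ext := inferInstanceAs (Module (Base 𝒢) (P × X))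

theorem ext_iff' {s t : d.Ext} : s = t ↔ s.1 = t.1 ∧ s.2 = t.2 := Prod.ext_iff

instance : Mul d.Ext := ⟨fun s t => (s.1 * t.1, d.rm t.1 s.2 + d.lm s.1 t.2 + d.dl s.1 t.1)⟩

theorem mul_fst (s t : d.Ext) : (s * t).1 = s.1 * t.1 := rfl
theorem mul_snd (s t : d.Ext) :
    (s * t).2 = d.rm t.1 s.2 + d.lm s.1 t.2 + d.dl s.1 t.1 := rfl
theorem add_fst (s t : d.Ext) : (s + t).1 = s.1 + t.1 := rfl
theorem add_snd (s t : d.Ext) : (s + t).2 = s.2 + t.2 := rfl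
theorem sub_fst (s t : d.Ext) : (s - t).1 = s.1 - t.1 := rfl
theorem sub_snd (s t : d.Ext) : (s - t).2 = s.2 - t.2 := rfl
theorem zero_fst : (0 : d.Ext).1 = 0 := rfl
theorem zero_snd : (0 : d.Ext).2 = 0 := rfl
theorem smul_fst (r : Base 𝒢) (s : d.Ext) : (r • s).1 = r • s.1 := rfl
theorem smul_snd (r : Base 𝒢) (s : d.Ext) : (r • s).2 = r • s.2 := rfl

instance : NonUnitalRing d.Ext where
  __ := (inferInstance : AddCommGroup d.Ext)
  left_distrib a b c := by
    rw [ext_iff']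
    simp only [mul_fst, mul_snd, add_fst, add_snd, map_add, LinearMap.add_apply, mul_add]
    exact ⟨trivial, by abel⟩
  right_distrib a b c := by
    rw [ext_iff']
    simp only [mul_fst, mul_snd, add_fst, add_snd, map_add, LinearMap.add_apply, add_mul]
    exact ⟨trivial, by abel⟩
  zero_mul a := by
    rw [ext_iff']
    simp [mul_fst, mul_snd, zero_fst, zero_snd]
  mul_zero a := by
    rw [ext_iff']
    simp [mul_fst, mul_snd, zero_fst, zero_snd]
  mul_assoc a b c := by
    rw [ext_iff']
    refine ⟨mul_assoc _ _ _, ?_⟩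
    simp only [mul_fst, mul_snd, map_add, rm_mul, lm_mul, lm_rm]
    have := d.cocycle a.1 b.1 c.1
    rw [← sub_eq_zero] at this ⊢
    rw [← this]; abel

variable [IsScalarTower (Base 𝒢) P P] [SMulCommClass (Base 𝒢) P P]

instance : IsScalarTower (Base 𝒢) d.Ext d.Ext := ⟨fun r a b => by
  rw [ext_iff']
  simp [mul_fst, mul_snd, smul_fst, smul_snd, smul_add, smul_mul_assoc]⟩

instance : SMulCommClass (Base 𝒢) d.Ext d.Ext := ⟨fun r a b => by
  rw [ext_iff']
  simp [mul_fst, mul_snd, smul_fst, smul_snd, smul_add, mul_smul_comm]⟩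

end CocycleData

variable {A : GAlg.{u₁, u₂, v} 𝒢} {N : ℕ}

/-- The curvature of a letterwise prescription for a twisted derivation. -/
def cochainCurv (d : CocycleData (𝒢 := 𝒢) (TA A N) X) (g : A →ₗ[Base 𝒢] X) (a b : A) : X :=
  g (a * b) - d.rm (gen A N b) (g a) - d.lm (gen A N a) (g b) - d.dl (gen A N a) (gen A N b)

theorem exists_cochain (d : CocycleData (𝒢 := 𝒢) (TA A N) X) (g : A →ₗ[Base 𝒢] X)
    (Xf : ℕ → Submodule (Base 𝒢) X) (hg : ∀ a, g a ∈ Xf 0)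
    (h1 : ∀ a b, cochainCurv d g a b ∈ Xf 1)
    (hm : ∀ k m a b, m ∈ Xf k → d.rm (curv (gen A N) a b) m ∈ Xf (k + 1))
    (hy : ∀ k y a b, y ∈ JA A N k → d.lm y (cochainCurv d g a b) +
      d.dl y (curv (gen A N) a b) ∈ Xf (k + 1))
    (h0 : ∀ m, m ∈ Xf (N + 1) → m = 0) :
    ∃ D : TA A N →ₗ[Base 𝒢] X, (∀ a, D (gen A N a) = g a) ∧
      ∀ x y, D (x * y) = d.rm y (D x) + d.lm x (D y) + d.dl x y := by
  let ρ : A →ₗ[Base 𝒢] d.Ext := (gen A N).prod g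
  have hρ : ∀ a, ρ a = (gen A N a, g a) := fun _ => rfl
  have hc : ∀ a b, (curv ρ a b).1 = curv (gen A N) a b ∧ (curv ρ a b).2 = cochainCurv d g a b := by
    intro a b
    refine ⟨rfl, ?_⟩
    rw [curv_apply, CocycleData.sub_snd, CocycleData.mul_snd, cochainCurv]
    simp only [hρ]; abel
  let F : CurvFilt ρ N :=
    { F := fun k => (JA A N k).prod (Xf k)
      mem_zero := fun a => ⟨Submodule.mem_top, hg a⟩
      curv_mem := fun a b => ⟨curv_mem_JA a b, (hc a b).2 ▸ h1 a b⟩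
      mul_curv := fun k s hs a b => by
        refine ⟨?_, ?_⟩
        · rw [CocycleData.mul_fst, (hc a b).1]; exact mul_curv_mem_JA hs.1 a b
        · rw [CocycleData.mul_snd, (hc a b).1, (hc a b).2, add_assoc]
          exact add_mem (hm k _ a b hs.2) (hy k _ a b hs.1)
      eq_zero := fun s hs => by
        rw [CocycleData.ext_iff']
        exact ⟨JA_eq_zero (Nat.lt_succ_self N) hs.1, h0 _ hs.2⟩ }
  obtain ⟨φ, hφ, hmul⟩ := exists_ext ρ F
  have hid : ∀ x, (φ x).1 = x := by
    refine fun x => TA_ind' (p := fun x => (φ x).1 = x) ?_ ?_ ?_ ?_ x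
    · rw [map_zero]; rfl
    · intro x y hx hy
      rw [map_sub, CocycleData.sub_fst, hx, hy]
    · intro a
      rw [hφ]; rfl
    · intro x a hx
      rw [hmul, CocycleData.mul_fst, hx, hφ]; rfl
  refine ⟨(LinearMap.snd (Base 𝒢) (TA A N) X) ∘ₗ φ, fun a => ?_, fun x y => ?_⟩
  · exact congrArg Prod.snd (hφ a)
  · have := congrArg Prod.snd (hmul x y)
    refine this.trans ?_
    rw [CocycleData.mul_snd, hid, hid]; rfl

end cochain

end Forms

/-! ### Cutoff functions on proper groupoids -/

theorem exists_compactOpen_between {X : Type*} [TopologicalSpace X] [T2Space X]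
    [LocallyCompactSpace X] [TotallyDisconnectedSpace X] {K O : Set X} (hK : IsCompact K)
    (hO : IsOpen O) (h : K ⊆ O) : ∃ V : CompactOpens X, K ⊆ V ∧ (V : Set X) ⊆ O := by
  classical
  obtain ⟨t, ht⟩ := hK.elim_finite_subcover
    (fun V : {V : CompactOpens X // (V : Set X) ⊆ O} => (V.1 : Set X))
    (fun V => V.1.isOpen) (fun x hx => by
      obtain ⟨V, hV, hVO⟩ := exists_compactOpen hO (h hx)
      exact Set.mem_iUnion.mpr ⟨⟨V, hVO⟩, hV⟩)
  refine ⟨t.sup fun V => V.1, fun x hx => ?_, ?_⟩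
  · obtain ⟨V, hV, h⟩ := Set.mem_iUnion₂.mp (ht hx)
    exact (Finset.le_sup (f := fun V : {V : CompactOpens X // (V : Set X) ⊆ O} => V.1) hV) h
  · refine Finset.sup_induction (p := fun V : CompactOpens X => (V : Set X) ⊆ O)
      (Set.empty_subset _) (fun V hV W hW => ?_) (fun V _ => V.2)
    exact Set.union_subset hV hW

namespace AmpleGroupoid

theorem orbitRel_equivalence : Equivalence 𝒢.OrbitRel where
  refl x := ⟨𝒢.unit x, 𝒢.src_unit x, 𝒢.rng_unit x⟩
  symm := fun ⟨α, h, h'⟩ => ⟨𝒢.inv α, by rw [𝒢.src_inv, h'], by rw [𝒢.rng_inv, h]⟩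
  trans := fun ⟨α, h, h'⟩ ⟨β, k, k'⟩ => ⟨𝒢.mul β α,
    by rw [𝒢.src_mul _ _ (k.trans h'.symm), h], by rw [𝒢.rng_mul _ _ (k.trans h'.symm), k']⟩

/-- The projection onto the orbit space. -/
def orbit (x : 𝒢.Obj) : 𝒢.OrbitSpace := Quot.mk _ x

theorem orbit_eq_iff {x y : 𝒢.Obj} : orbit x = orbit y ↔ 𝒢.OrbitRel x y :=
  (orbitRel_equivalence.quot_mk_eq_iff x y)

theorem isOpenQuotientMap_orbit : IsOpenQuotientMap (orbit (𝒢 := 𝒢)) := by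
  refine IsOpenQuotientMap.iff_isOpenMap_isQuotientMap.mpr ⟨fun O hO => ?_, isQuotientMap_quot_mk⟩
  have hq : Topology.IsQuotientMap (orbit (𝒢 := 𝒢)) := isQuotientMap_quot_mk
  rw [← hq.isOpen_preimage]
  have : orbit ⁻¹' (orbit '' O) = 𝒢.rng '' (𝒢.src ⁻¹' O) := by
    ext x
    constructor
    · rintro ⟨y, hy, h⟩
      obtain ⟨α, h1, h2⟩ := orbit_eq_iff.mp h
      exact ⟨α, by rwa [Set.mem_preimage, h1], h2⟩
    · rintro ⟨α, hα, rfl⟩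
      exact ⟨_, hα, orbit_eq_iff.mpr ⟨α, rfl, rfl⟩⟩
  rw [this]
  exact isOpenMap_rng _ (hO.preimage 𝒢.continuous_src)

theorem t2Space_orbitSpace (hG : 𝒢.IsProper) : T2Space 𝒢.OrbitSpace := by
  rw [t2Space_iff_of_isOpenQuotientMap isOpenQuotientMap_orbit]
  convert! hG.isClosedMap.isClosed_range using 1
  ext ⟨x, y⟩
  simp only [Set.mem_ofPred_eq, orbit_eq_iff, OrbitRel, Set.mem_range, Prod.mk.injEq]

theorem exists_cutoffSet (hG : 𝒢.IsProper) (hP : ParacompactSpace 𝒢.OrbitSpace) :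
    ∃ S : Set 𝒢.Obj, IsClopen S ∧ (∀ x, ∃ α, 𝒢.rng α = x ∧ 𝒢.src α ∈ S) ∧
      ∀ K, IsCompact K → IsCompact {α | 𝒢.rng α ∈ K ∧ 𝒢.src α ∈ S} := by
  have := t2Space_orbitSpace hG
  have hq := isOpenQuotientMap_orbit (𝒢 := 𝒢)
  choose V hV _ using fun x : 𝒢.Obj => exists_compactOpen isOpen_univ (Set.mem_univ x)
  obtain ⟨v, hvo, hvu, hvf, hvs⟩ := precise_refinement (fun x => orbit (𝒢 := 𝒢) '' (V x))
    (fun x => hq.isOpenMap _ (V x).isOpen) (Set.eq_univ_of_forall fun y => by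
      obtain ⟨x, rfl⟩ := hq.surjective y
      exact Set.mem_iUnion.mpr ⟨x, x, hV x, rfl⟩)
  obtain ⟨w, hwu, hwo, hwv⟩ := exists_iUnion_eq_closure_subset hvo hvf.point_finite hvu
  choose D hD hD' using fun x : 𝒢.Obj => exists_compactOpen_between
    (((V x).isCompact.inter_right (isClosed_closure (s := w x) |>.preimage hq.continuous)))
    ((V x).isOpen.inter ((hvo x).preimage hq.continuous))
    (fun z hz => ⟨hz.1, hwv x hz.2⟩)
  have hDf : LocallyFinite fun x => (D x : Set 𝒢.Obj) :=
    (hvf.preimage_continuous hq.continuous).subset fun x z hz => (hD' x hz).2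
  refine ⟨⋃ x, D x, ⟨hDf.isClosed_iUnion fun x => (D x).isCompact.isClosed,
    isOpen_iUnion fun x => (D x).isOpen⟩, fun x => ?_, fun K hK => ?_⟩
  · have : orbit x ∈ ⋃ i, w i := by rw [hwu]; trivial
    obtain ⟨i, hi⟩ := Set.mem_iUnion.mp this
    obtain ⟨z, hz, hzx⟩ := hvs i (hwv i (subset_closure hi))
    obtain ⟨α, h1, h2⟩ := orbit_eq_iff.mp hzx
    refine ⟨α, h2, Set.mem_iUnion.mpr ⟨i, hD i ⟨h1 ▸ hz, ?_⟩⟩⟩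
    rw [Set.mem_preimage, h1, hzx]
    exact subset_closure hi
  · have hfin := hvf.finite_nonempty_inter_compact (hK.image hq.continuous)
    have hK' : IsCompact (⋃ i ∈ hfin.toFinset, (D i : Set 𝒢.Obj)) :=
      hfin.toFinset.isCompact_biUnion fun i _ => (D i).isCompact
    have := hG.isCompact_preimage (hK'.prod hK)
    convert! this using 1
    ext α
    constructor
    · rintro ⟨h1, h2⟩
      refine ⟨?_, h1⟩
      obtain ⟨i, hi⟩ := Set.mem_iUnion.mp h2
      refine Set.mem_iUnion₂.mpr ⟨i, hfin.mem_toFinset.mpr ⟨_, (hD' i hi).2, 𝒢.rng α, h1, ?_⟩, hi⟩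
      exact (orbit_eq_iff.mpr ⟨α, rfl, rfl⟩).symm
    · rintro ⟨h1, h2⟩
      obtain ⟨i, _, hi⟩ := Set.mem_iUnion₂.mp h1
      exact ⟨h2, Set.mem_iUnion.mpr ⟨i, hi⟩⟩

end AmpleGroupoid

variable (𝒢) in
/-- A pair of equivariant sections of `C_c^∞(G)` over `C_c^∞(G⁰)` in duality. -/
structure Cutoff where
  e : Cc 𝒢.Obj →ₗ[Base 𝒢] Reg 𝒢
  f : Cc 𝒢.Obj →ₗ[Base 𝒢] Reg 𝒢
  e_equivariant : IsEquivariant 𝒢 e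
  f_equivariant : IsEquivariant 𝒢 f
  pairing_f_e : ∀ h h', pairing 𝒢 (f h) (e h') = of (h * h')

section cutoff

variable {S : Set 𝒢.Obj} (hS : IsClopen S)
  (hc : ∀ K, IsCompact K → IsCompact {α | 𝒢.rng α ∈ K ∧ 𝒢.src α ∈ S})

open Classical in
/-- The function `α ↦ h(r α) 1_S(s α)`. -/
def cutFun (h : Cc 𝒢.Obj) : Cc 𝒢.Arr :=
  Cc.mk' (fun α => if 𝒢.src α ∈ S then h (𝒢.rng α) else 0)
    (by
      rw [IsLocallyConstant.iff_exists_open]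
      intro α
      have ho := (h.locConst.isOpen_fiber (h (𝒢.rng α))).preimage 𝒢.continuous_rng
      by_cases hα : 𝒢.src α ∈ S
      · refine ⟨_, (hS.isOpen.preimage 𝒢.continuous_src).inter ho, ⟨hα, rfl⟩, ?_⟩
        rintro β ⟨h1, h2⟩
        rw [if_pos hα, if_pos (show 𝒢.src β ∈ S from h1)]; exact h2
      · refine ⟨_, (hS.compl.isOpen.preimage 𝒢.continuous_src).inter ho, ⟨hα, rfl⟩, ?_⟩
        rintro β ⟨h1, h2⟩
        rw [if_neg hα, if_neg (show 𝒢.src β ∉ S from h1)])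
    _ (hc _ h.isCompact_support) (fun α hα => by
      by_cases h1 : 𝒢.src α ∈ S
      · rw [if_pos h1]
        by_contra h2
        exact hα ⟨h2, h1⟩
      · rw [if_neg h1])

open Classical in
theorem cutFun_apply (h : Cc 𝒢.Obj) (α : 𝒢.Arr) :
    cutFun hS hc h α = if 𝒢.src α ∈ S then h (𝒢.rng α) else 0 := rfl

/-- `cutFun` as a linear map. -/
def cutLin : Cc 𝒢.Obj →ₗ[Base 𝒢] Reg 𝒢 :=
  Base.linearOf (M := Cc 𝒢.Obj) (N := Reg 𝒢)
    { toFun := cutFun hS hc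
      map_add' := fun h k => Cc.ext fun α => by
        change cutFun hS hc (h + k) α = cutFun hS hc h α + cutFun hS hc k α
        rw [cutFun_apply, cutFun_apply, cutFun_apply]
        split_ifs <;> simp
      map_smul' := fun c h => Cc.ext fun α => by
        change cutFun hS hc (c • h) α = c * cutFun hS hc h α
        rw [cutFun_apply, cutFun_apply]
        split_ifs <;> simp }
    (fun k h => Cc.ext fun α => by
      change cutFun hS hc (of k • h) α = (of k • cutFun hS hc h) α
      rw [Cc.of_smul_apply, cutFun_apply, cutFun_apply]
      split_ifs
      · exact Cc.of_smul_apply k h (𝒢.rng α)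
      · simp)

theorem fn_cutLin (h : Cc 𝒢.Obj) : Reg.fn (cutLin hS hc h) = cutFun hS hc h := rfl

theorem cutLin_equivariant : IsEquivariant 𝒢 (cutLin hS hc) := by
  classical
  refine isEquivariant_of_chi ((cutLin hS hc).restrictScalars ℂ) fun U hU h => ?_
  change cutFun hS hc (conv 𝒢 𝒢.Obj (Cc.chi U) h) = conv 𝒢 𝒢.Arr (Cc.chi U) (cutFun hS hc h)
  ext α
  by_cases hx : ∃ β ∈ U, 𝒢.rng β = 𝒢.rng α
  · obtain ⟨β, hβ, hr⟩ := hx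
    rw [conv_chi_of_mem (X := 𝒢.Arr) hU _ hβ hr, cutFun_apply, cutFun_apply,
      conv_chi_of_mem (X := 𝒢.Obj) hU _ hβ hr]
    change _ = if 𝒢.src (𝒢.mul (𝒢.inv β) α) ∈ S then h (𝒢.rng (𝒢.mul (𝒢.inv β) α)) else 0
    rw [𝒢.src_mul _ _ (by rw [𝒢.src_inv, hr]), 𝒢.rng_mul _ _ (by rw [𝒢.src_inv, hr])]
    rfl
  · have hx' : ∀ β ∈ U, 𝒢.rng β ≠ 𝒢.rng α := fun β hβ h' => hx ⟨β, hβ, h'⟩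
    rw [conv_chi_of_notMem (X := 𝒢.Arr) _ hx', cutFun_apply, conv_chi_of_notMem (X := 𝒢.Obj) _ hx',
      ite_self]

open Classical in
/-- The number of arrows with given range and source in `S`. -/
def cutCard (S : Set 𝒢.Obj) (x : 𝒢.Obj) : ℂ :=
  ∑ᶠ α : {α : 𝒢.Arr // 𝒢.rng α = x}, if 𝒢.src α.1 ∈ S then 1 else 0

theorem push_cutFun (h : Cc 𝒢.Obj) (x : 𝒢.Obj) :
    push 𝒢 (cutFun hS hc h) x = h x * cutCard S x := by
  classical
  rw [push_apply]
  by_cases hx : h x = 0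
  · rw [hx, zero_mul]
    refine finsum_eq_zero_of_forall_eq_zero fun α => ?_
    rw [cutFun_apply, α.2, hx, ite_self]
  · have hf : (Function.support fun α : {α : 𝒢.Arr // 𝒢.rng α = x} =>
        if 𝒢.src α.1 ∈ S then (1 : ℂ) else 0).Finite := by
      refine ((cutFun hS hc h).finite_fiber x).subset fun α hα => ?_
      rw [Function.mem_support] at hα ⊢
      rw [cutFun_apply, α.2]
      split_ifs at hα ⊢ <;> simp_all
    rw [cutCard, ← smul_eq_mul, smul_finsum' _ hf]
    refine finsum_congr fun α => ?_
    rw [cutFun_apply, α.2]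
    split_ifs <;> simp

theorem cutCard_mul (hS : IsClopen S)
    (hc : ∀ K, IsCompact K → IsCompact {α | 𝒢.rng α ∈ K ∧ 𝒢.src α ∈ S}) (h : Cc 𝒢.Obj) :
    ∃ k : Cc 𝒢.Obj, ∀ x, k x = h x * cutCard S x :=
  ⟨push 𝒢 (cutFun hS hc h), push_cutFun hS hc h⟩

theorem cutCard_isLocallyConstant (hS : IsClopen S)
    (hc : ∀ K, IsCompact K → IsCompact {α | 𝒢.rng α ∈ K ∧ 𝒢.src α ∈ S}) :
    IsLocallyConstant (cutCard (𝒢 := 𝒢) S) := by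
  rw [IsLocallyConstant.iff_exists_open]
  intro x
  obtain ⟨V, hxV, -⟩ := exists_compactOpen isOpen_univ (Set.mem_univ x)
  obtain ⟨k, hk⟩ := cutCard_mul hS hc (Cc.chi V)
  have hk' : ∀ y ∈ V, cutCard S y = k y := fun y hy => by
    rw [hk, Cc.chi_of_mem hy, one_mul]
  refine ⟨V ∩ k ⁻¹' {k x}, V.isOpen.inter (k.locConst.isOpen_fiber _), ⟨hxV, rfl⟩, ?_⟩
  rintro y ⟨hy, hy'⟩
  rw [hk' y hy, hk' x hxV]; exact hy'

theorem cutCard_rng (β : 𝒢.Arr) : cutCard S (𝒢.rng β) = cutCard S (𝒢.src β) := by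
  classical
  let e : {γ : 𝒢.Arr // 𝒢.rng γ = 𝒢.src β} ≃ {γ : 𝒢.Arr // 𝒢.rng γ = 𝒢.rng β} :=
    { toFun := fun γ => ⟨𝒢.mul β γ, 𝒢.rng_mul _ _ γ.2.symm⟩
      invFun := fun γ => ⟨𝒢.mul (𝒢.inv β) γ, by
        rw [𝒢.rng_mul _ _ (by rw [𝒢.src_inv, γ.2]), 𝒢.rng_inv]⟩
      left_inv := fun γ => Subtype.ext (AmpleGroupoid.inv_mul_cancel_left γ.2.symm)
      right_inv := fun γ => Subtype.ext (AmpleGroupoid.mul_inv_cancel_left γ.2.symm) }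
  rw [cutCard, ← finsum_comp_equiv e]
  refine finsum_congr fun γ => ?_
  change (if 𝒢.src (𝒢.mul β γ) ∈ S then (1 : ℂ) else 0) = _
  rw [𝒢.src_mul _ _ γ.2.symm]

theorem cutCard_ne_zero (hS : IsClopen S)
    (hc : ∀ K, IsCompact K → IsCompact {α | 𝒢.rng α ∈ K ∧ 𝒢.src α ∈ S})
    (hs : ∀ x, ∃ α, 𝒢.rng α = x ∧ 𝒢.src α ∈ S) (x : 𝒢.Obj) :
    cutCard S x ≠ 0 := by
  classical
  obtain ⟨V, hxV, -⟩ := exists_compactOpen isOpen_univ (Set.mem_univ x)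
  have hf : (Function.support fun α : {α : 𝒢.Arr // 𝒢.rng α = x} =>
        if 𝒢.src α.1 ∈ S then (1 : ℂ) else 0).Finite := by
    refine ((cutFun hS hc (Cc.chi V)).finite_fiber x).subset fun α hα => ?_
    rw [Function.mem_support] at hα ⊢
    rwa [cutFun_apply, α.2, Cc.chi_of_mem hxV]
  rw [cutCard, finsum_eq_sum _ hf, Finset.sum_boole, Nat.cast_ne_zero, Finset.card_ne_zero]
  obtain ⟨α, hα, hα'⟩ := hs x
  refine ⟨⟨α, hα⟩, Finset.mem_filter.mpr ⟨hf.mem_toFinset.mpr ?_, hα'⟩⟩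
  rw [Function.mem_support, if_pos hα']
  exact one_ne_zero

/-- Division by the number of arrows with given range and source in `S`. -/
def cutDiv : Cc 𝒢.Obj →ₗ[Base 𝒢] Cc 𝒢.Obj :=
  Base.linearOf
    { toFun := fun h => Cc.mk' (fun x => h x * (cutCard S x)⁻¹)
        (h.locConst.mul ((cutCard_isLocallyConstant hS hc).comp fun z => z⁻¹)) _
        h.isCompact_support (fun x hx => by rw [Function.notMem_support.mp hx, zero_mul])
      map_add' := fun h k => by ext x; simp [add_mul]
      map_smul' := fun c h => by ext x; simp [mul_assoc] }
    (fun k h => by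
      ext x
      simp [mul_assoc])

theorem cutDiv_apply (h : Cc 𝒢.Obj) (x : 𝒢.Obj) :
    cutDiv hS hc h x = h x * (cutCard S x)⁻¹ := rfl

theorem cutDiv_equivariant : IsEquivariant 𝒢 (cutDiv hS hc) := by
  refine isEquivariant_of_chi ((cutDiv hS hc).restrictScalars ℂ) fun U hU h => ?_
  change cutDiv hS hc (conv 𝒢 𝒢.Obj (Cc.chi U) h) = conv 𝒢 𝒢.Obj (Cc.chi U) (cutDiv hS hc h)
  ext x
  rw [cutDiv_apply]
  by_cases hx : ∃ β ∈ U, 𝒢.rng β = x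
  · obtain ⟨β, hβ, rfl⟩ := hx
    rw [conv_chi_of_mem (X := 𝒢.Obj) (x := 𝒢.rng β) hU _ hβ rfl,
      conv_chi_of_mem (X := 𝒢.Obj) (x := 𝒢.rng β) hU _ hβ rfl, cutDiv_apply]
    change _ = _ * (cutCard S (𝒢.rng (𝒢.inv β)))⁻¹
    rw [cutCard_rng, 𝒢.rng_inv]
  · have hx' : ∀ β ∈ U, 𝒢.rng β ≠ x := fun β hβ h' => hx ⟨β, hβ, h'⟩
    rw [conv_chi_of_notMem (X := 𝒢.Obj) _ hx', conv_chi_of_notMem (X := 𝒢.Obj) _ hx', zero_mul]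

end cutoff

theorem nonempty_cutoff (hG : 𝒢.IsProper) (hP : ParacompactSpace 𝒢.OrbitSpace) :
    Nonempty (Cutoff 𝒢) := by
  obtain ⟨S, hS, hs, hc⟩ := AmpleGroupoid.exists_cutoffSet hG hP
  refine ⟨⟨cutLin hS hc, cutLin hS hc ∘ₗ cutDiv hS hc, cutLin_equivariant hS hc, fun a m => ?_,
    fun h h' => ?_⟩⟩
  · rw [LinearMap.comp_apply, cutDiv_equivariant, cutLin_equivariant]; rfl
  · have e : Reg.fn (cutLin hS hc (cutDiv hS hc h)) * Reg.fn (cutLin hS hc h') =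
        cutFun hS hc (cutDiv hS hc h * h') := by
      ext α
      rw [Cc.mul_apply, fn_cutLin, fn_cutLin, cutFun_apply, cutFun_apply, cutFun_apply]
      split_ifs <;> simp
    rw [pairing_apply, LinearMap.comp_apply, e]
    congr 1
    ext x
    rw [push_cutFun, Cc.mul_apply, cutDiv_apply, Cc.mul_apply]
    have := cutCard_ne_zero hS hc hs x
    field_simp

/-! ### Inserting sections -/

namespace Cutoff

section ins

variable {M : Type v} [AddCommGroup M] [Module ℂ M] [Module (Base 𝒢) M]
  [IsScalarTower ℂ (Base 𝒢) M] [GModule 𝒢 M] (g : Cc 𝒢.Obj →ₗ[Base 𝒢] Reg 𝒢)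

theorem of_smul_Cc (h k : Cc 𝒢.Obj) : of h • k = h * k := by
  ext x
  rw [Cc.of_smul_apply]; rfl

theorem tmul_section_eq {h k : Cc 𝒢.Obj} {m : M} (hm : of h • m = m) (km : of k • m = m) :
    m ⊗ₜ[Base 𝒢] g h = m ⊗ₜ g k := by
  conv_lhs => rw [← km]
  conv_rhs => rw [← hm]
  rw [TensorProduct.smul_tmul, TensorProduct.smul_tmul, ← map_smul, ← map_smul, of_smul_Cc,
    of_smul_Cc, mul_comm]

theorem exists_common (𝒢 : AmpleGroupoid.{u₁, u₂}) {M : Type*} [AddCommGroup M] [Module ℂ M]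
    [Module (Base 𝒢) M]
    [IsScalarTower ℂ (Base 𝒢) M] [GModule 𝒢 M] {N : Type*} [AddCommGroup N] [Module ℂ N]
    [Module (Base 𝒢) N] [IsScalarTower ℂ (Base 𝒢) N] [GModule 𝒢 N] (m : M) (n : N) :
    ∃ h : Cc 𝒢.Obj, of h • m = m ∧ of h • n = n := by
  obtain ⟨V, hV⟩ := exists_chi_smul 𝒢 m
  obtain ⟨W, hW⟩ := exists_chi_smul 𝒢 n
  exact ⟨Cc.chi (V ⊔ W), chi_smul_of_le le_sup_left hV, chi_smul_of_le le_sup_right hW⟩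

theorem exists_unit (𝒢 : AmpleGroupoid.{u₁, u₂}) {M : Type*} [AddCommGroup M] [Module ℂ M]
    [Module (Base 𝒢) M]
    [IsScalarTower ℂ (Base 𝒢) M] [GModule 𝒢 M] (m : M) : ∃ h : Cc 𝒢.Obj, of h • m = m :=
  (exists_common 𝒢 m m).imp fun _ h => h.1

/-- `m ↦ m ⊗ g(χ_V)` for any `V` with `χ_V m = m`. -/
def ins : M →ₗ[Base 𝒢] M ⊗[Base 𝒢] Reg 𝒢 where
  toFun m := m ⊗ₜ g (exists_unit 𝒢 m).choose
  map_add' m n := by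
    obtain ⟨h, h1, h2⟩ := exists_common 𝒢 m n
    have h3 : of h • (m + n) = m + n := by rw [smul_add, h1, h2]
    rw [tmul_section_eq g (exists_unit 𝒢 m).choose_spec h1,
      tmul_section_eq g (exists_unit 𝒢 n).choose_spec h2,
      tmul_section_eq g (exists_unit 𝒢 (m + n)).choose_spec h3, TensorProduct.add_tmul]
  map_smul' k m := by
    have h := (exists_unit 𝒢 m).choose_spec
    rw [tmul_section_eq g (exists_unit 𝒢 (k • m)).choose_spec
      (show of (exists_unit 𝒢 m).choose • k • m = k • m by rw [smul_comm, h])]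
    rfl

theorem ins_eq {h : Cc 𝒢.Obj} {m : M} (hm : of h • m = m) : ins g m = m ⊗ₜ[Base 𝒢] g h :=
  tmul_section_eq g (exists_unit 𝒢 m).choose_spec hm

theorem act_ins (hg : IsEquivariant 𝒢 g) {U : CompactOpens 𝒢.Arr} (hU : IsBis 𝒢 U) (m : M) :
    ins g (act (𝒢 := 𝒢) (Cc.chi U) m) = act (𝒢 := 𝒢) (Cc.chi U) (ins g m) := by
  obtain ⟨h, hm⟩ := exists_unit 𝒢 m
  rw [ins_eq g hm, act_tmul hU, ← hg, ins_eq g (h := act (𝒢 := 𝒢) (Cc.chi U) h)]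
  exact (act_chi_smul hU h m).symm.trans (by rw [hm])

theorem map_ins {N : Type w} [AddCommGroup N] [Module ℂ N] [Module (Base 𝒢) N]
    [IsScalarTower ℂ (Base 𝒢) N] [GModule 𝒢 N] (φ : M →ₗ[Base 𝒢] N) (m : M) :
    ins g (φ m) = φ.rTensor (Reg 𝒢) (ins g m) := by
  obtain ⟨h, hm⟩ := exists_unit 𝒢 m
  rw [ins_eq g hm, LinearMap.rTensor_tmul, ins_eq g]
  rw [← map_smul, hm]

end ins

end Cutoff

open Cutoff

/-! ### Cut structures -/

section cut

variable (χ : Cutoff 𝒢) (E : Type v) [AddCommGroup E] [Module ℂ E] [Module (Base 𝒢) E]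
  [IsScalarTower ℂ (Base 𝒢) E] [GModule 𝒢 E]

/-- Operators which replace the left end `x ⊗ ⋯` of an element by `λ(η, x) e ⊗ ⋯`. -/
structure LeftCut where
  l : Reg 𝒢 →ₗ[Base 𝒢] E →ₗ[Base 𝒢] E
  act_l : ∀ U, IsBis 𝒢 U → ∀ η x,
    l (act (Cc.chi U) η) (act (Cc.chi U) x) = act (𝒢 := 𝒢) (Cc.chi U) (l η x)
  l_l : ∀ h η x, l (χ.f h) (l η x) = of h • l η x

/-- The operator which replaces the right end `⋯ ⊗ y` of an element by `⋯ ⊗ f` and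
returns `y`. -/
structure RightCut where
  r : E →ₗ[Base 𝒢] E ⊗[Base 𝒢] Reg 𝒢
  act_r : ∀ U, IsBis 𝒢 U → ∀ x, r (act (Cc.chi U) x) = act (𝒢 := 𝒢) (Cc.chi U) (r x)
  r_r : ∀ x, r.rTensor (Reg 𝒢) (r x) = (ins χ.f).rTensor (Reg 𝒢) (r x)

variable {χ} {E} {E' : Type w} [AddCommGroup E'] [Module ℂ E'] [Module (Base 𝒢) E']
  [IsScalarTower ℂ (Base 𝒢) E'] [GModule 𝒢 E']

/-- The operation `x ⊗ y ↦ x' ⊗ l_{x''} y`, where `r x = x' ⊗ x''`. -/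
def cut (R : RightCut χ E) (L : LeftCut χ E') : E ⊗[Base 𝒢] E' →ₗ[Base 𝒢] E ⊗[Base 𝒢] E' :=
  (TensorProduct.lift L.l).lTensor E ∘ₗ (TensorProduct.assoc (Base 𝒢) E (Reg 𝒢) E').toLinearMap ∘ₗ
    R.r.rTensor E'

/-- `q ⊗ η ↦ q ⊗ l_η y`. -/
def cutWith (L : LeftCut χ E') (y : E') : E ⊗[Base 𝒢] Reg 𝒢 →ₗ[Base 𝒢] E ⊗[Base 𝒢] E' :=
  (L.l.flip y).lTensor E

theorem cutWith_tmul (L : LeftCut χ E') (y : E') (q : E) (η : Reg 𝒢) :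
    cutWith L y (q ⊗ₜ η) = q ⊗ₜ L.l η y := rfl

theorem cut_tmul (R : RightCut χ E) (L : LeftCut χ E') (x : E) (y : E') :
    cut R L (x ⊗ₜ y) = cutWith L y (R.r x) := by
  rw [cut, LinearMap.comp_apply, LinearMap.comp_apply, LinearMap.rTensor_tmul]
  induction R.r x using TensorProduct.induction_on with
  | zero => simp
  | add a b ha hb => simp only [TensorProduct.add_tmul, map_add, ha, hb]
  | tmul q η => rfl

theorem cut_cut (R : RightCut χ E) (L : LeftCut χ E') (z : E ⊗[Base 𝒢] E') :
    cut R L (cut R L z) = cut R L z := by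
  induction z using TensorProduct.induction_on with
  | zero => simp
  | add a b ha hb => simp only [map_add, ha, hb]
  | tmul x y =>
    rw [cut_tmul]
    let Θ : (E ⊗[Base 𝒢] Reg 𝒢) ⊗[Base 𝒢] Reg 𝒢 →ₗ[Base 𝒢] E ⊗[Base 𝒢] E' :=
      TensorProduct.lift (LinearMap.flip
        ((LinearMap.lTensorHom E).comp (L.l.flip.comp (L.l.flip y))))
    have hΘ : ∀ t η, Θ (t ⊗ₜ η) = cutWith L (L.l η y) t := fun _ _ => rfl
    have h1 : ∀ t, cut R L (cutWith L y t) = Θ (R.r.rTensor (Reg 𝒢) t) := by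
      intro t
      induction t using TensorProduct.induction_on with
      | zero => simp
      | add a b ha hb => simp only [map_add, ha, hb]
      | tmul q η => rw [cutWith_tmul, cut_tmul, LinearMap.rTensor_tmul, hΘ]
    have h2 : ∀ t, Θ ((ins χ.f).rTensor (Reg 𝒢) t) = cutWith L y t := by
      intro t
      induction t using TensorProduct.induction_on with
      | zero => simp
      | add a b ha hb => simp only [map_add, ha, hb]
      | tmul q η =>
        obtain ⟨h, hq⟩ := exists_unit 𝒢 q
        rw [LinearMap.rTensor_tmul, hΘ, ins_eq _ hq, cutWith_tmul, cutWith_tmul, L.l_l,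
          ← TensorProduct.smul_tmul, hq]
    rw [h1, R.r_r, h2]

theorem act_cut (R : RightCut χ E) (L : LeftCut χ E') {U : CompactOpens 𝒢.Arr} (hU : IsBis 𝒢 U)
    (z : E ⊗[Base 𝒢] E') : cut R L (act (𝒢 := 𝒢) (Cc.chi U) z) =
      act (𝒢 := 𝒢) (Cc.chi U) (cut R L z) := by
  induction z using TensorProduct.induction_on with
  | zero => simp
  | add a b ha hb => simp only [map_add, ha, hb]
  | tmul x y =>
    rw [act_tmul hU, cut_tmul, cut_tmul, R.act_r U hU]
    induction R.r x using TensorProduct.induction_on with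
    | zero => simp
    | add a b ha hb => simp only [map_add, ha, hb]
    | tmul q η => rw [act_tmul hU, cutWith_tmul, cutWith_tmul, L.act_l U hU, act_tmul hU]

end cut

/-- `q ⊗ η ↦ q l_η(y)`. -/
def mulCon {Q : Type v} [NonUnitalRing Q] [Module (Base 𝒢) Q] [IsScalarTower (Base 𝒢) Q Q]
    [SMulCommClass (Base 𝒢) Q Q] (l : Reg 𝒢 →ₗ[Base 𝒢] Q →ₗ[Base 𝒢] Q) :
    Q →ₗ[Base 𝒢] (Q ⊗[Base 𝒢] Reg 𝒢) →ₗ[Base 𝒢] Q where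
  toFun y := LinearMap.mul' (Base 𝒢) Q ∘ₗ (l.flip y).lTensor Q
  map_add' x y := by
    refine TensorProduct.ext' fun q η => ?_
    simp
  map_smul' k y := by
    refine TensorProduct.ext' fun q η => ?_
    simp

theorem mulCon_tmul {Q : Type v} [NonUnitalRing Q] [Module (Base 𝒢) Q]
    [IsScalarTower (Base 𝒢) Q Q] [SMulCommClass (Base 𝒢) Q Q]
    (l : Reg 𝒢 →ₗ[Base 𝒢] Q →ₗ[Base 𝒢] Q) (y q : Q) (η : Reg 𝒢) :
    mulCon l y (q ⊗ₜ η) = q * l η y := rfl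

/-- Cut operators on an algebra, compatible with its multiplication. -/
structure CutAlg (χ : Cutoff 𝒢) (Q : GAlg.{u₁, u₂, v} 𝒢) extends LeftCut χ Q, RightCut χ Q where
  l_mul : ∀ η x y, l η (x * y) = l η x * y
  r_mul : ∀ x y, r (x * y) = (LinearMap.mul (Base 𝒢) Q x).rTensor (Reg 𝒢) (r y)
  r_l : ∀ η x, r (l η x) = (l η).rTensor (Reg 𝒢) (r x)

namespace CutAlg

variable {χ : Cutoff 𝒢} {Q : GAlg.{u₁, u₂, v} 𝒢} (C : CutAlg χ Q)

/-- `q ⊗ η ↦ q l_η(y)`. -/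
def con : Q →ₗ[Base 𝒢] (Q ⊗[Base 𝒢] Reg 𝒢) →ₗ[Base 𝒢] Q := mulCon C.l

theorem con_tmul (y q : Q) (η : Reg 𝒢) : C.con y (q ⊗ₜ η) = q * C.l η y := rfl

/-- The product `x' l_{x''}(y)`, where `r x = x' ⊗ x''`. -/
def cmul : Q →ₗ[Base 𝒢] Q →ₗ[Base 𝒢] Q := (C.con.flip ∘ₗ C.r)

theorem cmul_apply (x y : Q) : C.cmul x y = C.con y (C.r x) := rfl

theorem mul'_cut (x y : Q) :
    LinearMap.mul' (Base 𝒢) Q (cut C.toRightCut C.toLeftCut (x ⊗ₜ y)) = C.cmul x y := by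
  rw [cut_tmul]; rfl

theorem con_mul (y z : Q) (t) : C.con (y * z) t = C.con y t * z := by
  induction t using TensorProduct.induction_on with
  | zero => simp
  | add a b ha hb => simp only [map_add, ha, hb, add_mul]
  | tmul q η => rw [con_tmul, con_tmul, C.l_mul, mul_assoc]

theorem con_rTensor_mul (x y : Q) (t) :
    C.con y ((LinearMap.mul (Base 𝒢) Q x).rTensor (Reg 𝒢) t) = x * C.con y t := by
  induction t using TensorProduct.induction_on with
  | zero => simp
  | add a b ha hb => simp only [map_add, ha, hb, mul_add]
  | tmul q η => rw [LinearMap.rTensor_tmul, con_tmul, con_tmul, LinearMap.mul_apply', mul_assoc]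

theorem con_rTensor_l (ξ : Reg 𝒢) (y : Q) (t) :
    C.con y ((C.l ξ).rTensor (Reg 𝒢) t) = C.l ξ (C.con y t) := by
  induction t using TensorProduct.induction_on with
  | zero => simp
  | add a b ha hb => simp only [map_add, ha, hb]
  | tmul q η => rw [LinearMap.rTensor_tmul, con_tmul, con_tmul, C.l_mul]

theorem cmul_mul (x y z : Q) : C.cmul x (y * z) = C.cmul x y * z := C.con_mul y z _

theorem mul_cmul (x y z : Q) : C.cmul (x * y) z = x * C.cmul y z := by
  rw [cmul_apply, C.r_mul, con_rTensor_mul]; rfl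

theorem l_cmul (η : Reg 𝒢) (x y : Q) : C.cmul (C.l η x) y = C.l η (C.cmul x y) := by
  rw [cmul_apply, C.r_l, con_rTensor_l]; rfl

theorem act_con {U : CompactOpens 𝒢.Arr} (hU : IsBis 𝒢 U) (y : Q) (t) :
    C.con (act (Cc.chi U) y) (act (𝒢 := 𝒢) (Cc.chi U) t) = act (𝒢 := 𝒢) (Cc.chi U) (C.con y t) := by
  induction t using TensorProduct.induction_on with
  | zero => simp
  | add a b ha hb => simp only [map_add, ha, hb]
  | tmul q η => rw [act_tmul hU, con_tmul, con_tmul, C.act_l U hU, GAlgebra.act_mul hU]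

theorem act_cmul {U : CompactOpens 𝒢.Arr} (hU : IsBis 𝒢 U) (x y : Q) :
    C.cmul (act (Cc.chi U) x) (act (Cc.chi U) y) = act (𝒢 := 𝒢) (Cc.chi U) (C.cmul x y) := by
  rw [cmul_apply, C.act_r U hU, C.act_con hU]; rfl

end CutAlg

/-! ### The stabilisation -/

namespace KG

variable (χ : Cutoff 𝒢)

/-- `x ⊗ y ↦ λ(η, x) e ⊗ y`. -/
def left : Reg 𝒢 →ₗ[Base 𝒢] KG 𝒢 →ₗ[Base 𝒢] KG 𝒢 :=
  (LinearMap.llcomp (Base 𝒢) (KG 𝒢) (Reg 𝒢) (KG 𝒢)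
    ((TensorProduct.comm (Base 𝒢) (Reg 𝒢) (Reg 𝒢)).toLinearMap ∘ₗ ins χ.e)) ∘ₗ contract 𝒢

/-- `x ⊗ y ↦ (x ⊗ f) ⊗ y`. -/
def right : KG 𝒢 →ₗ[Base 𝒢] KG 𝒢 ⊗[Base 𝒢] Reg 𝒢 := (ins χ.f).rTensor (Reg 𝒢)

variable {χ}

theorem left_apply (η : Reg 𝒢) (z : KG 𝒢) :
    left χ η z = TensorProduct.comm (Base 𝒢) (Reg 𝒢) (Reg 𝒢) (ins χ.e (contract 𝒢 η z)) := rfl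

theorem left_tmul {h : Cc 𝒢.Obj} (η x : Reg 𝒢) {y : Reg 𝒢} (hy : of h • y = y) :
    left χ η (x ⊗ₜ y) = χ.e h ⊗ₜ (pairing 𝒢 η x • y) := by
  rw [left_apply, contract_tmul, map_smul, ins_eq _ hy, map_smul, TensorProduct.comm_tmul,
    TensorProduct.tmul_smul]

theorem right_tmul {h : Cc 𝒢.Obj} {x : Reg 𝒢} (hx : of h • x = x) (y : Reg 𝒢) :
    right χ (x ⊗ₜ y) = (x ⊗ₜ χ.f h) ⊗ₜ y := by
  rw [right, LinearMap.rTensor_tmul, ins_eq _ hx]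

theorem act_pairing {U : CompactOpens 𝒢.Arr} (hU : IsBis 𝒢 U) (x y z : Reg 𝒢) :
    pairing 𝒢 (act (Cc.chi U) x) (act (Cc.chi U) y) • act (𝒢 := 𝒢) (Cc.chi U) z =
      act (𝒢 := 𝒢) (Cc.chi U) (pairing 𝒢 x y • z) := by
  rw [pairing_apply, pairing_apply, act_chi_smul hU, Reg.fn_act, Reg.fn_act, ← conv_chi_mul hU,
    push_conv hU]

theorem act_contract {U : CompactOpens 𝒢.Arr} (hU : IsBis 𝒢 U) (η : Reg 𝒢) (z : KG 𝒢) :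
    contract 𝒢 (act (Cc.chi U) η) (act (𝒢 := 𝒢) (Cc.chi U) z) =
      act (𝒢 := 𝒢) (Cc.chi U) (contract 𝒢 η z) := by
  induction z using TensorProduct.induction_on with
  | zero => simp
  | add a b ha hb => simp only [map_add, ha, hb]
  | tmul x y => rw [act_tmul hU, contract_tmul, contract_tmul, act_pairing hU]

theorem act_comm {E E' : Type*} [AddCommGroup E] [Module ℂ E] [Module (Base 𝒢) E]
    [IsScalarTower ℂ (Base 𝒢) E] [GModule 𝒢 E] [AddCommGroup E'] [Module ℂ E'] [Module (Base 𝒢) E']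
    [IsScalarTower ℂ (Base 𝒢) E'] [GModule 𝒢 E'] {U : CompactOpens 𝒢.Arr} (hU : IsBis 𝒢 U)
    (z : E ⊗[Base 𝒢] E') : TensorProduct.comm (Base 𝒢) E E' (act (𝒢 := 𝒢) (Cc.chi U) z) =
      act (𝒢 := 𝒢) (Cc.chi U) (TensorProduct.comm (Base 𝒢) E E' z) := by
  induction z using TensorProduct.induction_on with
  | zero => simp
  | add a b ha hb => simp only [map_add, ha, hb]
  | tmul x y => rw [act_tmul hU, TensorProduct.comm_tmul, TensorProduct.comm_tmul, act_tmul hU]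

theorem act_left {U : CompactOpens 𝒢.Arr} (hU : IsBis 𝒢 U) (η : Reg 𝒢) (z : KG 𝒢) :
    left χ (act (Cc.chi U) η) (act (𝒢 := 𝒢) (Cc.chi U) z) =
      act (𝒢 := 𝒢) (Cc.chi U) (left χ η z) := by
  rw [left_apply, left_apply, act_contract hU, act_ins _ χ.e_equivariant hU, act_comm hU]

theorem act_rTensor {E E' E'' : Type*} [AddCommGroup E] [Module ℂ E] [Module (Base 𝒢) E]
    [IsScalarTower ℂ (Base 𝒢) E] [GModule 𝒢 E] [AddCommGroup E'] [Module ℂ E'] [Module (Base 𝒢) E']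
    [IsScalarTower ℂ (Base 𝒢) E'] [GModule 𝒢 E'] [AddCommGroup E''] [Module ℂ E'']
    [Module (Base 𝒢) E''] [IsScalarTower ℂ (Base 𝒢) E''] [GModule 𝒢 E''] {φ : E →ₗ[Base 𝒢] E'}
    {U : CompactOpens 𝒢.Arr} (hU : IsBis 𝒢 U)
    (hφ : ∀ x, φ (act (𝒢 := 𝒢) (Cc.chi U) x) = act (𝒢 := 𝒢) (Cc.chi U) (φ x)) (z : E ⊗[Base 𝒢] E'') :
    φ.rTensor E'' (act (𝒢 := 𝒢) (Cc.chi U) z) = act (𝒢 := 𝒢) (Cc.chi U) (φ.rTensor E'' z) := by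
  induction z using TensorProduct.induction_on with
  | zero => simp
  | add a b ha hb => simp only [map_add, ha, hb]
  | tmul x y => rw [act_tmul hU, LinearMap.rTensor_tmul, LinearMap.rTensor_tmul, act_tmul hU, hφ]

theorem act_right {U : CompactOpens 𝒢.Arr} (hU : IsBis 𝒢 U) (z : KG 𝒢) :
    right χ (act (𝒢 := 𝒢) (Cc.chi U) z) = act (𝒢 := 𝒢) (Cc.chi U) (right χ z) :=
  act_rTensor hU (act_ins _ χ.f_equivariant hU) z

theorem contract_left (h : Cc 𝒢.Obj) (η : Reg 𝒢) (z : KG 𝒢) :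
    contract 𝒢 (χ.f h) (left χ η z) = of h • contract 𝒢 η z := by
  induction z using TensorProduct.induction_on with
  | zero => simp
  | add a b ha hb => simp only [map_add, ha, hb, smul_add]
  | tmul x y =>
    obtain ⟨k, hy⟩ := exists_unit 𝒢 y
    rw [left_tmul η x hy, contract_tmul, contract_tmul, χ.pairing_f_e, map_mul, mul_smul,
      smul_comm (of k), hy]

theorem left_left (h : Cc 𝒢.Obj) (η : Reg 𝒢) (z : KG 𝒢) :
    left χ (χ.f h) (left χ η z) = of h • left χ η z := by
  rw [left_apply, contract_left, map_smul, map_smul]; rfl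

theorem left_mul (η : Reg 𝒢) (z z' : KG 𝒢) : left χ η (z * z') = left χ η z * z' := by
  induction z using TensorProduct.induction_on with
  | zero => simp
  | add a b ha hb => simp only [map_add, add_mul, ha, hb]
  | tmul x y =>
    induction z' using TensorProduct.induction_on with
    | zero => simp
    | add a b ha hb => simp only [map_add, mul_add, ha, hb]
    | tmul x' y' =>
      obtain ⟨k, hy, hy'⟩ := exists_common 𝒢 y y'
      rw [tmul_mul_tmul, left_tmul η x hy, tmul_mul_tmul, TensorProduct.tmul_smul, map_smul,
        left_tmul η x hy', map_smul, LinearMap.smul_apply, smul_eq_mul, mul_comm, mul_smul,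
        TensorProduct.tmul_smul, TensorProduct.tmul_smul, TensorProduct.tmul_smul]

theorem right_mul (z z' : KG 𝒢) :
    right χ (z * z') = (LinearMap.mul (Base 𝒢) (KG 𝒢) z).rTensor (Reg 𝒢) (right χ z') := by
  induction z using TensorProduct.induction_on with
  | zero => simp
  | add a b ha hb => simp only [map_add, add_mul, ha, hb, LinearMap.rTensor_add, LinearMap.add_apply]
  | tmul x y =>
    induction z' using TensorProduct.induction_on with
    | zero => simp
    | add a b ha hb => simp only [map_add, mul_add, ha, hb]
    | tmul x' y' =>
      obtain ⟨k, hx, hx'⟩ := exists_common 𝒢 x x'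
      rw [tmul_mul_tmul, right_tmul hx', LinearMap.rTensor_tmul, LinearMap.mul_apply',
        tmul_mul_tmul, right_tmul hx, TensorProduct.tmul_smul, TensorProduct.tmul_smul,
        TensorProduct.smul_tmul']

theorem right_left (η : Reg 𝒢) (z : KG 𝒢) :
    right χ (left χ η z) = (left χ η).rTensor (Reg 𝒢) (right χ z) := by
  induction z using TensorProduct.induction_on with
  | zero => simp
  | add a b ha hb => simp only [map_add, ha, hb]
  | tmul x y =>
    obtain ⟨k, hx, hy⟩ := exists_common 𝒢 x y
    obtain ⟨m, hm1, hm2⟩ := exists_common 𝒢 (χ.e k) (χ.f k)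
    have h : χ.e k ⊗ₜ[Base 𝒢] χ.f m = χ.e m ⊗ₜ χ.f k := by
      have h1 : of k • χ.e m = χ.e k := by
        rw [← hm1, ← map_smul, ← map_smul, of_smul_Cc, of_smul_Cc, mul_comm]
      have h2 : of k • χ.f m = χ.f k := by
        rw [← hm2, ← map_smul, ← map_smul, of_smul_Cc, of_smul_Cc, mul_comm]
      rw [← h1, TensorProduct.smul_tmul, h2]
    rw [left_tmul η x hy, right_tmul hm1, right_tmul hx, LinearMap.rTensor_tmul,
      left_tmul η x hm2, h, TensorProduct.tmul_smul, TensorProduct.tmul_smul,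
      TensorProduct.smul_tmul']

theorem right_right (z : KG 𝒢) :
    (right χ).rTensor (Reg 𝒢) (right χ z) = (ins χ.f).rTensor (Reg 𝒢) (right χ z) := by
  induction z using TensorProduct.induction_on with
  | zero => simp
  | add a b ha hb => simp only [map_add, ha, hb]
  | tmul x y =>
    obtain ⟨k, hx⟩ := exists_unit 𝒢 x
    have h : of k • (x ⊗ₜ[Base 𝒢] χ.f k) = x ⊗ₜ χ.f k := by
      rw [TensorProduct.smul_tmul', hx]
    rw [right_tmul hx, LinearMap.rTensor_tmul, LinearMap.rTensor_tmul, right_tmul hx, ins_eq _ h]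

/-- Cutting does not change products. -/
theorem mulCon_right (z y : KG 𝒢) : mulCon (left χ) y (right χ z) = z * y := by
  induction z using TensorProduct.induction_on with
  | zero => simp
  | add a b ha hb => simp only [map_add, add_mul, ha, hb]
  | tmul x x' =>
    induction y using TensorProduct.induction_on with
    | zero => simp
    | add a b ha hb => simp only [map_add, mul_add, ha, hb, LinearMap.add_apply]
    | tmul y y' =>
      obtain ⟨k, hx, hy⟩ := exists_common 𝒢 x y'
      rw [right_tmul hx, mulCon_tmul, left_tmul _ _ hy, tmul_mul_tmul, tmul_mul_tmul,
        χ.pairing_f_e, map_mul, mul_smul, smul_comm _ (pairing 𝒢 x' y),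
        smul_comm _ (pairing 𝒢 x' y), hy, hy]

end KG

section stab

variable (χ : Cutoff 𝒢) (A : GAlg.{u₁, u₂, v} 𝒢)

/-- `a ⊗ z ↦ a ⊗ l_η(z)`. -/
def stabLeft : Reg 𝒢 →ₗ[Base 𝒢] stab A →ₗ[Base 𝒢] stab A :=
  LinearMap.lTensorHom A ∘ₗ KG.left χ

/-- `a ⊗ z ↦ (a ⊗ z') ⊗ z''`. -/
def stabRight : stab A →ₗ[Base 𝒢] stab A ⊗[Base 𝒢] Reg 𝒢 :=
  (TensorProduct.assoc (Base 𝒢) A (KG 𝒢) (Reg 𝒢)).symm.toLinearMap ∘ₗ (KG.right χ).lTensor A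

variable {χ A}

/-- `z ⊗ y ↦ (a ⊗ z) ⊗ y`. -/
def stabCons (a : A) : KG 𝒢 →ₗ[Base 𝒢] stab A := TensorProduct.mk (Base 𝒢) A (KG 𝒢) a

theorem stab_ind {p : stab A → Prop} (h0 : p 0) (hadd : ∀ x y, p x → p y → p (x + y))
    (h : ∀ a z, p (stabCons a z)) (x : stab A) : p x :=
  TensorProduct.induction_on (motive := p) x h0 h hadd

theorem stabLeft_cons (η : Reg 𝒢) (a : A) (z : KG 𝒢) :
    stabLeft χ A η (stabCons a z) = stabCons a (KG.left χ η z) := rfl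

theorem stabRight_cons (a : A) (z : KG 𝒢) :
    stabRight χ A (stabCons a z) = (stabCons a).rTensor (Reg 𝒢) (KG.right χ z) := by
  change (TensorProduct.assoc (Base 𝒢) A (KG 𝒢) (Reg 𝒢)).symm (a ⊗ₜ KG.right χ z) = _
  induction KG.right χ z using TensorProduct.induction_on with
  | zero => rw [TensorProduct.tmul_zero, map_zero, map_zero]; rfl
  | add x y hx hy => rw [TensorProduct.tmul_add, map_add, map_add, hx, hy]; rfl
  | tmul x y => rfl

theorem stabCons_mul (a b : A) (z w : KG 𝒢) :
    stabCons a z * stabCons b w = stabCons (a * b) (z * w) :=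
  Algebra.TensorProduct.tmul_mul_tmul a b z w

theorem act_stabCons {U : CompactOpens 𝒢.Arr} (hU : IsBis 𝒢 U) (a : A) (z : KG 𝒢) :
    act (𝒢 := 𝒢) (Cc.chi U) (stabCons a z) =
      stabCons (act (𝒢 := 𝒢) (Cc.chi U) a) (act (𝒢 := 𝒢) (Cc.chi U) z) := act_tmul hU a z

theorem act_rTensor_stabCons {U : CompactOpens 𝒢.Arr} (hU : IsBis 𝒢 U) (a : A)
    (t : KG 𝒢 ⊗[Base 𝒢] Reg 𝒢) :
    act (𝒢 := 𝒢) (Cc.chi U) ((stabCons a).rTensor (Reg 𝒢) t) =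
      (stabCons (act (𝒢 := 𝒢) (Cc.chi U) a)).rTensor (Reg 𝒢) (act (𝒢 := 𝒢) (Cc.chi U) t) := by
  induction t using TensorProduct.induction_on with
  | zero => simp
  | add x y hx hy => simp only [map_add, hx, hy]
  | tmul x y =>
    rw [act_tmul hU, LinearMap.rTensor_tmul, LinearMap.rTensor_tmul, act_tmul hU, act_stabCons hU]

variable (χ A) in
/-- The cut operators on `A ⊗ K_G`. -/
def stabCut : CutAlg χ (stab A) where
  l := stabLeft χ A
  r := stabRight χ A
  act_l U hU η := stab_ind (by simp) (fun x y hx hy => by simp only [map_add, hx, hy])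
    fun a z => by
      rw [act_stabCons hU, stabLeft_cons, stabLeft_cons, act_stabCons hU, KG.act_left hU]
  l_l h η := stab_ind (by simp) (fun x y hx hy => by simp only [map_add, smul_add, hx, hy])
    fun a z => by
      rw [stabLeft_cons, stabLeft_cons, KG.left_left, map_smul]
  act_r U hU := stab_ind (by simp) (fun x y hx hy => by simp only [map_add, hx, hy])
    fun a z => by
      rw [act_stabCons hU, stabRight_cons, stabRight_cons, KG.act_right hU,
        act_rTensor_stabCons hU]
  r_r := stab_ind (by simp) (fun x y hx hy => by simp only [map_add, hx, hy])
    fun a z => by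
      have h1 : ∀ t, (stabRight χ A).rTensor (Reg 𝒢) ((stabCons a).rTensor (Reg 𝒢) t) =
          ((stabCons a).rTensor (Reg 𝒢)).rTensor (Reg 𝒢) ((KG.right χ).rTensor (Reg 𝒢) t) := by
        intro t
        induction t using TensorProduct.induction_on with
        | zero => simp
        | add x y hx hy => simp only [map_add, hx, hy]
        | tmul x y => simp only [LinearMap.rTensor_tmul, stabRight_cons]
      have h2 : ∀ t, (ins χ.f).rTensor (Reg 𝒢) ((stabCons a).rTensor (Reg 𝒢) t) =
          ((stabCons a).rTensor (Reg 𝒢)).rTensor (Reg 𝒢) ((ins χ.f).rTensor (Reg 𝒢) t) := by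
        intro t
        induction t using TensorProduct.induction_on with
        | zero => simp
        | add x y hx hy => simp only [map_add, hx, hy]
        | tmul x y => simp only [LinearMap.rTensor_tmul, map_ins]
      rw [stabRight_cons, h1, h2, KG.right_right]
  l_mul η x y := by
    refine stab_ind (p := fun x => stabLeft χ A η (x * y) = stabLeft χ A η x * y) (by simp)
      (fun x y hx hy => by simp only [map_add, add_mul, hx, hy]) (fun a z => ?_) x
    refine stab_ind (p := fun y => stabLeft χ A η (stabCons a z * y) =
      stabLeft χ A η (stabCons a z) * y) (by simp)
      (fun x y hx hy => by simp only [map_add, mul_add, hx, hy]) (fun b w => ?_) y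
    rw [stabCons_mul, stabLeft_cons, stabLeft_cons, stabCons_mul, KG.left_mul]
  r_mul x y := by
    refine stab_ind (p := fun x => stabRight χ A (x * y) =
      (LinearMap.mul (Base 𝒢) (stab A) x).rTensor (Reg 𝒢) (stabRight χ A y)) (by simp)
      (fun x y hx hy => by
        simp only [map_add, add_mul, hx, hy, LinearMap.rTensor_add, LinearMap.add_apply])
      (fun a z => ?_) x
    refine stab_ind (p := fun y => stabRight χ A (stabCons a z * y) =
      (LinearMap.mul (Base 𝒢) (stab A) (stabCons a z)).rTensor (Reg 𝒢) (stabRight χ A y)) (by simp)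
      (fun x y hx hy => by simp only [map_add, mul_add, hx, hy]) (fun b w => ?_) y
    rw [stabCons_mul, stabRight_cons, stabRight_cons, KG.right_mul]
    induction KG.right χ w using TensorProduct.induction_on with
    | zero => simp
    | add x y hx hy => simp only [map_add, hx, hy]
    | tmul x y =>
      simp only [LinearMap.rTensor_tmul, LinearMap.mul_apply', stabCons_mul]
  r_l η := stab_ind (by simp) (fun x y hx hy => by simp only [map_add, hx, hy])
    fun a z => by
      rw [stabLeft_cons, stabRight_cons, stabRight_cons, KG.right_left]
      induction KG.right χ z using TensorProduct.induction_on with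
      | zero => simp
      | add x y hx hy => simp only [map_add, hx, hy]
      | tmul x y => simp only [LinearMap.rTensor_tmul, stabLeft_cons]

theorem stabCut_cmul (x y : stab A) : (stabCut χ A).cmul x y = x * y := by
  refine stab_ind (p := fun x => (stabCut χ A).cmul x y = x * y) (by simp)
      (fun x y hx hy => by simp only [map_add, add_mul, hx, hy, LinearMap.add_apply])
      (fun a z => ?_) x
  refine stab_ind (p := fun y => (stabCut χ A).cmul (stabCons a z) y = stabCons a z * y) (by simp)
      (fun x y hx hy => by simp only [map_add, mul_add, hx, hy]) (fun b w => ?_) y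
  rw [stabCons_mul, ← KG.mulCon_right (χ := χ), CutAlg.cmul_apply]
  change mulCon (stabLeft χ A) (stabCons b w) (stabRight χ A (stabCons a z)) = _
  rw [stabRight_cons]
  induction KG.right χ z using TensorProduct.induction_on with
  | zero => simp
  | add x y hx hy => simp only [map_add, hx, hy]
  | tmul x y => rw [LinearMap.rTensor_tmul, mulCon_tmul, mulCon_tmul, stabLeft_cons, stabCons_mul]

variable (χ A) in
/-- The inclusion `a ↦ a ⊗ (e ⊗ f)` as a linear map. -/
def stabInclLin : A →ₗ[Base 𝒢] stab A :=
  (TensorProduct.assoc (Base 𝒢) A (Reg 𝒢) (Reg 𝒢)).toLinearMap ∘ₗ ins χ.f ∘ₗ ins χ.e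

theorem stabInclLin_eq {h : Cc 𝒢.Obj} {a : A} (ha : of h • a = a) :
    stabInclLin χ A a = stabCons a (χ.e h ⊗ₜ χ.f h) := by
  have h' : of h • (a ⊗ₜ[Base 𝒢] χ.e h) = a ⊗ₜ χ.e h := by rw [TensorProduct.smul_tmul', ha]
  change TensorProduct.assoc (Base 𝒢) A (Reg 𝒢) (Reg 𝒢) (ins χ.f (ins χ.e a)) = _
  rw [ins_eq _ ha, ins_eq _ h']
  rfl

variable (χ A) in
/-- The inclusion `a ↦ a ⊗ (e ⊗ f)`. -/
def stabIncl : GAlgHom A (stab A) where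
  toLin := stabInclLin χ A
  map_mul a b := by
    obtain ⟨h, ha, hb⟩ := exists_common 𝒢 a b
    have hab : of h • (a * b) = a * b := by rw [← smul_mul_assoc, ha]
    rw [stabInclLin_eq ha, stabInclLin_eq hb, stabInclLin_eq hab, stabCons_mul, KG.tmul_mul_tmul,
      χ.pairing_f_e, map_mul, mul_smul, TensorProduct.tmul_smul, TensorProduct.tmul_smul,
      map_smul, map_smul]
    change _ = of h • of h • ((a * b) ⊗ₜ[Base 𝒢] _)
    rw [TensorProduct.smul_tmul', TensorProduct.smul_tmul', hab, hab]
    rfl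
  equivariant := by
    refine isEquivariant_of_chi' _ fun U hU a => ?_
    obtain ⟨h, ha⟩ := exists_unit 𝒢 a
    have h' : of (act (𝒢 := 𝒢) (Cc.chi U) h) • act (𝒢 := 𝒢) (Cc.chi U) a = act (Cc.chi U) a :=
      (act_chi_smul hU h a).symm.trans (by rw [ha])
    rw [stabInclLin_eq ha, stabInclLin_eq h', act_stabCons hU, act_tmul hU, χ.e_equivariant,
      χ.f_equivariant]

theorem stabMap_stabIncl {A' : GAlg.{u₁, u₂, w} 𝒢} (φ : GAlgHom A A') (a : A) :
    (stabMap φ).toLin ((stabIncl χ A).toLin a) = (stabIncl χ A').toLin (φ.toLin a) := by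
  obtain ⟨h, ha⟩ := exists_unit 𝒢 a
  have h' : of h • φ.toLin a = φ.toLin a := by rw [← map_smul, ha]
  change (stabMap φ).toLin (stabInclLin χ A a) = stabInclLin χ A' (φ.toLin a)
  rw [stabInclLin_eq ha, stabInclLin_eq h']; rfl

end stab

/-! ### Cut operators on the truncated tensor algebra -/

namespace Forms

section basic

variable {A : GAlg.{u₁, u₂, v} 𝒢}

theorem act_gen {N : ℕ} (f : Cc 𝒢.Arr) (a : A) :
    act (𝒢 := 𝒢) f (gen A N a) = gen A N (act f a) := by
  refine (act_evP f (iA A a)).trans (congrArg (evP A N) ?_)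
  exact (act_inn f 0 (io A a)).trans (congrArg (inn A 0) (act_io f a))

theorem TAproj_gen {N M : ℕ} (h : N ≤ M) (a : A) :
    (TAproj A h).toLin (gen A M a) = gen A N a := evP_evI_evP h (iA A a)

theorem TAmap_gen {B : GAlg.{u₁, u₂, w} 𝒢} (φ : GAlgHom A B) {N : ℕ} (a : A) :
    (TAmap φ N).toLin (gen A N a) = gen B N (φ.toLin a) := by
  refine (evP_totMap_evP φ le_rfl (iA A a)).trans (congrArg (evP B N) ?_)
  exact totMap_iA φ a

theorem mul_mem_JA_add {N k l : ℕ} {x y : TA A N} (hx : x ∈ JA A N k) (hy : y ∈ JA A N l) :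
    x * y ∈ JA A N (k + l) := by
  refine JA_ind (p := fun l y => x * y ∈ JA A N (k + l)) (fun l => by simp) ?_ ?_
    (fun y => mem_JA_mul hx y) (fun a b => mul_curv_mem_JA hx a b) ?_ l y hy
  · intro l y z hy hz
    rw [mul_add]; exact add_mem hy hz
  · intro l r y hy
    rw [mul_smul_comm]; exact Submodule.smul_mem _ _ hy
  · intro l y a b _ hy
    rw [← mul_assoc]; exact mul_curv_mem_JA hy a b

theorem map_curv {N : ℕ} {B : GAlg.{u₁, u₂, w} 𝒢} {M : ℕ} (φ : GAlgHom (TA A N) (TA B M))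
    {ψ : A →ₗ[Base 𝒢] B} (hψ : ∀ a b, ψ (a * b) = ψ a * ψ b)
    (h : ∀ a, φ.toLin (gen A N a) = gen B M (ψ a)) (a b : A) :
    φ.toLin (curv (gen A N) a b) = curv (gen B M) (ψ a) (ψ b) := by
  rw [curv_apply, curv_apply, map_sub, φ.map_mul, h, h, h, hψ]

theorem TAproj_mem_JA {N M : ℕ} (h : N ≤ M) {k : ℕ} {x : TA A M} (hx : x ∈ JA A M k) :
    (TAproj A h).toLin x ∈ JA A N k := by
  have hc : ∀ a b, (TAproj A h).toLin (curv (gen A M) a b) = curv (gen A N) a b :=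
    map_curv (TAproj A h) (ψ := LinearMap.id) (fun _ _ => rfl) (TAproj_gen h)
  refine JA_ind (p := fun k x => (TAproj A h).toLin x ∈ JA A N k) (fun k => by simp) ?_ ?_
    (fun _ => trivial) (fun a b => ?_) (fun k x a b _ hx => ?_) k x hx
  · intro k x y hx hy
    rw [map_add]; exact add_mem hx hy
  · intro k r x hx
    rw [map_smul]; exact Submodule.smul_mem _ _ hx
  · rw [hc]; exact curv_mem_JA a b
  · rw [(TAproj A h).map_mul, hc]; exact mul_curv_mem_JA hx a b

end basic

section cuts

variable {χ : Cutoff 𝒢} {B : GAlg.{u₁, u₂, v} 𝒢} (C : CutAlg χ B) (N : ℕ)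

theorem exists_tl : ∃ D : TA B N →ₗ[Base 𝒢] Reg 𝒢 →ₗ[Base 𝒢] TA B N,
    (∀ a η, D (gen B N a) η = gen B N (C.l η a)) ∧ ∀ x y η, D (x * y) η = D x η * y := by
  let d : CocycleData (𝒢 := 𝒢) (TA B N) (Reg 𝒢 →ₗ[Base 𝒢] TA B N) :=
    { lm := 0
      rm := LinearMap.llcomp (Base 𝒢) (Reg 𝒢) (TA B N) (TA B N) ∘ₗ (LinearMap.mul (Base 𝒢) (TA B N)).flip
      dl := 0
      lm_mul := fun x y m => by simp
      rm_mul := fun x y m => by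
        ext η; exact (mul_assoc (m η) x y).symm
      lm_rm := fun x y m => by simp
      cocycle := fun x y z => by simp }
  have hrm : ∀ y m η, d.rm y m η = m η * y := fun _ _ _ => rfl
  have hω : ∀ a b η, cochainCurv d ((LinearMap.llcomp (Base 𝒢) (Reg 𝒢) B (TA B N) (gen B N)) ∘ₗ
      C.l.flip) a b η = curv (gen B N) (C.l η a) b := by
    intro a b η
    rw [cochainCurv, LinearMap.sub_apply, LinearMap.sub_apply, LinearMap.sub_apply, hrm]
    change gen B N (C.l η (a * b)) - gen B N (C.l η a) * gen B N b - 0 - 0 = _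
    rw [sub_zero, sub_zero, C.l_mul, curv_apply]
  obtain ⟨D, h1, h2⟩ := exists_cochain d ((LinearMap.llcomp (Base 𝒢) (Reg 𝒢) B (TA B N)
      (gen B N)) ∘ₗ C.l.flip)
    (fun k => ⨅ η, (JA B N k).comap (LinearMap.applyₗ η))
    (fun a => Submodule.mem_iInf _ |>.mpr fun η => trivial)
    (fun a b => Submodule.mem_iInf _ |>.mpr fun η => by
      change cochainCurv d _ a b η ∈ JA B N 1
      rw [hω]; exact curv_mem_JA _ _)
    (fun k m a b hm => Submodule.mem_iInf _ |>.mpr fun η =>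
      mul_curv_mem_JA (Submodule.mem_iInf _ |>.mp hm η) a b)
    (fun k y a b _ => (add_zero (0 : Reg 𝒢 →ₗ[Base 𝒢] TA B N)).symm ▸ zero_mem _)
    (fun m hm => by
      ext η
      exact JA_eq_zero (Nat.lt_succ_self N) (Submodule.mem_iInf _ |>.mp hm η))
  refine ⟨D, fun a η => ?_, fun x y η => ?_⟩
  · rw [h1]; rfl
  · rw [h2, LinearMap.add_apply, LinearMap.add_apply]
    exact (add_zero _).trans (add_zero _)

/-- Elements of `S ⊗ M` in `Q ⊗ M`. -/
def tensorSub {Q : Type v} [AddCommGroup Q] [Module (Base 𝒢) Q] (S : Submodule (Base 𝒢) Q)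
    (M : Type w) [AddCommGroup M] [Module (Base 𝒢) M] : Submodule (Base 𝒢) (Q ⊗[Base 𝒢] M) :=
  LinearMap.range (S.subtype.rTensor M)

theorem tmul_mem_tensorSub {Q : Type v} [AddCommGroup Q] [Module (Base 𝒢) Q]
    {S : Submodule (Base 𝒢) Q} {M : Type w} [AddCommGroup M] [Module (Base 𝒢) M] {q : Q} (hq : q ∈ S)
    (m : M) : q ⊗ₜ m ∈ tensorSub S M := ⟨(⟨q, hq⟩ : S) ⊗ₜ m, rfl⟩

theorem tensorSub_ind {Q : Type v} [AddCommGroup Q] [Module (Base 𝒢) Q]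
    {S : Submodule (Base 𝒢) Q} {M : Type w} [AddCommGroup M] [Module (Base 𝒢) M]
    {p : Q ⊗[Base 𝒢] M → Prop} (h0 : p 0) (hadd : ∀ x y, p x → p y → p (x + y))
    (h : ∀ q ∈ S, ∀ m, p (q ⊗ₜ m)) {t} (ht : t ∈ tensorSub S M) : p t := by
  obtain ⟨s, rfl⟩ := ht
  induction s using TensorProduct.induction_on with
  | zero => rw [map_zero]; exact h0
  | add x y hx hy => rw [map_add]; exact hadd _ _ hx hy
  | tmul q m => exact h _ q.2 m

theorem rTensor_mem_tensorSub {Q : Type v} [AddCommGroup Q] [Module (Base 𝒢) Q] {P : Type x}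
    [AddCommGroup P] [Module (Base 𝒢) P]
    {S : Submodule (Base 𝒢) Q} {M : Type w} [AddCommGroup M] [Module (Base 𝒢) M]
    {φ : P →ₗ[Base 𝒢] Q} (hφ : ∀ p, φ p ∈ S) (t : P ⊗[Base 𝒢] M) :
    φ.rTensor M t ∈ tensorSub S M := by
  induction t using TensorProduct.induction_on with
  | zero => rw [map_zero]; exact zero_mem _
  | add x y hx hy => rw [map_add]; exact add_mem hx hy
  | tmul q m => exact tmul_mem_tensorSub (hφ q) m

theorem exists_tr : ∃ D : TA B N →ₗ[Base 𝒢] TA B N ⊗[Base 𝒢] Reg 𝒢,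
    (∀ a, D (gen B N a) = (gen B N).rTensor (Reg 𝒢) (C.r a)) ∧
      ∀ x y, D (x * y) = (LinearMap.mul (Base 𝒢) (TA B N) x).rTensor (Reg 𝒢) (D y) := by
  let d : CocycleData (𝒢 := 𝒢) (TA B N) (TA B N ⊗[Base 𝒢] Reg 𝒢) :=
    { lm := LinearMap.rTensorHom (Reg 𝒢) ∘ₗ LinearMap.mul (Base 𝒢) (TA B N)
      rm := 0
      dl := 0
      lm_mul := fun x y m => by
        induction m using TensorProduct.induction_on with
        | zero => simp
        | add a b ha hb => simp only [map_add, ha, hb]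
        | tmul q η => simp [mul_assoc]
      rm_mul := fun x y m => by simp
      lm_rm := fun x y m => by simp
      cocycle := fun x y z => by simp }
  have hω : ∀ a b, cochainCurv d ((gen B N).rTensor (Reg 𝒢) ∘ₗ C.r) a b =
      (curv (gen B N) a).rTensor (Reg 𝒢) (C.r b) := by
    intro a b
    change (gen B N).rTensor (Reg 𝒢) (C.r (a * b)) - 0 -
      (LinearMap.mul (Base 𝒢) (TA B N) (gen B N a)).rTensor (Reg 𝒢)
        ((gen B N).rTensor (Reg 𝒢) (C.r b)) - 0 = _
    rw [C.r_mul, sub_zero, sub_zero]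
    induction C.r b using TensorProduct.induction_on with
    | zero => simp
    | add a b ha hb => simp only [map_add, ← ha, ← hb]; abel
    | tmul q η =>
      simp only [LinearMap.rTensor_tmul, LinearMap.mul_apply', curv_apply, TensorProduct.sub_tmul]
  obtain ⟨D, h1, h2⟩ := exists_cochain d ((gen B N).rTensor (Reg 𝒢) ∘ₗ C.r)
    (fun k => tensorSub (JA B N k) (Reg 𝒢))
    (fun a => rTensor_mem_tensorSub (S := JA B N 0) (fun p => Submodule.mem_top) _)
    (fun a b => by
      rw [hω]; exact rTensor_mem_tensorSub (fun p => curv_mem_JA a p) _)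
    (fun k m a b hm => zero_mem _)
    (fun k y a b hy => by
      rw [hω]
      change (LinearMap.mul (Base 𝒢) (TA B N) y).rTensor (Reg 𝒢) _ + 0 ∈ _
      rw [add_zero, ← LinearMap.comp_apply, ← LinearMap.rTensor_comp]
      exact rTensor_mem_tensorSub (fun p => mul_curv_mem_JA hy a p) _)
    (fun m hm => tensorSub_ind (p := fun m => m = 0) rfl
      (fun x y hx hy => by rw [hx, hy, add_zero])
      (fun q hq m => by rw [JA_eq_zero (Nat.lt_succ_self N) hq, TensorProduct.zero_tmul]) hm)
  refine ⟨D, fun a => ?_, fun x y => ?_⟩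
  · rw [h1]; rfl
  · rw [h2]
    exact (add_zero _).trans (zero_add _)

/-- The left cut operators on the truncated tensor algebra. -/
def tl : Reg 𝒢 →ₗ[Base 𝒢] TA B N →ₗ[Base 𝒢] TA B N := (exists_tl C N).choose.flip

/-- The right cut operator on the truncated tensor algebra. -/
def tr : TA B N →ₗ[Base 𝒢] TA B N ⊗[Base 𝒢] Reg 𝒢 := (exists_tr C N).choose

variable {N}

theorem tl_gen (η : Reg 𝒢) (a : B) : tl C N η (gen B N a) = gen B N (C.l η a) :=
  (exists_tl C N).choose_spec.1 a η

theorem tl_mul (η : Reg 𝒢) (x y : TA B N) : tl C N η (x * y) = tl C N η x * y :=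
  (exists_tl C N).choose_spec.2 x y η

theorem tr_gen (a : B) : tr C N (gen B N a) = (gen B N).rTensor (Reg 𝒢) (C.r a) :=
  (exists_tr C N).choose_spec.1 a

theorem tr_mul (x y : TA B N) :
    tr C N (x * y) = (LinearMap.mul (Base 𝒢) (TA B N) x).rTensor (Reg 𝒢) (tr C N y) :=
  (exists_tr C N).choose_spec.2 x y

theorem act_mulLeft_rTensor {Q : GAlg.{u₁, u₂, v} 𝒢} {U : CompactOpens 𝒢.Arr} (hU : IsBis 𝒢 U)
    (x : Q) (t : Q ⊗[Base 𝒢] Reg 𝒢) :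
    act (𝒢 := 𝒢) (Cc.chi U) ((LinearMap.mul (Base 𝒢) Q x).rTensor (Reg 𝒢) t) =
      (LinearMap.mul (Base 𝒢) Q (act (Cc.chi U) x)).rTensor (Reg 𝒢) (act (𝒢 := 𝒢) (Cc.chi U) t) := by
  induction t using TensorProduct.induction_on with
  | zero => simp
  | add a b ha hb => simp only [map_add, ha, hb]
  | tmul q η =>
    rw [LinearMap.rTensor_tmul, act_tmul hU, act_tmul hU, LinearMap.rTensor_tmul,
      LinearMap.mul_apply', LinearMap.mul_apply', GAlgebra.act_mul hU]

variable (N) in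
/-- The cut structure of the truncated tensor algebra. -/
def tCut : CutAlg χ (TA B N) where
  l := tl C N
  r := tr C N
  l_mul := tl_mul C
  r_mul := tr_mul C
  act_l U hU η := TA_ind' (by simp) (fun x y hx hy => by simp only [map_sub, hx, hy])
    (fun a => by rw [act_gen, tl_gen, tl_gen, act_gen, C.act_l U hU])
    (fun x a hx => by
      rw [GAlgebra.act_mul hU, tl_mul, tl_mul, hx, GAlgebra.act_mul hU])
  l_l h η := TA_ind' (by simp) (fun x y hx hy => by simp only [map_sub, smul_sub, hx, hy])
    (fun a => by rw [tl_gen, tl_gen, C.l_l, map_smul])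
    (fun x a hx => by rw [tl_mul, tl_mul, hx, smul_mul_assoc])
  act_r U hU := TA_ind' (by simp) (fun x y hx hy => by simp only [map_sub, hx, hy])
    (fun a => by
      rw [act_gen, tr_gen, tr_gen, C.act_r U hU]
      exact KG.act_rTensor hU (fun x => (act_gen _ x).symm) _)
    (fun x a hx => by
      rw [GAlgebra.act_mul hU, tr_mul, tr_mul, act_mulLeft_rTensor hU, act_gen, tr_gen, tr_gen,
        C.act_r U hU, KG.act_rTensor hU (fun x => (act_gen _ x).symm) _])
  r_r := by
    have h1 : ∀ x t, (tr C N).rTensor (Reg 𝒢)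
        ((LinearMap.mul (Base 𝒢) (TA B N) x).rTensor (Reg 𝒢) t) =
        ((LinearMap.mul (Base 𝒢) (TA B N) x).rTensor (Reg 𝒢)).rTensor (Reg 𝒢)
          ((tr C N).rTensor (Reg 𝒢) t) := by
      intro x t
      induction t using TensorProduct.induction_on with
      | zero => simp
      | add x y hx hy => simp only [map_add, hx, hy]
      | tmul x y => simp only [LinearMap.rTensor_tmul, LinearMap.mul_apply', tr_mul]
    have h2 : ∀ x t, (ins χ.f).rTensor (Reg 𝒢)
        ((LinearMap.mul (Base 𝒢) (TA B N) x).rTensor (Reg 𝒢) t) =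
        ((LinearMap.mul (Base 𝒢) (TA B N) x).rTensor (Reg 𝒢)).rTensor (Reg 𝒢)
          ((ins χ.f).rTensor (Reg 𝒢) t) := by
      intro x t
      induction t using TensorProduct.induction_on with
      | zero => simp
      | add x y hx hy => simp only [map_add, hx, hy]
      | tmul x y => simp only [LinearMap.rTensor_tmul, map_ins]
    have h3 : ∀ a, (tr C N).rTensor (Reg 𝒢) (tr C N (gen B N a)) =
        (ins χ.f).rTensor (Reg 𝒢) (tr C N (gen B N a)) := by
      intro a
      have h4 : ∀ t, (tr C N).rTensor (Reg 𝒢) ((gen B N).rTensor (Reg 𝒢) t) =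
          ((gen B N).rTensor (Reg 𝒢)).rTensor (Reg 𝒢) (C.r.rTensor (Reg 𝒢) t) := by
        intro t
        induction t using TensorProduct.induction_on with
        | zero => simp
        | add x y hx hy => simp only [map_add, hx, hy]
        | tmul x y => simp only [LinearMap.rTensor_tmul, tr_gen]
      have h5 : ∀ t, (ins χ.f).rTensor (Reg 𝒢) ((gen B N).rTensor (Reg 𝒢) t) =
          ((gen B N).rTensor (Reg 𝒢)).rTensor (Reg 𝒢) ((ins χ.f).rTensor (Reg 𝒢) t) := by
        intro t
        induction t using TensorProduct.induction_on with
        | zero => simp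
        | add x y hx hy => simp only [map_add, hx, hy]
        | tmul x y => simp only [LinearMap.rTensor_tmul, map_ins]
      rw [tr_gen, h4, h5, C.r_r]
    exact TA_ind' (by simp) (fun x y hx hy => by simp only [map_sub, hx, hy]) h3
      (fun x a hx => by rw [tr_mul, h1, h2, h3])
  r_l η := by
    refine TA_ind' (by simp) (fun x y hx hy => by simp only [map_sub, hx, hy])
      (fun a => ?_) (fun x a hx => ?_)
    · rw [tl_gen, tr_gen, tr_gen, C.r_l]
      induction C.r a using TensorProduct.induction_on with
      | zero => simp
      | add x y hx hy => simp only [map_add, hx, hy]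
      | tmul x y => simp only [LinearMap.rTensor_tmul, tl_gen]
    · rw [tl_mul, tr_mul, tr_mul]
      induction tr C N (gen B N a) using TensorProduct.induction_on with
      | zero => simp
      | add x y hx hy => simp only [map_add, hx, hy]
      | tmul x y => simp only [LinearMap.rTensor_tmul, tl_mul, LinearMap.mul_apply']

end cuts

end Forms

namespace Forms

section ops

variable {χ : Cutoff 𝒢} {B : GAlg.{u₁, u₂, v} 𝒢} (C : CutAlg χ B) {N : ℕ}

theorem tr_curv (a b : B) :
    tr C N (curv (gen B N) a b) = (curv (gen B N) a).rTensor (Reg 𝒢) (C.r b) := by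
  rw [curv_apply, map_sub, tr_mul, tr_gen, tr_gen, C.r_mul]
  induction C.r b using TensorProduct.induction_on with
  | zero => simp
  | add a b ha hb => simp only [map_add, ← ha, ← hb]; abel
  | tmul q η =>
    simp only [LinearMap.rTensor_tmul, LinearMap.mul_apply', curv_apply, TensorProduct.sub_tmul]

theorem mem_tensorSub_top {Q : Type v} [AddCommGroup Q] [Module (Base 𝒢) Q] {M : Type w}
    [AddCommGroup M] [Module (Base 𝒢) M] (t : Q ⊗[Base 𝒢] M) : t ∈ tensorSub ⊤ M := by
  have := rTensor_mem_tensorSub (S := (⊤ : Submodule (Base 𝒢) Q)) (φ := LinearMap.id)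
    (fun p => Submodule.mem_top) t
  rwa [LinearMap.rTensor_id] at this

theorem tr_mem {k : ℕ} {x : TA B N} (hx : x ∈ JA B N k) :
    tr C N x ∈ tensorSub (JA B N k) (Reg 𝒢) := by
  refine JA_ind (p := fun k x => tr C N x ∈ tensorSub (JA B N k) (Reg 𝒢)) (fun k => by simp) ?_ ?_
    (fun x => mem_tensorSub_top _) (fun a b => ?_) (fun k x a b hx _ => ?_) k x hx
  · intro k x y hx hy
    rw [map_add]; exact add_mem hx hy
  · intro k r x hx
    rw [map_smul]; exact Submodule.smul_mem _ _ hx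
  · rw [tr_curv]; exact rTensor_mem_tensorSub (fun p => curv_mem_JA a p) _
  · rw [tr_mul, tr_curv, ← LinearMap.comp_apply, ← LinearMap.rTensor_comp]
    exact rTensor_mem_tensorSub (fun p => mul_curv_mem_JA hx a p) _

theorem tCut_l (η : Reg 𝒢) (x : TA B N) : (tCut C N).l η x = tl C N η x := rfl

theorem tCut_r (x : TA B N) : (tCut C N).r x = tr C N x := rfl

theorem tl_curv (η : Reg 𝒢) (a b : B) :
    tl C N η (curv (gen B N) a b) = curv (gen B N) (C.l η a) b := by
  rw [curv_apply, curv_apply, map_sub, tl_mul, tl_gen, tl_gen, C.l_mul]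

/-- The defect of the multiplicativity of cutting. -/
def cutDefect (N : ℕ) : TA B N →ₗ[Base 𝒢] TA B N →ₗ[Base 𝒢] TA B N :=
  (tCut C N).cmul - LinearMap.mul (Base 𝒢) (TA B N)

theorem cutDefect_apply (x y : TA B N) : cutDefect C N x y = (tCut C N).cmul x y - x * y := rfl

variable {C} in
theorem cutDefect_gen (hC : ∀ x y, C.cmul x y = x * y) (a b : B) :
    cutDefect C N (gen B N a) (gen B N b) ∈ JA B N 1 := by
  have h : ∀ t, gen B N (C.con b t) -
      (tCut C N).con (gen B N b) ((gen B N).rTensor (Reg 𝒢) t) ∈ JA B N 1 := by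
    intro t
    induction t using TensorProduct.induction_on with
    | zero => simp
    | add s t hs ht =>
      simp only [map_add]
      rw [add_sub_add_comm]
      exact add_mem hs ht
    | tmul q η =>
      rw [LinearMap.rTensor_tmul, CutAlg.con_tmul, CutAlg.con_tmul, tCut_l, tl_gen]
      exact curv_mem_JA q _
  have h1 := h (C.r a)
  rw [← CutAlg.cmul_apply, hC, ← tr_gen, ← tCut_r, ← CutAlg.cmul_apply] at h1
  have h2 := sub_mem (curv_mem_JA (N := N) a b) h1
  rw [cutDefect_apply]
  convert h2 using 1
  rw [curv_apply]; abel

theorem cutDefect_curv {k : ℕ} {y : TA B N} (hy : y ∈ JA B N k) (a b : B) :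
    cutDefect C N y (curv (gen B N) a b) ∈ JA B N (k + 1) := by
  refine sub_mem ?_ (mul_curv_mem_JA hy a b)
  rw [CutAlg.cmul_apply]
  refine tensorSub_ind (p := fun t => (tCut C N).con (curv (gen B N) a b) t ∈ JA B N (k + 1))
    (by simp) (fun x y hx hy => by rw [map_add]; exact add_mem hx hy) (fun q hq η => ?_)
    (tr_mem C hy)
  rw [CutAlg.con_tmul, tCut_l, tl_curv]
  exact mul_curv_mem_JA hq _ _

variable (N) {C} in
theorem exists_tL (hC : ∀ x y, C.cmul x y = x * y) : ∃ D : TA B N →ₗ[Base 𝒢] TA B N,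
    (∀ a, D (gen B N a) = 0) ∧ ∀ x y, D (x * y) = D x * y + x * D y + cutDefect C N x y := by
  let d : CocycleData (𝒢 := 𝒢) (TA B N) (TA B N) :=
    { lm := LinearMap.mul (Base 𝒢) (TA B N)
      rm := (LinearMap.mul (Base 𝒢) (TA B N)).flip
      dl := cutDefect C N
      lm_mul := fun x y m => mul_assoc x y m
      rm_mul := fun x y m => (mul_assoc m x y).symm
      lm_rm := fun x y m => (mul_assoc x m y).symm
      cocycle := fun x y z => by
        simp only [LinearMap.flip_apply, LinearMap.mul_apply', cutDefect_apply, sub_mul, mul_sub,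
          CutAlg.cmul_mul, CutAlg.mul_cmul, mul_assoc]
        abel }
  have hω : ∀ a b, cochainCurv d 0 a b = - cutDefect C N (gen B N a) (gen B N b) := by
    intro a b
    simp only [cochainCurv, LinearMap.zero_apply, map_zero, sub_zero, zero_sub]
    rfl
  obtain ⟨D, h1, h2⟩ := exists_cochain d 0 (JA B N) (fun a => zero_mem _)
    (fun a b => by rw [hω]; exact neg_mem (cutDefect_gen hC a b))
    (fun k m a b hm => mul_curv_mem_JA hm a b)
    (fun k y a b hy => by
      rw [hω]
      refine add_mem ?_ (cutDefect_curv C hy a b)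
      exact mul_mem_JA_add hy (neg_mem (cutDefect_gen hC a b)))
    (fun m hm => JA_eq_zero (Nat.lt_succ_self N) hm)
  exact ⟨D, h1, h2⟩

/-- The span of all `x ⊗ y` with `x ∈ Jᵃ`, `y ∈ Jᵇ` and `a + b = k`. -/
def tensorJA (B : GAlg.{u₁, u₂, v} 𝒢) (N k : ℕ) : Submodule (Base 𝒢) (TA B N ⊗[Base 𝒢] TA B N) :=
  Submodule.span (Base 𝒢) {t | ∃ a b x y, a + b = k ∧ x ∈ JA B N a ∧ y ∈ JA B N b ∧ x ⊗ₜ y = t}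

theorem tmul_mem_tensorJA {a b k : ℕ} {x y : TA B N} (hk : a + b = k) (hx : x ∈ JA B N a)
    (hy : y ∈ JA B N b) : x ⊗ₜ y ∈ tensorJA B N k :=
  Submodule.subset_span ⟨a, b, x, y, hk, hx, hy, rfl⟩

theorem mem_tensorJA_zero (t : TA B N ⊗[Base 𝒢] TA B N) : t ∈ tensorJA B N 0 := by
  induction t using TensorProduct.induction_on with
  | zero => exact zero_mem _
  | add x y hx hy => exact add_mem hx hy
  | tmul x y => exact tmul_mem_tensorJA (a := 0) (b := 0) rfl trivial trivial

/-- The operation `x ⊗ y ↦ x' ⊗ l_{x''} y` on the truncated tensor algebra. -/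
def tcut (N : ℕ) : TA B N ⊗[Base 𝒢] TA B N →ₗ[Base 𝒢] TA B N ⊗[Base 𝒢] TA B N :=
  cut (tCut C N).toRightCut (tCut C N).toLeftCut

theorem tcut_tmul (x y : TA B N) : tcut C N (x ⊗ₜ y) =
    cutWith (tCut C N).toLeftCut y (tr C N x) := cut_tmul _ _ x y

theorem tcut_mem {k : ℕ} {x y : TA B N} (hx : x ∈ JA B N k) : tcut C N (x ⊗ₜ y) ∈ tensorJA B N k := by
  rw [tcut_tmul]
  refine tensorSub_ind (p := fun t => cutWith (tCut C N).toLeftCut y t ∈ tensorJA B N k)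
    (by simp) (fun x y hx hy => by rw [map_add]; exact add_mem hx hy) (fun q hq η => ?_)
    (tr_mem C hx)
  rw [cutWith_tmul]
  exact tmul_mem_tensorJA (b := 0) rfl hq trivial

theorem tcut_mul_left (x y z : TA B N) : tcut C N ((x * y) ⊗ₜ z) =
    (LinearMap.mul (Base 𝒢) (TA B N) x).rTensor (TA B N) (tcut C N (y ⊗ₜ z)) := by
  rw [tcut_tmul, tcut_tmul, tr_mul]
  induction tr C N y using TensorProduct.induction_on with
  | zero => simp
  | add s t hs ht => simp only [map_add, hs, ht]
  | tmul q η => simp only [LinearMap.rTensor_tmul, cutWith_tmul]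

theorem tcut_mul_right (x y z : TA B N) : tcut C N (x ⊗ₜ (y * z)) =
    ((LinearMap.mul (Base 𝒢) (TA B N)).flip z).lTensor (TA B N) (tcut C N (x ⊗ₜ y)) := by
  rw [tcut_tmul, tcut_tmul]
  induction tr C N x using TensorProduct.induction_on with
  | zero => simp
  | add s t hs ht => simp only [map_add, hs, ht]
  | tmul q η =>
    simp only [LinearMap.lTensor_tmul, cutWith_tmul, tCut_l, tl_mul, LinearMap.flip_apply,
      LinearMap.mul_apply']

variable (N) in
theorem exists_tK : ∃ D : TA B (2 * N + 1) →ₗ[Base 𝒢] TA B N ⊗[Base 𝒢] TA B N,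
    (∀ a, D (gen B _ a) = 0) ∧ ∀ x y, D (x * y) =
      ((LinearMap.mul (Base 𝒢) (TA B N)).flip ((TAproj B (by omega)).toLin y)).lTensor (TA B N) (D x) +
      (LinearMap.mul (Base 𝒢) (TA B N) ((TAproj B (by omega)).toLin x)).rTensor (TA B N) (D y) +
      (tcut C N ((TAproj B (by omega)).toLin x ⊗ₜ (TAproj B (by omega)).toLin y) -
        (TAproj B (by omega)).toLin x ⊗ₜ (TAproj B (by omega)).toLin y) := by
  have hNM : N ≤ 2 * N + 1 := by omega
  let π := (TAproj B hNM).toLin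
  have hπ : ∀ x y, π (x * y) = π x * π y := (TAproj B hNM).map_mul
  have hπg : ∀ a, π (gen B _ a) = gen B N a := TAproj_gen hNM
  have hπc : ∀ a b, π (curv (gen B _) a b) = curv (gen B N) a b := fun a b => by
    rw [curv_apply, curv_apply, map_sub, hπ, hπg, hπg, hπg]
  let d : CocycleData (𝒢 := 𝒢) (TA B (2 * N + 1)) (TA B N ⊗[Base 𝒢] TA B N) :=
    { lm := LinearMap.rTensorHom (TA B N) ∘ₗ LinearMap.mul (Base 𝒢) (TA B N) ∘ₗ π
      rm := LinearMap.lTensorHom (TA B N) ∘ₗ (LinearMap.mul (Base 𝒢) (TA B N)).flip ∘ₗ π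
      dl := ((TensorProduct.mk (Base 𝒢) (TA B N) (TA B N)).compl₁₂ π π).compr₂
        (tcut C N - LinearMap.id)
      lm_mul := fun x y m => by
        induction m using TensorProduct.induction_on with
        | zero => simp
        | add a b ha hb => simp only [map_add, ha, hb]
        | tmul q η => simp [mul_assoc, hπ]
      rm_mul := fun x y m => by
        induction m using TensorProduct.induction_on with
        | zero => simp
        | add a b ha hb => simp only [map_add, ha, hb]
        | tmul q η => simp [mul_assoc, hπ]
      lm_rm := fun x y m => by
        induction m using TensorProduct.induction_on with
        | zero => simp
        | add a b ha hb => simp only [map_add, ha, hb]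
        | tmul q η => simp
      cocycle := fun x y z => by
        simp only [LinearMap.comp_apply, LinearMap.compr₂_apply, LinearMap.compl₁₂_apply,
          LinearMap.coe_rTensorHom, LinearMap.coe_lTensorHom, TensorProduct.mk_apply,
          LinearMap.sub_apply, LinearMap.id_apply, map_sub, hπ, tcut_mul_left, tcut_mul_right,
          LinearMap.lTensor_tmul, LinearMap.rTensor_tmul, LinearMap.flip_apply,
          LinearMap.mul_apply']
        abel }
  have hdl : ∀ x y, d.dl x y = tcut C N (π x ⊗ₜ π y) - π x ⊗ₜ π y := fun _ _ => rfl
  have hω : ∀ a b, cochainCurv d 0 a b = - d.dl (gen B _ a) (gen B _ b) := by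
    intro a b
    simp only [cochainCurv, LinearMap.zero_apply, map_zero, sub_zero, zero_sub]
  have hlm : ∀ k y t, y ∈ JA B (2 * N + 1) k → d.lm y t ∈ tensorJA B N k := by
    intro k y t hy
    induction t using TensorProduct.induction_on with
    | zero => rw [map_zero]; exact zero_mem _
    | add a b ha hb => rw [map_add]; exact add_mem ha hb
    | tmul q r => exact tmul_mem_tensorJA (b := 0) rfl (mem_JA_mul (TAproj_mem_JA hNM hy) q) trivial
  obtain ⟨D, h1, h2⟩ := exists_cochain d 0 (fun k => if k = 0 then ⊤ else tensorJA B N (k - 1))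
    (fun a => zero_mem _)
    (fun a b => mem_tensorJA_zero _)
    (fun k m a b hm => by
      change d.rm _ m ∈ tensorJA B N k
      cases k with
      | zero => exact mem_tensorJA_zero _
      | succ k =>
        change m ∈ tensorJA B N k at hm
        refine Submodule.span_induction (p := fun m _ => d.rm _ m ∈ tensorJA B N (k + 1)) ?_
          (by simp) (fun x y _ _ hx hy => by rw [map_add]; exact add_mem hx hy)
          (fun r x _ hx => by rw [map_smul]; exact Submodule.smul_mem _ _ hx) hm
        rintro _ ⟨i, j, x, y, rfl, hx, hy, rfl⟩
        refine tmul_mem_tensorJA (a := i) (b := j + 1) rfl hx ?_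
        change y * π _ ∈ _
        rw [hπc]
        exact mul_curv_mem_JA hy a b)
    (fun k y a b hy => by
      change _ ∈ tensorJA B N k
      refine add_mem (hlm k y _ hy) ?_
      rw [hdl]
      exact sub_mem (tcut_mem C (TAproj_mem_JA hNM hy))
        (tmul_mem_tensorJA (b := 0) rfl (TAproj_mem_JA hNM hy) trivial))
    (fun m hm => by
      change m ∈ tensorJA B N (2 * N + 1) at hm
      refine Submodule.span_induction (p := fun m _ => m = 0) ?_ rfl
        (fun x y _ _ hx hy => by rw [hx, hy, add_zero])
        (fun r x _ hx => by rw [hx, smul_zero]) hm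
      rintro _ ⟨i, j, x, y, hij, hx, hy, rfl⟩
      by_cases hi : N < i
      · rw [JA_eq_zero hi hx, TensorProduct.zero_tmul]
      · rw [JA_eq_zero (by omega) hy, TensorProduct.tmul_zero])
  exact ⟨D, h1, h2⟩

end ops

end Forms

/-- Compatibility of an algebra homomorphism with cut operators. -/
structure CutAlg.Compat {χ : Cutoff 𝒢} {Q : GAlg.{u₁, u₂, v} 𝒢} {Q' : GAlg.{u₁, u₂, w} 𝒢}
    (C : CutAlg χ Q) (C' : CutAlg χ Q') (φ : GAlgHom Q Q') : Prop where
  l : ∀ η x, φ.toLin (C.l η x) = C'.l η (φ.toLin x)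
  r : ∀ x, C'.r (φ.toLin x) = φ.toLin.rTensor (Reg 𝒢) (C.r x)

namespace CutAlg.Compat

variable {χ : Cutoff 𝒢} {Q : GAlg.{u₁, u₂, v} 𝒢} {Q' : GAlg.{u₁, u₂, w} 𝒢}
    {C : CutAlg χ Q} {C' : CutAlg χ Q'} {φ : GAlgHom Q Q'} (h : C.Compat C' φ)
include h

theorem cut (x y : Q) : TensorProduct.map φ.toLin φ.toLin
    (cut C.toRightCut C.toLeftCut (x ⊗ₜ y)) =
    AmpleHP.cut C'.toRightCut C'.toLeftCut (φ.toLin x ⊗ₜ φ.toLin y) := by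
  rw [cut_tmul, cut_tmul]
  change _ = cutWith C'.toLeftCut (φ.toLin y) (C'.r (φ.toLin x))
  rw [h.r]
  change TensorProduct.map φ.toLin φ.toLin (cutWith C.toLeftCut y (C.r x)) = _
  induction C.r x using TensorProduct.induction_on with
  | zero => simp
  | add s t hs ht => simp only [map_add, hs, ht]
  | tmul q η =>
    rw [LinearMap.rTensor_tmul, cutWith_tmul, cutWith_tmul, TensorProduct.map_tmul, h.l]

end CutAlg.Compat

namespace Forms

section ops

variable {χ : Cutoff 𝒢} {B : GAlg.{u₁, u₂, v} 𝒢} (C : CutAlg χ B)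

theorem tCut_compat {N M : ℕ} (h : N ≤ M) : (tCut C M).Compat (tCut C N) (TAproj B h) where
  l η := TA_ind' (by simp) (fun x y hx hy => by simp only [map_sub, hx, hy])
    (fun a => by rw [tCut_l, tCut_l, tl_gen, TAproj_gen, TAproj_gen, tl_gen])
    (fun x a hx => by
      rw [tCut_l, tCut_l] at *
      rw [tl_mul, (TAproj B h).map_mul, (TAproj B h).map_mul, hx, tl_mul])
  r := TA_ind' (by simp) (fun x y hx hy => by simp only [map_sub, hx, hy])
    (fun a => by
      rw [tCut_r, tCut_r, TAproj_gen, tr_gen, tr_gen]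
      induction C.r a using TensorProduct.induction_on with
      | zero => simp
      | add s t hs ht => simp only [map_add, hs, ht]
      | tmul q η => simp only [LinearMap.rTensor_tmul, TAproj_gen])
    (fun x a hx => by
      rw [tCut_r, tCut_r, (TAproj B h).map_mul, TAproj_gen, tr_mul, tr_mul, tr_gen, tr_gen]
      induction C.r a using TensorProduct.induction_on with
      | zero => simp
      | add s t hs ht => simp only [map_add, hs, ht]
      | tmul q η =>
        simp only [LinearMap.rTensor_tmul, LinearMap.mul_apply', (TAproj B h).map_mul, TAproj_gen])

/-- The projection `T B / J²ᴺ⁺² → T B / Jᴺ⁺¹`. -/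
abbrev dproj (B : GAlg.{u₁, u₂, v} 𝒢) (N : ℕ) : GAlgHom (TA B (2 * N + 1)) (TA B N) :=
  TAproj B (by omega)

/-- The operator which cuts at one place and vanishes on letters, with values in tensors. -/
def tK (N : ℕ) : TA B (2 * N + 1) →ₗ[Base 𝒢] TA B N ⊗[Base 𝒢] TA B N := (exists_tK C N).choose

variable {N : ℕ}

theorem tK_gen (a : B) : tK C N (gen B _ a) = 0 := (exists_tK C N).choose_spec.1 a

theorem tK_mul (x y : TA B (2 * N + 1)) : tK C N (x * y) =
    ((LinearMap.mul (Base 𝒢) (TA B N)).flip ((dproj B N).toLin y)).lTensor (TA B N) (tK C N x) +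
    (LinearMap.mul (Base 𝒢) (TA B N) ((dproj B N).toLin x)).rTensor (TA B N) (tK C N y) +
    (tcut C N ((dproj B N).toLin x ⊗ₜ (dproj B N).toLin y) -
        (dproj B N).toLin x ⊗ₜ (dproj B N).toLin y) := (exists_tK C N).choose_spec.2 x y

theorem act_mulLeft_rTensor' {Q : GAlg.{u₁, u₂, v} 𝒢} {U : CompactOpens 𝒢.Arr} (hU : IsBis 𝒢 U)
    (x : Q) (t : Q ⊗[Base 𝒢] Q) :
    act (𝒢 := 𝒢) (Cc.chi U) ((LinearMap.mul (Base 𝒢) Q x).rTensor Q t) =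
      (LinearMap.mul (Base 𝒢) Q (act (Cc.chi U) x)).rTensor Q (act (𝒢 := 𝒢) (Cc.chi U) t) := by
  induction t using TensorProduct.induction_on with
  | zero => simp
  | add a b ha hb => simp only [map_add, ha, hb]
  | tmul q η =>
    rw [LinearMap.rTensor_tmul, act_tmul hU, act_tmul hU, LinearMap.rTensor_tmul,
      LinearMap.mul_apply', LinearMap.mul_apply', GAlgebra.act_mul hU]

theorem act_mulRight_lTensor {Q : GAlg.{u₁, u₂, v} 𝒢} {U : CompactOpens 𝒢.Arr} (hU : IsBis 𝒢 U)
    (x : Q) (t : Q ⊗[Base 𝒢] Q) :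
    act (𝒢 := 𝒢) (Cc.chi U) (((LinearMap.mul (Base 𝒢) Q).flip x).lTensor Q t) =
      ((LinearMap.mul (Base 𝒢) Q).flip (act (Cc.chi U) x)).lTensor Q
        (act (𝒢 := 𝒢) (Cc.chi U) t) := by
  induction t using TensorProduct.induction_on with
  | zero => simp
  | add a b ha hb => simp only [map_add, ha, hb]
  | tmul q η =>
    rw [LinearMap.lTensor_tmul, act_tmul hU, act_tmul hU, LinearMap.lTensor_tmul,
      LinearMap.flip_apply, LinearMap.flip_apply, LinearMap.mul_apply', LinearMap.mul_apply',
      GAlgebra.act_mul hU]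

theorem act_tK {U : CompactOpens 𝒢.Arr} (hU : IsBis 𝒢 U) (x : TA B (2 * N + 1)) :
    tK C N (act (Cc.chi U) x) = act (𝒢 := 𝒢) (Cc.chi U) (tK C N x) := by
  refine TA_ind' (p := fun x => tK C N (act (Cc.chi U) x) = act (𝒢 := 𝒢) (Cc.chi U) (tK C N x))
    (by simp) (fun x y hx hy => by simp only [map_sub, hx, hy])
    (fun a => by rw [act_gen, tK_gen, tK_gen, map_zero]) (fun x a hx => ?_) x
  rw [GAlgebra.act_mul hU, tK_mul, tK_mul, hx, (dproj B N).equivariant, (dproj B N).equivariant,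
    map_add, map_add, map_sub, act_mulLeft_rTensor' hU, act_mulRight_lTensor hU, act_gen, tK_gen,
    tK_gen, map_zero, map_zero, map_zero, ← act_tmul hU, tcut, act_cut _ _ hU]

theorem TAproj_tK {N M : ℕ} (h : N ≤ M) (x : TA B (2 * M + 1)) :
    TensorProduct.map (TAproj B h).toLin (TAproj B h).toLin (tK C M x) =
      tK C N ((TAproj B (by omega)).toLin x) := by
  refine TA_ind' (p := fun x => TensorProduct.map (TAproj B h).toLin (TAproj B h).toLin (tK C M x) =
      tK C N ((TAproj B (by omega)).toLin x)) (by simp)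
    (fun x y hx hy => by simp only [map_sub, hx, hy])
    (fun a => by rw [TAproj_gen, tK_gen, tK_gen, map_zero]) (fun x a hx => ?_) x
  have e : ∀ y, (dproj B N).toLin ((TAproj B (show 2 * N + 1 ≤ 2 * M + 1 by omega)).toLin y) =
      (TAproj B h).toLin ((dproj B M).toLin y) := fun y => by
    rw [TAproj_TAproj, TAproj_TAproj]
  have g0 : tK C N ((TAproj B (show 2 * N + 1 ≤ 2 * M + 1 by omega)).toLin (gen B _ a)) = 0 := by
    rw [TAproj_gen, tK_gen]
  rw [(TAproj B _).map_mul, tK_mul, tK_mul, ← hx, e, e, g0, tK_gen, map_zero,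
    map_zero, add_zero, add_zero, map_add, map_sub, tcut, tcut, (tCut_compat C h).cut,
    TensorProduct.map_tmul]
  congr 1
  induction tK C M x using TensorProduct.induction_on with
  | zero => simp
  | add s t hs ht => simp only [map_add, hs, ht]
  | tmul q η => simp [(TAproj B h).map_mul]

variable {C} (hC : ∀ x y, C.cmul x y = x * y)
include hC

/-- The operator which cuts at one place and vanishes on letters. -/
def tL (N : ℕ) : TA B N →ₗ[Base 𝒢] TA B N := (exists_tL N hC).choose

theorem tL_gen (a : B) : tL hC N (gen B N a) = 0 := (exists_tL N hC).choose_spec.1 a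

theorem tL_mul (x y : TA B N) : tL hC N (x * y) =
    tL hC N x * y + x * tL hC N y + ((tCut C N).cmul x y - x * y) :=
  (exists_tL N hC).choose_spec.2 x y

theorem act_tL {U : CompactOpens 𝒢.Arr} (hU : IsBis 𝒢 U) (x : TA B N) :
    tL hC N (act (Cc.chi U) x) = act (𝒢 := 𝒢) (Cc.chi U) (tL hC N x) := by
  refine TA_ind' (p := fun x => tL hC N (act (Cc.chi U) x) = act (𝒢 := 𝒢) (Cc.chi U) (tL hC N x))
    (by simp) (fun x y hx hy => by simp only [map_sub, hx, hy])
    (fun a => by rw [act_gen, tL_gen, tL_gen, map_zero]) (fun x a hx => ?_) x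
  rw [GAlgebra.act_mul hU, tL_mul, tL_mul, hx, map_add, map_add, map_sub, GAlgebra.act_mul hU,
    GAlgebra.act_mul hU, GAlgebra.act_mul hU, CutAlg.act_cmul _ hU, act_gen, tL_gen, tL_gen,
    map_zero]

theorem tL_tl (η : Reg 𝒢) (x : TA B N) : tL hC N (tl C N η x) = tl C N η (tL hC N x) := by
  refine TA_ind' (p := fun x => tL hC N (tl C N η x) = tl C N η (tL hC N x))
    (by simp) (fun x y hx hy => by simp only [map_sub, hx, hy])
    (fun a => by rw [tl_gen, tL_gen, tL_gen, map_zero]) (fun x a hx => ?_) x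
  rw [tl_mul, tL_mul, tL_mul, hx, map_add, map_add, map_sub, tl_mul, tl_mul, tl_mul,
    ← tCut_l, ← tCut_l, ← tCut_l, CutAlg.l_cmul]

theorem tr_tL (x : TA B N) : tr C N (tL hC N x) = (tL hC N).rTensor (Reg 𝒢) (tr C N x) := by
  refine TA_ind' (p := fun x => tr C N (tL hC N x) = (tL hC N).rTensor (Reg 𝒢) (tr C N x))
    (by simp) (fun x y hx hy => by simp only [map_sub, hx, hy])
    (fun a => ?_) (fun x a hx => ?_) x
  · rw [tL_gen, tr_gen, map_zero]
    induction C.r a using TensorProduct.induction_on with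
    | zero => simp
    | add s t hs ht => rw [map_add, map_add, ← hs, ← ht, add_zero]
    | tmul q η => rw [LinearMap.rTensor_tmul, LinearMap.rTensor_tmul, tL_gen, TensorProduct.zero_tmul]
  · have h : tr C N ((tCut C N).cmul x (gen B N a)) =
        ((tCut C N).cmul x).rTensor (Reg 𝒢) (tr C N (gen B N a)) := by
      have h1 : ∀ η t, (LinearMap.mul (Base 𝒢) (TA B N) η).rTensor (Reg 𝒢)
          ((tl C N t).rTensor (Reg 𝒢) (tr C N (gen B N a))) =
          tr C N (η * tl C N t (gen B N a)) := by
        intro η t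
        rw [tr_mul, ← tCut_r, ← tCut_r, ← tCut_l C, CutAlg.r_l]
        rfl
      rw [CutAlg.cmul_apply, tCut_r]
      have h2 : (tCut C N).cmul x = (tCut C N).con.flip (tr C N x) := rfl
      rw [h2]
      induction tr C N x using TensorProduct.induction_on with
      | zero => simp
      | add s t hs ht => simp only [map_add, hs, ht, LinearMap.rTensor_add, LinearMap.add_apply]
      | tmul q η =>
        rw [CutAlg.con_tmul, tCut_l, ← h1, ← LinearMap.comp_apply, ← LinearMap.rTensor_comp]
        rfl
    rw [tL_mul, map_add, map_add, map_sub, h, tL_gen, mul_zero, map_zero, add_zero, tr_mul, tr_mul,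
      tr_gen]
    induction C.r a using TensorProduct.induction_on with
    | zero => simp
    | add s t hs ht =>
      simp only [map_add, ← hs, ← ht]; abel
    | tmul q η =>
      simp only [LinearMap.rTensor_tmul, LinearMap.mul_apply', tL_mul, tL_gen, mul_zero, add_zero,
        TensorProduct.add_tmul, TensorProduct.sub_tmul]

theorem mul'_tK (x : TA B (2 * N + 1)) :
    LinearMap.mul' (Base 𝒢) (TA B N) (tK C N x) = tL hC N ((dproj B N).toLin x) := by
  refine TA_ind' (p := fun x => LinearMap.mul' (Base 𝒢) (TA B N) (tK C N x) =
      tL hC N ((dproj B N).toLin x)) (by simp) (fun x y hx hy => by simp only [map_sub, hx, hy])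
    (fun a => by rw [TAproj_gen, tK_gen, tL_gen, map_zero]) (fun x a hx => ?_) x
  rw [tK_mul, (dproj B N).map_mul, tL_mul, ← hx, TAproj_gen, tL_gen, tK_gen, map_zero, mul_zero,
    map_add, map_add, map_sub, tcut, CutAlg.mul'_cut, map_zero, LinearMap.mul'_apply]
  congr 2
  induction tK C N x using TensorProduct.induction_on with
  | zero => simp
  | add s t hs ht => simp only [map_add, hs, ht, add_mul]
  | tmul q r => simp [mul_assoc]

end ops

end Forms

/-! ### Twisted maps on `O_G ⊗ E` -/

theorem chi_tmul_smul {M : Type*} [AddCommGroup M] [Module (Base 𝒢) M] {U : CompactOpens 𝒢.Arr}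
    {W : CompactOpens (Ad 𝒢)} (hU : IsBis 𝒢 U) (hW : W ≤ adCO U) (h : Cc 𝒢.Obj) (m : M) :
    (Cc.chi W : OG 𝒢) ⊗ₜ[Base 𝒢] (of (conv 𝒢 𝒢.Obj (Cc.chi (binv U)) h) • m) =
      Cc.chi W ⊗ₜ (of h • m) := by
  rw [← TensorProduct.smul_tmul, ← TensorProduct.smul_tmul]
  congr 1
  ext α
  rw [Cc.of_smul_apply, Cc.of_smul_apply]
  by_cases hα : α ∈ W
  · have h1 : 𝒢.inv α.arr ∈ binv U := by
      rw [mem_binv, AmpleGroupoid.inv_inv]; exact hW hα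
    have h2 : 𝒢.rng (𝒢.inv α.arr) = 𝒢.rng α.arr := by rw [𝒢.rng_inv, α.loop]
    congr 1
    change conv 𝒢 𝒢.Obj (Cc.chi (binv U)) h (𝒢.rng α.arr) = h (𝒢.rng α.arr)
    rw [conv_chi_of_mem (X := 𝒢.Obj) (x := 𝒢.rng α.arr) (isBis_binv hU) h h1 h2]
    change h (𝒢.rng (𝒢.inv (𝒢.inv α.arr))) = _
    rw [AmpleGroupoid.inv_inv]
  · rw [Cc.chi_of_notMem hα, mul_zero, mul_zero]

section twR

variable (E : Type v) [AddCommGroup E] [Module ℂ E] [Module (Base 𝒢) E]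
  [IsScalarTower ℂ (Base 𝒢) E] [GModule 𝒢 E] (F : Type w) [AddCommGroup F] [Module ℂ F]
  [Module (Base 𝒢) F] [IsScalarTower ℂ (Base 𝒢) F] [GModule 𝒢 F]

/-- The canonical automorphism of `O_G ⊗ F`. -/
def twOn : OG 𝒢 ⊗[Base 𝒢] F →ₗ[Base 𝒢] OG 𝒢 ⊗[Base 𝒢] F := twist (⟨F⟩ : GMod 𝒢)

/-- The twist of the second factor of `O_G ⊗ (E ⊗ F)`. -/
def twR : OG 𝒢 ⊗[Base 𝒢] (E ⊗[Base 𝒢] F) →ₗ[Base 𝒢] OG 𝒢 ⊗[Base 𝒢] (E ⊗[Base 𝒢] F) :=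
  (TensorProduct.leftComm (Base 𝒢) E (OG 𝒢) F).toLinearMap ∘ₗ (twOn F).lTensor E ∘ₗ
    (TensorProduct.leftComm (Base 𝒢) (OG 𝒢) E F).toLinearMap

variable {E F}

theorem twOn_chi {U : CompactOpens 𝒢.Arr} {W : CompactOpens (Ad 𝒢)} (hU : IsBis 𝒢 U)
    (hW : W ≤ adCO U) (η : F) :
    twOn F ((Cc.chi W : OG 𝒢) ⊗ₜ η) = (Cc.chi W : OG 𝒢) ⊗ₜ act (𝒢 := 𝒢) (Cc.chi (binv U)) η :=
  twist_chi (E := ⟨F⟩) hU hW η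

theorem twR_tmul (f : OG 𝒢) (q : E) (η : F) : twR E F (f ⊗ₜ (q ⊗ₜ η)) =
    TensorProduct.leftComm (Base 𝒢) E (OG 𝒢) F (q ⊗ₜ twOn F (f ⊗ₜ η)) := rfl

theorem twR_chi {U : CompactOpens 𝒢.Arr} {W : CompactOpens (Ad 𝒢)} (hU : IsBis 𝒢 U)
    (hW : W ≤ adCO U) (q : E) (η : F) : twR E F ((Cc.chi W : OG 𝒢) ⊗ₜ (q ⊗ₜ η)) =
      (Cc.chi W : OG 𝒢) ⊗ₜ (q ⊗ₜ act (𝒢 := 𝒢) (Cc.chi (binv U)) η) := by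
  rw [twR_tmul, twOn_chi hU hW, TensorProduct.leftComm_tmul]

theorem twR_equivariant : IsEquivariant 𝒢 (twR (𝒢 := 𝒢) E F) := by
  refine isEquivariant_tensor _ fun U hU f x => ?_
  induction x with
  | zero => simp
  | add x y hx hy => simp only [map_add, TensorProduct.tmul_add, hx, hy]
  | tmul q η =>
    have h : ∀ t : OG 𝒢 ⊗[Base 𝒢] F, TensorProduct.leftComm (Base 𝒢) E (OG 𝒢) F
        (act (𝒢 := 𝒢) (Cc.chi U) q ⊗ₜ act (𝒢 := 𝒢) (Cc.chi U) t) =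
        act (𝒢 := 𝒢) (Cc.chi U) (TensorProduct.leftComm (Base 𝒢) E (OG 𝒢) F (q ⊗ₜ t)) := by
      intro t
      induction t with
      | zero => simp
      | add x y hx hy => simp only [map_add, TensorProduct.tmul_add, hx, hy]
      | tmul g k =>
        rw [act_tmul hU, TensorProduct.leftComm_tmul, TensorProduct.leftComm_tmul, act_tmul hU,
          act_tmul hU]
    have h' := twist_equivariant (E := (⟨F⟩ : GMod 𝒢)) (Cc.chi U) (f ⊗ₜ η)
    rw [act_tmul hU] at h'
    rw [act_tmul hU, twR_tmul, twR_tmul, ← h]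
    congr 2

theorem twR_omul (f : OG 𝒢) (x : OG 𝒢 ⊗[Base 𝒢] (E ⊗[Base 𝒢] F)) :
    twR E F (omul (⟨E ⊗[Base 𝒢] F⟩ : GMod 𝒢) f x) = omul (⟨E ⊗[Base 𝒢] F⟩ : GMod 𝒢) f (twR E F x) := by
  induction x with
  | zero => simp
  | add x y hx hy => simp only [map_add, hx, hy]
  | tmul g x =>
    induction x with
    | zero => simp
    | add x y hx hy => simp only [map_add, TensorProduct.tmul_add, hx, hy]
    | tmul q η =>
      have h : ∀ t : OG 𝒢 ⊗[Base 𝒢] F, TensorProduct.leftComm (Base 𝒢) E (OG 𝒢) F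
          (q ⊗ₜ omul ⟨F⟩ f t) =
          omul (⟨E ⊗[Base 𝒢] F⟩ : GMod 𝒢) f
            (TensorProduct.leftComm (Base 𝒢) E (OG 𝒢) F (q ⊗ₜ t)) := by
        intro t
        induction t with
        | zero => simp
        | add x y hx hy => simp only [map_add, TensorProduct.tmul_add, hx, hy]
        | tmul g k => rfl
      rw [twR_tmul, ← h]
      exact congrArg (fun t => TensorProduct.leftComm (Base 𝒢) E (OG 𝒢) F (q ⊗ₜ t))
        (twist_omul (E := ⟨F⟩) f (g ⊗ₜ η))

variable {D : Type x} [AddCommGroup D] [Module ℂ D] [Module (Base 𝒢) D]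
  [IsScalarTower ℂ (Base 𝒢) D] [GModule 𝒢 D] {P : Type y} [AddCommGroup P] [Module ℂ P]
  [Module (Base 𝒢) P] [IsScalarTower ℂ (Base 𝒢) P] [GModule 𝒢 P]

/-- The twist followed by a map. -/
def twOut (u : E ⊗[Base 𝒢] F →ₗ[Base 𝒢] P) :
    OG 𝒢 ⊗[Base 𝒢] (E ⊗[Base 𝒢] F) →ₗ[Base 𝒢] OG 𝒢 ⊗[Base 𝒢] P :=
  u.lTensor (OG 𝒢) ∘ₗ twR E F

theorem twOut_chi (u : E ⊗[Base 𝒢] F →ₗ[Base 𝒢] P) {U : CompactOpens 𝒢.Arr}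
    {W : CompactOpens (Ad 𝒢)} (hU : IsBis 𝒢 U) (hW : W ≤ adCO U) (q : E) (η : F) :
    twOut u ((Cc.chi W : OG 𝒢) ⊗ₜ (q ⊗ₜ η)) =
      (Cc.chi W : OG 𝒢) ⊗ₜ u (q ⊗ₜ act (𝒢 := 𝒢) (Cc.chi (binv U)) η) := by
  rw [twOut, LinearMap.comp_apply, twR_chi hU hW, LinearMap.lTensor_tmul]

theorem twOut_mem (u : E ⊗[Base 𝒢] F →ₗ[Base 𝒢] P)
    (h : ∀ U, IsBis 𝒢 U → ∀ m n, u (act (𝒢 := 𝒢) (Cc.chi U) m ⊗ₜ act (𝒢 := 𝒢) (Cc.chi U) n) =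
      act (𝒢 := 𝒢) (Cc.chi U) (u (m ⊗ₜ n))) :
    twOut u ∈ AYDHom (oTensor (⟨E ⊗[Base 𝒢] F⟩ : GMod 𝒢)) (oTensor (⟨P⟩ : GMod 𝒢)) :=
  (AYD.comp (oTensorMap (E := ⟨E ⊗[Base 𝒢] F⟩) (F := ⟨P⟩) u fun _ _ m =>
    isEquivariant_tensor u h _ m) (⟨twR E F, twR_equivariant, twR_omul⟩ :
      AYDHom (oTensor (⟨E ⊗[Base 𝒢] F⟩ : GMod 𝒢)) (oTensor (⟨E ⊗[Base 𝒢] F⟩ : GMod 𝒢)))).2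

theorem lTensor_mem (u : D →ₗ[Base 𝒢] P)
    (h : ∀ U, IsBis 𝒢 U → ∀ m, u (act (𝒢 := 𝒢) (Cc.chi U) m) = act (𝒢 := 𝒢) (Cc.chi U) (u m)) :
    u.lTensor (OG 𝒢) ∈ AYDHom (oTensor (⟨D⟩ : GMod 𝒢)) (oTensor (⟨P⟩ : GMod 𝒢)) :=
  (oTensorMap (E := ⟨D⟩) (F := ⟨P⟩) u h).2

end twR

/-! ### The twisted cut -/

/-- Commuting left and right cut operators. -/
structure BiCut (χ : Cutoff 𝒢) (E : Type v) [AddCommGroup E] [Module ℂ E] [Module (Base 𝒢) E]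
    [IsScalarTower ℂ (Base 𝒢) E] [GModule 𝒢 E] extends LeftCut χ E, RightCut χ E where
  r_l : ∀ η x, r (l η x) = (l η).rTensor (Reg 𝒢) (r x)

namespace BiCut

variable {χ : Cutoff 𝒢} {E : Type v} [AddCommGroup E] [Module ℂ E] [Module (Base 𝒢) E]
    [IsScalarTower ℂ (Base 𝒢) E] [GModule 𝒢 E] (D : BiCut χ E)

/-- `q ⊗ η ↦ l_η q`. -/
def app : E ⊗[Base 𝒢] Reg 𝒢 →ₗ[Base 𝒢] E := TensorProduct.lift D.l.flip

/-- The operation `x ↦ l_{T(x'')} x'`, where `r x = x' ⊗ x''`. -/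
def tcut : OG 𝒢 ⊗[Base 𝒢] E →ₗ[Base 𝒢] OG 𝒢 ⊗[Base 𝒢] E := twOut D.app ∘ₗ D.r.lTensor (OG 𝒢)

theorem tcut_tmul (f : OG 𝒢) (e : E) : D.tcut (f ⊗ₜ e) = twOut D.app (f ⊗ₜ D.r e) := rfl

theorem tcut_mem : D.tcut ∈ AYDHom (oTensor (⟨E⟩ : GMod 𝒢)) (oTensor (⟨E⟩ : GMod 𝒢)) :=
  (AYD.comp ⟨_, twOut_mem D.app fun U hU m n => D.act_l U hU n m⟩ ⟨_, lTensor_mem D.r D.act_r⟩).2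

variable {U : CompactOpens 𝒢.Arr} {W : CompactOpens (Ad 𝒢)}

theorem twOut_app_chi (hU : IsBis 𝒢 U) (hW : W ≤ adCO U) (q : E) (η : Reg 𝒢) :
    twOut D.app ((Cc.chi W : OG 𝒢) ⊗ₜ (q ⊗ₜ η)) =
      (Cc.chi W : OG 𝒢) ⊗ₜ D.l (act (Cc.chi (binv U)) η) q := twOut_chi _ hU hW q η

theorem l_f_chi (hU : IsBis 𝒢 U) (hW : W ≤ adCO U) (h : Cc 𝒢.Obj) (ξ : Reg 𝒢) (q : E) :
    (Cc.chi W : OG 𝒢) ⊗ₜ[Base 𝒢] D.l (act (Cc.chi (binv U)) (χ.f h)) (D.l ξ q) =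
      Cc.chi W ⊗ₜ (of h • D.l ξ q) := by
  rw [← χ.f_equivariant, D.l_l]
  exact chi_tmul_smul hU hW h _

theorem tcut_tcut (z : OG 𝒢 ⊗[Base 𝒢] E) : D.tcut (D.tcut z) = D.tcut z := by
  refine LinearMap.congr_fun (f := D.tcut ∘ₗ D.tcut) (g := D.tcut)
    (oTensor_ext (E := ⟨E⟩) fun U W hU hW e => ?_) z
  let u : (E ⊗[Base 𝒢] Reg 𝒢) ⊗[Base 𝒢] Reg 𝒢 →ₗ[Base 𝒢] E ⊗[Base 𝒢] Reg 𝒢 :=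
    TensorProduct.lift ((LinearMap.rTensorHom (Reg 𝒢)).comp D.l).flip
  have hu : ∀ t η, u (t ⊗ₜ η) = (D.l η).rTensor (Reg 𝒢) t := fun _ _ => rfl
  have h0 : ∀ t η, twOut D.app (twOut u ((Cc.chi W : OG 𝒢) ⊗ₜ (t ⊗ₜ η))) = twOut D.app
      ((Cc.chi W : OG 𝒢) ⊗ₜ (D.l (act (Cc.chi (binv U)) η)).rTensor (Reg 𝒢) t) := fun t η => by
    rw [twOut_chi u hU hW, hu]
  have h1 : ∀ t, D.tcut (twOut D.app ((Cc.chi W : OG 𝒢) ⊗ₜ t)) =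
      twOut D.app (twOut u ((Cc.chi W : OG 𝒢) ⊗ₜ D.r.rTensor (Reg 𝒢) t)) := by
    intro t
    induction t using TensorProduct.induction_on with
    | zero => simp
    | add a b ha hb => simp only [map_add, TensorProduct.tmul_add, ha, hb]
    | tmul q η =>
      rw [D.twOut_app_chi hU hW, tcut_tmul, D.r_l, LinearMap.rTensor_tmul, h0]
  have h2 : ∀ t, twOut D.app (twOut u ((Cc.chi W : OG 𝒢) ⊗ₜ (ins χ.f).rTensor (Reg 𝒢) t)) =
      twOut D.app ((Cc.chi W : OG 𝒢) ⊗ₜ t) := by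
    intro t
    induction t using TensorProduct.induction_on with
    | zero => simp
    | add a b ha hb => simp only [map_add, TensorProduct.tmul_add, ha, hb]
    | tmul q η =>
      obtain ⟨h, hq⟩ := exists_unit 𝒢 q
      rw [LinearMap.rTensor_tmul, h0, ins_eq _ hq, LinearMap.rTensor_tmul, D.twOut_app_chi hU hW,
        D.twOut_app_chi hU hW, D.l_f_chi hU hW, ← map_smul, hq]
  change D.tcut (D.tcut ((Cc.chi W : OG 𝒢) ⊗ₜ (e : E))) = D.tcut ((Cc.chi W : OG 𝒢) ⊗ₜ (e : E))
  rw [tcut_tmul, h1, D.r_r, h2]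

end BiCut

/-! ### Generators and relations for the X-complex -/

section XO

variable (Q : GAlg.{u₁, u₂, v} 𝒢)

/-- `x ⊗ y ↦ x dy`. -/
def dm : Q ⊗[Base 𝒢] Q →ₗ[Base 𝒢] Om Q 1 := LinearMap.inl (Base 𝒢) (Q ⊗[Base 𝒢] Q) Q

/-- `y ↦ dy`. -/
def dd : Q →ₗ[Base 𝒢] Om Q 1 := LinearMap.inr (Base 𝒢) (Q ⊗[Base 𝒢] Q) Q

/-- `x dy + dz ↦ x ⊗ y`. -/
def omFst : Om Q 1 →ₗ[Base 𝒢] Q ⊗[Base 𝒢] Q := LinearMap.fst (Base 𝒢) (Q ⊗[Base 𝒢] Q) Q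

/-- `x dy + dz ↦ z`. -/
def omSnd : Om Q 1 →ₗ[Base 𝒢] Q := LinearMap.snd (Base 𝒢) (Q ⊗[Base 𝒢] Q) Q

variable {Q}

theorem dm_tmul (x y : Q) : dm Q (x ⊗ₜ y) = mulD Q 0 (io Q x) y := rfl

theorem dd_apply (y : Q) : dd Q y = dn Q 0 (io Q y) := rfl

theorem act_dm {U : CompactOpens 𝒢.Arr} (_hU : IsBis 𝒢 U) (t : Q ⊗[Base 𝒢] Q) :
    dm Q (act (𝒢 := 𝒢) (Cc.chi U) t) = act (𝒢 := 𝒢) (Cc.chi U) (dm Q t) :=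
  (Prod.ext rfl (map_zero (act (𝒢 := 𝒢) (M := Q) (Cc.chi U))).symm :
    ((act (𝒢 := 𝒢) (Cc.chi U) t, 0) : (Q ⊗[Base 𝒢] Q) × Q) =
      (act (𝒢 := 𝒢) (Cc.chi U) t, act (𝒢 := 𝒢) (Cc.chi U) 0)).trans
    (act_prod (M := Q ⊗[Base 𝒢] Q) (N := Q) (Cc.chi U) (t, 0)).symm

theorem act_omFst {U : CompactOpens 𝒢.Arr} (_hU : IsBis 𝒢 U) (t : Om Q 1) :
    omFst Q (act (𝒢 := 𝒢) (Cc.chi U) t) = act (𝒢 := 𝒢) (Cc.chi U) (omFst Q t) :=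
  congrArg Prod.fst (act_prod (M := Q ⊗[Base 𝒢] Q) (N := Q) (Cc.chi U) t)

theorem act_omSnd {U : CompactOpens 𝒢.Arr} (_hU : IsBis 𝒢 U) (t : Om Q 1) :
    omSnd Q (act (𝒢 := 𝒢) (Cc.chi U) t) = act (𝒢 := 𝒢) (Cc.chi U) (omSnd Q t) :=
  congrArg Prod.snd (act_prod (M := Q ⊗[Base 𝒢] Q) (N := Q) (Cc.chi U) t)

variable (Q)

/-- The underlying module of the odd part of the X-complex. -/
abbrev XOc : Type (max u₂ v) := (XO Q).toGMod

/-- The projection `♮`. -/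
def nat1 : OG 𝒢 ⊗[Base 𝒢] Om Q 1 →ₗ[Base 𝒢] XOc Q := (natural Q).1

/-- `f ⊗ x ⊗ y ↦ ♮(f ⊗ x dy)`. -/
def nm : OG 𝒢 ⊗[Base 𝒢] (Q ⊗[Base 𝒢] Q) →ₗ[Base 𝒢] XOc Q := nat1 Q ∘ₗ (dm Q).lTensor (OG 𝒢)

/-- `f ⊗ y ↦ ♮(f ⊗ dy)`. -/
def nd : OG 𝒢 ⊗[Base 𝒢] Q →ₗ[Base 𝒢] XOc Q := nat1 Q ∘ₗ (dd Q).lTensor (OG 𝒢)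

/-- The boundary from the odd to the even part. -/
def bd : XOc Q →ₗ[Base 𝒢] OG 𝒢 ⊗[Base 𝒢] Q := (Xd1 Q).1

theorem nm_mem : nm Q ∈ AYDHom (oTensor (⟨Q ⊗[Base 𝒢] Q⟩ : GMod 𝒢)) (XO Q) :=
  (AYD.comp (natural Q) ⟨_, lTensor_mem (D := Q ⊗[Base 𝒢] Q) (P := Om Q 1) (dm Q)
    fun _ hU t => act_dm hU t⟩).2

theorem nd_mem : nd Q ∈ AYDHom (oTensor (⟨Q⟩ : GMod 𝒢)) (XO Q) := (Xd0 Q).2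

variable {Q} {U : CompactOpens 𝒢.Arr} {W : CompactOpens (Ad 𝒢)}

theorem mulL_one_zero (x y z : Q) : mulL Q 1 (dm Q (x ⊗ₜ y)) z = dm Q ((z * x) ⊗ₜ y) := by
  rw [dm_tmul, mulL_mulD, mulL_io]; rfl

theorem nat1_bG (x : OG 𝒢 ⊗[Base 𝒢] Om Q 2) : nat1 Q (bG Q 1 x) = 0 :=
  (Submodule.Quotient.mk_eq_zero _).mpr ⟨x, rfl⟩

theorem nm_mul (hU : IsBis 𝒢 U) (hW : W ≤ adCO U) (x y z : Q) :
    nm Q ((Cc.chi W : OG 𝒢) ⊗ₜ (x ⊗ₜ (y * z))) = nm Q ((Cc.chi W : OG 𝒢) ⊗ₜ ((x * y) ⊗ₜ z)) +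
      nm Q ((Cc.chi W : OG 𝒢) ⊗ₜ ((act (𝒢 := 𝒢) (Cc.chi (binv U)) z * x) ⊗ₜ y)) := by
  have h := nat1_bG ((Cc.chi W : OG 𝒢) ⊗ₜ mulD Q 1 (dm Q (x ⊗ₜ y)) z)
  rw [bG_mulD_chi hU hW, mulL_one_zero, dm_tmul, mulR_mulD, mulR_io, map_smul, pow_one, neg_smul,
    one_smul, neg_eq_zero, TensorProduct.tmul_sub, TensorProduct.tmul_sub, map_sub, map_sub,
    sub_sub, sub_eq_zero] at h
  exact h

theorem nd_mul (hU : IsBis 𝒢 U) (hW : W ≤ adCO U) (y z : Q) :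
    nd Q ((Cc.chi W : OG 𝒢) ⊗ₜ (y * z)) = nm Q ((Cc.chi W : OG 𝒢) ⊗ₜ (y ⊗ₜ z)) +
      nm Q ((Cc.chi W : OG 𝒢) ⊗ₜ (act (𝒢 := 𝒢) (Cc.chi (binv U)) z ⊗ₜ y)) := by
  have h := nat1_bG ((Cc.chi W : OG 𝒢) ⊗ₜ mulD Q 1 (dd Q y) z)
  rw [bG_mulD_chi hU hW, dd_apply, mulR_dn, mulL_dn, map_smul, pow_one, neg_smul,
    one_smul, neg_eq_zero, TensorProduct.tmul_sub, TensorProduct.tmul_sub, map_sub, map_sub,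
    sub_sub, sub_eq_zero] at h
  exact h

theorem bd_nm (hU : IsBis 𝒢 U) (hW : W ≤ adCO U) (x y : Q) :
    bd Q (nm Q ((Cc.chi W : OG 𝒢) ⊗ₜ (x ⊗ₜ y))) = (Cc.chi W : OG 𝒢) ⊗ₜ (x * y) -
      (Cc.chi W : OG 𝒢) ⊗ₜ (act (𝒢 := 𝒢) (Cc.chi (binv U)) y * x) := by
  refine (bG_mulD_chi hU hW 0 (io Q x) y).trans ?_
  rw [pow_zero, one_smul, mulR_io, mulL_io, TensorProduct.tmul_sub]; rfl

theorem bd_nd (hU : IsBis 𝒢 U) (hW : W ≤ adCO U) (y : Q) :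
    bd Q (nd Q ((Cc.chi W : OG 𝒢) ⊗ₜ y)) = (Cc.chi W : OG 𝒢) ⊗ₜ y -
      (Cc.chi W : OG 𝒢) ⊗ₜ act (𝒢 := 𝒢) (Cc.chi (binv U)) y := by
  refine (bG_dn_chi hU hW y).trans ?_
  rw [map_sub, TensorProduct.tmul_sub]; rfl

theorem XO_ext {P : Type*} [AddCommGroup P] [Module (Base 𝒢) P] {f g : XOc Q →ₗ[Base 𝒢] P}
    (h1 : ∀ t, f (nm Q t) = g (nm Q t)) (h2 : ∀ t, f (nd Q t) = g (nd Q t)) : f = g := by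
  refine LinearMap.ext fun m => ?_
  obtain ⟨t, rfl⟩ := natural_surjective Q m
  refine LinearMap.congr_fun (f := f ∘ₗ nat1 Q) (g := g ∘ₗ nat1 Q)
    (oTensor_ext (E := Om Q 1) fun U W _ _ e => ?_) t
  refine ind1 (A := Q) (p := fun e => (f ∘ₗ nat1 Q) ((Cc.chi W : OG 𝒢) ⊗ₜ[Base 𝒢] e) =
    (g ∘ₗ nat1 Q) ((Cc.chi W : OG 𝒢) ⊗ₜ[Base 𝒢] e)) (by simp)
    (fun x y hx hy => by rw [TensorProduct.tmul_add, map_add, map_add, hx, hy])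
    (fun b a => ?_) (fun c => ?_) e
  · exact h1 ((Cc.chi W : OG 𝒢) ⊗ₜ (b ⊗ₜ a))
  · exact h2 ((Cc.chi W : OG 𝒢) ⊗ₜ c)

theorem XO_ext_chi {P : Type*} [AddCommGroup P] [Module (Base 𝒢) P] {f g : XOc Q →ₗ[Base 𝒢] P}
    (h1 : ∀ U W, IsBis 𝒢 U → W ≤ adCO U → ∀ x y,
      f (nm Q ((Cc.chi W : OG 𝒢) ⊗ₜ (x ⊗ₜ y))) = g (nm Q ((Cc.chi W : OG 𝒢) ⊗ₜ (x ⊗ₜ y))))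
    (h2 : ∀ U W, IsBis 𝒢 U → W ≤ adCO U → ∀ y,
      f (nd Q ((Cc.chi W : OG 𝒢) ⊗ₜ y)) = g (nd Q ((Cc.chi W : OG 𝒢) ⊗ₜ y))) : f = g := by
  refine XO_ext (fun t => ?_) fun t => ?_
  · refine LinearMap.congr_fun (f := f ∘ₗ nm Q) (g := g ∘ₗ nm Q)
      (oTensor_ext (E := ⟨Q ⊗[Base 𝒢] Q⟩) fun U W hU hW e => ?_) t
    change Q ⊗[Base 𝒢] Q at e
    induction e with
    | zero => simp
    | add x y hx hy => rw [TensorProduct.tmul_add, map_add, map_add, hx, hy]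
    | tmul x y => exact h1 U W hU hW x y
  · exact LinearMap.congr_fun (f := f ∘ₗ nd Q) (g := g ∘ₗ nd Q)
      (oTensor_ext (E := ⟨Q⟩) fun U W hU hW e => h2 U W hU hW e) t

variable {P : Type*} [AddCommGroup P] [Module (Base 𝒢) P]
  (α : OG 𝒢 ⊗[Base 𝒢] (Q ⊗[Base 𝒢] Q) →ₗ[Base 𝒢] P) (β : OG 𝒢 ⊗[Base 𝒢] Q →ₗ[Base 𝒢] P)

/-- The linear map on one-forms with given values on `f ⊗ x dy` and `f ⊗ dy`. -/
def preXO : OG 𝒢 ⊗[Base 𝒢] Om Q 1 →ₗ[Base 𝒢] P :=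
  α ∘ₗ (omFst Q).lTensor (OG 𝒢) + β ∘ₗ (omSnd Q).lTensor (OG 𝒢)

theorem preXO_dm (f : OG 𝒢) (t : Q ⊗[Base 𝒢] Q) : preXO α β (f ⊗ₜ dm Q t) = α (f ⊗ₜ t) := by
  change α (f ⊗ₜ t) + β (f ⊗ₜ 0) = _
  rw [TensorProduct.tmul_zero, map_zero, add_zero]

theorem preXO_dd (f : OG 𝒢) (y : Q) : preXO α β (f ⊗ₜ dd Q y) = β (f ⊗ₜ y) := by
  change α (f ⊗ₜ 0) + β (f ⊗ₜ y) = _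
  rw [TensorProduct.tmul_zero, map_zero, zero_add]

theorem preXO_bG (h1 : ∀ U W, IsBis 𝒢 U → W ≤ adCO U → ∀ x y z : Q,
      α ((Cc.chi W : OG 𝒢) ⊗ₜ (x ⊗ₜ (y * z))) = α ((Cc.chi W : OG 𝒢) ⊗ₜ ((x * y) ⊗ₜ z)) +
        α ((Cc.chi W : OG 𝒢) ⊗ₜ ((act (𝒢 := 𝒢) (Cc.chi (binv U)) z * x) ⊗ₜ y)))
    (h2 : ∀ U W, IsBis 𝒢 U → W ≤ adCO U → ∀ y z : Q,
      β ((Cc.chi W : OG 𝒢) ⊗ₜ (y * z)) = α ((Cc.chi W : OG 𝒢) ⊗ₜ (y ⊗ₜ z)) +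
        α ((Cc.chi W : OG 𝒢) ⊗ₜ (act (𝒢 := 𝒢) (Cc.chi (binv U)) z ⊗ₜ y)))
    (t : OG 𝒢 ⊗[Base 𝒢] Om Q 2) : preXO α β (bG Q 1 t) = 0 := by
  refine LinearMap.congr_fun (f := preXO α β ∘ₗ bG Q 1) (g := 0)
    (oTensor_ext (E := Om Q 2) fun U W hU hW e => ?_) t
  refine ind2 0 (p := fun e => (preXO α β ∘ₗ bG Q 1) ((Cc.chi W : OG 𝒢) ⊗ₜ[Base 𝒢] e) =
    (0 : OG 𝒢 ⊗[Base 𝒢] Om Q 2 →ₗ[Base 𝒢] P) ((Cc.chi W : OG 𝒢) ⊗ₜ[Base 𝒢] e)) (by simp)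
    (fun x y hx hy => by rw [TensorProduct.tmul_add, map_add, map_add, hx, hy]) (fun ω z => ?_) e
  rw [LinearMap.comp_apply, LinearMap.zero_apply, bG_mulD_chi hU hW, map_smul]
  suffices h : preXO α β ((Cc.chi W : OG 𝒢) ⊗ₜ (mulR Q 1 ω z -
      mulL Q 1 ω (act (𝒢 := 𝒢) (Cc.chi (binv U)) z))) = 0 by
    rw [h, smul_zero]
  refine ind1 (p := fun ω => preXO α β ((Cc.chi W : OG 𝒢) ⊗ₜ (mulR Q 1 ω z -
      mulL Q 1 ω (act (𝒢 := 𝒢) (Cc.chi (binv U)) z))) = 0) (by simp)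
    (fun x y hx hy => ?_) (fun x y => ?_) (fun y => ?_) ω
  · rw [map_add, map_add, LinearMap.add_apply, LinearMap.add_apply, add_sub_add_comm,
      TensorProduct.tmul_add, map_add, hx, hy, add_zero]
  · rw [mulR_mulD, mulR_io, mulL_mulD, mulL_io, ← dm_tmul, ← dm_tmul, ← dm_tmul,
      TensorProduct.tmul_sub, TensorProduct.tmul_sub, map_sub, map_sub, preXO_dm, preXO_dm,
      preXO_dm, h1 U W hU hW]
    abel
  · rw [mulR_dn, mulL_dn, ← dd_apply, ← dm_tmul, ← dm_tmul, TensorProduct.tmul_sub,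
      TensorProduct.tmul_sub, map_sub, map_sub, preXO_dm, preXO_dm, preXO_dd, h2 U W hU hW]
    abel

/-- A map on one-forms which vanishes on boundaries, as a map on the odd part of the X-complex. -/
def liftXO (h : ∀ t, preXO α β (bG Q 1 t) = 0) : XOc Q →ₗ[Base 𝒢] P :=
  (LinearMap.range (bG Q 1)).liftQ (preXO α β) (by rintro _ ⟨t, rfl⟩; exact h t)

theorem liftXO_nm (h : ∀ t, preXO α β (bG Q 1 t) = 0) (t) : liftXO α β h (nm Q t) = α t := by
  refine LinearMap.congr_fun (f := liftXO α β h ∘ₗ nm Q) (g := α) (TensorProduct.ext' fun f t => ?_) t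
  exact preXO_dm α β f t

theorem liftXO_nd (h : ∀ t, preXO α β (bG Q 1 t) = 0) (t) : liftXO α β h (nd Q t) = β t := by
  refine LinearMap.congr_fun (f := liftXO α β h ∘ₗ nd Q) (g := β) (TensorProduct.ext' fun f t => ?_) t
  exact preXO_dd α β f t

theorem liftXO_mem {N : AYD.{u₁, u₂, w} 𝒢} {α : OG 𝒢 ⊗[Base 𝒢] (Q ⊗[Base 𝒢] Q) →ₗ[Base 𝒢] N.toGMod}
    {β : OG 𝒢 ⊗[Base 𝒢] Q →ₗ[Base 𝒢] N.toGMod}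
    (hα : α ∈ AYDHom (oTensor (⟨Q ⊗[Base 𝒢] Q⟩ : GMod 𝒢)) N)
    (hβ : β ∈ AYDHom (oTensor (⟨Q⟩ : GMod 𝒢)) N) (h : ∀ t, preXO α β (bG Q 1 t) = 0) :
    liftXO α β h ∈ AYDHom (XO Q) N := by
  have h0 : preXO α β ∈ AYDHom (oTensor (Om Q 1)) N :=
    add_mem (AYD.comp ⟨α, hα⟩ ⟨_, lTensor_mem (D := Om Q 1) (P := Q ⊗[Base 𝒢] Q) (omFst Q)
      fun _ hU t => act_omFst hU t⟩).2
      (AYD.comp ⟨β, hβ⟩ ⟨_, lTensor_mem (D := Om Q 1) (P := Q) (omSnd Q)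
        fun _ hU t => act_omSnd hU t⟩).2
  refine ⟨fun a m => ?_, fun a m => ?_⟩
  · obtain ⟨x, rfl⟩ := natural_surjective Q m
    exact h0.1 a x
  · obtain ⟨x, rfl⟩ := natural_surjective Q m
    exact h0.2 a x

end XO

/-! ### Homotopies on the X-complex -/

/-- The commuting cut operators of an algebra. -/
def CutAlg.biCut {χ : Cutoff 𝒢} {Q : GAlg.{u₁, u₂, v} 𝒢} (C : CutAlg χ Q) : BiCut χ Q :=
  { C.toLeftCut, C.toRightCut with r_l := C.r_l }

section outer

variable {χ : Cutoff 𝒢} {E : Type v} [AddCommGroup E] [Module ℂ E] [Module (Base 𝒢) E]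
  [IsScalarTower ℂ (Base 𝒢) E] [GModule 𝒢 E] {E' : Type w} [AddCommGroup E'] [Module ℂ E']
  [Module (Base 𝒢) E'] [IsScalarTower ℂ (Base 𝒢) E'] [GModule 𝒢 E']

/-- `x ⊗ (q ⊗ η) ↦ (x ⊗ q) ⊗ η`. -/
def consL (x : E) : E' ⊗[Base 𝒢] Reg 𝒢 →ₗ[Base 𝒢] (E ⊗[Base 𝒢] E') ⊗[Base 𝒢] Reg 𝒢 :=
  (TensorProduct.mk (Base 𝒢) E E' x).rTensor (Reg 𝒢)

theorem consL_tmul (x : E) (q : E') (η : Reg 𝒢) : consL x (q ⊗ₜ η) = (x ⊗ₜ q) ⊗ₜ η := rfl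

theorem act_consL {U : CompactOpens 𝒢.Arr} (hU : IsBis 𝒢 U) (x : E) (t : E' ⊗[Base 𝒢] Reg 𝒢) :
    consL (act (Cc.chi U) x) (act (𝒢 := 𝒢) (Cc.chi U) t) =
      act (𝒢 := 𝒢) (Cc.chi U) (consL x t) := by
  induction t using TensorProduct.induction_on with
  | zero => simp
  | add a b ha hb => simp only [map_add, ha, hb]
  | tmul q η => rw [act_tmul hU, consL_tmul, consL_tmul, act_tmul hU, act_tmul hU]

/-- The right cut on the second factor. -/
def outerR (R : RightCut χ E') :
    E ⊗[Base 𝒢] E' →ₗ[Base 𝒢] (E ⊗[Base 𝒢] E') ⊗[Base 𝒢] Reg 𝒢 :=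
  (TensorProduct.assoc (Base 𝒢) E E' (Reg 𝒢)).symm.toLinearMap ∘ₗ R.r.lTensor E

theorem outerR_tmul (R : RightCut χ E') (x : E) (y : E') :
    outerR R (x ⊗ₜ y) = consL x (R.r y) := by
  rw [outerR, LinearMap.comp_apply, LinearMap.lTensor_tmul]
  induction R.r y using TensorProduct.induction_on with
  | zero => simp
  | add a b ha hb => simp only [map_add, TensorProduct.tmul_add, ha, hb]
  | tmul q η => rfl

/-- The cut operators on `E ⊗ E'` at the outer ends. -/
def outerCut (L : LeftCut χ E) (R : RightCut χ E') : BiCut χ (E ⊗[Base 𝒢] E') where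
  l := LinearMap.rTensorHom E' ∘ₗ L.l
  act_l U hU η x := by
    induction x using TensorProduct.induction_on with
    | zero => simp
    | add a b ha hb => simp only [map_add, ha, hb]
    | tmul x y =>
      rw [act_tmul hU]
      change L.l _ _ ⊗ₜ[Base 𝒢] _ = act (𝒢 := 𝒢) (Cc.chi U) (L.l _ _ ⊗ₜ[Base 𝒢] _)
      rw [L.act_l U hU, act_tmul hU]
      rfl
  l_l h η x := by
    induction x using TensorProduct.induction_on with
    | zero => simp
    | add a b ha hb => simp only [map_add, smul_add, ha, hb]
    | tmul x y =>
      change L.l _ (L.l _ _) ⊗ₜ[Base 𝒢] _ = of h • (L.l _ _ ⊗ₜ[Base 𝒢] _)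
      rw [L.l_l]; rfl
  r := outerR R
  act_r U hU x := by
    induction x using TensorProduct.induction_on with
    | zero => simp
    | add a b ha hb => simp only [map_add, ha, hb]
    | tmul x y => rw [act_tmul hU, outerR_tmul, outerR_tmul, R.act_r U hU, act_consL hU]
  r_r x := by
    induction x using TensorProduct.induction_on with
    | zero => simp
    | add a b ha hb => simp only [map_add, ha, hb]
    | tmul x y =>
      let Θ : (E' ⊗[Base 𝒢] Reg 𝒢) ⊗[Base 𝒢] Reg 𝒢 →ₗ[Base 𝒢]
          ((E ⊗[Base 𝒢] E') ⊗[Base 𝒢] Reg 𝒢) ⊗[Base 𝒢] Reg 𝒢 := (consL x).rTensor (Reg 𝒢)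
      have h1 : ∀ t, (outerR R).rTensor (Reg 𝒢) (consL x t) = Θ (R.r.rTensor (Reg 𝒢) t) := by
        intro t
        induction t using TensorProduct.induction_on with
        | zero => simp
        | add a b ha hb => simp only [map_add, ha, hb]
        | tmul q η =>
          rw [consL_tmul, LinearMap.rTensor_tmul, LinearMap.rTensor_tmul, outerR_tmul]; rfl
      have h2 : ∀ t, (ins χ.f).rTensor (Reg 𝒢) (consL x t) =
          Θ ((ins χ.f).rTensor (Reg 𝒢) t) := by
        intro t
        induction t using TensorProduct.induction_on with
        | zero => simp
        | add a b ha hb => simp only [map_add, ha, hb]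
        | tmul q η =>
          obtain ⟨h, hq⟩ := exists_unit 𝒢 q
          rw [consL_tmul, LinearMap.rTensor_tmul, LinearMap.rTensor_tmul, ins_eq _ hq,
            ins_eq (h := h) _ (by rw [← TensorProduct.tmul_smul, hq])]
          rfl
      rw [outerR_tmul, h1, h2, R.r_r]
  r_l η x := by
    induction x using TensorProduct.induction_on with
    | zero => simp
    | add a b ha hb => simp only [map_add, ha, hb]
    | tmul x y =>
      change outerR R (L.l η x ⊗ₜ y) = _
      rw [outerR_tmul, outerR_tmul]
      induction R.r y using TensorProduct.induction_on with
      | zero => simp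
      | add a b ha hb => simp only [map_add, ha, hb]
      | tmul q ξ => rfl

theorem outerCut_l (L : LeftCut χ E) (R : RightCut χ E') (η : Reg 𝒢) (x : E) (y : E') :
    (outerCut L R).l η (x ⊗ₜ y) = L.l η x ⊗ₜ y := rfl

theorem outerCut_r (L : LeftCut χ E) (R : RightCut χ E') (x : E) (y : E') :
    (outerCut L R).r (x ⊗ₜ y) = consL x (R.r y) := outerR_tmul R x y

end outer

/-- `p ⊗ q ↦ q p`. -/
def mulSwap (Q : GAlg.{u₁, u₂, v} 𝒢) : Q ⊗[Base 𝒢] Q →ₗ[Base 𝒢] Q :=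
  TensorProduct.lift (LinearMap.mul (Base 𝒢) Q).flip

/-- `(x ⊗ p) ⊗ q ↦ (q x) p`. -/
def mulSwap3 (Q : GAlg.{u₁, u₂, v} 𝒢) : (Q ⊗[Base 𝒢] Q) ⊗[Base 𝒢] Q →ₗ[Base 𝒢] Q :=
  TensorProduct.lift ((LinearMap.lcomp (Base 𝒢) Q (LinearMap.mul' (Base 𝒢) Q)).comp
    (LinearMap.mul (Base 𝒢) Q)).flip

/-- Data for the contraction of the cut operator on the X-complex. -/
structure CutHtp {χ : Cutoff 𝒢} {Q' Q : GAlg.{u₁, u₂, v} 𝒢} (C : CutAlg χ Q)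
    (π : GAlgHom Q' Q) where
  K : Q' →ₗ[Base 𝒢] Q ⊗[Base 𝒢] Q
  L : Q →ₗ[Base 𝒢] Q
  act_K : ∀ U, IsBis 𝒢 U → ∀ x, K (act (Cc.chi U) x) = act (𝒢 := 𝒢) (Cc.chi U) (K x)
  act_L : ∀ U, IsBis 𝒢 U → ∀ x, L (act (Cc.chi U) x) = act (𝒢 := 𝒢) (Cc.chi U) (L x)
  K_mul : ∀ x y, K (x * y) =
    ((LinearMap.mul (Base 𝒢) Q).flip (π.toLin y)).lTensor Q (K x) +
    (LinearMap.mul (Base 𝒢) Q (π.toLin x)).rTensor Q (K y) +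
    (cut C.toRightCut C.toLeftCut (π.toLin x ⊗ₜ π.toLin y) - π.toLin x ⊗ₜ π.toLin y)
  mul'_K : ∀ x, LinearMap.mul' (Base 𝒢) Q (K x) = L (π.toLin x)

theorem mulSwap_tmul {Q : GAlg.{u₁, u₂, v} 𝒢} (p q : Q) : mulSwap Q (p ⊗ₜ q) = q * p := rfl

theorem mulSwap3_tmul {Q : GAlg.{u₁, u₂, v} 𝒢} (x p q : Q) :
    mulSwap3 Q ((x ⊗ₜ p) ⊗ₜ q) = q * (x * p) := rfl

namespace CutHtp

variable {χ : Cutoff 𝒢} {Q' Q : GAlg.{u₁, u₂, v} 𝒢} {C : CutAlg χ Q} {π : GAlgHom Q' Q}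
  (H : CutHtp C π)

/-- The twisted cut on the even part of the X-complex. -/
abbrev c0 (_ : CutHtp C π) : OG 𝒢 ⊗[Base 𝒢] Q →ₗ[Base 𝒢] OG 𝒢 ⊗[Base 𝒢] Q := C.biCut.tcut

/-- The cut operator on the even part. -/
def LE : OG 𝒢 ⊗[Base 𝒢] Q →ₗ[Base 𝒢] OG 𝒢 ⊗[Base 𝒢] Q :=
  H.L.lTensor (OG 𝒢) + (H.c0 - LinearMap.id)

/-- The values of the cut operator on `x dy`. -/
def LOm : OG 𝒢 ⊗[Base 𝒢] (Q ⊗[Base 𝒢] Q) →ₗ[Base 𝒢] XOc Q :=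
  nm Q ∘ₗ ((H.L.rTensor Q).lTensor (OG 𝒢) + (H.L.lTensor Q).lTensor (OG 𝒢) +
    ((cut C.toRightCut C.toLeftCut).lTensor (OG 𝒢) - LinearMap.id) +
    ((outerCut C.toLeftCut C.toRightCut).tcut - LinearMap.id))

/-- The homotopy from the even to the odd part. -/
def h0 : OG 𝒢 ⊗[Base 𝒢] Q' →ₗ[Base 𝒢] XOc Q := nm Q ∘ₗ H.K.lTensor (OG 𝒢)

/-- The homotopy on forms `x dy`. -/
def h1m : OG 𝒢 ⊗[Base 𝒢] (Q' ⊗[Base 𝒢] Q') →ₗ[Base 𝒢] OG 𝒢 ⊗[Base 𝒢] Q :=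
  twOut (mulSwap3 Q) ∘ₗ ((TensorProduct.assoc (Base 𝒢) Q Q Q).symm.toLinearMap ∘ₗ
    TensorProduct.map π.toLin H.K).lTensor (OG 𝒢) +
  (H.c0 - LinearMap.id) ∘ₗ (π.toLin ∘ₗ LinearMap.mul' (Base 𝒢) Q').lTensor (OG 𝒢)

/-- The homotopy on forms `dy`. -/
def h1d : OG 𝒢 ⊗[Base 𝒢] Q' →ₗ[Base 𝒢] OG 𝒢 ⊗[Base 𝒢] Q :=
  twOut (mulSwap Q) ∘ₗ H.K.lTensor (OG 𝒢) + (H.c0 - LinearMap.id) ∘ₗ π.toLin.lTensor (OG 𝒢)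

/-- `p ⊗ q ↦ (x ⊗ p) ⊗ q`. -/
def consT (x : Q) : Q ⊗[Base 𝒢] Q →ₗ[Base 𝒢] (Q ⊗[Base 𝒢] Q) ⊗[Base 𝒢] Q :=
  (TensorProduct.mk (Base 𝒢) Q Q x).rTensor Q

theorem consT_tmul (x p q : Q) : consT x (p ⊗ₜ q) = (x ⊗ₜ p) ⊗ₜ q := rfl

variable {U : CompactOpens 𝒢.Arr} {W : CompactOpens (Ad 𝒢)}

theorem LE_tmul (f : OG 𝒢) (x : Q) :
    H.LE (f ⊗ₜ x) = f ⊗ₜ H.L x + (H.c0 (f ⊗ₜ x) - f ⊗ₜ x) := rfl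

theorem LOm_tmul (f : OG 𝒢) (x y : Q) : H.LOm (f ⊗ₜ (x ⊗ₜ y)) =
    nm Q (f ⊗ₜ (H.L x ⊗ₜ y)) + nm Q (f ⊗ₜ (x ⊗ₜ H.L y)) +
    (nm Q (f ⊗ₜ cut C.toRightCut C.toLeftCut (x ⊗ₜ y)) - nm Q (f ⊗ₜ (x ⊗ₜ y))) +
    (nm Q ((outerCut C.toLeftCut C.toRightCut).tcut (f ⊗ₜ (x ⊗ₜ y))) - nm Q (f ⊗ₜ (x ⊗ₜ y))) := by
  rw [LOm, LinearMap.comp_apply]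
  simp only [LinearMap.add_apply, LinearMap.sub_apply, map_add, map_sub, LinearMap.id_apply,
    LinearMap.lTensor_tmul, LinearMap.rTensor_tmul]

theorem h0_tmul (f : OG 𝒢) (x : Q') : H.h0 (f ⊗ₜ x) = nm Q (f ⊗ₜ H.K x) := rfl

theorem h1m_tmul (f : OG 𝒢) (x y : Q') : H.h1m (f ⊗ₜ (x ⊗ₜ y)) =
    twOut (mulSwap3 Q) (f ⊗ₜ consT (π.toLin x) (H.K y)) +
      (H.c0 (f ⊗ₜ (π.toLin x * π.toLin y)) - f ⊗ₜ (π.toLin x * π.toLin y)) := by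
  have h : ∀ t : Q ⊗[Base 𝒢] Q, (TensorProduct.assoc (Base 𝒢) Q Q Q).symm (π.toLin x ⊗ₜ t) =
      consT (π.toLin x) t := by
    intro t
    induction t using TensorProduct.induction_on with
    | zero => simp
    | add a b ha hb => simp only [map_add, TensorProduct.tmul_add, ha, hb]
    | tmul q η => rfl
  rw [← h, ← π.map_mul]; rfl

theorem h1d_tmul (f : OG 𝒢) (y : Q') : H.h1d (f ⊗ₜ y) =
    twOut (mulSwap Q) (f ⊗ₜ H.K y) + (H.c0 (f ⊗ₜ π.toLin y) - f ⊗ₜ π.toLin y) := rfl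

theorem c0_tmul (f : OG 𝒢) (x : Q) : H.c0 (f ⊗ₜ x) = twOut C.biCut.app (f ⊗ₜ C.r x) := rfl

theorem app_chi (hU : IsBis 𝒢 U) (hW : W ≤ adCO U) (q : Q) (η : Reg 𝒢) :
    twOut C.biCut.app ((Cc.chi W : OG 𝒢) ⊗ₜ (q ⊗ₜ η)) =
      (Cc.chi W : OG 𝒢) ⊗ₜ C.l (act (Cc.chi (binv U)) η) q := twOut_chi _ hU hW q η

theorem outer_tmul (f : OG 𝒢) (x y : Q) :
    (outerCut C.toLeftCut C.toRightCut).tcut (f ⊗ₜ (x ⊗ₜ y)) =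
      twOut (outerCut C.toLeftCut C.toRightCut).app (f ⊗ₜ consL x (C.r y)) := by
  rw [BiCut.tcut_tmul]
  congr 2

theorem outer_chi (hU : IsBis 𝒢 U) (hW : W ≤ adCO U) (x q : Q) (η : Reg 𝒢) :
    twOut (outerCut C.toLeftCut C.toRightCut).app ((Cc.chi W : OG 𝒢) ⊗ₜ ((x ⊗ₜ q) ⊗ₜ η)) =
      (Cc.chi W : OG 𝒢) ⊗ₜ (C.l (act (Cc.chi (binv U)) η) x ⊗ₜ q) := twOut_chi _ hU hW _ η

/-- The homotopy identity on the even part. -/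
theorem htp_even (z : OG 𝒢 ⊗[Base 𝒢] Q') :
    bd Q (H.h0 z) + H.h1d z = H.LE (π.toLin.lTensor (OG 𝒢) z) := by
  refine LinearMap.congr_fun (f := bd Q ∘ₗ H.h0 + H.h1d) (g := H.LE ∘ₗ π.toLin.lTensor (OG 𝒢))
    (oTensor_ext (E := ⟨Q'⟩) fun U W hU hW y => ?_) z
  change Q' at y
  have h : ∀ t, bd Q (nm Q ((Cc.chi W : OG 𝒢) ⊗ₜ t)) =
      (Cc.chi W : OG 𝒢) ⊗ₜ LinearMap.mul' (Base 𝒢) Q t -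
        twOut (mulSwap Q) ((Cc.chi W : OG 𝒢) ⊗ₜ t) := by
    intro t
    induction t using TensorProduct.induction_on with
    | zero => simp
    | add a b ha hb => simp only [map_add, TensorProduct.tmul_add, ha, hb]; abel
    | tmul p q => rw [bd_nm hU hW, twOut_chi _ hU hW]; rfl
  change bd Q (H.h0 ((Cc.chi W : OG 𝒢) ⊗ₜ y)) + H.h1d ((Cc.chi W : OG 𝒢) ⊗ₜ y) =
    H.LE ((Cc.chi W : OG 𝒢) ⊗ₜ π.toLin y)
  rw [h0_tmul, h1d_tmul, LE_tmul, h, H.mul'_K]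
  abel

/-- The homotopy identity on forms `dy`. -/
theorem htp_d (z : OG 𝒢 ⊗[Base 𝒢] Q') :
    nd Q (H.h1d z) + H.h0 (bd Q' (nd Q' z)) = nd Q (H.LE (π.toLin.lTensor (OG 𝒢) z)) := by
  refine LinearMap.congr_fun (f := nd Q ∘ₗ H.h1d + H.h0 ∘ₗ bd Q' ∘ₗ nd Q')
    (g := nd Q ∘ₗ H.LE ∘ₗ π.toLin.lTensor (OG 𝒢))
    (oTensor_ext (E := ⟨Q'⟩) fun U W hU hW y => ?_) z
  change Q' at y
  have h : ∀ t, nd Q (twOut (mulSwap Q) ((Cc.chi W : OG 𝒢) ⊗ₜ t)) + nm Q ((Cc.chi W : OG 𝒢) ⊗ₜ t) =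
      nd Q ((Cc.chi W : OG 𝒢) ⊗ₜ LinearMap.mul' (Base 𝒢) Q t) +
        nm Q ((Cc.chi W : OG 𝒢) ⊗ₜ act (𝒢 := 𝒢) (Cc.chi (binv U)) t) := by
    intro t
    induction t using TensorProduct.induction_on with
    | zero => simp
    | add a b ha hb =>
      have := congrArg₂ (· + ·) ha hb
      simp only [map_add, TensorProduct.tmul_add] at this ⊢
      rw [add_add_add_comm, this, add_add_add_comm]
    | tmul p q =>
      rw [twOut_chi _ hU hW, mulSwap_tmul, nd_mul hU hW, LinearMap.mul'_apply, nd_mul hU hW,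
        act_tmul (isBis_binv hU)]
      abel
  change nd Q (H.h1d ((Cc.chi W : OG 𝒢) ⊗ₜ y)) + H.h0 (bd Q' (nd Q' ((Cc.chi W : OG 𝒢) ⊗ₜ y))) =
    nd Q (H.LE ((Cc.chi W : OG 𝒢) ⊗ₜ π.toLin y))
  rw [bd_nd hU hW, map_sub, h0_tmul, h0_tmul, h1d_tmul, LE_tmul, H.act_K _ (isBis_binv hU), map_add,
    map_add, ← H.mul'_K, add_sub_assoc', sub_eq_iff_eq_add, add_right_comm, h]
  abel

theorem nd_c0_mul (hU : IsBis 𝒢 U) (hW : W ≤ adCO U) (x y : Q) :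
    nd Q (H.c0 ((Cc.chi W : OG 𝒢) ⊗ₜ (x * y))) =
      nm Q ((outerCut C.toLeftCut C.toRightCut).tcut ((Cc.chi W : OG 𝒢) ⊗ₜ (x ⊗ₜ y))) +
      nm Q ((Cc.chi W : OG 𝒢) ⊗ₜ cut C.toRightCut C.toLeftCut
        (act (𝒢 := 𝒢) (Cc.chi (binv U)) y ⊗ₜ x)) := by
  rw [c0_tmul, outer_tmul, cut_tmul, C.act_r _ (isBis_binv hU), C.r_mul]
  induction C.r y using TensorProduct.induction_on with
  | zero => simp
  | add a b ha hb => simp only [map_add, TensorProduct.tmul_add, ha, hb]; abel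
  | tmul q η =>
    rw [LinearMap.rTensor_tmul, LinearMap.mul_apply', app_chi hU hW, C.l_mul, nd_mul hU hW,
      consL_tmul, outer_chi hU hW, act_tmul (isBis_binv hU), cutWith_tmul]

/-- The homotopy identity on forms `x dy`. -/
theorem htp_m (z : OG 𝒢 ⊗[Base 𝒢] (Q' ⊗[Base 𝒢] Q')) :
    nd Q (H.h1m z) + H.h0 (bd Q' (nm Q' z)) =
      H.LOm ((TensorProduct.map π.toLin π.toLin).lTensor (OG 𝒢) z) := by
  refine LinearMap.congr_fun (f := nd Q ∘ₗ H.h1m + H.h0 ∘ₗ bd Q' ∘ₗ nm Q')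
    (g := H.LOm ∘ₗ (TensorProduct.map π.toLin π.toLin).lTensor (OG 𝒢))
    (oTensor_ext (E := ⟨Q' ⊗[Base 𝒢] Q'⟩) fun U W hU hW e => ?_) z
  change Q' ⊗[Base 𝒢] Q' at e
  induction e with
  | zero => simp
  | add x y hx hy => rw [TensorProduct.tmul_add, map_add, map_add, hx, hy]
  | tmul x y =>
  change nd Q (H.h1m ((Cc.chi W : OG 𝒢) ⊗ₜ (x ⊗ₜ y))) +
    H.h0 (bd Q' (nm Q' ((Cc.chi W : OG 𝒢) ⊗ₜ (x ⊗ₜ y)))) =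
    H.LOm ((Cc.chi W : OG 𝒢) ⊗ₜ (π.toLin x ⊗ₜ π.toLin y))
  have hB := isBis_binv hU
  rw [bd_nm hU hW, map_sub, h0_tmul, h0_tmul, h1m_tmul, LOm_tmul, map_add, map_sub,
    H.nd_c0_mul hU hW, nd_mul hU hW, H.K_mul, H.K_mul, H.act_K _ hB, π.equivariant]
  have h1 : ∀ t, nm Q ((Cc.chi W : OG 𝒢) ⊗ₜ
      ((LinearMap.mul (Base 𝒢) Q).flip (π.toLin y)).lTensor Q t) =
      nm Q ((Cc.chi W : OG 𝒢) ⊗ₜ (LinearMap.mul' (Base 𝒢) Q t ⊗ₜ π.toLin y)) +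
      nm Q ((Cc.chi W : OG 𝒢) ⊗ₜ (LinearMap.mul (Base 𝒢) Q
        (act (𝒢 := 𝒢) (Cc.chi (binv U)) (π.toLin y))).rTensor Q t) := by
    intro t
    induction t using TensorProduct.induction_on with
    | zero => simp
    | add a b ha hb =>
      simp only [map_add, TensorProduct.tmul_add, TensorProduct.add_tmul, ha, hb]; abel
    | tmul p q =>
      rw [LinearMap.lTensor_tmul, LinearMap.flip_apply, LinearMap.mul_apply', nm_mul hU hW]; rfl
  have h2 : ∀ t, nd Q (twOut (mulSwap3 Q) ((Cc.chi W : OG 𝒢) ⊗ₜ consT (π.toLin x) t)) =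
      nm Q ((Cc.chi W : OG 𝒢) ⊗ₜ (π.toLin x ⊗ₜ LinearMap.mul' (Base 𝒢) Q t)) +
      nm Q ((Cc.chi W : OG 𝒢) ⊗ₜ ((LinearMap.mul (Base 𝒢) Q).flip (π.toLin x)).lTensor Q
        (act (𝒢 := 𝒢) (Cc.chi (binv U)) t)) -
      nm Q ((Cc.chi W : OG 𝒢) ⊗ₜ (LinearMap.mul (Base 𝒢) Q (π.toLin x)).rTensor Q t) := by
    intro t
    induction t using TensorProduct.induction_on with
    | zero => simp
    | add a b ha hb => simp only [map_add, TensorProduct.tmul_add, ha, hb]; abel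
    | tmul p q =>
      rw [consT_tmul, twOut_chi _ hU hW, mulSwap3_tmul, ← mul_assoc, nd_mul hU hW,
        LinearMap.mul'_apply, nm_mul hU hW (π.toLin x) p q, act_tmul hB, LinearMap.lTensor_tmul,
        LinearMap.rTensor_tmul, LinearMap.flip_apply, LinearMap.mul_apply', LinearMap.mul_apply']
      abel
  rw [h2, H.mul'_K]
  simp only [TensorProduct.tmul_add, TensorProduct.tmul_sub, map_add, map_sub]
  rw [h1, H.mul'_K]
  abel

theorem h1m_mul (hU : IsBis 𝒢 U) (hW : W ≤ adCO U) (x y z : Q') :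
    H.h1m ((Cc.chi W : OG 𝒢) ⊗ₜ (x ⊗ₜ (y * z))) = H.h1m ((Cc.chi W : OG 𝒢) ⊗ₜ ((x * y) ⊗ₜ z)) +
      H.h1m ((Cc.chi W : OG 𝒢) ⊗ₜ ((act (𝒢 := 𝒢) (Cc.chi (binv U)) z * x) ⊗ₜ y)) := by
  have hB := isBis_binv hU
  rw [h1m_tmul, h1m_tmul, h1m_tmul, H.K_mul, π.map_mul, π.map_mul, π.map_mul, π.equivariant]
  generalize π.toLin x = x
  have h1 : ∀ t, twOut (mulSwap3 Q) ((Cc.chi W : OG 𝒢) ⊗ₜ consT x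
      (((LinearMap.mul (Base 𝒢) Q).flip (π.toLin z)).lTensor Q t)) =
      twOut (mulSwap3 Q) ((Cc.chi W : OG 𝒢) ⊗ₜ
        consT (act (𝒢 := 𝒢) (Cc.chi (binv U)) (π.toLin z) * x) t) := by
    intro t
    induction t using TensorProduct.induction_on with
    | zero => simp
    | add a b ha hb => simp only [map_add, TensorProduct.tmul_add, ha, hb]
    | tmul p q =>
      rw [LinearMap.lTensor_tmul, consT_tmul, consT_tmul, twOut_chi _ hU hW, twOut_chi _ hU hW,
        mulSwap3_tmul, mulSwap3_tmul, LinearMap.flip_apply, LinearMap.mul_apply',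
        GAlgebra.act_mul hB, mul_assoc, mul_assoc]
  have h2 : ∀ t, twOut (mulSwap3 Q) ((Cc.chi W : OG 𝒢) ⊗ₜ consT x
      ((LinearMap.mul (Base 𝒢) Q (π.toLin y)).rTensor Q t)) =
      twOut (mulSwap3 Q) ((Cc.chi W : OG 𝒢) ⊗ₜ consT (x * π.toLin y) t) := by
    intro t
    induction t using TensorProduct.induction_on with
    | zero => simp
    | add a b ha hb => simp only [map_add, TensorProduct.tmul_add, ha, hb]
    | tmul p q =>
      rw [LinearMap.rTensor_tmul, consT_tmul, consT_tmul, twOut_chi _ hU hW, twOut_chi _ hU hW,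
        mulSwap3_tmul, mulSwap3_tmul, LinearMap.mul_apply', mul_assoc]
  have h3 : twOut (mulSwap3 Q) ((Cc.chi W : OG 𝒢) ⊗ₜ consT x
      (cut C.toRightCut C.toLeftCut (π.toLin y ⊗ₜ π.toLin z))) =
      H.c0 ((Cc.chi W : OG 𝒢) ⊗ₜ
        (act (𝒢 := 𝒢) (Cc.chi (binv U)) (π.toLin z) * x * π.toLin y)) := by
    rw [cut_tmul, c0_tmul, C.r_mul]
    induction C.r (π.toLin y) using TensorProduct.induction_on with
    | zero => simp
    | add a b ha hb => simp only [map_add, TensorProduct.tmul_add, ha, hb]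
    | tmul q η =>
      rw [cutWith_tmul, consT_tmul, twOut_chi _ hU hW, mulSwap3_tmul, LinearMap.rTensor_tmul,
        app_chi hU hW, LinearMap.mul_apply', C.l_mul, C.l_mul, C.act_l _ hB, mul_assoc]
  simp only [TensorProduct.tmul_add, TensorProduct.tmul_sub, map_add, map_sub]
  rw [h1, h2, h3, consT_tmul, twOut_chi _ hU hW, mulSwap3_tmul, mul_assoc x, mul_assoc _ x]
  abel

theorem h1d_mul (hU : IsBis 𝒢 U) (hW : W ≤ adCO U) (y z : Q') :
    H.h1d ((Cc.chi W : OG 𝒢) ⊗ₜ (y * z)) = H.h1m ((Cc.chi W : OG 𝒢) ⊗ₜ (y ⊗ₜ z)) +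
      H.h1m ((Cc.chi W : OG 𝒢) ⊗ₜ (act (𝒢 := 𝒢) (Cc.chi (binv U)) z ⊗ₜ y)) := by
  have hB := isBis_binv hU
  rw [h1m_tmul, h1m_tmul, h1d_tmul, H.K_mul, π.map_mul, π.equivariant]
  have h1 : ∀ t, twOut (mulSwap Q) ((Cc.chi W : OG 𝒢) ⊗ₜ
      (((LinearMap.mul (Base 𝒢) Q).flip (π.toLin z)).lTensor Q t)) =
      twOut (mulSwap3 Q) ((Cc.chi W : OG 𝒢) ⊗ₜ
        consT (act (𝒢 := 𝒢) (Cc.chi (binv U)) (π.toLin z)) t) := by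
    intro t
    induction t using TensorProduct.induction_on with
    | zero => simp
    | add a b ha hb => simp only [map_add, TensorProduct.tmul_add, ha, hb]
    | tmul p q =>
      rw [LinearMap.lTensor_tmul, consT_tmul, twOut_chi _ hU hW, twOut_chi _ hU hW,
        mulSwap_tmul, mulSwap3_tmul, LinearMap.flip_apply, LinearMap.mul_apply',
        GAlgebra.act_mul hB, mul_assoc]
  have h2 : ∀ t, twOut (mulSwap Q) ((Cc.chi W : OG 𝒢) ⊗ₜ
      ((LinearMap.mul (Base 𝒢) Q (π.toLin y)).rTensor Q t)) =
      twOut (mulSwap3 Q) ((Cc.chi W : OG 𝒢) ⊗ₜ consT (π.toLin y) t) := by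
    intro t
    induction t using TensorProduct.induction_on with
    | zero => simp
    | add a b ha hb => simp only [map_add, TensorProduct.tmul_add, ha, hb]
    | tmul p q =>
      rw [LinearMap.rTensor_tmul, consT_tmul, twOut_chi _ hU hW, twOut_chi _ hU hW,
        mulSwap_tmul, mulSwap3_tmul, LinearMap.mul_apply']
  have h3 : twOut (mulSwap Q) ((Cc.chi W : OG 𝒢) ⊗ₜ
      (cut C.toRightCut C.toLeftCut (π.toLin y ⊗ₜ π.toLin z))) =
      H.c0 ((Cc.chi W : OG 𝒢) ⊗ₜ (act (𝒢 := 𝒢) (Cc.chi (binv U)) (π.toLin z) * π.toLin y)) := by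
    rw [cut_tmul, c0_tmul, C.r_mul]
    induction C.r (π.toLin y) using TensorProduct.induction_on with
    | zero => simp
    | add a b ha hb => simp only [map_add, TensorProduct.tmul_add, ha, hb]
    | tmul q η =>
      rw [cutWith_tmul, twOut_chi _ hU hW, mulSwap_tmul, LinearMap.rTensor_tmul,
        app_chi hU hW, LinearMap.mul_apply', C.l_mul, C.act_l _ hB]
  simp only [TensorProduct.tmul_add, TensorProduct.tmul_sub, map_add, map_sub]
  rw [h1, h2, h3, twOut_chi _ hU hW, mulSwap_tmul]
  abel

theorem h1_bG (t : OG 𝒢 ⊗[Base 𝒢] Om Q' 2) : preXO H.h1m H.h1d (bG Q' 1 t) = 0 :=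
  preXO_bG _ _ (fun _ _ hU hW => H.h1m_mul hU hW) (fun _ _ hU hW => H.h1d_mul hU hW) t

/-- The homotopy from the odd to the even part. -/
def h1 : XOc Q' →ₗ[Base 𝒢] OG 𝒢 ⊗[Base 𝒢] Q := liftXO H.h1m H.h1d H.h1_bG

theorem h1_nm (t) : H.h1 (nm Q' t) = H.h1m t := liftXO_nm _ _ _ t

theorem h1_nd (t) : H.h1 (nd Q' t) = H.h1d t := liftXO_nd _ _ _ t

end CutHtp

section naturality

variable {E : Type v} [AddCommGroup E] [Module ℂ E] [Module (Base 𝒢) E]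
  [IsScalarTower ℂ (Base 𝒢) E] [GModule 𝒢 E] {F : Type w} [AddCommGroup F] [Module ℂ F]
  [Module (Base 𝒢) F] [IsScalarTower ℂ (Base 𝒢) F] [GModule 𝒢 F]
  {P : Type y} [AddCommGroup P] [Module ℂ P]
  [Module (Base 𝒢) P] [IsScalarTower ℂ (Base 𝒢) P] [GModule 𝒢 P]

theorem twOn_lTensor (u : E →ₗ[Base 𝒢] P)
    (h : ∀ U, IsBis 𝒢 U → ∀ m, u (act (𝒢 := 𝒢) (Cc.chi U) m) = act (𝒢 := 𝒢) (Cc.chi U) (u m))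
    (z : OG 𝒢 ⊗[Base 𝒢] E) : twOn P (u.lTensor (OG 𝒢) z) = u.lTensor (OG 𝒢) (twOn E z) := by
  refine LinearMap.congr_fun (f := twOn P ∘ₗ u.lTensor (OG 𝒢)) (g := u.lTensor (OG 𝒢) ∘ₗ twOn E)
    (oTensor_ext (E := ⟨E⟩) fun U W hU hW e => ?_) z
  change E at e
  rw [LinearMap.comp_apply, LinearMap.comp_apply, LinearMap.lTensor_tmul, twOn_chi hU hW,
    twOn_chi hU hW, LinearMap.lTensor_tmul, h _ (isBis_binv hU)]

theorem twOn_twOut (u : E ⊗[Base 𝒢] F →ₗ[Base 𝒢] P)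
    (h : ∀ U, IsBis 𝒢 U → ∀ m n, u (act (𝒢 := 𝒢) (Cc.chi U) m ⊗ₜ act (𝒢 := 𝒢) (Cc.chi U) n) =
      act (𝒢 := 𝒢) (Cc.chi U) (u (m ⊗ₜ n)))
    (z : OG 𝒢 ⊗[Base 𝒢] (E ⊗[Base 𝒢] F)) : twOn P (twOut u z) = twOut u (twOn (E ⊗[Base 𝒢] F) z) := by
  refine LinearMap.congr_fun (f := twOn P ∘ₗ twOut u) (g := twOut u ∘ₗ twOn (E ⊗[Base 𝒢] F))
    (oTensor_ext (E := ⟨E ⊗[Base 𝒢] F⟩) fun U W hU hW e => ?_) z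
  change E ⊗[Base 𝒢] F at e
  induction e with
  | zero => simp
  | add x y hx hy => rw [TensorProduct.tmul_add, map_add, map_add, hx, hy]
  | tmul x y =>
    rw [LinearMap.comp_apply, LinearMap.comp_apply, twOut_chi u hU hW, twOn_chi hU hW,
      twOn_chi hU hW, act_tmul (isBis_binv hU), twOut_chi u hU hW, h _ (isBis_binv hU)]

theorem twOn_tcut {χ : Cutoff 𝒢} (D : BiCut χ E) (z : OG 𝒢 ⊗[Base 𝒢] E) :
    twOn E (D.tcut z) = D.tcut (twOn E z) := by
  rw [BiCut.tcut, LinearMap.comp_apply, LinearMap.comp_apply,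
    twOn_twOut _ fun U hU m n => D.act_l U hU n m, twOn_lTensor _ D.act_r]

end naturality

section XOmap

variable {Q : GAlg.{u₁, u₂, v} 𝒢} {Q₂ : GAlg.{u₁, u₂, w} 𝒢} (φ : GAlgHom Q Q₂)

/-- The map induced by a homomorphism on the odd part of the X-complex. -/
def xoMap : XOc Q →ₗ[Base 𝒢] XOc Q₂ := (XOmap φ).1

theorem xoMap_nm (t) : xoMap φ (nm Q t) =
    nm Q₂ ((TensorProduct.map φ.toLin φ.toLin).lTensor (OG 𝒢) t) := by
  refine LinearMap.congr_fun (f := xoMap φ ∘ₗ nm Q)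
    (g := nm Q₂ ∘ₗ (TensorProduct.map φ.toLin φ.toLin).lTensor (OG 𝒢))
    (TensorProduct.ext' fun f t => ?_) t
  induction t with
  | zero => simp
  | add x y hx hy => rw [TensorProduct.tmul_add, map_add, map_add, hx, hy]
  | tmul x y => exact congrArg (fun ω => nat1 Q₂ (f ⊗ₜ ω)) (omMap_mulD φ 0 (io Q x) y)

theorem xoMap_nd (t) : xoMap φ (nd Q t) = nd Q₂ (φ.toLin.lTensor (OG 𝒢) t) := by
  refine LinearMap.congr_fun (f := xoMap φ ∘ₗ nd Q) (g := nd Q₂ ∘ₗ φ.toLin.lTensor (OG 𝒢))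
    (TensorProduct.ext' fun f y => ?_) t
  exact congrArg (fun ω => nat1 Q₂ (f ⊗ₜ ω)) (omMap_dn φ 0 (io Q y))

theorem bd_xoMap (m : XOc Q) : bd Q₂ (xoMap φ m) = φ.toLin.lTensor (OG 𝒢) (bd Q m) :=
  LinearMap.congr_fun (congrArg Subtype.val (Xd1_map φ)) m

theorem bd_nd' (z : OG 𝒢 ⊗[Base 𝒢] Q) : bd Q (nd Q z) = z - twOn Q z := by
  refine LinearMap.congr_fun (f := bd Q ∘ₗ nd Q) (g := LinearMap.id - twOn Q)
    (oTensor_ext (E := ⟨Q⟩) fun U W hU hW e => ?_) z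
  change Q at e
  rw [LinearMap.comp_apply, bd_nd hU hW, LinearMap.sub_apply, twOn_chi hU hW]; rfl

theorem nd_bd_nm (z) : nd Q (bd Q (nm Q z)) = nm Q z - nm Q (twOn (Q ⊗[Base 𝒢] Q) z) := by
  refine LinearMap.congr_fun (f := nd Q ∘ₗ bd Q ∘ₗ nm Q)
    (g := nm Q - nm Q ∘ₗ twOn (Q ⊗[Base 𝒢] Q))
    (oTensor_ext (E := ⟨Q ⊗[Base 𝒢] Q⟩) fun U W hU hW e => ?_) z
  change Q ⊗[Base 𝒢] Q at e
  induction e with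
  | zero => simp
  | add x y hx hy => rw [TensorProduct.tmul_add, map_add, map_add, hx, hy]
  | tmul x y =>
    rw [LinearMap.comp_apply, LinearMap.comp_apply, LinearMap.sub_apply, LinearMap.comp_apply,
      bd_nm hU hW, twOn_chi hU hW, map_sub, nd_mul hU hW, nd_mul hU hW, act_tmul (isBis_binv hU)]
    abel

theorem xoMap_surjective (h : Function.Surjective φ.toLin) : Function.Surjective (xoMap φ) := by
  rw [← LinearMap.range_eq_top, ← Submodule.ker_mkQ (LinearMap.range (xoMap φ)),
    LinearMap.ker_eq_top]
  refine XO_ext (fun t => ?_) fun t => ?_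
  · obtain ⟨t, rfl⟩ := LinearMap.lTensor_surjective (OG 𝒢) (TensorProduct.map_surjective h h) t
    exact (Submodule.Quotient.mk_eq_zero _).mpr ⟨nm Q t, xoMap_nm φ t⟩
  · obtain ⟨t, rfl⟩ := LinearMap.lTensor_surjective (OG 𝒢) h t
    exact (Submodule.Quotient.mk_eq_zero _).mpr ⟨nd Q t, xoMap_nd φ t⟩

end XOmap

namespace CutHtp

variable {χ : Cutoff 𝒢} {Q' Q : GAlg.{u₁, u₂, v} 𝒢} {C : CutAlg χ Q} {π : GAlgHom Q' Q}
  (H : CutHtp C π)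

theorem mulSwap_equivariant : ∀ U, IsBis 𝒢 U → ∀ m n : Q,
    mulSwap Q (act (𝒢 := 𝒢) (Cc.chi U) m ⊗ₜ act (𝒢 := 𝒢) (Cc.chi U) n) =
      act (𝒢 := 𝒢) (Cc.chi U) (mulSwap Q (m ⊗ₜ n)) := fun U hU m n => by
  rw [mulSwap_tmul, mulSwap_tmul, GAlgebra.act_mul hU]

theorem mulSwap3_equivariant : ∀ U, IsBis 𝒢 U → ∀ (m : Q ⊗[Base 𝒢] Q) (n : Q),
    mulSwap3 Q (act (𝒢 := 𝒢) (Cc.chi U) m ⊗ₜ act (𝒢 := 𝒢) (Cc.chi U) n) =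
      act (𝒢 := 𝒢) (Cc.chi U) (mulSwap3 Q (m ⊗ₜ n)) := fun U hU m n => by
  induction m with
  | zero => simp
  | add x y hx hy => simp only [map_add, TensorProduct.add_tmul, hx, hy]
  | tmul x y =>
    rw [act_tmul hU, mulSwap3_tmul, mulSwap3_tmul, GAlgebra.act_mul hU, GAlgebra.act_mul hU]

theorem consK_equivariant : ∀ U, IsBis 𝒢 U → ∀ m : Q' ⊗[Base 𝒢] Q',
    ((TensorProduct.assoc (Base 𝒢) Q Q Q).symm.toLinearMap ∘ₗ TensorProduct.map π.toLin H.K)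
      (act (𝒢 := 𝒢) (Cc.chi U) m) = act (𝒢 := 𝒢) (Cc.chi U)
    (((TensorProduct.assoc (Base 𝒢) Q Q Q).symm.toLinearMap ∘ₗ TensorProduct.map π.toLin H.K) m) :=
  fun U hU m => by
  induction m with
  | zero => simp
  | add x y hx hy => simp only [map_add, hx, hy]
  | tmul x y =>
    rw [act_tmul hU, LinearMap.comp_apply, LinearMap.comp_apply, TensorProduct.map_tmul,
      TensorProduct.map_tmul, H.act_K U hU, π.equivariant]
    induction H.K y with
    | zero => simp
    | add x y hx hy => simp only [map_add, TensorProduct.tmul_add, hx, hy]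
    | tmul p q =>
      rw [act_tmul hU]
      change (_ ⊗ₜ[Base 𝒢] _) ⊗ₜ[Base 𝒢] _ = act (𝒢 := 𝒢) (Cc.chi U) ((_ ⊗ₜ[Base 𝒢] _) ⊗ₜ[Base 𝒢] _)
      rw [act_tmul hU, act_tmul hU]

theorem piMul_equivariant (π : GAlgHom Q' Q) : ∀ U, IsBis 𝒢 U → ∀ m : Q' ⊗[Base 𝒢] Q',
    (π.toLin ∘ₗ LinearMap.mul' (Base 𝒢) Q') (act (𝒢 := 𝒢) (Cc.chi U) m) =
      act (𝒢 := 𝒢) (Cc.chi U) ((π.toLin ∘ₗ LinearMap.mul' (Base 𝒢) Q') m) := fun U hU m => by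
  rw [LinearMap.comp_apply, GAlgebra.mul_equivariant, π.equivariant]; rfl

theorem id_mem (E : GMod.{u₁, u₂, w} 𝒢) :
    (LinearMap.id : OG 𝒢 ⊗[Base 𝒢] E →ₗ[Base 𝒢] OG 𝒢 ⊗[Base 𝒢] E) ∈
      AYDHom (oTensor E) (oTensor E) := (AYD.id _).2

theorem c0_mem : H.c0 ∈ AYDHom (oTensor (⟨Q⟩ : GMod 𝒢)) (oTensor (⟨Q⟩ : GMod 𝒢)) :=
  C.biCut.tcut_mem

theorem LE_mem : H.LE ∈ AYDHom (oTensor (⟨Q⟩ : GMod 𝒢)) (oTensor (⟨Q⟩ : GMod 𝒢)) :=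
  add_mem (lTensor_mem H.L H.act_L) (sub_mem H.c0_mem (id_mem _))

theorem act_rTensor_alg {U : CompactOpens 𝒢.Arr} (hU : IsBis 𝒢 U) {L : Q →ₗ[Base 𝒢] Q}
    (h : ∀ x, L (act (Cc.chi U) x) = act (𝒢 := 𝒢) (Cc.chi U) (L x)) (m : Q ⊗[Base 𝒢] Q) :
    L.rTensor Q (act (𝒢 := 𝒢) (Cc.chi U) m) = act (𝒢 := 𝒢) (Cc.chi U) (L.rTensor Q m) := by
  induction m with
  | zero => simp
  | add x y hx hy => simp only [map_add, hx, hy]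
  | tmul x y => rw [act_tmul hU, LinearMap.rTensor_tmul, LinearMap.rTensor_tmul, h, act_tmul hU]

theorem act_lTensor_alg {U : CompactOpens 𝒢.Arr} (hU : IsBis 𝒢 U) {L : Q →ₗ[Base 𝒢] Q}
    (h : ∀ x, L (act (Cc.chi U) x) = act (𝒢 := 𝒢) (Cc.chi U) (L x)) (m : Q ⊗[Base 𝒢] Q) :
    L.lTensor Q (act (𝒢 := 𝒢) (Cc.chi U) m) = act (𝒢 := 𝒢) (Cc.chi U) (L.lTensor Q m) := by
  induction m with
  | zero => simp
  | add x y hx hy => simp only [map_add, hx, hy]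
  | tmul x y => rw [act_tmul hU, LinearMap.lTensor_tmul, LinearMap.lTensor_tmul, h, act_tmul hU]

theorem LOm_mem : H.LOm ∈ AYDHom (oTensor (⟨Q ⊗[Base 𝒢] Q⟩ : GMod 𝒢)) (XO Q) :=
  (AYD.comp ⟨_, nm_mem Q⟩ ⟨_, add_mem (add_mem (add_mem
    (lTensor_mem _ fun U hU => act_rTensor_alg hU (H.act_L U hU))
    (lTensor_mem _ fun U hU => act_lTensor_alg hU (H.act_L U hU)))
    (sub_mem (lTensor_mem (cut C.toRightCut C.toLeftCut) fun _ hU => act_cut _ _ hU) (id_mem _)))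
    (sub_mem (BiCut.tcut_mem _) (id_mem _))⟩).2

theorem h0_mem : H.h0 ∈ AYDHom (oTensor (⟨Q'⟩ : GMod 𝒢)) (XO Q) :=
  (AYD.comp ⟨_, nm_mem Q⟩ ⟨_, lTensor_mem H.K H.act_K⟩).2

theorem h1d_mem : H.h1d ∈ AYDHom (oTensor (⟨Q'⟩ : GMod 𝒢)) (oTensor (⟨Q⟩ : GMod 𝒢)) :=
  add_mem (AYD.comp ⟨_, twOut_mem (mulSwap Q) mulSwap_equivariant⟩ ⟨_, lTensor_mem H.K H.act_K⟩).2
    (AYD.comp ⟨_, sub_mem H.c0_mem (id_mem _)⟩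
      ⟨_, lTensor_mem π.toLin fun _ _ m => π.equivariant _ m⟩).2

theorem h1m_mem :
    H.h1m ∈ AYDHom (oTensor (⟨Q' ⊗[Base 𝒢] Q'⟩ : GMod 𝒢)) (oTensor (⟨Q⟩ : GMod 𝒢)) :=
  add_mem (AYD.comp ⟨_, twOut_mem (mulSwap3 Q) mulSwap3_equivariant⟩
    ⟨_, lTensor_mem _ H.consK_equivariant⟩).2
    (AYD.comp ⟨_, sub_mem H.c0_mem (id_mem _)⟩ ⟨_, lTensor_mem _ (piMul_equivariant π)⟩).2

theorem h1_mem : H.h1 ∈ AYDHom (XO Q') (oTensor (⟨Q⟩ : GMod 𝒢)) :=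
  liftXO_mem (N := oTensor (⟨Q⟩ : GMod 𝒢)) H.h1m_mem H.h1d_mem H.h1_bG

theorem twOn_h1d (z) : twOn Q (H.h1d z) = H.h1d (twOn Q' z) := by
  rw [h1d, LinearMap.add_apply, LinearMap.add_apply, LinearMap.comp_apply, LinearMap.comp_apply,
    LinearMap.comp_apply, LinearMap.comp_apply, LinearMap.sub_apply, LinearMap.sub_apply, map_add,
    map_sub, twOn_twOut _ mulSwap_equivariant, twOn_lTensor _ H.act_K, c0, twOn_tcut,
    LinearMap.id_apply, LinearMap.id_apply, twOn_lTensor _ fun _ _ m => π.equivariant _ m]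

theorem twOn_h1m (z) : twOn Q (H.h1m z) = H.h1m (twOn (Q' ⊗[Base 𝒢] Q') z) := by
  rw [h1m, LinearMap.add_apply, LinearMap.add_apply, LinearMap.comp_apply, LinearMap.comp_apply,
    LinearMap.comp_apply, LinearMap.comp_apply, LinearMap.sub_apply, LinearMap.sub_apply, map_add,
    map_sub, twOn_twOut _ mulSwap3_equivariant, twOn_lTensor _ H.consK_equivariant, c0, twOn_tcut,
    LinearMap.id_apply, LinearMap.id_apply, twOn_lTensor _ (piMul_equivariant π)]

theorem h1_nd_bd (m : XOc Q') : H.h1 (nd Q' (bd Q' m)) = bd Q (nd Q (H.h1 m)) := by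
  refine LinearMap.congr_fun (f := H.h1 ∘ₗ nd Q' ∘ₗ bd Q') (g := bd Q ∘ₗ nd Q ∘ₗ H.h1)
    (XO_ext (fun z => ?_) fun z => ?_) m
  · simp only [LinearMap.comp_apply]
    rw [nd_bd_nm, map_sub, h1_nm, h1_nm, bd_nd', twOn_h1m]
  · simp only [LinearMap.comp_apply]
    rw [bd_nd', map_sub, map_sub, h1_nd, h1_nd, bd_nd', twOn_h1d]

variable (hπ : Function.Surjective π.toLin)
include hπ

theorem LO_bG (t : OG 𝒢 ⊗[Base 𝒢] Om Q 2) : preXO H.LOm (nd Q ∘ₗ H.LE) (bG Q 1 t) = 0 := by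
  refine preXO_bG _ _ (fun U W hU hW x y z => ?_) (fun U W hU hW y z => ?_) t
  · obtain ⟨x, rfl⟩ := hπ x
    obtain ⟨y, rfl⟩ := hπ y
    obtain ⟨z, rfl⟩ := hπ z
    have h := fun a b : Q' => (H.htp_m ((Cc.chi W : OG 𝒢) ⊗ₜ (a ⊗ₜ b))).symm
    simp only [LinearMap.lTensor_tmul, TensorProduct.map_tmul] at h
    rw [← π.map_mul, ← π.map_mul, ← π.equivariant, ← π.map_mul, h, h, h, ← h1_nm, nm_mul hU hW,
      map_add, map_add, map_add, map_add, h1_nm, h1_nm]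
    abel
  · obtain ⟨y, rfl⟩ := hπ y
    obtain ⟨z, rfl⟩ := hπ z
    have h := fun a b : Q' => (H.htp_m ((Cc.chi W : OG 𝒢) ⊗ₜ (a ⊗ₜ b))).symm
    have h' := fun a : Q' => (H.htp_d ((Cc.chi W : OG 𝒢) ⊗ₜ a)).symm
    simp only [LinearMap.lTensor_tmul, TensorProduct.map_tmul] at h h'
    rw [← π.map_mul, ← π.equivariant, h, h, LinearMap.comp_apply, h', ← h1_nd, nd_mul hU hW,
      map_add, map_add, map_add, map_add, h1_nm, h1_nm]
    abel

/-- The cut operator on the odd part. -/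
def LO : XOc Q →ₗ[Base 𝒢] XOc Q := liftXO H.LOm (nd Q ∘ₗ H.LE) (H.LO_bG hπ)

theorem LO_mem : H.LO hπ ∈ AYDHom (XO Q) (XO Q) :=
  liftXO_mem (N := XO Q) H.LOm_mem (AYD.comp ⟨_, nd_mem Q⟩ ⟨_, H.LE_mem⟩).2 (H.LO_bG hπ)

theorem LO_nm (t) : H.LO hπ (nm Q t) = H.LOm t := liftXO_nm _ _ _ t

theorem LO_nd (t) : H.LO hπ (nd Q t) = nd Q (H.LE t) := liftXO_nd _ _ _ t

theorem LO_xoMap (m : XOc Q') : H.LO hπ (xoMap π m) = nd Q (H.h1 m) + H.h0 (bd Q' m) := by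
  refine LinearMap.congr_fun (f := H.LO hπ ∘ₗ xoMap π) (g := nd Q ∘ₗ H.h1 + H.h0 ∘ₗ bd Q')
    (XO_ext (fun z => ?_) fun z => ?_) m
  · simp only [LinearMap.comp_apply, LinearMap.add_apply]
    rw [xoMap_nm, LO_nm, h1_nm, htp_m]
  · simp only [LinearMap.comp_apply, LinearMap.add_apply]
    rw [xoMap_nd, LO_nd, h1_nd, htp_d]

theorem LE_lTensor (z : OG 𝒢 ⊗[Base 𝒢] Q') :
    H.LE (π.toLin.lTensor (OG 𝒢) z) = bd Q (H.h0 z) + H.h1 (nd Q' z) := by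
  rw [h1_nd, htp_even]

theorem bd_LO (m : XOc Q) : bd Q (H.LO hπ m) = H.LE (bd Q m) := by
  obtain ⟨m, rfl⟩ := xoMap_surjective π hπ m
  rw [LO_xoMap, bd_xoMap, H.LE_lTensor hπ, map_add, ← h1_nd_bd, add_comm]

end CutHtp

namespace CutHtp

variable {χ : Cutoff 𝒢} {Q' Q : GAlg.{u₁, u₂, v} 𝒢} {C : CutAlg χ Q} {π : GAlgHom Q' Q}
  {P' P : GAlg.{u₁, u₂, v} 𝒢} {D : CutAlg χ P} {ρ : GAlgHom P' P}

/-- Compatibility of contraction data with homomorphisms. -/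
structure Compat (H : CutHtp C π) (H' : CutHtp D ρ) (φ' : GAlgHom Q' P') (φ : GAlgHom Q P) :
    Prop where
  cut : C.Compat D φ
  comm : ∀ x, φ.toLin (π.toLin x) = ρ.toLin (φ'.toLin x)
  K : ∀ x, TensorProduct.map φ.toLin φ.toLin (H.K x) = H'.K (φ'.toLin x)

variable {H : CutHtp C π} {H' : CutHtp D ρ} {φ' : GAlgHom Q' P'} {φ : GAlgHom Q P}
  (hc : H.Compat H' φ' φ)

theorem Compat.c0_map (hc : H.Compat H' φ' φ) (z : OG 𝒢 ⊗[Base 𝒢] Q) :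
    φ.toLin.lTensor (OG 𝒢) (H.c0 z) = H'.c0 (φ.toLin.lTensor (OG 𝒢) z) := by
  refine LinearMap.congr_fun (f := φ.toLin.lTensor (OG 𝒢) ∘ₗ H.c0)
    (g := H'.c0 ∘ₗ φ.toLin.lTensor (OG 𝒢)) (oTensor_ext (E := ⟨Q⟩) fun U W hU hW x => ?_) z
  change Q at x
  simp only [LinearMap.comp_apply]
  rw [LinearMap.lTensor_tmul, c0_tmul, c0_tmul, hc.cut.r]
  induction C.r x using TensorProduct.induction_on with
  | zero => simp
  | add a b ha hb => simp only [map_add, TensorProduct.tmul_add, ha, hb]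
  | tmul q η =>
    rw [LinearMap.rTensor_tmul, app_chi hU hW, app_chi hU hW, LinearMap.lTensor_tmul, hc.cut.l]

include hc

theorem h0_map (z : OG 𝒢 ⊗[Base 𝒢] Q') :
    xoMap φ (H.h0 z) = H'.h0 (φ'.toLin.lTensor (OG 𝒢) z) := by
  rw [h0, h0, LinearMap.comp_apply, xoMap_nm, LinearMap.comp_apply]
  congr 1
  rw [← LinearMap.comp_apply, ← LinearMap.comp_apply, ← LinearMap.lTensor_comp,
    ← LinearMap.lTensor_comp]
  congr 2
  exact LinearMap.ext hc.K

theorem h1d_map (z : OG 𝒢 ⊗[Base 𝒢] Q') :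
    φ.toLin.lTensor (OG 𝒢) (H.h1d z) = H'.h1d (φ'.toLin.lTensor (OG 𝒢) z) := by
  refine LinearMap.congr_fun (f := φ.toLin.lTensor (OG 𝒢) ∘ₗ H.h1d)
    (g := H'.h1d ∘ₗ φ'.toLin.lTensor (OG 𝒢)) (oTensor_ext (E := ⟨Q'⟩) fun U W hU hW x => ?_) z
  change Q' at x
  simp only [LinearMap.comp_apply]
  rw [LinearMap.lTensor_tmul, h1d_tmul, h1d_tmul, map_add, map_sub, hc.c0_map,
    LinearMap.lTensor_tmul, hc.comm, ← hc.K]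
  congr 1
  induction H.K x using TensorProduct.induction_on with
  | zero => simp
  | add a b ha hb => simp only [map_add, TensorProduct.tmul_add, ha, hb]
  | tmul p q =>
    rw [TensorProduct.map_tmul, twOut_chi _ hU hW, twOut_chi _ hU hW, LinearMap.lTensor_tmul,
      mulSwap_tmul, mulSwap_tmul, φ.map_mul, φ.equivariant]

theorem h1m_map (z : OG 𝒢 ⊗[Base 𝒢] (Q' ⊗[Base 𝒢] Q')) :
    φ.toLin.lTensor (OG 𝒢) (H.h1m z) =
      H'.h1m ((TensorProduct.map φ'.toLin φ'.toLin).lTensor (OG 𝒢) z) := by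
  refine LinearMap.congr_fun (f := φ.toLin.lTensor (OG 𝒢) ∘ₗ H.h1m)
    (g := H'.h1m ∘ₗ (TensorProduct.map φ'.toLin φ'.toLin).lTensor (OG 𝒢))
    (oTensor_ext (E := ⟨Q' ⊗[Base 𝒢] Q'⟩) fun U W hU hW e => ?_) z
  change Q' ⊗[Base 𝒢] Q' at e
  induction e with
  | zero => simp
  | add x y hx hy => rw [TensorProduct.tmul_add, map_add, map_add, hx, hy]
  | tmul x y =>
  simp only [LinearMap.comp_apply]
  rw [LinearMap.lTensor_tmul, TensorProduct.map_tmul, h1m_tmul, h1m_tmul, map_add, map_sub,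
    hc.c0_map, LinearMap.lTensor_tmul, φ.map_mul, hc.comm, hc.comm, ← hc.K, ← hc.comm]
  congr 1
  induction H.K y using TensorProduct.induction_on with
  | zero => simp
  | add a b ha hb => simp only [map_add, TensorProduct.tmul_add, ha, hb]
  | tmul p q =>
    rw [TensorProduct.map_tmul, consT_tmul, consT_tmul, twOut_chi _ hU hW, twOut_chi _ hU hW,
      LinearMap.lTensor_tmul, mulSwap3_tmul, mulSwap3_tmul, φ.map_mul, φ.map_mul, φ.equivariant]

theorem h1_map (m : XOc Q') : φ.toLin.lTensor (OG 𝒢) (H.h1 m) = H'.h1 (xoMap φ' m) := by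
  refine LinearMap.congr_fun (f := φ.toLin.lTensor (OG 𝒢) ∘ₗ H.h1) (g := H'.h1 ∘ₗ xoMap φ')
    (XO_ext (fun z => ?_) fun z => ?_) m
  · simp only [LinearMap.comp_apply]
    rw [xoMap_nm, h1_nm, h1_nm, h1m_map hc]
  · simp only [LinearMap.comp_apply]
    rw [xoMap_nd, h1_nd, h1_nd, h1d_map hc]

theorem xoMap_comm (m : XOc Q') : xoMap φ (xoMap π m) = xoMap ρ (xoMap φ' m) := by
  have h1 := XOmap_comp π φ (GAlgHom.comp φ π) fun _ => rfl
  have h2 := XOmap_comp φ' ρ (GAlgHom.comp φ π) fun x => (hc.comm x).symm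
  exact LinearMap.congr_fun (congrArg Subtype.val (h1.trans h2.symm)) m

theorem lTensor_comm (z : OG 𝒢 ⊗[Base 𝒢] Q') :
    φ.toLin.lTensor (OG 𝒢) (π.toLin.lTensor (OG 𝒢) z) =
      ρ.toLin.lTensor (OG 𝒢) (φ'.toLin.lTensor (OG 𝒢) z) := by
  rw [← LinearMap.comp_apply, ← LinearMap.comp_apply, ← LinearMap.lTensor_comp,
    ← LinearMap.lTensor_comp]
  congr 2
  exact LinearMap.ext hc.comm

theorem LE_map (hπ : Function.Surjective π.toLin) (hρ : Function.Surjective ρ.toLin)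
    (z : OG 𝒢 ⊗[Base 𝒢] Q) :
    φ.toLin.lTensor (OG 𝒢) (H.LE z) = H'.LE (φ.toLin.lTensor (OG 𝒢) z) := by
  obtain ⟨z, rfl⟩ := LinearMap.lTensor_surjective (OG 𝒢) hπ z
  rw [H.LE_lTensor hπ, lTensor_comm hc, H'.LE_lTensor hρ, map_add, h1_map hc, ← bd_xoMap,
    h0_map hc, xoMap_nd]

theorem LO_map (hπ : Function.Surjective π.toLin) (hρ : Function.Surjective ρ.toLin) (m : XOc Q) :
    xoMap φ (H.LO hπ m) = H'.LO hρ (xoMap φ m) := by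
  obtain ⟨m, rfl⟩ := xoMap_surjective π hπ m
  rw [LO_xoMap, xoMap_comm hc, LO_xoMap, map_add, xoMap_nd, h1_map hc, h0_map hc, bd_xoMap]

end CutHtp

namespace Forms

variable {χ : Cutoff 𝒢} {B : GAlg.{u₁, u₂, v} 𝒢}

theorem TAproj_surjective {N M : ℕ} (h : N ≤ M) : Function.Surjective (TAproj B h).toLin := by
  intro x
  refine TA_ind' (p := fun x => ∃ y, (TAproj B h).toLin y = x) ⟨0, map_zero _⟩ ?_
    (fun a => ⟨_, TAproj_gen h a⟩) ?_ x
  · rintro _ _ ⟨x, rfl⟩ ⟨y, rfl⟩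
    exact ⟨x - y, map_sub _ _ _⟩
  · rintro _ a ⟨x, rfl⟩
    exact ⟨x * gen B M a, by rw [(TAproj B h).map_mul, TAproj_gen]⟩

variable {C : CutAlg χ B} (hC : ∀ x y, C.cmul x y = x * y)

/-- The contraction data of the truncated tensor algebras. -/
def tHtp (N : ℕ) : CutHtp (tCut C N) (dproj B N) where
  K := tK C N
  L := tL hC N
  act_K _ hU := act_tK C hU
  act_L _ hU := act_tL hC hU
  K_mul := tK_mul C
  mul'_K := mul'_tK hC

theorem tHtp_compat {N M : ℕ} (h : N ≤ M) :
    (tHtp hC M).Compat (tHtp hC N) (TAproj B (by omega)) (TAproj B h) where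
  cut := tCut_compat C h
  comm x := by rw [TAproj_TAproj, TAproj_TAproj]
  K x := TAproj_tK C h x

end Forms

section eigen

variable {R : Type*} [CommRing R] [Algebra ℂ R] {V : Type*} [AddCommGroup V] [Module R V]

/-- The sum of a submodule and the eigenspaces for the eigenvalues `-1, …, -k`. -/
def EigLe (L : V →ₗ[R] V) (Z : Submodule R V) : ℕ → Submodule R V
  | 0 => Z
  | k + 1 => EigLe L Z k ⊔ LinearMap.ker (L + (k + 1) • LinearMap.id)

variable {L : V →ₗ[R] V} {Z : Submodule R V}

theorem EigLe.mono {k : ℕ} {v : V} (h : v ∈ EigLe L Z k) : v ∈ EigLe L Z (k + 1) :=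
  Submodule.mem_sup_left h

theorem EigLe.of_eigen {k : ℕ} {v : V} (h : L v + (k + 1) • v = 0) : v ∈ EigLe L Z (k + 1) :=
  Submodule.mem_sup_right h

theorem EigLe.ind {p : ℕ → V → Prop} (hadd : ∀ k x y, p k x → p k y → p k (x + y))
    (hs : ∀ k x, p k x → p (k + 1) x) (h0 : ∀ z ∈ Z, p 0 z)
    (h1 : ∀ k v, L v + (k + 1) • v = 0 → p (k + 1) v) (k : ℕ) (v : V) (hv : v ∈ EigLe L Z k) :
    p k v := by
  induction k generalizing v with
  | zero => exact h0 v hv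
  | succ k ih =>
    obtain ⟨a, ha, b, hb, rfl⟩ := Submodule.mem_sup.mp hv
    exact hadd _ _ _ (hs _ _ (ih a ha)) (h1 k b hb)

theorem EigLe.cut {c : V →ₗ[R] V} (hc : ∀ v, c (c v) = c v) (hL : ∀ v, c (L v) = L (c v))
    (hZ : ∀ z ∈ Z, L z = 0) {k : ℕ} {v : V} (hv : v ∈ EigLe L Z k) :
    v ∈ EigLe (L + (c - LinearMap.id)) (Z.map c) (k + 1) := by
  refine EigLe.ind (p := fun k v => v ∈ EigLe (L + (c - LinearMap.id)) (Z.map c) (k + 1))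
    (fun _ _ _ => add_mem) (fun _ _ => EigLe.mono) (fun z hz => ?_) (fun k v hv => ?_) k v hv
  · rw [← add_sub_cancel (c z) z]
    refine add_mem (EigLe.mono ⟨z, hz, rfl⟩) (EigLe.of_eigen ?_)
    simp only [LinearMap.add_apply, LinearMap.sub_apply, LinearMap.id_apply, map_sub, hc, ← hL,
      hZ z hz, map_zero, zero_add, one_smul]
    abel
  · rw [← add_sub_cancel (c v) v]
    have h : L v = -((k + 1) • v) := eq_neg_of_add_eq_zero_left hv
    refine add_mem (EigLe.mono (EigLe.of_eigen ?_)) (EigLe.of_eigen ?_)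
    · simp only [LinearMap.add_apply, LinearMap.sub_apply, LinearMap.id_apply, hc, ← hL, h, map_neg,
        map_nsmul]
      abel
    · simp only [LinearMap.add_apply, LinearMap.sub_apply, LinearMap.id_apply, map_sub, hc, ← hL, h,
        map_neg, map_nsmul]
      rw [succ_nsmul (v - c v), smul_sub]
      abel

theorem EigLe.map {V' : Type*} [AddCommGroup V'] [Module R V'] {L' : V' →ₗ[R] V'}
    {Z' : Submodule R V'} (m : V →ₗ[R] V') (hm : ∀ v, m (L v) = L' (m v))
    (hZ : ∀ z ∈ Z, m z ∈ Z') {k : ℕ} {v : V} (hv : v ∈ EigLe L Z k) : m v ∈ EigLe L' Z' k := by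
  refine EigLe.ind (p := fun k v => m v ∈ EigLe L' Z' k)
    (fun _ _ _ h h' => by rw [map_add]; exact add_mem h h') (fun _ _ => EigLe.mono) hZ
    (fun k v hv => EigLe.of_eigen ?_) k v hv
  rw [← hm, ← map_nsmul, ← map_add, hv, map_zero]

variable (R) in
/-- The scalar `1 / (k + 1)`. -/
def invNat (k : ℕ) : R := algebraMap ℂ R ((k + 1 : ℂ)⁻¹)

theorem invNat_smul (k : ℕ) (v : V) : invNat R k • (k + 1) • v = v := by
  rw [← Nat.cast_smul_eq_nsmul R, smul_smul]
  have : ((k + 1 : ℕ) : R) = algebraMap ℂ R (k + 1 : ℂ) := by simp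
  rw [invNat, this, ← map_mul, inv_mul_cancel₀ (Nat.cast_add_one_ne_zero k), map_one, one_smul]

/-- The product of the operators `1 + L / j` for `1 ≤ j ≤ k`. -/
def prodE (L : V →ₗ[R] V) : ℕ → V →ₗ[R] V
  | 0 => LinearMap.id
  | k + 1 => prodE L k + invNat R k • L ∘ₗ prodE L k

/-- The quotient `(prodE L k - 1) / L`. -/
def prodQ (L : V →ₗ[R] V) : ℕ → V →ₗ[R] V
  | 0 => 0
  | k + 1 => prodQ L k + invNat R k • prodE L k

theorem prodE_succ (k : ℕ) (v : V) :
    prodE L (k + 1) v = prodE L k v + invNat R k • L (prodE L k v) := rfl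

theorem prodQ_succ (k : ℕ) (v : V) :
    prodQ L (k + 1) v = prodQ L k v + invNat R k • prodE L k v := rfl

theorem prodE_eq (k : ℕ) (v : V) : prodE L k v = v + L (prodQ L k v) := by
  induction k with
  | zero => rw [prodQ, LinearMap.zero_apply, map_zero, add_zero]; rfl
  | succ k ih => rw [prodE_succ, prodQ_succ, map_add, map_smul, ← add_assoc, ← ih]

section map

variable {V' : Type*} [AddCommGroup V'] [Module R V'] {L' : V' →ₗ[R] V'} (m : V →ₗ[R] V')
  (hm : ∀ v, m (L v) = L' (m v))
include hm

theorem map_prodE (k : ℕ) (v : V) : m (prodE L k v) = prodE L' k (m v) := by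
  induction k with
  | zero => rfl
  | succ k ih => rw [prodE_succ, prodE_succ, map_add, map_smul, hm, ih]

theorem map_prodQ (k : ℕ) (v : V) : m (prodQ L k v) = prodQ L' k (m v) := by
  induction k with
  | zero => exact map_zero m
  | succ k ih => rw [prodQ_succ, prodQ_succ, map_add, map_smul, ih, map_prodE m hm]

end map

theorem prodE_of_ker {v : V} (h : L v = 0) (k : ℕ) : prodE L k v = v := by
  induction k with
  | zero => rfl
  | succ k ih => rw [prodE_succ, ih, h, smul_zero, add_zero]

theorem prodE_mem (hZ : ∀ z ∈ Z, L z = 0) {k : ℕ} {v : V} (hv : v ∈ EigLe L Z k) :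
    prodE L k v ∈ Z := by
  refine EigLe.ind (p := fun k v => prodE L k v ∈ Z)
    (fun _ _ _ h h' => by rw [map_add]; exact add_mem h h') (fun k x h => ?_) (fun z hz => hz)
    (fun k v hv => ?_) k v hv
  · rw [prodE_succ, hZ _ h, smul_zero, add_zero]; exact h
  · have h : L v = -((k + 1) • v) := eq_neg_of_add_eq_zero_left hv
    rw [prodE_succ, map_prodE L (fun _ => rfl), h, map_neg, map_nsmul, smul_neg, invNat_smul,
      add_neg_cancel]
    exact zero_mem _

theorem prodE_succ_of_eig (hZ : ∀ z ∈ Z, L z = 0) {k : ℕ} {v : V} (hv : v ∈ EigLe L Z k) :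
    prodE L (k + 1) v = prodE L k v := by
  rw [prodE_succ, hZ _ (prodE_mem hZ hv), smul_zero, add_zero]

theorem EigLe.le {k l : ℕ} (h : k ≤ l) {v : V} (hv : v ∈ EigLe L Z k) : v ∈ EigLe L Z l := by
  induction h with
  | refl => exact hv
  | step _ ih => exact EigLe.mono ih

theorem prodE_le (hZ : ∀ z ∈ Z, L z = 0) {k l : ℕ} (h : k ≤ l) {v : V} (hv : v ∈ EigLe L Z k) :
    prodE L l v = prodE L k v := by
  induction h with
  | refl => rfl
  | step h ih => rw [prodE_succ_of_eig hZ (EigLe.le h hv), ih]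

/-- The inverse of `L` on the sum of the eigenspaces, vanishing on the kernel of `L`. -/
def prodG (L : V →ₗ[R] V) (k : ℕ) : V →ₗ[R] V := prodQ L k ∘ₗ (LinearMap.id - prodE L k)

section top

variable {k : ℕ} (hZ : ∀ z ∈ Z, L z = 0) (hT : ∀ v, v ∈ EigLe L Z k)
include hZ hT

theorem L_prodE (v : V) : L (prodE L k v) = 0 := hZ _ (prodE_mem hZ (hT v))

theorem prodE_prodE (v : V) : prodE L k (prodE L k v) = prodE L k v :=
  prodE_of_ker (L_prodE hZ hT v) k

theorem L_prodG (v : V) : v + L (prodG L k v) = prodE L k v := by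
  have h := prodE_eq (L := L) k (v - prodE L k v)
  rw [map_sub, prodE_prodE hZ hT, sub_self] at h
  change v + L (prodQ L k (v - prodE L k v)) = _
  rw [eq_comm, sub_add_eq_add_sub, sub_eq_zero] at h
  exact h

theorem prodE_prodG (v : V) : prodE L k (prodG L k v) = 0 := by
  change prodE L k (prodQ L k (v - prodE L k v)) = 0
  rw [map_prodQ (prodE L k) fun v => (map_prodE L (fun _ => rfl) k v).symm, map_sub,
    prodE_prodE hZ hT, sub_self, map_zero]

theorem prodG_le {l : ℕ} (h : k ≤ l) (v : V) : prodG L l v = prodG L k v := by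
  have hl : ∀ v, v ∈ EigLe L Z l := fun v => EigLe.le h (hT v)
  have h1 : L (prodG L l v - prodG L k v) = 0 := by
    rw [map_sub, sub_eq_zero]
    have h2 := L_prodG hZ hl v
    rw [prodE_le hZ h (hT v), ← L_prodG hZ hT v] at h2
    exact add_left_cancel h2
  rw [← sub_eq_zero, ← prodE_of_ker h1 k, map_sub, prodE_prodG hZ hT,
    ← prodE_le hZ h (hT _), prodE_prodG hZ hl, sub_zero]

end top

end eigen

section core

variable {χ : Cutoff 𝒢} {P : GAlg.{u₁, u₂, w} 𝒢} {Q : GAlg.{u₁, u₂, v} 𝒢} (C : CutAlg χ Q)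
  (ι : GAlgHom P Q)

/-- The elements which left cuts take into the image of a homomorphism. -/
def CutAlg.core : Submodule (Base 𝒢) Q := ⨅ η, (LinearMap.range ι.toLin).comap (C.l η)

/-- Homomorphisms onto the corner of a cut structure. -/
structure CutAlg.Corner : Prop where
  r_map : ∀ a, C.r (ι.toLin a) = ins χ.f (ι.toLin a)
  l_map : ∀ h a, C.l (χ.f h) (ι.toLin a) = of h • ι.toLin a

/-- Homomorphisms onto the corner of a full cut structure. -/
structure CutAlg.FullCorner : Prop extends C.Corner ι where
  r_core : ∀ b, C.r b ∈ tensorSub (C.core ι) (Reg 𝒢)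

variable {C ι}

theorem CutAlg.mem_core {q : Q} : q ∈ C.core ι ↔ ∀ η, C.l η q ∈ LinearMap.range ι.toLin := by
  simp [CutAlg.core]

theorem CutAlg.Corner.cmul (h : C.Corner ι) (a b : P) :
    C.cmul (ι.toLin a) (ι.toLin b) = ι.toLin a * ι.toLin b := by
  obtain ⟨k, hk⟩ := exists_unit 𝒢 (ι.toLin a)
  rw [cmul_apply, h.r_map, ins_eq _ hk, con_tmul, h.l_map, mul_smul_comm, ← smul_mul_assoc, hk]

end core

section cutComm

variable {χ : Cutoff 𝒢} {E : Type v} [AddCommGroup E] [Module ℂ E] [Module (Base 𝒢) E]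
  [IsScalarTower ℂ (Base 𝒢) E] [GModule 𝒢 E] {E' : Type w} [AddCommGroup E'] [Module ℂ E']
  [Module (Base 𝒢) E'] [IsScalarTower ℂ (Base 𝒢) E'] [GModule 𝒢 E']

theorem cut_rTensor (R : RightCut χ E) (L' : LeftCut χ E') {L : E →ₗ[Base 𝒢] E}
    (h : ∀ x, R.r (L x) = L.rTensor (Reg 𝒢) (R.r x)) (z : E ⊗[Base 𝒢] E') :
    cut R L' (L.rTensor E' z) = L.rTensor E' (cut R L' z) := by
  induction z using TensorProduct.induction_on with
  | zero => simp
  | add a b ha hb => simp only [map_add, ha, hb]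
  | tmul x y =>
    rw [LinearMap.rTensor_tmul, cut_tmul, cut_tmul, h]
    induction R.r x using TensorProduct.induction_on with
    | zero => simp
    | add a b ha hb => simp only [map_add, ha, hb]
    | tmul q η => rw [LinearMap.rTensor_tmul, cutWith_tmul, cutWith_tmul, LinearMap.rTensor_tmul]

end cutComm

namespace Forms

variable {χ : Cutoff 𝒢} {A : GAlg.{u₁, u₂, w} 𝒢} {B : GAlg.{u₁, u₂, v} 𝒢} {C : CutAlg χ B}
  {ι : GAlgHom A B} {N : ℕ}

theorem tCorner (h : C.Corner ι) : (tCut C N).Corner (TAmap ι N) where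
  r_map := TA_ind' (by simp) (fun x y hx hy => by simp only [map_sub, hx, hy])
    (fun a => by rw [TAmap_gen, tCut_r, tr_gen, h.r_map, ← map_ins])
    (fun x a _ => by
      rw [(TAmap ι N).map_mul, TAmap_gen, tCut_r, tr_mul, tr_gen, h.r_map, ← map_ins, ← map_ins]
      rfl)
  l_map k := TA_ind' (by simp) (fun x y hx hy => by simp only [map_sub, smul_sub, hx, hy])
    (fun a => by rw [TAmap_gen, tCut_l, tl_gen, h.l_map, map_smul])
    (fun x a hx => by
      rw [(TAmap ι N).map_mul, (tCut C N).l_mul, hx, smul_mul_assoc])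

theorem gen_mem_core {q : B} (hq : q ∈ C.core ι) : gen B N q ∈ (tCut C N).core (TAmap ι N) := by
  rw [CutAlg.mem_core] at *
  intro η
  obtain ⟨a, ha⟩ := hq η
  exact ⟨gen A N a, by rw [TAmap_gen, ha, tCut_l, tl_gen]⟩

theorem mul_mem_core {q : TA B N} (hq : q ∈ (tCut C N).core (TAmap ι N)) (a : TA A N) :
    q * (TAmap ι N).toLin a ∈ (tCut C N).core (TAmap ι N) := by
  rw [CutAlg.mem_core] at *
  intro η
  obtain ⟨x, hx⟩ := hq η
  exact ⟨x * a, by rw [(TAmap ι N).map_mul, hx, (tCut C N).l_mul]⟩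

variable (hC : ∀ x y, C.cmul x y = x * y)

theorem tL_TAmap (h : C.Corner ι) (x : TA A N) : tL hC N ((TAmap ι N).toLin x) = 0 := by
  refine TA_ind' (p := fun x => tL hC N ((TAmap ι N).toLin x) = 0) (by simp)
    (fun x y hx hy => by rw [map_sub, map_sub, hx, hy, sub_zero])
    (fun a => by rw [TAmap_gen, tL_gen]) (fun x a hx => ?_) x
  rw [(TAmap ι N).map_mul, tL_mul, (tCorner h).cmul, hx, TAmap_gen, tL_gen]
  simp

variable (ι N) in
/-- The elements killed by the cut operator all of whose right cuts lie in the core. -/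
def tZ : Submodule (Base 𝒢) (TA B N) := LinearMap.ker (tL hC N) ⊓
  (tensorSub ((tCut C N).core (TAmap ι N)) (Reg 𝒢)).comap (tr C N)

variable (B N) in
/-- `x ⊗ b ↦ x b`. -/
def mulGen : TA B N ⊗[Base 𝒢] B →ₗ[Base 𝒢] TA B N :=
  LinearMap.mul' (Base 𝒢) (TA B N) ∘ₗ (gen B N).lTensor (TA B N)

theorem mulGen_tmul (x : TA B N) (b : B) : mulGen B N (x ⊗ₜ b) = x * gen B N b := rfl

variable (C N) in
/-- The cut between the two factors of `T B ⊗ B`. -/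
def gcut : TA B N ⊗[Base 𝒢] B →ₗ[Base 𝒢] TA B N ⊗[Base 𝒢] B :=
  cut (tCut C N).toRightCut C.toLeftCut

theorem gcut_tmul (x : TA B N) (b : B) : gcut C N (x ⊗ₜ b) = cutWith C.toLeftCut b (tr C N x) :=
  cut_tmul _ _ x b

theorem gcut_tL (z : TA B N ⊗[Base 𝒢] B) :
    gcut C N ((tL hC N).rTensor B z) = (tL hC N).rTensor B (gcut C N z) :=
  cut_rTensor _ _ (fun x => tr_tL hC x) z

theorem mulGen_gcut (x : TA B N) (b : B) :
    mulGen B N (gcut C N (x ⊗ₜ b)) = (tCut C N).cmul x (gen B N b) := by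
  rw [gcut_tmul, CutAlg.cmul_apply, tCut_r]
  induction tr C N x using TensorProduct.induction_on with
  | zero => simp
  | add a b ha hb => simp only [map_add, ha, hb]
  | tmul q η => rw [cutWith_tmul, mulGen_tmul, CutAlg.con_tmul, tCut_l, tl_gen]

theorem tL_mulGen (z : TA B N ⊗[Base 𝒢] B) : mulGen B N
    (((tL hC N).rTensor B + (gcut C N - LinearMap.id) :
      TA B N ⊗[Base 𝒢] B →ₗ[Base 𝒢] TA B N ⊗[Base 𝒢] B) z) = tL hC N (mulGen B N z) := by
  induction z using TensorProduct.induction_on with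
  | zero => simp
  | add a b ha hb => simp only [map_add, ha, hb]
  | tmul x b =>
    rw [mulGen_tmul, tL_mul, tL_gen, mul_zero, add_zero, LinearMap.add_apply, LinearMap.sub_apply,
      map_add, map_sub, mulGen_gcut, LinearMap.rTensor_tmul, mulGen_tmul, LinearMap.id_apply,
      mulGen_tmul]

theorem mulGen_gcut_mem (h : C.FullCorner ι) {z : TA B N ⊗[Base 𝒢] B}
    (hz : z ∈ tensorSub (tZ ι N hC) B) : mulGen B N (gcut C N z) ∈ tZ ι N hC := by
  refine tensorSub_ind (p := fun z => mulGen B N (gcut C N z) ∈ tZ ι N hC) (by simp)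
    (fun x y hx hy => by rw [map_add, map_add]; exact add_mem hx hy) (fun x hx b => ⟨?_, ?_⟩) hz
  · have h0 : tL hC N x = 0 := hx.1
    change tL hC N _ = 0
    rw [← tL_mulGen, LinearMap.add_apply, LinearMap.sub_apply, ← gcut_tL, LinearMap.rTensor_tmul, h0,
      TensorProduct.zero_tmul, map_zero, zero_add, LinearMap.id_apply, gcut, cut_cut, sub_self,
      map_zero]
  · change tr C N _ ∈ tensorSub ((tCut C N).core (TAmap ι N)) (Reg 𝒢)
    rw [gcut_tmul]
    refine tensorSub_ind (p := fun t => tr C N (mulGen B N (cutWith C.toLeftCut b t)) ∈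
      tensorSub ((tCut C N).core (TAmap ι N)) (Reg 𝒢)) (by simp)
      (fun x y hx hy => by rw [map_add, map_add, map_add]; exact add_mem hx hy)
      (fun q hq s => ?_) hx.2
    rw [cutWith_tmul, mulGen_tmul, tr_mul, tr_gen, C.r_l]
    refine tensorSub_ind (p := fun t => (LinearMap.mul (Base 𝒢) (TA B N) q).rTensor (Reg 𝒢)
      ((gen B N).rTensor (Reg 𝒢) ((C.l s).rTensor (Reg 𝒢) t)) ∈
      tensorSub ((tCut C N).core (TAmap ι N)) (Reg 𝒢)) (by simp)
      (fun x y hx hy => by rw [map_add, map_add, map_add]; exact add_mem hx hy)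
      (fun w hw ξ => ?_) (h.r_core b)
    obtain ⟨a, ha⟩ := CutAlg.mem_core.mp hw s
    refine tmul_mem_tensorSub ?_ ξ
    change q * gen B N (C.l s w) ∈ _
    rw [← ha, ← TAmap_gen]
    exact mul_mem_core hq _

theorem tEig (h : C.FullCorner ι) (x : TA B N) : x ∈ EigLe (tL hC N) (tZ ι N hC) (2 * N) := by
  refine TA_ind (p := fun k x => x ∈ EigLe (tL hC N) (tZ ι N hC) k) (fun _ => zero_mem _)
    (fun _ _ _ => sub_mem) (fun _ _ => EigLe.mono) (fun a => ⟨tL_gen hC a, ?_⟩)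
    (fun k x b hx => ?_) x
  · change tr C N _ ∈ tensorSub ((tCut C N).core (TAmap ι N)) (Reg 𝒢)
    rw [tr_gen]
    refine tensorSub_ind (p := fun t => (gen B N).rTensor (Reg 𝒢) t ∈
      tensorSub ((tCut C N).core (TAmap ι N)) (Reg 𝒢)) (by simp)
      (fun x y hx hy => by rw [map_add]; exact add_mem hx hy)
      (fun q hq s => tmul_mem_tensorSub (gen_mem_core hq) s) (h.r_core a)
  · have h1 : x ⊗ₜ b ∈ EigLe ((tL hC N).rTensor B) (tensorSub (tZ ι N hC) B) k :=
      EigLe.map ((TensorProduct.mk (Base 𝒢) (TA B N) B).flip b) (fun _ => rfl)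
        (fun z hz => tmul_mem_tensorSub hz b) hx
    have h2 := EigLe.cut (c := gcut C N) (cut_cut _ _) (gcut_tL hC) (fun z hz => ?_) h1
    · refine EigLe.map (mulGen B N) (tL_mulGen hC) ?_ h2
      rintro _ ⟨z, hz, rfl⟩
      exact mulGen_gcut_mem hC h hz
    · refine tensorSub_ind (p := fun z => (tL hC N).rTensor B z = 0) (by simp)
        (fun x y hx hy => by rw [map_add, hx, hy, add_zero]) (fun z hz b => ?_) hz
      rw [LinearMap.rTensor_tmul, hz.1, TensorProduct.zero_tmul]

end Forms

/-! ### The cut operator on the X-complex is diagonalisable -/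

section tcut

theorem oTensor_tmul_mem {E : Type*} [AddCommGroup E] [Module (Base 𝒢) E] {P : Type*}
    [AddCommGroup P] [Module (Base 𝒢) P] {S : Submodule (Base 𝒢) P}
    (g : OG 𝒢 ⊗[Base 𝒢] E →ₗ[Base 𝒢] P) (e : E)
    (h : ∀ U W, IsBis 𝒢 U → W ≤ adCO U → g ((Cc.chi W : OG 𝒢) ⊗ₜ e) ∈ S) (f : OG 𝒢) :
    g (f ⊗ₜ e) ∈ S := by
  refine Cc.span_induction (adFamily 𝒢) (P := fun k => g ((k : OG 𝒢) ⊗ₜ e) ∈ S) ?_ ?_ ?_ ?_ f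
  · rintro W ⟨U, hU, hW⟩
    exact h U W hU hW
  · rw [TensorProduct.zero_tmul, map_zero]; exact zero_mem _
  · intro a b ha hb
    rw [TensorProduct.add_tmul, map_add]; exact add_mem ha hb
  · intro c a ha
    rw [← algebraMap_smul (Base 𝒢) c, ← TensorProduct.smul_tmul', map_smul]
    exact S.smul_mem _ ha

variable {χ : Cutoff 𝒢} {E : Type v} [AddCommGroup E] [Module ℂ E] [Module (Base 𝒢) E]
  [IsScalarTower ℂ (Base 𝒢) E] [GModule 𝒢 E] {E' : Type w} [AddCommGroup E'] [Module ℂ E']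
  [Module (Base 𝒢) E'] [IsScalarTower ℂ (Base 𝒢) E'] [GModule 𝒢 E']

theorem BiCut.tcut_lTensor (D : BiCut χ E) (D' : BiCut χ E') {u : E →ₗ[Base 𝒢] E'}
    (hr : ∀ x, D'.r (u x) = u.rTensor (Reg 𝒢) (D.r x)) (hl : ∀ η x, D'.l η (u x) = u (D.l η x))
    (z : OG 𝒢 ⊗[Base 𝒢] E) : D'.tcut (u.lTensor (OG 𝒢) z) = u.lTensor (OG 𝒢) (D.tcut z) := by
  refine LinearMap.congr_fun (f := D'.tcut ∘ₗ u.lTensor (OG 𝒢)) (g := u.lTensor (OG 𝒢) ∘ₗ D.tcut)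
    (oTensor_ext (E := ⟨E⟩) fun U W hU hW x => ?_) z
  change E at x
  rw [LinearMap.comp_apply, LinearMap.comp_apply, LinearMap.lTensor_tmul, tcut_tmul, tcut_tmul, hr]
  induction D.r x using TensorProduct.induction_on with
  | zero => simp
  | add a b ha hb => simp only [map_add, TensorProduct.tmul_add, ha, hb]
  | tmul q η =>
    rw [LinearMap.rTensor_tmul, D.twOut_app_chi hU hW, D'.twOut_app_chi hU hW,
      LinearMap.lTensor_tmul, hl]

theorem BiCut.tcut_tmul_mem (D : BiCut χ E) {S : Submodule (Base 𝒢) E} {P : Type*}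
    [AddCommGroup P] [Module (Base 𝒢) P] {Z : Submodule (Base 𝒢) P}
    (g : OG 𝒢 ⊗[Base 𝒢] E →ₗ[Base 𝒢] P)
    (hS : ∀ q ∈ S, ∀ η (f : OG 𝒢), g (f ⊗ₜ D.l η q) ∈ Z) {x : E}
    (hx : D.r x ∈ tensorSub S (Reg 𝒢)) (f : OG 𝒢) : g (D.tcut (f ⊗ₜ x)) ∈ Z := by
  refine oTensor_tmul_mem (g ∘ₗ D.tcut) x (fun U W hU hW => ?_) f
  rw [LinearMap.comp_apply, tcut_tmul]
  refine tensorSub_ind (p := fun t => g (twOut D.app ((Cc.chi W : OG 𝒢) ⊗ₜ t)) ∈ Z) (by simp)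
    (fun x y hx hy => ?_) (fun q hq η => ?_) hx
  · rw [TensorProduct.tmul_add, map_add, map_add]; exact add_mem hx hy
  · rw [D.twOut_app_chi hU hW]; exact hS q hq _ _

end tcut

namespace Forms

variable {χ : Cutoff 𝒢} {A : GAlg.{u₁, u₂, w} 𝒢} {B : GAlg.{u₁, u₂, v} 𝒢} {C : CutAlg χ B}
  {ι : GAlgHom A B} {N : ℕ} (hC : ∀ x y, C.cmul x y = x * y)

theorem c0_tL (z : OG 𝒢 ⊗[Base 𝒢] TA B N) : (tCut C N).biCut.tcut ((tL hC N).lTensor (OG 𝒢) z) =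
    (tL hC N).lTensor (OG 𝒢) ((tCut C N).biCut.tcut z) :=
  BiCut.tcut_lTensor _ _ (fun x => tr_tL hC x) (fun η x => (tL_tl hC η x).symm) z

theorem LE_eig (h : C.FullCorner ι) (z : OG 𝒢 ⊗[Base 𝒢] TA B N) :
    z ∈ EigLe (tHtp hC N).LE (LinearMap.range ((TAmap ι N).toLin.lTensor (OG 𝒢))) (2 * N + 1) := by
  induction z using TensorProduct.induction_on with
  | zero => exact zero_mem _
  | add x y hx hy => exact add_mem hx hy
  | tmul f x =>
  let Z : Submodule (Base 𝒢) (OG 𝒢 ⊗[Base 𝒢] TA B N) := LinearMap.ker ((tL hC N).lTensor (OG 𝒢)) ⊓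
    (LinearMap.range ((TAmap ι N).toLin.lTensor (OG 𝒢))).comap (tCut C N).biCut.tcut
  have h1 : f ⊗ₜ x ∈ EigLe ((tL hC N).lTensor (OG 𝒢)) Z (2 * N) := by
    refine EigLe.map (Z' := Z) (TensorProduct.mk (Base 𝒢) (OG 𝒢) (TA B N) f) (fun _ => rfl)
      (fun x hx => Submodule.mem_inf.mpr ⟨?_, ?_⟩) (tEig hC h x)
    · exact (congrArg (fun y => f ⊗ₜ y) hx.1).trans (TensorProduct.tmul_zero _ f)
    · refine BiCut.tcut_tmul_mem (Z := LinearMap.range ((TAmap ι N).toLin.lTensor (OG 𝒢)))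
        (tCut C N).biCut LinearMap.id (fun q hq η g => ?_) (x := x) hx.2 f
      obtain ⟨a, ha⟩ := CutAlg.mem_core.mp hq η
      exact ⟨g ⊗ₜ a, congrArg (fun y => g ⊗ₜ y) ha⟩
  have h2 := EigLe.cut (BiCut.tcut_tcut _) (c0_tL hC) (fun z hz => (Submodule.mem_inf.mp hz).1) h1
  refine EigLe.map LinearMap.id (L' := (tHtp hC N).LE) (fun _ => rfl) ?_ h2
  rintro _ ⟨z, hz, rfl⟩
  exact (Submodule.mem_inf.mp hz).2

variable (C N) in
/-- The cut operators at the outer ends of `T B ⊗ B`. -/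
def gOuter : BiCut χ (TA B N ⊗[Base 𝒢] B) := outerCut (tCut C N).toLeftCut C.toRightCut

theorem gOuter_l (η : Reg 𝒢) (x : TA B N) (b : B) :
    (gOuter C N).l η (x ⊗ₜ b) = tl C N η x ⊗ₜ b := rfl

theorem gOuter_r (x : TA B N) (b : B) : (gOuter C N).r (x ⊗ₜ b) = consL x (C.r b) :=
  outerR_tmul _ x b

theorem gOuter_tL (z : OG 𝒢 ⊗[Base 𝒢] (TA B N ⊗[Base 𝒢] B)) :
    (gOuter C N).tcut (((tL hC N).rTensor B).lTensor (OG 𝒢) z) =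
      ((tL hC N).rTensor B).lTensor (OG 𝒢) ((gOuter C N).tcut z) := by
  refine BiCut.tcut_lTensor _ _ (fun x => ?_) (fun η x => ?_) z
  · induction x using TensorProduct.induction_on with
    | zero => simp
    | add a b ha hb => simp only [map_add, ha, hb]
    | tmul x b =>
      rw [LinearMap.rTensor_tmul, gOuter_r, gOuter_r]
      induction C.r b using TensorProduct.induction_on with
      | zero => simp
      | add a b ha hb => simp only [map_add, ha, hb]
      | tmul q η => rw [consL_tmul, consL_tmul, LinearMap.rTensor_tmul, LinearMap.rTensor_tmul]
  · induction x using TensorProduct.induction_on with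
    | zero => simp
    | add a b ha hb => simp only [map_add, ha, hb]
    | tmul x b =>
      rw [LinearMap.rTensor_tmul, gOuter_l, gOuter_l, LinearMap.rTensor_tmul, tL_tl]

theorem gOuter_gcut (z : OG 𝒢 ⊗[Base 𝒢] (TA B N ⊗[Base 𝒢] B)) :
    (gOuter C N).tcut ((gcut C N).lTensor (OG 𝒢) z) =
      (gcut C N).lTensor (OG 𝒢) ((gOuter C N).tcut z) := by
  refine BiCut.tcut_lTensor _ _ (fun x => ?_) (fun η x => ?_) z
  · induction x using TensorProduct.induction_on with
    | zero => simp
    | add a b ha hb => simp only [map_add, ha, hb]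
    | tmul x b =>
      let K : TA B N ⊗[Base 𝒢] Reg 𝒢 →ₗ[Base 𝒢] B →ₗ[Base 𝒢] TA B N ⊗[Base 𝒢] B :=
        (LinearMap.lTensorHom (TA B N) ∘ₗ C.l.flip).flip
      have h1 : ∀ u, (gcut C N).rTensor (Reg 𝒢) (consL x u) = (K (tr C N x)).rTensor (Reg 𝒢) u := by
        intro u
        induction u using TensorProduct.induction_on with
        | zero => simp
        | add a b ha hb => simp only [map_add, ha, hb]
        | tmul w ξ => rw [consL_tmul, LinearMap.rTensor_tmul, gcut_tmul]; rfl
      have h2 : ∀ t, (gOuter C N).r (cutWith C.toLeftCut b t) = (K t).rTensor (Reg 𝒢) (C.r b) := by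
        intro t
        induction t using TensorProduct.induction_on with
        | zero => simp
        | add a b ha hb => simp only [map_add, ha, hb, LinearMap.rTensor_add, LinearMap.add_apply]
        | tmul q η =>
          rw [cutWith_tmul, gOuter_r, C.r_l]
          induction C.r b using TensorProduct.induction_on with
          | zero => simp
          | add a b ha hb => simp only [map_add, ha, hb]
          | tmul w ξ => rfl
      rw [gcut_tmul, gOuter_r, h1, h2]
  · exact (cut_rTensor _ _ (fun x => (tCut C N).r_l η x) x).symm

theorem gOuter_gcut_r (h : C.FullCorner ι) {x : TA B N} (hx : x ∈ tZ ι N hC) (b : B) :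
    (gOuter C N).r (gcut C N (x ⊗ₜ b)) ∈ tensorSub (LinearMap.range
      (TensorProduct.map ((tCut C N).core (TAmap ι N)).subtype ι.toLin)) (Reg 𝒢) := by
  rw [gcut_tmul]
  refine tensorSub_ind (p := fun t => (gOuter C N).r (cutWith C.toLeftCut b t) ∈
    tensorSub (LinearMap.range
      (TensorProduct.map ((tCut C N).core (TAmap ι N)).subtype ι.toLin)) (Reg 𝒢)) (by simp)
    (fun x y hx hy => by rw [map_add, map_add]; exact add_mem hx hy) (fun q hq s => ?_) hx.2
  rw [cutWith_tmul, gOuter_r, C.r_l]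
  refine tensorSub_ind (p := fun t => consL q ((C.l s).rTensor (Reg 𝒢) t) ∈
    tensorSub (LinearMap.range
      (TensorProduct.map ((tCut C N).core (TAmap ι N)).subtype ι.toLin)) (Reg 𝒢)) (by simp)
    (fun x y hx hy => by rw [map_add, map_add]; exact add_mem hx hy) (fun v hv ξ => ?_) (h.r_core b)
  obtain ⟨a, ha⟩ := CutAlg.mem_core.mp hv s
  rw [LinearMap.rTensor_tmul, consL_tmul, ← ha]
  exact tmul_mem_tensorSub (LinearMap.mem_range.mpr
    ⟨(⟨q, hq⟩ : (tCut C N).core (TAmap ι N)) ⊗ₜ a, rfl⟩) ξ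

variable (B N) in
/-- `f ⊗ x ⊗ b ↦ ♮(f ⊗ x db)`. -/
def nmGen : OG 𝒢 ⊗[Base 𝒢] (TA B N ⊗[Base 𝒢] B) →ₗ[Base 𝒢] XOc (TA B N) :=
  nm (TA B N) ∘ₗ ((gen B N).lTensor (TA B N)).lTensor (OG 𝒢)

theorem nmGen_tmul (f : OG 𝒢) (x : TA B N) (b : B) :
    nmGen B N (f ⊗ₜ (x ⊗ₜ b)) = nm (TA B N) (f ⊗ₜ (x ⊗ₜ gen B N b)) := rfl

theorem outer_gen (z : OG 𝒢 ⊗[Base 𝒢] (TA B N ⊗[Base 𝒢] B)) :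
    (outerCut (tCut C N).toLeftCut (tCut C N).toRightCut).tcut
      (((gen B N).lTensor (TA B N)).lTensor (OG 𝒢) z) =
      ((gen B N).lTensor (TA B N)).lTensor (OG 𝒢) ((gOuter C N).tcut z) := by
  refine BiCut.tcut_lTensor _ _ (fun x => ?_) (fun η x => ?_) z
  · induction x using TensorProduct.induction_on with
    | zero => simp
    | add a b ha hb => simp only [map_add, ha, hb]
    | tmul x b =>
      rw [LinearMap.lTensor_tmul, outerCut_r, gOuter_r, tCut_r, tr_gen]
      induction C.r b using TensorProduct.induction_on with
      | zero => simp
      | add a b ha hb => simp only [map_add, ha, hb]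
      | tmul q η => rfl
  · induction x using TensorProduct.induction_on with
    | zero => simp
    | add a b ha hb => simp only [map_add, ha, hb]
    | tmul x b => rfl

theorem cut_gen (z : TA B N ⊗[Base 𝒢] B) :
    cut (tCut C N).toRightCut (tCut C N).toLeftCut ((gen B N).lTensor (TA B N) z) =
      (gen B N).lTensor (TA B N) (gcut C N z) := by
  induction z using TensorProduct.induction_on with
  | zero => simp
  | add a b ha hb => simp only [map_add, ha, hb]
  | tmul x b =>
    rw [LinearMap.lTensor_tmul, cut_tmul, gcut_tmul, tCut_r]
    induction tr C N x using TensorProduct.induction_on with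
    | zero => simp
    | add a b ha hb => simp only [map_add, ha, hb]
    | tmul q η => rw [cutWith_tmul, cutWith_tmul, LinearMap.lTensor_tmul, tCut_l, tl_gen]

/-- The operator on `O_G ⊗ (T B ⊗ B)` corresponding to the cut operator on the X-complex. -/
def gOp : OG 𝒢 ⊗[Base 𝒢] (TA B N ⊗[Base 𝒢] B) →ₗ[Base 𝒢] OG 𝒢 ⊗[Base 𝒢] (TA B N ⊗[Base 𝒢] B) :=
  (((tL hC N).rTensor B).lTensor (OG 𝒢) + ((gcut C N).lTensor (OG 𝒢) - LinearMap.id)) +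
    ((gOuter C N).tcut - LinearMap.id)

theorem nmGen_gOp (z : OG 𝒢 ⊗[Base 𝒢] (TA B N ⊗[Base 𝒢] B)) :
    nmGen B N (gOp hC z) =
      (tHtp hC N).LO (TAproj_surjective (by omega)) (nmGen B N z) := by
  refine LinearMap.congr_fun (f := nmGen B N ∘ₗ gOp hC)
    (g := (tHtp hC N).LO (TAproj_surjective (by omega)) ∘ₗ nmGen B N) (TensorProduct.ext' fun f t => ?_) z
  induction t with
  | zero => simp
  | add x y hx hy => rw [TensorProduct.tmul_add, map_add, map_add, hx, hy]
  | tmul x b =>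
    have h1 : (tHtp hC N).L (gen B N b) = 0 := tL_gen hC b
    have h2 := outer_gen (C := C) (f ⊗ₜ (x ⊗ₜ b))
    have h3 := cut_gen (C := C) (x ⊗ₜ b)
    rw [LinearMap.lTensor_tmul, LinearMap.lTensor_tmul] at h2
    rw [LinearMap.lTensor_tmul] at h3
    rw [LinearMap.comp_apply, LinearMap.comp_apply, nmGen_tmul, CutHtp.LO_nm, CutHtp.LOm_tmul, h1,
      TensorProduct.tmul_zero, TensorProduct.tmul_zero, map_zero, add_zero, h2, h3]
    simp only [gOp, LinearMap.add_apply, LinearMap.sub_apply, map_add, map_sub, LinearMap.id_apply]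
    rfl

/-- The image of the X-complex of a corner. -/
abbrev xoRange (ι : GAlgHom A B) (N : ℕ) : Submodule (Base 𝒢) (XOc (TA B N)) :=
  LinearMap.range (xoMap (TAmap ι N))

theorem nmGen_eig (h : C.FullCorner ι) (z : OG 𝒢 ⊗[Base 𝒢] (TA B N ⊗[Base 𝒢] B)) :
    nmGen B N z ∈ EigLe ((tHtp hC N).LO (TAproj_surjective (by omega))) (xoRange ι N)
      (2 * N + 2) := by
  induction z using TensorProduct.induction_on with
  | zero => rw [map_zero]; exact zero_mem _
  | add x y hx hy => rw [map_add]; exact add_mem hx hy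
  | tmul f t =>
  induction t using TensorProduct.induction_on with
  | zero => rw [TensorProduct.tmul_zero, map_zero]; exact zero_mem _
  | add x y hx hy => rw [TensorProduct.tmul_add, map_add]; exact add_mem hx hy
  | tmul x b =>
  let L := ((tL hC N).rTensor B).lTensor (OG 𝒢)
  let c := (gcut C N).lTensor (OG 𝒢)
  have hcc : ∀ z, c (c z) = c z := fun z => by
    change (c ∘ₗ c) z = _
    rw [← LinearMap.lTensor_comp]
    exact congrArg (fun u : _ →ₗ[Base 𝒢] _ => u.lTensor (OG 𝒢) z) (LinearMap.ext (cut_cut _ _))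
  have hcL : ∀ z, c (L z) = L (c z) := fun z => by
    change (c ∘ₗ L) z = (L ∘ₗ c) z
    rw [← LinearMap.lTensor_comp, ← LinearMap.lTensor_comp]
    exact congrArg (fun u : _ →ₗ[Base 𝒢] _ => u.lTensor (OG 𝒢) z) (LinearMap.ext (gcut_tL hC))
  let Z : Submodule (Base 𝒢) (OG 𝒢 ⊗[Base 𝒢] (TA B N ⊗[Base 𝒢] B)) := LinearMap.ker L ⊓
    (xoRange ι N).comap (nmGen B N ∘ₗ (gOuter C N).tcut ∘ₗ c)
  have h1 : f ⊗ₜ (x ⊗ₜ b) ∈ EigLe L Z (2 * N) := by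
    refine EigLe.map (Z' := Z) (TensorProduct.mk (Base 𝒢) (OG 𝒢) (TA B N ⊗[Base 𝒢] B) f ∘ₗ
      (TensorProduct.mk (Base 𝒢) (TA B N) B).flip b) (fun _ => rfl)
      (fun x hx => Submodule.mem_inf.mpr ⟨?_, ?_⟩) (tEig hC h x)
    · have h0 : tL hC N x = 0 := hx.1
      change f ⊗ₜ (tL hC N x ⊗ₜ b) = 0
      rw [h0, TensorProduct.zero_tmul, TensorProduct.tmul_zero]
    · refine BiCut.tcut_tmul_mem (Z := xoRange ι N) (gOuter C N) (nmGen B N) (fun q hq η g => ?_)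
        (gOuter_gcut_r hC h hx b) f
      obtain ⟨t, rfl⟩ := hq
      induction t using TensorProduct.induction_on with
      | zero => simp
      | add x y hx hy =>
        rw [map_add, map_add, TensorProduct.tmul_add, map_add]; exact add_mem hx hy
      | tmul q a =>
        obtain ⟨y, hy⟩ := CutAlg.mem_core.mp q.2 η
        refine ⟨nm _ (g ⊗ₜ (y ⊗ₜ gen A N a)), ?_⟩
        rw [xoMap_nm, LinearMap.lTensor_tmul, TensorProduct.map_tmul, TAmap_gen, hy]
        rfl
  have h2 := EigLe.cut hcc hcL (fun z hz => (Submodule.mem_inf.mp hz).1) h1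
  have h3 := EigLe.cut (c := (gOuter C N).tcut) (BiCut.tcut_tcut _) (fun z => ?_) ?_ h2
  · refine EigLe.map (nmGen B N) (nmGen_gOp hC) ?_ h3
    rintro _ ⟨_, ⟨z, hz, rfl⟩, rfl⟩
    exact (Submodule.mem_inf.mp hz).2
  · simp only [LinearMap.add_apply, LinearMap.sub_apply, LinearMap.id_apply, map_add, map_sub]
    rw [gOuter_tL, gOuter_gcut]
  · rintro _ ⟨z, hz, rfl⟩
    have h0 : L z = 0 := (Submodule.mem_inf.mp hz).1
    rw [LinearMap.add_apply, LinearMap.sub_apply, LinearMap.id_apply, ← hcL, h0, map_zero, hcc,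
      sub_self, add_zero]

theorem ndGen_eig (h : C.FullCorner ι) (f : OG 𝒢) (b : B) :
    nd (TA B N) (f ⊗ₜ gen B N b) ∈
      EigLe ((tHtp hC N).LO (TAproj_surjective (by omega))) (xoRange ι N) (2 * N + 2) := by
  let D := C.biCut.tcut
  have hgen : ∀ z, (tCut C N).biCut.tcut ((gen B N).lTensor (OG 𝒢) z) =
      (gen B N).lTensor (OG 𝒢) (D z) := fun z =>
    BiCut.tcut_lTensor C.biCut (tCut C N).biCut (fun x => tr_gen C x) (fun η x => tl_gen C η x) z
  let g : OG 𝒢 ⊗[Base 𝒢] B →ₗ[Base 𝒢] XOc (TA B N) := nd (TA B N) ∘ₗ (gen B N).lTensor (OG 𝒢)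
  let Z : Submodule (Base 𝒢) (OG 𝒢 ⊗[Base 𝒢] B) := (xoRange ι N).comap (g ∘ₗ D)
  have h1 : f ⊗ₜ b ∈ EigLe (0 : OG 𝒢 ⊗[Base 𝒢] B →ₗ[Base 𝒢] OG 𝒢 ⊗[Base 𝒢] B) Z 0 := by
    refine BiCut.tcut_tmul_mem (Z := xoRange ι N) C.biCut g (fun q hq η k => ?_) (h.r_core b) f
    obtain ⟨a, ha⟩ := CutAlg.mem_core.mp hq η
    refine ⟨nd _ (k ⊗ₜ gen A N a), ?_⟩
    rw [xoMap_nd, LinearMap.lTensor_tmul, TAmap_gen, ha]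
    rfl
  have h2 := EigLe.cut (c := D) (BiCut.tcut_tcut _) (fun z => by simp) (fun z _ => rfl) h1
  refine EigLe.le (by omega) (EigLe.map g (fun z => ?_) ?_ h2)
  · have hL : ∀ z : OG 𝒢 ⊗[Base 𝒢] B, (tL hC N).lTensor (OG 𝒢) ((gen B N).lTensor (OG 𝒢) z) = 0 := by
      intro z
      induction z with
      | zero => simp
      | add x y hx hy => rw [map_add, map_add, hx, hy, add_zero]
      | tmul f b =>
        rw [LinearMap.lTensor_tmul, LinearMap.lTensor_tmul, tL_gen, TensorProduct.tmul_zero]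
    change _ = (tHtp hC N).LO _ (nd (TA B N) ((gen B N).lTensor (OG 𝒢) z))
    rw [CutHtp.LO_nd]
    change g ((0 : OG 𝒢 ⊗[Base 𝒢] B) + (D z - z)) = nd (TA B N)
      ((tL hC N).lTensor (OG 𝒢) ((gen B N).lTensor (OG 𝒢) z) +
      ((tCut C N).biCut.tcut ((gen B N).lTensor (OG 𝒢) z) - (gen B N).lTensor (OG 𝒢) z))
    rw [hL, hgen, zero_add, zero_add, ← map_sub]
    rfl
  · rintro _ ⟨z, hz, rfl⟩
    exact hz

theorem LO_eig (h : C.FullCorner ι) (m : XOc (TA B N)) :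
    m ∈ EigLe ((tHtp hC N).LO (TAproj_surjective (by omega))) (xoRange ι N) (2 * N + 2) := by
  set S := EigLe ((tHtp hC N).LO (TAproj_surjective (by omega))) (xoRange ι N) (2 * N + 2) with hS
  have hm : ∀ U W, IsBis 𝒢 U → W ≤ adCO U → ∀ y x : TA B N,
      nm (TA B N) ((Cc.chi W : OG 𝒢) ⊗ₜ (x ⊗ₜ y)) ∈ S := by
    intro U W hU hW
    refine TA_ind' (fun x => ?_) (fun x y hx hy z => ?_) (fun a x => ?_) (fun y b hy x => ?_)
    · rw [TensorProduct.tmul_zero, TensorProduct.tmul_zero, map_zero]; exact zero_mem _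
    · rw [TensorProduct.tmul_sub, TensorProduct.tmul_sub, map_sub]; exact sub_mem (hx z) (hy z)
    · exact nmGen_eig hC h ((Cc.chi W : OG 𝒢) ⊗ₜ (x ⊗ₜ a))
    · rw [nm_mul hU hW]
      exact add_mem (nmGen_eig hC h ((Cc.chi W : OG 𝒢) ⊗ₜ ((x * y) ⊗ₜ b))) (hy _)
  have hd : ∀ U W, IsBis 𝒢 U → W ≤ adCO U → ∀ y : TA B N,
      nd (TA B N) ((Cc.chi W : OG 𝒢) ⊗ₜ y) ∈ S := by
    intro U W hU hW
    refine TA_ind' ?_ (fun x y hx hy => ?_) (fun a => ?_) (fun y b _ => ?_)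
    · rw [TensorProduct.tmul_zero, map_zero]; exact zero_mem _
    · rw [TensorProduct.tmul_sub, map_sub]; exact sub_mem hx hy
    · exact ndGen_eig hC h _ a
    · rw [nd_mul hU hW]
      exact add_mem (hm U W hU hW _ _) (hm U W hU hW _ _)
  have h0 : S.mkQ = 0 := XO_ext_chi
    (fun U W hU hW x y => (Submodule.Quotient.mk_eq_zero S).mpr (hm U W hU hW y x))
    (fun U W hU hW y => (Submodule.Quotient.mk_eq_zero S).mpr (hd U W hU hW y))
  exact (Submodule.Quotient.mk_eq_zero S).mp (LinearMap.congr_fun h0 m)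

end Forms

/-! ### The cut operator vanishes on the corner -/

namespace CutAlg.Corner

variable {χ : Cutoff 𝒢} {P : GAlg.{u₁, u₂, w} 𝒢} {Q : GAlg.{u₁, u₂, v} 𝒢} {C : CutAlg χ Q}
  {ι : GAlgHom P Q} (h : C.Corner ι)
include h

theorem cut_tmul (x y : P) : cut C.toRightCut C.toLeftCut (ι.toLin x ⊗ₜ ι.toLin y) =
    ι.toLin x ⊗ₜ ι.toLin y := by
  obtain ⟨k, hk⟩ := exists_unit 𝒢 (ι.toLin x)
  rw [AmpleHP.cut_tmul, h.r_map, ins_eq _ hk, cutWith_tmul, h.l_map, ← TensorProduct.smul_tmul, hk]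

theorem tcut_lTensor (z : OG 𝒢 ⊗[Base 𝒢] P) :
    C.biCut.tcut (ι.toLin.lTensor (OG 𝒢) z) = ι.toLin.lTensor (OG 𝒢) z := by
  refine LinearMap.congr_fun (f := C.biCut.tcut ∘ₗ ι.toLin.lTensor (OG 𝒢))
    (g := ι.toLin.lTensor (OG 𝒢)) (oTensor_ext (E := ⟨P⟩) fun U W hU hW x => ?_) z
  change P at x
  obtain ⟨k, hk⟩ := exists_unit 𝒢 (ι.toLin x)
  have h1 : C.biCut.r (ι.toLin x) = ι.toLin x ⊗ₜ χ.f k := (h.r_map x).trans (ins_eq _ hk)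
  have h2 : C.biCut.l (act (Cc.chi (binv U)) (χ.f k)) (ι.toLin x) =
      of (conv 𝒢 𝒢.Obj (Cc.chi (binv U)) k) • ι.toLin x := by
    rw [← χ.f_equivariant]; exact h.l_map _ x
  rw [LinearMap.comp_apply, LinearMap.lTensor_tmul, BiCut.tcut_tmul, h1,
    C.biCut.twOut_app_chi hU hW, h2, chi_tmul_smul hU hW, hk]

theorem outer_lTensor (z : OG 𝒢 ⊗[Base 𝒢] (P ⊗[Base 𝒢] P)) :
    (outerCut C.toLeftCut C.toRightCut).tcut
      ((TensorProduct.map ι.toLin ι.toLin).lTensor (OG 𝒢) z) =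
      (TensorProduct.map ι.toLin ι.toLin).lTensor (OG 𝒢) z := by
  refine LinearMap.congr_fun (f := (outerCut C.toLeftCut C.toRightCut).tcut ∘ₗ
      (TensorProduct.map ι.toLin ι.toLin).lTensor (OG 𝒢))
    (g := (TensorProduct.map ι.toLin ι.toLin).lTensor (OG 𝒢))
    (oTensor_ext (E := ⟨P ⊗[Base 𝒢] P⟩) fun U W hU hW e => ?_) z
  change P ⊗[Base 𝒢] P at e
  induction e with
  | zero => simp
  | add x y hx hy => rw [TensorProduct.tmul_add, map_add, map_add, hx, hy]
  | tmul x y =>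
    obtain ⟨k, hk⟩ := exists_unit 𝒢 (ι.toLin y)
    rw [LinearMap.comp_apply, LinearMap.lTensor_tmul, TensorProduct.map_tmul, BiCut.tcut_tmul,
      outerCut_r, h.r_map, ins_eq _ hk, consL_tmul, BiCut.twOut_app_chi _ hU hW, outerCut_l,
      ← χ.f_equivariant, h.l_map, ← TensorProduct.smul_tmul']
    refine (chi_tmul_smul hU hW k _).trans ?_
    rw [← TensorProduct.tmul_smul, hk]

end CutAlg.Corner

namespace Forms

variable {χ : Cutoff 𝒢} {A : GAlg.{u₁, u₂, w} 𝒢} {B : GAlg.{u₁, u₂, v} 𝒢} {C : CutAlg χ B}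
  {ι : GAlgHom A B} {N : ℕ} (hC : ∀ x y, C.cmul x y = x * y) (h : C.Corner ι)
include h

theorem LE_TAmap (z : OG 𝒢 ⊗[Base 𝒢] TA A N) :
    (tHtp hC N).LE ((TAmap ι N).toLin.lTensor (OG 𝒢) z) = 0 := by
  have h1 := (tCorner (N := N) h).tcut_lTensor z
  have h2 : (tL hC N).lTensor (OG 𝒢) ((TAmap ι N).toLin.lTensor (OG 𝒢) z) = 0 := by
    induction z with
    | zero => simp
    | add x y hx hy =>
      rw [map_add, map_add, hx ((tCorner h).tcut_lTensor x), hy ((tCorner h).tcut_lTensor y),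
        add_zero]
    | tmul f x =>
      rw [LinearMap.lTensor_tmul, LinearMap.lTensor_tmul, tL_TAmap hC h, TensorProduct.tmul_zero]
  change (tL hC N).lTensor (OG 𝒢) _ + ((tCut C N).biCut.tcut _ - _) = 0
  rw [h1, h2, LinearMap.id_apply, sub_self, zero_add]

theorem LO_TAmap (m : XOc (TA A N)) : (tHtp hC N).LO (TAproj_surjective (by omega))
    (xoMap (TAmap ι N) m) = 0 := by
  refine LinearMap.congr_fun (f := (tHtp hC N).LO (TAproj_surjective (by omega)) ∘ₗ
    xoMap (TAmap ι N)) (g := 0) (XO_ext_chi (fun U W hU hW x y => ?_) fun U W hU hW y => ?_) m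
  · have h1 := (tCorner (N := N) h).outer_lTensor ((Cc.chi W : OG 𝒢) ⊗ₜ (x ⊗ₜ y))
    have h2 : ∀ x, (tHtp hC N).L ((TAmap ι N).toLin x) = 0 := tL_TAmap hC h
    rw [LinearMap.lTensor_tmul, TensorProduct.map_tmul] at h1
    rw [LinearMap.comp_apply, xoMap_nm, LinearMap.lTensor_tmul, TensorProduct.map_tmul,
      CutHtp.LO_nm, CutHtp.LOm_tmul, h2, h2, h1, (tCorner h).cut_tmul]
    simp
  · rw [LinearMap.comp_apply, xoMap_nd, CutHtp.LO_nd, LE_TAmap hC h, map_zero]; rfl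

end Forms

section stab

variable {χ : Cutoff 𝒢} {A : GAlg.{u₁, u₂, v} 𝒢}

theorem smul_map_of_smul_map {M : Type*} [AddCommGroup M] [Module (Base 𝒢) M]
    {g : Cc 𝒢.Obj →ₗ[Base 𝒢] M} {h k : Cc 𝒢.Obj} (hk : of k • g h = g h) : of h • g k = g h := by
  rw [← hk, ← map_smul, ← map_smul, of_smul_Cc, of_smul_Cc, mul_comm]

theorem stabIncl_eq {h : Cc 𝒢.Obj} {a : A} (ha : of h • a = a) :
    (stabIncl χ A).toLin a = stabCons a (χ.e h ⊗ₜ χ.f h) := stabInclLin_eq ha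

theorem stab_fullCorner : (stabCut χ A).FullCorner (stabIncl χ A) where
  r_map a := by
    obtain ⟨h, ha⟩ := exists_unit 𝒢 a
    obtain ⟨k, hka, hk⟩ := exists_common 𝒢 a (χ.e h)
    have h1 : of h • (stabIncl χ A).toLin a = (stabIncl χ A).toLin a := by rw [← map_smul, ha]
    have h2 : stabCons a (χ.e h ⊗ₜ χ.f k) = (stabIncl χ A).toLin a := by
      rw [← smul_map_of_smul_map hk, ← TensorProduct.smul_tmul', map_smul, ← stabIncl_eq hka, h1]
    rw [ins_eq _ h1, stabIncl_eq ha]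
    change stabRight χ A _ = _
    rw [stabRight_cons, KG.right_tmul hk, LinearMap.rTensor_tmul, h2, stabIncl_eq ha]
  l_map k a := by
    obtain ⟨h, ha⟩ := exists_unit 𝒢 a
    obtain ⟨m, hm⟩ := exists_unit 𝒢 (χ.f h)
    obtain ⟨n, hn, hn'⟩ := exists_common 𝒢 (χ.f h) (χ.e h)
    rw [stabIncl_eq ha]
    change stabLeft χ A _ _ = _
    rw [stabLeft_cons, KG.left_tmul _ _ hn, χ.pairing_f_e, map_mul, mul_smul,
      TensorProduct.tmul_smul, TensorProduct.tmul_smul, TensorProduct.smul_tmul',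
      smul_map_of_smul_map hn', map_smul]
  r_core := stab_ind (by rw [map_zero]; exact zero_mem _)
    (fun x y hx hy => by rw [map_add]; exact add_mem hx hy) fun a z => by
      change stabRight χ A _ ∈ _
      rw [stabRight_cons]
      induction z using TensorProduct.induction_on with
      | zero => rw [map_zero, map_zero]; exact zero_mem _
      | add x y hx hy => rw [map_add, map_add]; exact add_mem hx hy
      | tmul x y =>
        obtain ⟨h, hx⟩ := exists_unit 𝒢 x
        rw [KG.right_tmul hx, LinearMap.rTensor_tmul]
        refine tmul_mem_tensorSub (CutAlg.mem_core.mpr fun η => ?_) y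
        obtain ⟨m, ha, hm⟩ := exists_common 𝒢 a (χ.f h)
        refine ⟨pairing 𝒢 η x • of h • a, ?_⟩
        change _ = stabLeft χ A η _
        rw [stabLeft_cons, KG.left_tmul _ _ hm, map_smul, map_smul, stabIncl_eq ha,
          ← smul_map_of_smul_map hm, TensorProduct.tmul_smul, TensorProduct.tmul_smul, map_smul,
          map_smul]

end stab

/-! ### The twisted trace -/

section trace

variable {χ : Cutoff 𝒢} {Q : GAlg.{u₁, u₂, v} 𝒢}

theorem stab_ind_tmul {p : stab Q → Prop} (h0 : p 0) (hadd : ∀ x y, p x → p y → p (x + y))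
    (h : ∀ a x y, p (stabCons a (x ⊗ₜ y))) (x : stab Q) : p x := by
  refine stab_ind h0 hadd (fun a z => ?_) x
  induction z using TensorProduct.induction_on with
  | zero => rw [map_zero]; exact h0
  | add x y hx hy => rw [map_add]; exact hadd _ _ hx hy
  | tmul x y => exact h a x y

theorem chi_pairing {M : Type*} [AddCommGroup M] [Module (Base 𝒢) M] {U : CompactOpens 𝒢.Arr}
    {W : CompactOpens (Ad 𝒢)} (hU : IsBis 𝒢 U) (hW : W ≤ adCO U) (x y : Reg 𝒢) (m : M) :
    (Cc.chi W : OG 𝒢) ⊗ₜ[Base 𝒢] (pairing 𝒢 (act (Cc.chi (binv U)) x) (act (Cc.chi (binv U)) y) • m) =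
      (Cc.chi W : OG 𝒢) ⊗ₜ (pairing 𝒢 x y • m) := by
  rw [pairing_apply, pairing_apply, Reg.fn_act, Reg.fn_act, ← conv_chi_mul (isBis_binv hU),
    push_conv (isBis_binv hU)]
  exact chi_tmul_smul hU hW _ m

/-- `p ⊗ (x ⊗ y) ↦ λ(y, x) p`. -/
def evalPairing (M : Type*) [AddCommGroup M] [Module (Base 𝒢) M] :
    M ⊗[Base 𝒢] (Reg 𝒢 ⊗[Base 𝒢] Reg 𝒢) →ₗ[Base 𝒢] M :=
  (TensorProduct.rid (Base 𝒢) M).toLinearMap ∘ₗ (TensorProduct.lift (pairing 𝒢).flip).lTensor M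

variable (Q)

/-- The twisted trace on the even part of the X-complex. -/
def trE : OG 𝒢 ⊗[Base 𝒢] stab Q →ₗ[Base 𝒢] OG 𝒢 ⊗[Base 𝒢] Q :=
  twOut (evalPairing Q ∘ₗ (TensorProduct.assoc (Base 𝒢) Q (Reg 𝒢) (Reg 𝒢)).toLinearMap) ∘ₗ
    (TensorProduct.assoc (Base 𝒢) Q (Reg 𝒢) (Reg 𝒢)).symm.toLinearMap.lTensor (OG 𝒢)

/-- `(p ⊗ y) ⊗ (q ⊗ x) ↦ λ(y, x) p ⊗ q`. -/
def evalMid : (Q ⊗[Base 𝒢] Reg 𝒢) ⊗[Base 𝒢] (Q ⊗[Base 𝒢] Reg 𝒢) →ₗ[Base 𝒢] Q ⊗[Base 𝒢] Q :=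
  evalPairing (Q ⊗[Base 𝒢] Q) ∘ₗ
    (TensorProduct.comm (Base 𝒢) (Reg 𝒢) (Reg 𝒢)).toLinearMap.lTensor (Q ⊗[Base 𝒢] Q) ∘ₗ
    (TensorProduct.tensorTensorTensorComm (Base 𝒢) Q (Reg 𝒢) Q (Reg 𝒢)).toLinearMap

/-- `(p ⊗ x ⊗ y) ⊗ (q ⊗ x') ⊗ y' ↦ λ(y', x) λ(y, x') p ⊗ q`. -/
def evalTwo : (stab Q ⊗[Base 𝒢] (Q ⊗[Base 𝒢] Reg 𝒢)) ⊗[Base 𝒢] Reg 𝒢 →ₗ[Base 𝒢] Q ⊗[Base 𝒢] Q :=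
  TensorProduct.lift (LinearMap.flip ((LinearMap.llcomp (Base 𝒢) (stab Q ⊗[Base 𝒢] (Q ⊗[Base 𝒢] Reg 𝒢))
    ((Q ⊗[Base 𝒢] Reg 𝒢) ⊗[Base 𝒢] (Q ⊗[Base 𝒢] Reg 𝒢)) (Q ⊗[Base 𝒢] Q) (evalMid Q)) ∘ₗ
    LinearMap.rTensorHom (Q ⊗[Base 𝒢] Reg 𝒢) ∘ₗ LinearMap.lTensorHom Q ∘ₗ KG.contract 𝒢))

/-- The twisted trace on forms `x dy`. -/
def trM : OG 𝒢 ⊗[Base 𝒢] (stab Q ⊗[Base 𝒢] stab Q) →ₗ[Base 𝒢] OG 𝒢 ⊗[Base 𝒢] (Q ⊗[Base 𝒢] Q) :=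
  twOut (evalTwo Q) ∘ₗ
    ((TensorProduct.assoc (Base 𝒢) (stab Q) (Q ⊗[Base 𝒢] Reg 𝒢) (Reg 𝒢)).symm.toLinearMap ∘ₗ
      (TensorProduct.assoc (Base 𝒢) Q (Reg 𝒢) (Reg 𝒢)).symm.toLinearMap.lTensor (stab Q)).lTensor (OG 𝒢)

variable {Q} {U : CompactOpens 𝒢.Arr} {W : CompactOpens (Ad 𝒢)}

theorem trE_chi (hU : IsBis 𝒢 U) (hW : W ≤ adCO U) (q : Q) (x y : Reg 𝒢) :
    trE Q ((Cc.chi W : OG 𝒢) ⊗ₜ stabCons q (x ⊗ₜ y)) =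
      (Cc.chi W : OG 𝒢) ⊗ₜ (pairing 𝒢 (act (Cc.chi (binv U)) y) x • q) :=
  twOut_chi (E := Q ⊗[Base 𝒢] Reg 𝒢) _ hU hW (q ⊗ₜ x) y

theorem evalTwo_tmul (p q : Q) (x y x' y' : Reg 𝒢) :
    evalTwo Q ((stabCons p (x ⊗ₜ y) ⊗ₜ (q ⊗ₜ x')) ⊗ₜ y') =
      pairing 𝒢 y' x • pairing 𝒢 y x' • (p ⊗ₜ q) := by
  change pairing 𝒢 (pairing 𝒢 y' x • y) x' • (p ⊗ₜ[Base 𝒢] q) = _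
  rw [map_smul, LinearMap.smul_apply, smul_eq_mul, mul_smul]

theorem trM_chi (hU : IsBis 𝒢 U) (hW : W ≤ adCO U) (p q : Q) (x y x' y' : Reg 𝒢) :
    trM Q ((Cc.chi W : OG 𝒢) ⊗ₜ (stabCons p (x ⊗ₜ y) ⊗ₜ stabCons q (x' ⊗ₜ y'))) =
      (Cc.chi W : OG 𝒢) ⊗ₜ (pairing 𝒢 (act (Cc.chi (binv U)) y') x • pairing 𝒢 y x' • (p ⊗ₜ q)) :=
  (twOut_chi (E := stab Q ⊗[Base 𝒢] (Q ⊗[Base 𝒢] Reg 𝒢)) _ hU hW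
    (stabCons p (x ⊗ₜ y) ⊗ₜ (q ⊗ₜ x')) y').trans (by rw [evalTwo_tmul])

theorem act_stab_tmul (hU : IsBis 𝒢 U) (q : Q) (x y : Reg 𝒢) :
    act (𝒢 := 𝒢) (Cc.chi (binv U)) (stabCons q (x ⊗ₜ y)) = stabCons (act (𝒢 := 𝒢) (Cc.chi (binv U)) q)
      (act (Cc.chi (binv U)) x ⊗ₜ act (Cc.chi (binv U)) y) := by
  rw [act_stabCons (isBis_binv hU), act_tmul (isBis_binv hU)]

theorem stab_tmul_mul (p q : Q) (x y x' y' : Reg 𝒢) :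
    stabCons p (x ⊗ₜ y) * stabCons q (x' ⊗ₜ y') =
      stabCons (p * q) (x ⊗ₜ (pairing 𝒢 y x' • y')) := by
  rw [stabCons_mul, KG.tmul_mul_tmul]

theorem tr_mul_mul (hU : IsBis 𝒢 U) (hW : W ≤ adCO U) (X Y Z : stab Q) :
    nm Q (trM Q ((Cc.chi W : OG 𝒢) ⊗ₜ (X ⊗ₜ (Y * Z)))) =
      nm Q (trM Q ((Cc.chi W : OG 𝒢) ⊗ₜ ((X * Y) ⊗ₜ Z))) +
      nm Q (trM Q ((Cc.chi W : OG 𝒢) ⊗ₜ ((act (𝒢 := 𝒢) (Cc.chi (binv U)) Z * X) ⊗ₜ Y))) := by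
  revert X Y Z
  refine stab_ind_tmul (by simp) (fun X X' hX hX' Y Z => ?_) fun q x y => ?_
  · simp only [map_add, TensorProduct.tmul_add, TensorProduct.add_tmul, mul_add, add_mul, hX, hX']
    abel
  refine stab_ind_tmul (by simp) (fun X X' hX hX' Z => ?_) fun q' x' y' => ?_
  · simp only [map_add, TensorProduct.tmul_add, TensorProduct.add_tmul, mul_add, add_mul, hX, hX']
    abel
  refine stab_ind_tmul (by simp) (fun X X' hX hX' => ?_) fun q'' x'' y'' => ?_
  · simp only [map_add, TensorProduct.tmul_add, TensorProduct.add_tmul, mul_add, add_mul, hX, hX']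
    abel
  rw [act_stab_tmul hU, stab_tmul_mul, stab_tmul_mul, stab_tmul_mul, trM_chi hU hW, trM_chi hU hW,
    trM_chi hU hW, ← KG.act_pairing (isBis_binv hU), map_smul, map_smul, map_smul,
    LinearMap.smul_apply, LinearMap.smul_apply, LinearMap.smul_apply, smul_eq_mul, smul_eq_mul,
    smul_eq_mul, mul_smul, mul_smul, mul_smul]
  have h := nm_mul hU hW (pairing 𝒢 (act (Cc.chi (binv U)) y') (act (Cc.chi (binv U)) x'') •
    pairing 𝒢 (act (Cc.chi (binv U)) y'') x • pairing 𝒢 y x' • q) q' q''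
  simp only [smul_mul_assoc, mul_smul_comm, ← TensorProduct.smul_tmul'] at h
  rw [h, chi_pairing hU hW]
  congr 3
  rw [smul_comm (pairing 𝒢 y' x''), smul_comm (pairing 𝒢 y' x'')]

theorem tr_mul (hU : IsBis 𝒢 U) (hW : W ≤ adCO U) (Y Z : stab Q) :
    nd Q (trE Q ((Cc.chi W : OG 𝒢) ⊗ₜ (Y * Z))) = nm Q (trM Q ((Cc.chi W : OG 𝒢) ⊗ₜ (Y ⊗ₜ Z))) +
      nm Q (trM Q ((Cc.chi W : OG 𝒢) ⊗ₜ (act (𝒢 := 𝒢) (Cc.chi (binv U)) Z ⊗ₜ Y))) := by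
  revert Y Z
  refine stab_ind_tmul (by simp) (fun X X' hX hX' Z => ?_) fun q' x' y' => ?_
  · simp only [map_add, TensorProduct.tmul_add, TensorProduct.add_tmul, add_mul, hX, hX']
    abel
  refine stab_ind_tmul (by simp) (fun X X' hX hX' => ?_) fun q'' x'' y'' => ?_
  · simp only [map_add, TensorProduct.tmul_add, TensorProduct.add_tmul, mul_add, hX, hX']
    abel
  rw [act_stab_tmul hU, stab_tmul_mul, trM_chi hU hW, trM_chi hU hW, trE_chi hU hW,
    ← KG.act_pairing (isBis_binv hU), map_smul, LinearMap.smul_apply, smul_eq_mul, mul_smul]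
  have h := nd_mul hU hW (pairing 𝒢 (act (Cc.chi (binv U)) y') (act (Cc.chi (binv U)) x'') •
    pairing 𝒢 (act (Cc.chi (binv U)) y'') x' • q') q''
  have h3 : ∀ r r' : Base 𝒢, act (𝒢 := 𝒢) (Cc.chi (binv U)) q'' ⊗ₜ[Base 𝒢] (r • r' • q') =
      r • r' • (act (𝒢 := 𝒢) (Cc.chi (binv U)) q'' ⊗ₜ q') := fun r r' => by
    rw [TensorProduct.tmul_smul, TensorProduct.tmul_smul]
  simp only [smul_mul_assoc, ← TensorProduct.smul_tmul', h3] at h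
  rw [h, chi_pairing hU hW]
  congr 3
  rw [smul_comm (pairing 𝒢 y' x'')]

variable (Q) in
/-- The twisted trace on the odd part of the X-complex. -/
def trO : XOc (stab Q) →ₗ[Base 𝒢] XOc Q :=
  liftXO (nm Q ∘ₗ trM Q) (nd Q ∘ₗ trE Q) (preXO_bG _ _ (fun _ _ hU hW => tr_mul_mul hU hW)
    fun _ _ hU hW => tr_mul hU hW)

theorem trE_stabIncl (z : OG 𝒢 ⊗[Base 𝒢] Q) :
    trE Q ((stabIncl χ Q).toLin.lTensor (OG 𝒢) z) = z := by
  refine LinearMap.congr_fun (f := trE Q ∘ₗ (stabIncl χ Q).toLin.lTensor (OG 𝒢))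
    (g := LinearMap.id) (oTensor_ext (E := ⟨Q⟩) fun U W hU hW q => ?_) z
  change Q at q
  obtain ⟨h, hq⟩ := exists_unit 𝒢 q
  rw [LinearMap.comp_apply, LinearMap.lTensor_tmul, stabIncl_eq hq, trE_chi hU hW,
    ← χ.f_equivariant, χ.pairing_f_e, map_mul, mul_smul, hq]
  refine (chi_tmul_smul hU hW h q).trans ?_
  rw [hq]; rfl

theorem trO_stabIncl (m : XOc Q) : trO Q (xoMap (stabIncl χ Q) m) = m := by
  refine LinearMap.congr_fun (f := trO Q ∘ₗ xoMap (stabIncl χ Q)) (g := LinearMap.id)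
    (XO_ext_chi (fun U W hU hW p q => ?_) fun U W hU hW q => ?_) m
  · obtain ⟨h, hp, hq⟩ := exists_common 𝒢 p q
    have h1 : of h • (p ⊗ₜ[Base 𝒢] q) = p ⊗ₜ q := by rw [TensorProduct.smul_tmul', hp]
    rw [LinearMap.comp_apply, xoMap_nm, LinearMap.lTensor_tmul, TensorProduct.map_tmul, trO,
      liftXO_nm, LinearMap.comp_apply, stabIncl_eq hp, stabIncl_eq hq, trM_chi hU hW,
      ← χ.f_equivariant, χ.pairing_f_e, χ.pairing_f_e, map_mul, map_mul, mul_smul, mul_smul, h1, h1,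
      h1]
    refine (congrArg (nm Q) (chi_tmul_smul hU hW h _)).trans ?_
    rw [h1]; rfl
  · rw [LinearMap.comp_apply, xoMap_nd, trO, liftXO_nd, LinearMap.comp_apply, trE_stabIncl]; rfl

end trace

/-! ### Injectivity of the inclusion on X-complexes -/

namespace Forms

variable {χ : Cutoff 𝒢} (A : GAlg.{u₁, u₂, v} 𝒢) (N : ℕ)

/-- `a ⊗ z ↦ gen a ⊗ z`. -/
def stabGen : stab A →ₗ[Base 𝒢] stab (TA A N) := (gen A N).rTensor (KG 𝒢)

variable {A N}

theorem stabGen_cons (a : A) (z : KG 𝒢) :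
    stabGen A N (stabCons a z) = stabCons (gen A N a) z := rfl

variable (A N) in
/-- The powers of the ideal `J A`, stabilised. -/
def stabJA (k : ℕ) : Submodule (Base 𝒢) (stab (TA A N)) := tensorSub (JA A N k) (KG 𝒢)

theorem stabCons_mem_stabJA {k : ℕ} {q : TA A N} (hq : q ∈ JA A N k) (z : KG 𝒢) :
    stabCons q z ∈ stabJA A N k := tmul_mem_tensorSub hq z

theorem stabJA_ind {k : ℕ} {p : stab (TA A N) → Prop} (h0 : p 0)
    (hadd : ∀ x y, p x → p y → p (x + y)) (h : ∀ q ∈ JA A N k, ∀ z, p (stabCons q z))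
    {s : stab (TA A N)} (hs : s ∈ stabJA A N k) : p s :=
  tensorSub_ind (p := p) h0 hadd h hs

theorem curv_stabGen (a b : A) (z w : KG 𝒢) : curv (stabGen A N) (stabCons a z) (stabCons b w) =
    stabCons (curv (gen A N) a b) (z * w) := by
  rw [curv_apply, curv_apply, stabCons_mul, stabGen_cons, stabGen_cons, stabGen_cons, stabCons_mul]
  exact (TensorProduct.sub_tmul _ _ _).symm

theorem mul_curv_stabGen {l : ℕ} {s : stab (TA A N)}
    (h : ∀ a b z w, s * stabCons (curv (gen A N) a b) (z * w) ∈ stabJA A N l) (x y : stab A) :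
    s * curv (stabGen A N) x y ∈ stabJA A N l := by
  revert x y
  refine stab_ind (by simp) (fun x x' hx hx' y => ?_) fun a z => ?_
  · rw [map_add, LinearMap.add_apply, mul_add]; exact add_mem (hx y) (hx' y)
  refine stab_ind (by simp) (fun x x' hx hx' => ?_) fun b w => ?_
  · rw [map_add, mul_add]; exact add_mem hx hx'
  rw [curv_stabGen]
  exact h a b z w

variable (A N) in
/-- The filtration of the stabilised tensor algebra. -/
def stabFilt : CurvFilt (stabGen A N) N where
  F := stabJA A N
  mem_zero x := rTensor_mem_tensorSub (S := JA A N 0) (fun _ => Submodule.mem_top) x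
  curv_mem := by
    refine stab_ind (by simp) (fun x x' hx hx' y => ?_) fun a z => ?_
    · rw [map_add, LinearMap.add_apply]; exact add_mem (hx y) (hx' y)
    refine stab_ind (by simp) (fun x x' hx hx' => ?_) fun b w => ?_
    · rw [map_add]; exact add_mem hx hx'
    rw [curv_stabGen]
    exact stabCons_mem_stabJA (curv_mem_JA a b) _
  mul_curv k s hs x y := by
    refine mul_curv_stabGen (fun a b z w => ?_) x y
    refine stabJA_ind (p := fun s =>
      s * stabCons (curv (gen A N) a b) (z * w) ∈ stabJA A N (k + 1)) (by simp)
      (fun x y hx hy => by rw [add_mul]; exact add_mem hx hy) (fun q hq m => ?_) hs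
    rw [stabCons_mul]
    exact stabCons_mem_stabJA (mul_curv_mem_JA hq a b) _
  eq_zero s hs := stabJA_ind (p := fun s => s = 0) rfl
    (fun x y hx hy => by rw [hx, hy, add_zero])
    (fun q hq m => by
      rw [JA_eq_zero (Nat.lt_succ_self N) hq]; exact TensorProduct.zero_tmul _ _) hs

variable (A N) in
/-- The homomorphism `T(A ⊗ K_G) → T A ⊗ K_G`. -/
def TAstab : GAlgHom (TA (stab A) N) (stab (TA A N)) where
  toLin := (exists_ext (stabGen A N) (stabFilt A N)).choose
  map_mul := (exists_ext (stabGen A N) (stabFilt A N)).choose_spec.2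
  equivariant := by
    have h1 := (exists_ext (stabGen A N) (stabFilt A N)).choose_spec.1
    have h2 := (exists_ext (stabGen A N) (stabFilt A N)).choose_spec.2
    refine isEquivariant_of_chi' _ fun U hU => ?_
    have h3 : ∀ x, stabGen A N (act (𝒢 := 𝒢) (Cc.chi U) x) =
        act (𝒢 := 𝒢) (Cc.chi U) (stabGen A N x) := KG.act_rTensor hU fun a => (act_gen (Cc.chi U) a).symm
    refine TA_ind' (by simp) (fun x y hx hy => by simp only [map_sub, hx, hy])
      (fun a => by rw [act_gen, h1, h1, h3]) (fun x a hx => ?_)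
    rw [GAlgebra.act_mul hU, h2, h2, act_gen, h1, h1, h3, hx, GAlgebra.act_mul hU]

theorem TAstab_gen (a : stab A) : (TAstab A N).toLin (gen (stab A) N a) = stabGen A N a :=
  (exists_ext (stabGen A N) (stabFilt A N)).choose_spec.1 a

theorem TAstab_TAmap (x : TA A N) : (TAstab A N).toLin ((TAmap (stabIncl χ A) N).toLin x) =
    (stabIncl χ (TA A N)).toLin x := by
  refine TA_ind' (p := fun x => (TAstab A N).toLin ((TAmap (stabIncl χ A) N).toLin x) =
    (stabIncl χ (TA A N)).toLin x) (by simp) (fun x y hx hy => by simp only [map_sub, hx, hy])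
    (fun a => ?_) (fun x a hx => ?_) x
  all_goals
    have h1 : (TAstab A N).toLin ((TAmap (stabIncl χ A) N).toLin (gen A N a)) =
        (stabIncl χ (TA A N)).toLin (gen A N a) := by
      obtain ⟨h, ha⟩ := exists_unit 𝒢 a
      have h' : of h • gen A N a = gen A N a := by rw [← map_smul, ha]
      rw [TAmap_gen, TAstab_gen, stabIncl_eq ha, stabGen_cons, stabIncl_eq h']
  · exact h1
  · rw [(TAmap (stabIncl χ A) N).map_mul, (TAstab A N).map_mul, hx, h1,
      (stabIncl χ (TA A N)).map_mul]

theorem lTensor_TAmap_injective :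
    Function.Injective ((TAmap (stabIncl χ A) N).toLin.lTensor (OG 𝒢)) := by
  refine Function.LeftInverse.injective
    (g := trE (TA A N) ∘ₗ (TAstab A N).toLin.lTensor (OG 𝒢)) fun z => ?_
  rw [LinearMap.comp_apply, ← LinearMap.comp_apply (LinearMap.lTensor _ _), ← LinearMap.lTensor_comp,
    ← trE_stabIncl (χ := χ) z]
  congr 3
  · exact LinearMap.ext TAstab_TAmap
  · rw [trE_stabIncl]

theorem xoMap_TAmap_injective : Function.Injective (xoMap (TAmap (stabIncl χ A) N)) := by
  refine Function.LeftInverse.injective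
    (g := trO (TA A N) ∘ₗ xoMap (TAstab A N)) fun m => ?_
  have h := LinearMap.congr_fun (congrArg Subtype.val (XOmap_comp (TAmap (stabIncl χ A) N) (TAstab A N)
    (stabIncl χ (TA A N)) TAstab_TAmap)) m
  exact (congrArg (trO (TA A N)) h).trans (trO_stabIncl m)

end Forms

/-! ### Shifted morphisms of projective systems -/

namespace ColimHom

theorem of_map (V : ProAYD.{u₁, u₂, v} 𝒢) (N : AYD.{u₁, u₂, w} 𝒢) {i j : ℕ} (h : i ≤ j)
    (f : AYDHom (V.obj i) N) : of V N j (AYD.comp f (V.map h)) = of V N i f :=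
  Module.DirectLimit.of_f (R := ℂ) (G := fun i : ℕ => AYDHom (V.obj i) N)
    (f := fun _ _ h => AYD.precomp (V.map h) N) (hij := h)

theorem post_add (V : ProAYD.{u₁, u₂, v} 𝒢) {N : AYD.{u₁, u₂, w} 𝒢} {N' : AYD.{u₁, u₂, x} 𝒢}
    (g g' : AYDHom N N') (z : ColimHom V N) : post V (g + g') z = post V g z + post V g' z := by
  refine ind (p := fun z => post V (g + g') z = post V g z + post V g' z) (fun i f => ?_) z
  rw [post_of, post_of, post_of, ← map_add]; rfl

theorem post_id (V : ProAYD.{u₁, u₂, v} 𝒢) {N : AYD.{u₁, u₂, w} 𝒢} (z : ColimHom V N) :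
    post V (AYD.id N) z = z := by
  refine ind (p := fun z => post V (AYD.id N) z = z) (fun i f => ?_) z
  rw [post_of]; rfl

end ColimHom

theorem AYD.comp_add {M : AYD.{u₁, u₂, v} 𝒢} {N : AYD.{u₁, u₂, w} 𝒢} {P : AYD.{u₁, u₂, x} 𝒢}
    (g : AYDHom N P) (f f' : AYDHom M N) :
    AYD.comp g (f + f') = AYD.comp g f + AYD.comp g f' := map_add (AYD.postcomp M g) f f'

/-- A morphism of projective systems which lowers the level. -/
structure ShiftHom (V : ProAYD.{u₁, u₂, v} 𝒢) (W : ProAYD.{u₁, u₂, w} 𝒢) (s : ℕ → ℕ)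
    (hs : Monotone s) where
  app : ∀ i, AYDHom (V.obj (s i)) (W.obj i)
  comm : ∀ {i j : ℕ} (h : i ≤ j),
    AYD.comp (W.map h) (app j) = AYD.comp (app i) (V.map (hs h))

namespace ShiftHom

variable {s : ℕ → ℕ} {hs : Monotone s}

/-- Composition `φ ↦ S φ`. -/
def post (V : ProAYD.{u₁, u₂, v} 𝒢) {W : ProAYD.{u₁, u₂, w} 𝒢} {W' : ProAYD.{u₁, u₂, x} 𝒢}
    (S : ShiftHom W W' s hs) (φ : ProHom V W) : ProHom V W' :=
  ⟨fun j => ColimHom.post V (S.app j) (φ.1 (s j)), fun {i j} h => by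
    rw [ColimHom.post_post, S.comm, ← ColimHom.post_post, φ.2]⟩

variable {V : ProAYD.{u₁, u₂, v} 𝒢} {V' : ProAYD.{u₁, u₂, w} 𝒢} (S : ShiftHom V V' s hs)

/-- The map `colim_i Hom(V'_i, N) → colim_i Hom(V_i, N)` given by a shifted morphism. -/
def colimPre (N : AYD.{u₁, u₂, x} 𝒢) : ColimHom V' N →ₗ[ℂ] ColimHom V N :=
  Module.DirectLimit.lift ℂ ℕ (fun i : ℕ => AYDHom (V'.obj i) N)
    (fun _ _ h => AYD.precomp (V'.map h) N)
    (fun i => ColimHom.of V N (s i) ∘ₗ AYD.precomp (S.app i) N) fun i j h f => by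
      change ColimHom.of V N (s j) (AYD.comp f (AYD.comp (V'.map h) (S.app j))) =
        ColimHom.of V N (s i) (AYD.comp f (S.app i))
      rw [S.comm, ← ColimHom.of_map V N (hs h)]
      rfl

theorem colimPre_of (N : AYD.{u₁, u₂, x} 𝒢) (i : ℕ) (f : AYDHom (V'.obj i) N) :
    S.colimPre N (ColimHom.of V' N i f) = ColimHom.of V N (s i) (AYD.comp f (S.app i)) :=
  Module.DirectLimit.lift_of ..

theorem post_colimPre {N : AYD.{u₁, u₂, x} 𝒢} {N' : AYD.{u₁, u₂, y} 𝒢} (g : AYDHom N N')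
    (z : ColimHom V' N) :
    ColimHom.post V g (S.colimPre N z) = S.colimPre N' (ColimHom.post V' g z) := by
  refine ColimHom.ind (p := fun z =>
    ColimHom.post V g (S.colimPre N z) = S.colimPre N' (ColimHom.post V' g z)) (fun i f => ?_) z
  rw [colimPre_of, ColimHom.post_of, ColimHom.post_of, colimPre_of]; rfl

/-- Composition `φ ↦ φ S`. -/
def pre (W : ProAYD.{u₁, u₂, x} 𝒢) (φ : ProHom V' W) : ProHom V W :=
  ⟨fun j => S.colimPre (W.obj j) (φ.1 j), fun {i j} h => by rw [post_colimPre, φ.2]⟩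

theorem post_pre {W : ProAYD.{u₁, u₂, x} 𝒢} {W' : ProAYD.{u₁, u₂, y} 𝒢} (g : LevelHom W W')
    (φ : ProHom V' W) : ProHom.post V g (S.pre W φ) = S.pre W' (ProHom.post V' g φ) :=
  Subtype.ext (funext fun j => S.post_colimPre (g.app j) (φ.1 j))

theorem pre_post {W : ProAYD.{u₁, u₂, x} 𝒢} {W' : ProAYD.{u₁, u₂, y} 𝒢} (T : ShiftHom W W' s hs)
    (f : LevelHom V V') (φ : ProHom V' W) :
    ProHom.pre f W' (T.post V' φ) = T.post V (ProHom.pre f W φ) :=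
  Subtype.ext (funext fun j => (ColimHom.post_pre f (T.app j) (φ.1 (s j))).symm)

theorem post_neg {W : ProAYD.{u₁, u₂, x} 𝒢} (φ : ProHom W V) : S.post W (-φ) = -S.post W φ :=
  Subtype.ext (funext fun j => map_neg (ColimHom.post W (S.app j)) _)

theorem pre_neg {W : ProAYD.{u₁, u₂, x} 𝒢} (φ : ProHom V' W) : S.pre W (-φ) = -S.pre W φ :=
  Subtype.ext (funext fun j => map_neg (S.colimPre (W.obj j)) _)

end ShiftHom

section homotopy

variable {s : ℕ → ℕ} {hs : Monotone s} {V : ProAYD.{u₁, u₂, v} 𝒢} {W : ProAYD.{u₁, u₂, w} 𝒢}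
  {L : LevelHom V V} {S : ShiftHom V W s hs} {T : ShiftHom W V s hs} {d : LevelHom V W}
  {d' : LevelHom W V} (hle : ∀ i, i ≤ s i)
  (h : ∀ i, AYD.comp (L.app i) (V.map (hle i)) =
    AYD.comp (d'.app i) (S.app i) + AYD.comp (T.app i) (d.app (s i)))
include h

theorem post_of_homotopy (X : ProAYD.{u₁, u₂, x} 𝒢) (φ : ProHom X V) : ProHom.post X L φ =
    ProHom.post X d' (S.post X φ) + T.post X (ProHom.post X d φ) :=
  Subtype.ext (funext fun j => by
    change ColimHom.post X (L.app j) (φ.1 j) =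
      ColimHom.post X (d'.app j) (ColimHom.post X (S.app j) (φ.1 (s j))) +
        ColimHom.post X (T.app j) (ColimHom.post X (d.app (s j)) (φ.1 (s j)))
    rw [← φ.2 (hle j), ColimHom.post_post, h, ColimHom.post_add, ColimHom.post_post,
      ColimHom.post_post])

theorem pre_of_homotopy (X : ProAYD.{u₁, u₂, x} 𝒢) (φ : ProHom V X) : ProHom.pre L X φ =
    S.pre X (ProHom.pre d' X φ) + ProHom.pre d X (T.pre X φ) :=
  Subtype.ext (funext fun j => by
    change ColimHom.pre L (X.obj j) (φ.1 j) =
      S.colimPre (X.obj j) (ColimHom.pre d' (X.obj j) (φ.1 j)) +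
        ColimHom.pre d (X.obj j) (T.colimPre (X.obj j) (φ.1 j))
    refine ColimHom.ind (p := fun z => ColimHom.pre L (X.obj j) z =
      S.colimPre (X.obj j) (ColimHom.pre d' (X.obj j) z) +
        ColimHom.pre d (X.obj j) (T.colimPre (X.obj j) z)) (fun i f => ?_) (φ.1 j)
    rw [ColimHom.pre_of, ColimHom.pre_of, T.colimPre_of, ColimHom.pre_of, S.colimPre_of, ← map_add,
      ← ColimHom.of_map V (X.obj j) (hle i)]
    refine congrArg (ColimHom.of V (X.obj j) (s i)) ?_
    exact (congrArg (AYD.comp f) (h i)).trans (AYD.comp_add _ _ _))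

end homotopy

/-! ### Homology -/

namespace GradedAYD

section homology

variable {M N M' N' : Type*} [AddCommGroup M] [Module ℂ M] [AddCommGroup N] [Module ℂ N]
  [AddCommGroup M'] [Module ℂ M'] [AddCommGroup N'] [Module ℂ N']
  {f : M →ₗ[ℂ] N} {g : N →ₗ[ℂ] M} {f' : M' →ₗ[ℂ] N'} {g' : N' →ₗ[ℂ] M'}

/-- The class of a cycle. -/
def Homology.mk (y : N) (hy : g y = 0) : Homology f g :=
  Submodule.Quotient.mk (p := (LinearMap.range f).submoduleOf (LinearMap.ker g)) ⟨y, hy⟩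

theorem Homology.ind {p : Homology f g → Prop} (h : ∀ y hy, p (Homology.mk y hy)) (z) : p z :=
  Submodule.Quotient.induction_on _ z fun y => h y.1 y.2

theorem Homology.mk_eq {y y' : N} {hy : g y = 0} {hy' : g y' = 0} (x : M) (h : y = y' + f x) :
    (Homology.mk y hy : Homology f g) = Homology.mk y' hy' :=
  (Submodule.Quotient.eq _).mpr ⟨x, by
    change f x = y - y'
    rw [h, add_sub_cancel_left]⟩

end homology

end GradedAYD

/-! ### Contractible operators and deformation retracts -/

namespace ProHom

variable {V : ProAYD.{u₁, u₂, v} 𝒢} {W : ProAYD.{u₁, u₂, w} 𝒢} {ι : LevelHom V W} {τ : LevelHom W V}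

theorem post_eq_of_comp {L G : LevelHom W W}
    (h : ∀ i, AYD.comp (ι.app i) (τ.app i) = AYD.id _ + AYD.comp (L.app i) (G.app i))
    (X : ProAYD.{u₁, u₂, x} 𝒢) (φ : ProHom X W) :
    ProHom.post X ι (ProHom.post X τ φ) = φ + ProHom.post X L (ProHom.post X G φ) :=
  Subtype.ext (funext fun j => by
    change ColimHom.post X (ι.app j) (ColimHom.post X (τ.app j) (φ.1 j)) =
      φ.1 j + ColimHom.post X (L.app j) (ColimHom.post X (G.app j) (φ.1 j))
    rw [ColimHom.post_post, ColimHom.post_post, h, ColimHom.post_add, ColimHom.post_id])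

theorem pre_eq_of_comp {L G : LevelHom W W}
    (h : ∀ i, AYD.comp (ι.app i) (τ.app i) = AYD.id _ + AYD.comp (L.app i) (G.app i))
    (X : ProAYD.{u₁, u₂, x} 𝒢) (φ : ProHom W X) :
    ProHom.pre τ X (ProHom.pre ι X φ) = φ + ProHom.pre G X (ProHom.pre L X φ) :=
  Subtype.ext (funext fun j => by
    change ColimHom.pre τ (X.obj j) (ColimHom.pre ι (X.obj j) (φ.1 j)) =
      φ.1 j + ColimHom.pre G (X.obj j) (ColimHom.pre L (X.obj j) (φ.1 j))
    refine ColimHom.ind (p := fun z => ColimHom.pre τ (X.obj j) (ColimHom.pre ι (X.obj j) z) =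
      z + ColimHom.pre G (X.obj j) (ColimHom.pre L (X.obj j) z)) (fun i f => ?_) (φ.1 j)
    rw [ColimHom.pre_of, ColimHom.pre_of, ColimHom.pre_of, ColimHom.pre_of, ← map_add]
    refine congrArg (ColimHom.of W (X.obj j) i) ?_
    exact (congrArg (AYD.comp f) (h i)).trans (AYD.comp_add _ _ _))

variable (h : ∀ i, AYD.comp (τ.app i) (ι.app i) = AYD.id _)
include h

theorem post_post_of_comp_eq_id (X : ProAYD.{u₁, u₂, x} 𝒢) (φ : ProHom X V) :
    ProHom.post X τ (ProHom.post X ι φ) = φ :=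
  Subtype.ext (funext fun j => by
    change ColimHom.post X (τ.app j) (ColimHom.post X (ι.app j) (φ.1 j)) = φ.1 j
    rw [ColimHom.post_post, h, ColimHom.post_id])

theorem pre_pre_of_comp_eq_id (X : ProAYD.{u₁, u₂, x} 𝒢) (φ : ProHom V X) :
    ProHom.pre ι X (ProHom.pre τ X φ) = φ :=
  Subtype.ext (funext fun j => by
    change ColimHom.pre ι (X.obj j) (ColimHom.pre τ (X.obj j) (φ.1 j)) = φ.1 j
    refine ColimHom.ind (p := fun z => ColimHom.pre ι (X.obj j) (ColimHom.pre τ (X.obj j) z) = z)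
      (fun i f => ?_) (φ.1 j)
    rw [ColimHom.pre_of, ColimHom.pre_of]
    exact congrArg (ColimHom.of V (X.obj j) i) (congrArg (AYD.comp f) (h i)))

end ProHom

namespace GradedAYD

theorem Homology.map_bijective {M N M' N' : Type*} [AddCommGroup M] [Module ℂ M] [AddCommGroup N]
    [Module ℂ N] [AddCommGroup M'] [Module ℂ M'] [AddCommGroup N'] [Module ℂ N']
    {f : M →ₗ[ℂ] N} {g : N →ₗ[ℂ] M} {f' : M' →ₗ[ℂ] N'} {g' : N' →ₗ[ℂ] M'}
    {a : M →ₗ[ℂ] M'} {b : N →ₗ[ℂ] N'} {h : ∀ x, b (f x) = f' (a x)} {h' : ∀ y, a (g y) = g' (b y)}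
    (a' : M' →ₗ[ℂ] M) (b' : N' →ₗ[ℂ] N) (k : ∀ x, b' (f' x) = f (a' x))
    (k' : ∀ y, a' (g' y) = g (b' y)) (h1 : ∀ y, g y = 0 → ∃ x, b' (b y) = y + f x)
    (h2 : ∀ y, g' y = 0 → ∃ x, b (b' y) = y + f' x) :
    Function.Bijective (Homology.map (f := f) (g := g) (f' := f') (g' := g') a b h h') := by
  refine ⟨Function.LeftInverse.injective (g := Homology.map a' b' k k') ?_,
    Function.RightInverse.surjective (g := Homology.map a' b' k k') ?_⟩
  · refine Homology.ind fun y hy => ?_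
    obtain ⟨x, hx⟩ := h1 y hy
    exact Homology.mk_eq x hx
  · refine Homology.ind fun y hy => ?_
    obtain ⟨x, hx⟩ := h2 y hy
    exact Homology.mk_eq x hx

/-- An even operator which is contractible up to a shift of the level. -/
structure Contraction (W : GradedAYD.{u₁, u₂, w} 𝒢) where
  L0 : LevelHom W.even W.even
  L1 : LevelHom W.odd W.odd
  s : ℕ → ℕ
  hs : Monotone s
  le_s : ∀ i, i ≤ s i
  S : ShiftHom W.even W.odd s hs
  T : ShiftHom W.odd W.even s hs
  htp_even : ∀ i, AYD.comp (L0.app i) (W.even.map (le_s i)) =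
    AYD.comp (W.d1.app i) (S.app i) + AYD.comp (T.app i) (W.d0.app (s i))
  htp_odd : ∀ i, AYD.comp (L1.app i) (W.odd.map (le_s i)) =
    AYD.comp (W.d0.app i) (T.app i) + AYD.comp (S.app i) (W.d1.app (s i))

namespace Contraction

variable {W : GradedAYD.{u₁, u₂, w} 𝒢} (K : Contraction W) (X : GradedAYD.{u₁, u₂, x} 𝒢)

theorem post_even (ψ : HomEven X W) (hψ : dEven X W ψ = 0) : ∃ η,
    ((ProHom.post X.even K.L0 ψ.1, ProHom.post X.odd K.L1 ψ.2) : HomEven X W) = dOdd X W η := by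
  have h1 : ProHom.pre X.d0 W.odd ψ.2 = ProHom.post X.even W.d0 ψ.1 :=
    sub_eq_zero.mp (congrArg Prod.fst hψ)
  have h2 : ProHom.pre X.d1 W.even ψ.1 = ProHom.post X.odd W.d1 ψ.2 :=
    sub_eq_zero.mp (congrArg Prod.snd hψ)
  refine ⟨(K.S.post X.even ψ.1, K.T.post X.odd ψ.2), Prod.ext ?_ ?_⟩
  · rw [post_of_homotopy K.le_s K.htp_even, ← h1, ← ShiftHom.pre_post, add_comm]; rfl
  · rw [post_of_homotopy K.le_s K.htp_odd, ← h2, ← ShiftHom.pre_post, add_comm]; rfl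

theorem post_odd (ψ : HomOdd X W) (hψ : dOdd X W ψ = 0) : ∃ η,
    ((ProHom.post X.even K.L1 ψ.1, ProHom.post X.odd K.L0 ψ.2) : HomOdd X W) = dEven X W η := by
  have h1 : ProHom.post X.even W.d1 ψ.1 = -ProHom.pre X.d0 W.even ψ.2 :=
    eq_neg_of_add_eq_zero_right (congrArg Prod.fst hψ)
  have h2 : ProHom.post X.odd W.d0 ψ.2 = -ProHom.pre X.d1 W.odd ψ.1 :=
    eq_neg_of_add_eq_zero_right (congrArg Prod.snd hψ)
  refine ⟨-(K.T.post X.even ψ.1, K.S.post X.odd ψ.2), ?_⟩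
  rw [map_neg]
  refine Prod.ext ?_ ?_
  · rw [post_of_homotopy K.le_s K.htp_odd, h1, ShiftHom.post_neg, ← ShiftHom.pre_post,
      ← sub_eq_add_neg]
    exact (neg_sub _ _).symm
  · rw [post_of_homotopy K.le_s K.htp_even, h2, ShiftHom.post_neg, ← ShiftHom.pre_post,
      ← sub_eq_add_neg]
    exact (neg_sub _ _).symm

theorem pre_even (ψ : HomEven W X) (hψ : dEven W X ψ = 0) : ∃ η,
    ((ProHom.pre K.L0 X.even ψ.1, ProHom.pre K.L1 X.odd ψ.2) : HomEven W X) = dOdd W X η := by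
  have h1 : ProHom.pre W.d0 X.odd ψ.2 = ProHom.post W.even X.d0 ψ.1 :=
    sub_eq_zero.mp (congrArg Prod.fst hψ)
  have h2 : ProHom.pre W.d1 X.even ψ.1 = ProHom.post W.odd X.d1 ψ.2 :=
    sub_eq_zero.mp (congrArg Prod.snd hψ)
  refine ⟨(K.S.pre X.odd ψ.2, K.T.pre X.even ψ.1), Prod.ext ?_ ?_⟩
  · rw [pre_of_homotopy K.le_s K.htp_even, h2, ← ShiftHom.post_pre, add_comm]; rfl
  · rw [pre_of_homotopy K.le_s K.htp_odd, h1, ← ShiftHom.post_pre, add_comm]; rfl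

theorem pre_odd (ψ : HomOdd W X) (hψ : dOdd W X ψ = 0) : ∃ η,
    ((ProHom.pre K.L0 X.odd ψ.1, ProHom.pre K.L1 X.even ψ.2) : HomOdd W X) = dEven W X η := by
  have h1 : ProHom.pre W.d0 X.even ψ.2 = -ProHom.post W.even X.d1 ψ.1 :=
    eq_neg_of_add_eq_zero_left (congrArg Prod.fst hψ)
  have h2 : ProHom.pre W.d1 X.odd ψ.1 = -ProHom.post W.odd X.d0 ψ.2 :=
    eq_neg_of_add_eq_zero_left (congrArg Prod.snd hψ)
  refine ⟨(K.S.pre X.even ψ.2, K.T.pre X.odd ψ.1), Prod.ext ?_ ?_⟩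
  · rw [pre_of_homotopy K.le_s K.htp_even, h2, ShiftHom.pre_neg, ← ShiftHom.post_pre, add_comm,
      ← sub_eq_add_neg]; rfl
  · rw [pre_of_homotopy K.le_s K.htp_odd, h1, ShiftHom.pre_neg, ← ShiftHom.post_pre, add_comm,
      ← sub_eq_add_neg]; rfl

end Contraction

/-- A left inverse `tr` of `ι` such that `ι tr - 1` is a multiple of a contractible operator. -/
structure Retraction {V : GradedAYD.{u₁, u₂, v} 𝒢} {W : GradedAYD.{u₁, u₂, w} 𝒢}
    (ι : GradedMap V W) extends Contraction W where
  tr : GradedMap W V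
  G : GradedMap W W
  tr_even : ∀ i, AYD.comp (tr.even.app i) (ι.even.app i) = AYD.id _
  tr_odd : ∀ i, AYD.comp (tr.odd.app i) (ι.odd.app i) = AYD.id _
  incl_even : ∀ i, AYD.comp (ι.even.app i) (tr.even.app i) =
    AYD.id _ + AYD.comp (L0.app i) (G.even.app i)
  incl_odd : ∀ i, AYD.comp (ι.odd.app i) (tr.odd.app i) =
    AYD.id _ + AYD.comp (L1.app i) (G.odd.app i)

namespace Retraction

variable {V : GradedAYD.{u₁, u₂, v} 𝒢} {W : GradedAYD.{u₁, u₂, w} 𝒢} {ι : GradedMap V W}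
  (K : Retraction ι) (X : GradedAYD.{u₁, u₂, x} 𝒢)
include K

theorem post0_bijective : Function.Bijective (H0.post X ι) := by
  refine Homology.map_bijective (postOdd X K.tr) (postEven X K.tr) (postEven_dOdd X K.tr)
    (postOdd_dEven X K.tr) (fun φ _ => ⟨0, ?_⟩) fun φ hφ => ?_
  · rw [map_zero, add_zero]
    exact Prod.ext (ProHom.post_post_of_comp_eq_id K.tr_even _ _)
      (ProHom.post_post_of_comp_eq_id K.tr_odd _ _)
  · obtain ⟨η, hη⟩ := K.post_even X (postEven X K.G φ)
      (by rw [← postOdd_dEven, hφ, map_zero])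
    refine ⟨η, ?_⟩
    rw [← hη]
    exact Prod.ext (ProHom.post_eq_of_comp K.incl_even _ _) (ProHom.post_eq_of_comp K.incl_odd _ _)

theorem post1_bijective : Function.Bijective (H1.post X ι) := by
  refine Homology.map_bijective (postEven X K.tr) (postOdd X K.tr) (postOdd_dEven X K.tr)
    (postEven_dOdd X K.tr) (fun φ _ => ⟨0, ?_⟩) fun φ hφ => ?_
  · rw [map_zero, add_zero]
    exact Prod.ext (ProHom.post_post_of_comp_eq_id K.tr_odd _ _)
      (ProHom.post_post_of_comp_eq_id K.tr_even _ _)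
  · obtain ⟨η, hη⟩ := K.post_odd X (postOdd X K.G φ)
      (by rw [← postEven_dOdd, hφ, map_zero])
    refine ⟨η, ?_⟩
    rw [← hη]
    exact Prod.ext (ProHom.post_eq_of_comp K.incl_odd _ _) (ProHom.post_eq_of_comp K.incl_even _ _)

theorem pre0_bijective : Function.Bijective (H0.pre ι X) := by
  refine Homology.map_bijective (preOdd K.tr X) (preEven K.tr X) (preEven_dOdd K.tr X)
    (preOdd_dEven K.tr X) (fun φ hφ => ?_) fun φ _ => ⟨0, ?_⟩
  · obtain ⟨η, hη⟩ := K.pre_even X φ hφ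
    refine ⟨preOdd K.G X η, ?_⟩
    rw [← preEven_dOdd, ← hη]
    exact Prod.ext (ProHom.pre_eq_of_comp K.incl_even _ _) (ProHom.pre_eq_of_comp K.incl_odd _ _)
  · rw [map_zero, add_zero]
    exact Prod.ext (ProHom.pre_pre_of_comp_eq_id K.tr_even _ _)
      (ProHom.pre_pre_of_comp_eq_id K.tr_odd _ _)

theorem pre1_bijective : Function.Bijective (H1.pre ι X) := by
  refine Homology.map_bijective (preEven K.tr X) (preOdd K.tr X) (preOdd_dEven K.tr X)
    (preEven_dOdd K.tr X) (fun φ hφ => ?_) fun φ _ => ⟨0, ?_⟩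
  · obtain ⟨η, hη⟩ := K.pre_odd X φ hφ
    refine ⟨preEven K.G X η, ?_⟩
    rw [← preOdd_dEven, ← hη]
    exact Prod.ext (ProHom.pre_eq_of_comp K.incl_even _ _) (ProHom.pre_eq_of_comp K.incl_odd _ _)
  · rw [map_zero, add_zero]
    exact Prod.ext (ProHom.pre_pre_of_comp_eq_id K.tr_even _ _)
      (ProHom.pre_pre_of_comp_eq_id K.tr_odd _ _)

end Retraction

end GradedAYD

/-! ### The retraction given by a diagonalisable contractible operator -/

section prod

variable {R : Type*} [CommRing R] [Algebra ℂ R] {V V' : Type*} [AddCommGroup V] [Module R V]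
  [AddCommGroup V'] [Module R V'] {L : V →ₗ[R] V} {L' : V' →ₗ[R] V'}

theorem map_prodG (m : V →ₗ[R] V') (hm : ∀ v, m (L v) = L' (m v)) (k : ℕ) (v : V) :
    m (prodG L k v) = prodG L' k (m v) := by
  change m (prodQ L k (v - prodE L k v)) = prodQ L' k (m v - prodE L' k (m v))
  rw [map_prodQ m hm, map_sub, map_prodE m hm]

end prod

namespace AYD

variable {M : AYD.{u₁, u₂, v} 𝒢} {N : AYD.{u₁, u₂, w} 𝒢} {P : AYD.{u₁, u₂, x} 𝒢}

theorem invNat_smul_mem (k : ℕ) {f : M.toGMod →ₗ[Base 𝒢] N.toGMod} (hf : f ∈ AYDHom M N) :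
    invNat (Base 𝒢) k • f ∈ AYDHom M N := by
  have h : invNat (Base 𝒢) k • f = ((k + 1 : ℂ)⁻¹) • f := LinearMap.ext fun m =>
    algebraMap_smul (Base 𝒢) _ (f m)
  rw [h]
  exact Submodule.smul_mem _ _ hf

variable {L : M.toGMod →ₗ[Base 𝒢] M.toGMod} (hL : L ∈ AYDHom M M)
include hL

theorem prodE_mem (k : ℕ) : prodE L k ∈ AYDHom M M := by
  induction k with
  | zero => exact (AYD.id M).2
  | succ k ih => exact add_mem ih (invNat_smul_mem k (AYD.comp ⟨L, hL⟩ ⟨_, ih⟩).2)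

theorem prodQ_mem (k : ℕ) : prodQ L k ∈ AYDHom M M := by
  induction k with
  | zero => exact zero_mem _
  | succ k ih => exact add_mem ih (invNat_smul_mem k (prodE_mem hL k))

theorem prodG_mem (k : ℕ) : prodG L k ∈ AYDHom M M :=
  (AYD.comp ⟨_, prodQ_mem hL k⟩ ⟨_, sub_mem (AYD.id M).2 (prodE_mem hL k)⟩).2

omit hL

variable (ι : AYDHom M N) (hι : Function.Injective ι.1) (e : AYDHom P N)
  (he : ∀ p, e.1 p ∈ LinearMap.range ι.1)

/-- The lift of a morphism through an injective morphism. -/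
def lift : AYDHom P M :=
  let φ : P.toGMod →ₗ[Base 𝒢] M.toGMod :=
    (LinearEquiv.ofInjective ι.1 hι).symm.toLinearMap ∘ₗ e.1.codRestrict _ he
  have h : ∀ p, ι.1 (φ p) = e.1 p := fun p =>
    congrArg Subtype.val ((LinearEquiv.ofInjective ι.1 hι).apply_symm_apply ⟨e.1 p, he p⟩)
  ⟨φ, fun a m => hι (by rw [h, ι.2.1, h, e.2.1]), fun f m => hι (by rw [h, ι.2.2, h, e.2.2])⟩

theorem lift_apply (p : P.toGMod) : ι.1 ((lift ι hι e he).1 p) = e.1 p :=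
  congrArg Subtype.val ((LinearEquiv.ofInjective ι.1 hι).apply_symm_apply ⟨e.1 p, he p⟩)

theorem hom_ext {f g : AYDHom M N} (h : ∀ m, f.1 m = g.1 m) : f = g :=
  Subtype.ext (LinearMap.ext h)

end AYD

section pro

variable {V : ProAYD.{u₁, u₂, v} 𝒢} {W : ProAYD.{u₁, u₂, w} 𝒢}

/-- A diagonalisable operator on a projective system, with kernel the image of an injective map and
with eigenvalues `0, -1, …, -k i`. -/
structure Diag (ι : LevelHom V W) (L : LevelHom W W) (k : ℕ → ℕ) : Prop where
  inj : ∀ i, Function.Injective (ι.app i).1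
  kill : ∀ i x, (L.app i).1 ((ι.app i).1 x) = 0
  eig : ∀ i z, z ∈ EigLe (L.app i).1 (LinearMap.range (ι.app i).1) (k i)

namespace Diag

variable {ι : LevelHom V W} {L : LevelHom W W} {k : ℕ → ℕ} (D : Diag ι L k)

theorem comm_apply {V : ProAYD.{u₁, u₂, v} 𝒢} {W : ProAYD.{u₁, u₂, w} 𝒢} (F : LevelHom V W) {i j : ℕ}
    (h : i ≤ j) (z : (V.obj j).toGMod) : (W.map h).1 ((F.app j).1 z) = (F.app i).1 ((V.map h).1 z) :=
  LinearMap.congr_fun (congrArg Subtype.val (F.comm h)) z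

include D

theorem kill' (i : ℕ) : ∀ z ∈ LinearMap.range (ι.app i).1, (L.app i).1 z = 0 := by
  rintro _ ⟨x, rfl⟩
  exact D.kill i x

/-- The inverse of `L` on the non-zero eigenspaces. -/
def inv (hk : Monotone k) : LevelHom W W where
  app i := ⟨prodG (L.app i).1 (k i), AYD.prodG_mem (L.app i).2 _⟩
  comm {i j} h := AYD.hom_ext fun z =>
    (map_prodG (W.map h).1 (comm_apply L h) (k j) z).trans
      (prodG_le (D.kill' i) (D.eig i) (hk h) _)

/-- The projection to the kernel of `L` at a level. -/
def trApp (i : ℕ) : AYDHom (W.obj i) (V.obj i) :=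
  AYD.lift (ι.app i) (D.inj i) ⟨prodE (L.app i).1 (k i), AYD.prodE_mem (L.app i).2 _⟩
    fun z => prodE_mem (D.kill' i) (D.eig i z)

theorem ι_trApp (i : ℕ) (z : (W.obj i).toGMod) :
    (ι.app i).1 ((D.trApp i).1 z) = prodE (L.app i).1 (k i) z := AYD.lift_apply ..

/-- The projection to the kernel of `L`. -/
def tr (hk : Monotone k) : LevelHom W V where
  app i := D.trApp i
  comm {i j} h := AYD.hom_ext fun z => D.inj i (by
    change (ι.app i).1 ((V.map h).1 ((D.trApp j).1 z)) = (ι.app i).1 ((D.trApp i).1 ((W.map h).1 z))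
    rw [← comm_apply ι h, ι_trApp, ι_trApp]
    exact (map_prodE (W.map h).1 (comm_apply L h) (k j) z).trans
      (prodE_le (D.kill' i) (hk h) (D.eig i _)))

theorem ι_tr_apply (hk : Monotone k) (i : ℕ) (z : (W.obj i).toGMod) :
    (ι.app i).1 (((D.tr hk).app i).1 z) = prodE (L.app i).1 (k i) z := D.ι_trApp i z

theorem tr_ι (hk : Monotone k) (i : ℕ) : AYD.comp ((D.tr hk).app i) (ι.app i) = AYD.id _ :=
  AYD.hom_ext fun x => D.inj i ((D.ι_tr_apply hk i _).trans (prodE_of_ker (D.kill i x) _))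

theorem ι_tr (hk : Monotone k) (i : ℕ) : AYD.comp (ι.app i) ((D.tr hk).app i) =
    AYD.id _ + AYD.comp (L.app i) ((D.inv hk).app i) :=
  AYD.hom_ext fun z => (D.ι_tr_apply hk i z).trans (L_prodG (D.kill' i) (D.eig i) z).symm

omit D

theorem tr_comm {V' : ProAYD.{u₁, u₂, v} 𝒢} {W' : ProAYD.{u₁, u₂, w} 𝒢} {ι : LevelHom V W}
    {ι' : LevelHom V' W'} {L : LevelHom W W} {L' : LevelHom W' W'} (D : Diag ι L k)
    (D' : Diag ι' L' k) (hk : Monotone k) {i : ℕ} (d : AYDHom (V.obj i) (V'.obj i))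
    (d' : AYDHom (W.obj i) (W'.obj i)) (hι : AYD.comp d' (ι.app i) = AYD.comp (ι'.app i) d)
    (hL : AYD.comp d' (L.app i) = AYD.comp (L'.app i) d') :
    AYD.comp d ((D.tr hk).app i) = AYD.comp ((D'.tr hk).app i) d' :=
  AYD.hom_ext fun z => D'.inj i (by
    change (ι'.app i).1 (d.1 (((D.tr hk).app i).1 z)) = (ι'.app i).1 (((D'.tr hk).app i).1 (d'.1 z))
    rw [ι_tr_apply, ← map_prodE d'.1 (fun v => LinearMap.congr_fun (congrArg Subtype.val hL) v),
      ← D.ι_tr_apply hk]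
    exact (LinearMap.congr_fun (congrArg Subtype.val hι) _).symm)

end Diag

end pro

namespace GradedAYD

variable {V : GradedAYD.{u₁, u₂, v} 𝒢} {W : GradedAYD.{u₁, u₂, w} 𝒢} {ι : GradedMap V W}

/-- The retraction given by a diagonalisable contractible chain map. -/
def Contraction.retraction (K : Contraction W) {k : ℕ → ℕ} (hk : Monotone k)
    (D : Diag ι.even K.L0 k) (D' : Diag ι.odd K.L1 k)
    (h0 : ∀ i, AYD.comp (W.d0.app i) (K.L0.app i) = AYD.comp (K.L1.app i) (W.d0.app i))
    (h1 : ∀ i, AYD.comp (W.d1.app i) (K.L1.app i) = AYD.comp (K.L0.app i) (W.d1.app i)) :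
    Retraction ι :=
  { K with
    tr :=
      { even := D.tr hk
        odd := D'.tr hk
        comm0 := fun i => Diag.tr_comm D D' hk _ _ (ι.comm0 i) (h0 i)
        comm1 := fun i => Diag.tr_comm D' D hk _ _ (ι.comm1 i) (h1 i) }
    G :=
      { even := D.inv hk
        odd := D'.inv hk
        comm0 := fun i => AYD.hom_ext fun z => map_prodG (W.d0.app i).1
          (fun v => LinearMap.congr_fun (congrArg Subtype.val (h0 i)) v) (k i) z
        comm1 := fun i => AYD.hom_ext fun z => map_prodG (W.d1.app i).1
          (fun v => LinearMap.congr_fun (congrArg Subtype.val (h1 i)) v) (k i) z }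
    tr_even := D.tr_ι hk
    tr_odd := D'.tr_ι hk
    incl_even := D.ι_tr hk
    incl_odd := D'.ι_tr hk }

end GradedAYD

namespace GradedAYD

section homology

theorem Homology.mk_congr {M N : Type*} [AddCommGroup M] [Module ℂ M] [AddCommGroup N]
    [Module ℂ N] {f : M →ₗ[ℂ] N} {g : N →ₗ[ℂ] M} {y y' : N} {hy : g y = 0} {hy' : g y' = 0}
    (h : y = y') : (Homology.mk y hy : Homology f g) = Homology.mk y' hy' := by
  subst h; rfl

variable {V : GradedAYD.{u₁, u₂, v} 𝒢} {V' : GradedAYD.{u₁, u₂, w} 𝒢} {W : GradedAYD.{u₁, u₂, x} 𝒢}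
  {W' : GradedAYD.{u₁, u₂, y} 𝒢}

theorem H0.post_pre (F : GradedMap V V') (G : GradedMap W W') (z : H0 V' W) :
    H0.post V G (H0.pre F W z) = H0.pre F W' (H0.post V' G z) := by
  refine Homology.ind (p := fun z => H0.post V G (H0.pre F W z) = H0.pre F W' (H0.post V' G z))
    (fun _ _ => Homology.mk_congr ?_) z
  exact Prod.ext (ProHom.post_pre _ _ _) (ProHom.post_pre _ _ _)

theorem H1.post_pre (F : GradedMap V V') (G : GradedMap W W') (z : H1 V' W) :
    H1.post V G (H1.pre F W z) = H1.pre F W' (H1.post V' G z) := by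
  refine Homology.ind (p := fun z => H1.post V G (H1.pre F W z) = H1.pre F W' (H1.post V' G z))
    (fun _ _ => Homology.mk_congr ?_) z
  exact Prod.ext (ProHom.post_pre _ _ _) (ProHom.post_pre _ _ _)

/-- A commutative square. -/
structure Square (F : GradedMap V W) (G : GradedMap W W') (F' : GradedMap V V')
    (G' : GradedMap V' W') : Prop where
  even : ∀ N, AYD.comp (G.even.app N) (F.even.app N) = AYD.comp (G'.even.app N) (F'.even.app N)
  odd : ∀ N, AYD.comp (G.odd.app N) (F.odd.app N) = AYD.comp (G'.odd.app N) (F'.odd.app N)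

variable {F : GradedMap V W} {G : GradedMap W W'} {F' : GradedMap V V'} {G' : GradedMap V' W'}
  (h : Square F G F' G') (X : GradedAYD.{u₁, u₂, z} 𝒢)
include h

theorem H0.post_square (z : H0 X V) : H0.post X G (H0.post X F z) =
    H0.post X G' (H0.post X F' z) := by
  refine Homology.ind (p := fun z => H0.post X G (H0.post X F z) = H0.post X G' (H0.post X F' z))
    (fun _ _ => Homology.mk_congr ?_) z
  exact Prod.ext (ProHom.post_square h.even _) (ProHom.post_square h.odd _)

theorem H1.post_square (z : H1 X V) : H1.post X G (H1.post X F z) =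
    H1.post X G' (H1.post X F' z) := by
  refine Homology.ind (p := fun z => H1.post X G (H1.post X F z) = H1.post X G' (H1.post X F' z))
    (fun _ _ => Homology.mk_congr ?_) z
  exact Prod.ext (ProHom.post_square h.odd _) (ProHom.post_square h.even _)

theorem H0.pre_square (z : H0 W' X) : H0.pre F X (H0.pre G X z) =
    H0.pre F' X (H0.pre G' X z) := by
  refine Homology.ind (p := fun z => H0.pre F X (H0.pre G X z) = H0.pre F' X (H0.pre G' X z))
    (fun _ _ => Homology.mk_congr ?_) z
  exact Prod.ext (ProHom.pre_square h.even _) (ProHom.pre_square h.odd _)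

theorem H1.pre_square (z : H1 W' X) : H1.pre F X (H1.pre G X z) =
    H1.pre F' X (H1.pre G' X z) := by
  refine Homology.ind (p := fun z => H1.pre F X (H1.pre G X z) = H1.pre F' X (H1.pre G' X z))
    (fun _ _ => Homology.mk_congr ?_) z
  exact Prod.ext (ProHom.pre_square h.even _) (ProHom.pre_square h.odd _)

end homology

namespace Retraction

variable {V : GradedAYD.{u₁, u₂, v} 𝒢} {V' : GradedAYD.{u₁, u₂, w} 𝒢} {W : GradedAYD.{u₁, u₂, x} 𝒢}
  {W' : GradedAYD.{u₁, u₂, y} 𝒢} {ι : GradedMap V W} {ι' : GradedMap V' W'} (K : Retraction ι)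
  (K' : Retraction ι')

/-- The isomorphism on even homology induced by two retractions. -/
def iso0 : H0 W W' ≃ₗ[ℂ] H0 V V' :=
  (LinearEquiv.ofBijective (H0.pre ι W') (K.pre0_bijective W')).trans
    (LinearEquiv.ofBijective (H0.post V ι') (K'.post0_bijective V)).symm

/-- The isomorphism on odd homology induced by two retractions. -/
def iso1 : H1 W W' ≃ₗ[ℂ] H1 V V' :=
  (LinearEquiv.ofBijective (H1.pre ι W') (K.pre1_bijective W')).trans
    (LinearEquiv.ofBijective (H1.post V ι') (K'.post1_bijective V)).symm

theorem post_iso0 (z : H0 W W') : H0.post V ι' (iso0 K K' z) = H0.pre ι W' z :=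
  LinearEquiv.apply_symm_apply (LinearEquiv.ofBijective (H0.post V ι') (K'.post0_bijective V)) _

theorem post_iso1 (z : H1 W W') : H1.post V ι' (iso1 K K' z) = H1.pre ι W' z :=
  LinearEquiv.apply_symm_apply (LinearEquiv.ofBijective (H1.post V ι') (K'.post1_bijective V)) _

section pre

variable {V₁ : GradedAYD.{u₁, u₂, v} 𝒢} {W₁ : GradedAYD.{u₁, u₂, x} 𝒢} {ι₁ : GradedMap V₁ W₁}
  {K} (K₁ : Retraction ι₁) {F : GradedMap V V₁} {G : GradedMap W W₁} (h : Square ι G F ι₁)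
include h

theorem iso0_pre (z : H0 W₁ W') : iso0 K K' (H0.pre G W' z) = H0.pre F V' (iso0 K₁ K' z) :=
  (K'.post0_bijective V).1 (by
    rw [post_iso0, H0.post_pre, post_iso0, H0.pre_square h])

theorem iso1_pre (z : H1 W₁ W') : iso1 K K' (H1.pre G W' z) = H1.pre F V' (iso1 K₁ K' z) :=
  (K'.post1_bijective V).1 (by
    rw [post_iso1, H1.post_pre, post_iso1, H1.pre_square h])

end pre

section post

variable {V₁ : GradedAYD.{u₁, u₂, w} 𝒢} {W₁ : GradedAYD.{u₁, u₂, y} 𝒢} {ι₁ : GradedMap V₁ W₁}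
  {K'} (K₁ : Retraction ι₁) {F : GradedMap V' V₁} {G : GradedMap W' W₁} (h : Square ι' G F ι₁)
include h

theorem iso0_post (z : H0 W W') : iso0 K K₁ (H0.post W G z) = H0.post V F (iso0 K K' z) :=
  (K₁.post0_bijective V).1 (by
    rw [post_iso0, ← H0.post_pre, ← post_iso0 K K', H0.post_square h])

theorem iso1_post (z : H1 W W') : iso1 K K₁ (H1.post W G z) = H1.post V F (iso1 K K' z) :=
  (K₁.post1_bijective V).1 (by
    rw [post_iso1, ← H1.post_pre, ← post_iso1 K K', H1.post_square h])

end post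

end Retraction

end GradedAYD

/-! ### The X-complex of a full corner -/

section corner

variable {χ : Cutoff 𝒢} {A : GAlg.{u₁, u₂, w} 𝒢} {B : GAlg.{u₁, u₂, v} 𝒢} {C : CutAlg χ B}
  {ι : GAlgHom A B} (hC : ∀ x y, C.cmul x y = x * y)

theorem dproj_surjective (N : ℕ) : Function.Surjective (dproj B N).toLin :=
  TAproj_surjective (by omega)

/-- The cut operator on the even part of `X_G(T B)`. -/
def cutEven : LevelHom (XT B).even (XT B).even where
  app N := ⟨(tHtp hC N).LE, (tHtp hC N).LE_mem⟩
  comm h := AYD.hom_ext fun z => CutHtp.LE_map (tHtp_compat hC h) (dproj_surjective _)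
    (dproj_surjective _) z

/-- The cut operator on the odd part of `X_G(T B)`. -/
def cutOdd : LevelHom (XT B).odd (XT B).odd where
  app N := ⟨(tHtp hC N).LO (dproj_surjective N), (tHtp hC N).LO_mem _⟩
  comm h := AYD.hom_ext fun z => CutHtp.LO_map (tHtp_compat hC h) (dproj_surjective _)
    (dproj_surjective _) z

theorem monotone_two_mul_add (k : ℕ) : Monotone fun i => 2 * i + k := fun i j h => by grind

/-- The contraction of the cut operator on the even part. -/
def cutS : ShiftHom (XT B).even (XT B).odd (fun i => 2 * i + 1) (monotone_two_mul_add 1) where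
  app N := ⟨(tHtp hC N).h0, (tHtp hC N).h0_mem⟩
  comm h := AYD.hom_ext fun z => CutHtp.h0_map (tHtp_compat hC h) z

/-- The contraction of the cut operator on the odd part. -/
def cutT : ShiftHom (XT B).odd (XT B).even (fun i => 2 * i + 1) (monotone_two_mul_add 1) where
  app N := ⟨(tHtp hC N).h1, (tHtp hC N).h1_mem⟩
  comm h := AYD.hom_ext fun z => CutHtp.h1_map (tHtp_compat hC h) z

/-- The cut operator on `X_G(T B)` and its contraction. -/
def cutContraction : GradedAYD.Contraction (XT B) where
  L0 := cutEven hC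
  L1 := cutOdd hC
  s i := 2 * i + 1
  hs := monotone_two_mul_add 1
  le_s i := by omega
  S := cutS hC
  T := cutT hC
  htp_even N := AYD.hom_ext fun z => (tHtp hC N).LE_lTensor (dproj_surjective N) z
  htp_odd N := AYD.hom_ext fun z => (tHtp hC N).LO_xoMap (dproj_surjective N) z

theorem cutEven_diag (h : C.FullCorner ι)
    (hι : ∀ N, Function.Injective ((TAmap ι N).toLin.lTensor (OG 𝒢))) :
    Diag (XTmap ι).even (cutEven hC) fun i => 2 * i + 2 where
  inj := hι
  kill _ x := LE_TAmap hC h.toCorner x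
  eig i z := EigLe.le (by omega) (LE_eig (N := i) hC h z)

theorem cutOdd_diag (h : C.FullCorner ι)
    (hι : ∀ N, Function.Injective (xoMap (TAmap ι N))) :
    Diag (XTmap ι).odd (cutOdd hC) fun i => 2 * i + 2 where
  inj := hι
  kill _ x := LO_TAmap hC h.toCorner x
  eig _ z := LO_eig hC h z

/-- The X-complex of `T A` is a retract of that of `T B` up to homotopy if `A` is a full corner
of `B`. -/
def cornerRetraction (h : C.FullCorner ι)
    (hι : ∀ N, Function.Injective ((TAmap ι N).toLin.lTensor (OG 𝒢)))
    (hι' : ∀ N, Function.Injective (xoMap (TAmap ι N))) : GradedAYD.Retraction (XTmap ι) :=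
  (cutContraction hC).retraction (monotone_two_mul_add 2) (cutEven_diag hC h hι)
    (cutOdd_diag hC h hι')
    (fun N => AYD.hom_ext fun z => ((tHtp hC N).LO_nd (dproj_surjective N) z).symm)
    (fun N => AYD.hom_ext fun z => (tHtp hC N).bd_LO (dproj_surjective N) z)

end corner

/-- The X-complex of `T A` is a retract of that of `T(A ⊗ K_G)` up to homotopy. -/
def stabRetraction (χ : Cutoff 𝒢) (A : GAlg.{u₁, u₂, v} 𝒢) :
    GradedAYD.Retraction (XTmap (stabIncl χ A)) :=
  cornerRetraction stabCut_cmul stab_fullCorner (fun _ => lTensor_TAmap_injective)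
    fun _ => xoMap_TAmap_injective

/-! ### Naturality -/

section naturality

variable {A : GAlg.{u₁, u₂, v} 𝒢} {B : GAlg.{u₁, u₂, w} 𝒢} {B' : GAlg.{u₁, u₂, x} 𝒢}
  {C : GAlg.{u₁, u₂, y} 𝒢} {φ : GAlgHom A B} {ψ : GAlgHom B C} {φ' : GAlgHom A B'}
  {ψ' : GAlgHom B' C} (h : ∀ a, ψ.toLin (φ.toLin a) = ψ'.toLin (φ'.toLin a))
include h

theorem TAmap_square (N : ℕ) (x : TA A N) : (TAmap ψ N).toLin ((TAmap φ N).toLin x) =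
    (TAmap ψ' N).toLin ((TAmap φ' N).toLin x) := by
  refine TA_ind' (p := fun x => (TAmap ψ N).toLin ((TAmap φ N).toLin x) =
      (TAmap ψ' N).toLin ((TAmap φ' N).toLin x)) (by simp)
    (fun x y hx hy => by simp only [map_sub, hx, hy])
    (fun a => by simp only [TAmap_gen, h]) (fun x a hx => ?_) x
  simp only [GAlgHom.map_mul, TAmap_gen, h, hx]

theorem XTmap_square : GradedAYD.Square (XTmap φ) (XTmap ψ) (XTmap φ') (XTmap ψ') where
  even N := (XEmap_comp (TAmap φ N) (TAmap ψ N) (GAlgHom.comp (TAmap ψ N) (TAmap φ N))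
    fun _ => rfl).trans
      (XEmap_comp (TAmap φ' N) (TAmap ψ' N) _ fun a => (TAmap_square h N a).symm).symm
  odd N := (XOmap_comp (TAmap φ N) (TAmap ψ N) (GAlgHom.comp (TAmap ψ N) (TAmap φ N))
    fun _ => rfl).trans
      (XOmap_comp (TAmap φ' N) (TAmap ψ' N) _ fun a => (TAmap_square h N a).symm).symm

end naturality

section iso

open GradedAYD

/-- The retraction of stabilisations, in the first variable. -/
def preRetraction (χ : Cutoff 𝒢) (A : GAlg.{u₁, u₂, v} 𝒢) :
    Retraction.{u₁, u₂, max v u₂, max v u₂} (XTmap.{u₁, u₂, v, max v u₂} (stabIncl χ A)) :=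
  stabRetraction χ A

/-- The retraction of stabilisations, in the second variable. -/
def postRetraction (χ : Cutoff 𝒢) (A : GAlg.{u₁, u₂, v} 𝒢) :
    Retraction.{u₁, u₂, max u₂ v, max u₂ v} (XTmap.{u₁, u₂, v, max u₂ v} (stabIncl χ A)) :=
  stabRetraction χ A

theorem preSquare (χ : Cutoff 𝒢) {A A' : GAlg.{u₁, u₂, v} 𝒢} (φ : GAlgHom A A') :
    Square.{u₁, u₂, max v u₂, max v u₂, max v u₂, max v u₂}
      (XTmap.{u₁, u₂, v, max v u₂} (stabIncl χ A))
      (XTmap.{u₁, u₂, max v u₂, max v u₂} (stabMap φ)) (XTmap.{u₁, u₂, v, v} φ)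
      (XTmap.{u₁, u₂, v, max v u₂} (stabIncl χ A')) :=
  XTmap_square (stabMap_stabIncl φ)

theorem postSquare (χ : Cutoff 𝒢) {A A' : GAlg.{u₁, u₂, v} 𝒢} (φ : GAlgHom A A') :
    Square.{u₁, u₂, max u₂ v, max u₂ v, max u₂ v, max u₂ v}
      (XTmap.{u₁, u₂, v, max u₂ v} (stabIncl χ A))
      (XTmap.{u₁, u₂, max u₂ v, max u₂ v} (stabMap φ)) (XTmap.{u₁, u₂, v, v} φ)
      (XTmap.{u₁, u₂, v, max u₂ v} (stabIncl χ A')) :=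
  XTmap_square (stabMap_stabIncl φ)

variable (χ : Cutoff 𝒢) (A B : GAlg.{u₁, u₂, v} 𝒢)

/-- The stability isomorphism `HP^G_0(A, B) ≅ H_0(Hom(X_G(T A), X_G(T B)))`. -/
def stabIso0 : HP0 A B ≃ₗ[ℂ] H0 (XT A) (XT B) := by
  with_reducible
    exact Retraction.iso0.{u₁, u₂, max v u₂, max u₂ v, max v u₂, max u₂ v}
      (preRetraction χ A) (postRetraction χ B)

/-- The stability isomorphism `HP^G_1(A, B) ≅ H_1(Hom(X_G(T A), X_G(T B)))`. -/
def stabIso1 : HP1 A B ≃ₗ[ℂ] H1 (XT A) (XT B) := by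
  with_reducible
    exact Retraction.iso1.{u₁, u₂, max v u₂, max u₂ v, max v u₂, max u₂ v}
      (preRetraction χ A) (postRetraction χ B)

variable {A B} {A' B' : GAlg.{u₁, u₂, v} 𝒢}

theorem stabIso0_pre (φ : GAlgHom A A') (z : HP0 A' B) :
    stabIso0 χ A B (HP0.pre φ B z) = H0.pre (XTmap φ) (XT B) (stabIso0 χ A' B z) := by
  unfold stabIso0 HP0.pre
  with_reducible
    exact Retraction.iso0_pre.{u₁, u₂, max v u₂, max u₂ v, max v u₂, max u₂ v}
      (postRetraction χ B) (preRetraction χ A') (preSquare χ φ) z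

theorem stabIso1_pre (φ : GAlgHom A A') (z : HP1 A' B) :
    stabIso1 χ A B (HP1.pre φ B z) = H1.pre (XTmap φ) (XT B) (stabIso1 χ A' B z) := by
  unfold stabIso1 HP1.pre
  with_reducible
    exact Retraction.iso1_pre.{u₁, u₂, max v u₂, max u₂ v, max v u₂, max u₂ v}
      (postRetraction χ B) (preRetraction χ A') (preSquare χ φ) z

theorem stabIso0_post (ψ : GAlgHom B B') (z : HP0 A B) :
    stabIso0 χ A B' (HP0.post A ψ z) = H0.post (XT A) (XTmap ψ) (stabIso0 χ A B z) := by
  unfold stabIso0 HP0.post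
  with_reducible
    exact Retraction.iso0_post.{u₁, u₂, max v u₂, max u₂ v, max v u₂, max u₂ v}
      (preRetraction χ A) (postRetraction χ B') (postSquare χ ψ) z

theorem stabIso1_post (ψ : GAlgHom B B') (z : HP1 A B) :
    stabIso1 χ A B' (HP1.post A ψ z) = H1.post (XT A) (XTmap ψ) (stabIso1 χ A B z) := by
  unfold stabIso1 HP1.post
  with_reducible
    exact Retraction.iso1_post.{u₁, u₂, max v u₂, max u₂ v, max v u₂, max u₂ v}
      (preRetraction χ A) (postRetraction χ B') (postSquare χ ψ) z

end iso

end AmpleHP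

end

theorem mainTheorem10 (𝒢 : AmpleGroupoid.{u₁, u₂}) (hG : 𝒢.IsProper)
    (hP : ParacompactSpace 𝒢.OrbitSpace) :
    ∃ (Φ₀ : ∀ A B : GAlg.{u₁, u₂, v} 𝒢, HP0 A B ≃ₗ[ℂ] GradedAYD.H0 (XT A) (XT B))
      (Φ₁ : ∀ A B : GAlg.{u₁, u₂, v} 𝒢, HP1 A B ≃ₗ[ℂ] GradedAYD.H1 (XT A) (XT B)),
      (∀ (A A' B : GAlg.{u₁, u₂, v} 𝒢) (φ : GAlgHom A A'),
        (∀ z : HP0 A' B, Φ₀ A B (HP0.pre φ B z) = GradedAYD.H0.pre (XTmap φ) (XT B) (Φ₀ A' B z)) ∧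
        (∀ z : HP1 A' B, Φ₁ A B (HP1.pre φ B z) = GradedAYD.H1.pre (XTmap φ) (XT B) (Φ₁ A' B z))) ∧
      (∀ (A B B' : GAlg.{u₁, u₂, v} 𝒢) (ψ : GAlgHom B B'),
        (∀ z : HP0 A B, Φ₀ A B' (HP0.post A ψ z) = GradedAYD.H0.post (XT A) (XTmap ψ) (Φ₀ A B z)) ∧
        (∀ z : HP1 A B, Φ₁ A B' (HP1.post A ψ z) =
          GradedAYD.H1.post (XT A) (XTmap ψ) (Φ₁ A B z))) := by
  obtain ⟨χ⟩ := nonempty_cutoff hG hP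
  have h : ∀ (A A' B : GAlg.{u₁, u₂, v} 𝒢) (φ : GAlgHom A A'), _ ∧ _ :=
    fun A A' B φ => ⟨stabIso0_pre (B := B) χ φ, stabIso1_pre (B := B) χ φ⟩
  have h' : ∀ (A B B' : GAlg.{u₁, u₂, v} 𝒢) (ψ : GAlgHom B B'), _ ∧ _ :=
    fun A B B' ψ => ⟨stabIso0_post (A := A) χ ψ, stabIso1_post (A := A) χ ψ⟩
  exact ⟨stabIso0 χ, stabIso1 χ, h, h'⟩
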